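/- Let $(M,g)$ be a connected Riemannian $3$-manifold (smooth, without boundary) with sectional curvature $\sec(g)\ge 1$ and distance function $d$, and let $\alpha$ be a contact form on $M$ for which $(M,\alpha,g)$ is a contact metric manifold: the Reeb field $R_\alpha$ satisfies $\|R_\alpha\|=1$, and $\ast d\alpha=\theta'\alpha$ for some constant $\theta'>0$, where $\ast$ is the Hodge star of $g$ and of the orientation given by $\alpha\wedge d\alpha$. Put $\xi=\ker\alpha$. Let $W=\mathbb{R}_+\times M$ be the symplectization, with symplectic form $\omega=d(t\alpha)$ and product metric $dt^2+g$, and let $J$ be an $\omega$-compatible almost complex structure on $W$ that preserves this metric and satisfies $J\partial_t=R_\alpha$ and $J\xi=\xi$. Let $D\subset M$ be a closed set with nonempty boundary $\partial D$ that is convex (any two points of $D$ are joined by a minimal geodesic of $M$ contained in $D$) and complete as a metric space (which is automatic if $M$ is complete, in particular if $M$ is closed). Define $f(x)=e^{\pi/2-d(x,\partial D)}$ for $x\in D$. For $c<e^{\pi/2}$ let $$\Omega^c=\mathbb{R}_+\times f^{-1}((-\infty,c]),\qquad \Sigma^c=\mathbb{R}_+\times f^{-1}(c).$$ Then $\Sigma^c$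 is the boundary of $\Omega^c$ in $W$, and the interior of any $J$-holomorphic curve in $\Omega^c$ is disjoint from $\Sigma^c$. That is: let $S$ be a connected Riemann surface with (possibly empty) boundary, and let $u:S\to W$ be a nonconstant continuous map that is smooth and $J$-holomorphic ($du\circ i=J\circ du$) on the interior $S\setminus\partial S$. If $u(S)\subset\Omega^c$, then $u(S\setminus\partial S)\cap\Sigma^c=\emptyset$. -/

import Mathlib

open Set Topology Manifold Bundle
open scoped ContDiff

noncomputable section

/-- The model space of 3-manifolds. -/
abbrev E3 : Type := EuclideanSpace ℝ (Fin 3)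

/-- The `i`-th standard basis vector of the model space. -/
abbrev stdVec (i : Fin 3) : E3 := EuclideanSpace.single i 1

/-- The partial derivative `∂F/∂yⁱ` of a function on coordinate space. -/
def partialD (i : Fin 3) (F : E3 → ℝ) (y : E3) : ℝ := fderiv ℝ F y (stdVec i)

section Manifold3

variable {M : Type*} [TopologicalSpace M] [ChartedSpace E3 M]

/-- The coordinate vector field `∂ᵢ` of the chart `e`, at the point with coordinates `y`. -/
def coordVec (e : OpenPartialHomeomorph M E3) (i : Fin 3) (y : E3) :
    TangentSpace (𝓡 3) (e.symm y) :=
  mfderiv (𝓡 3) (𝓡 3) e.symm y (stdVec i)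

/-- The `i`-th component of the tangent vector `v` in the chart `e`. -/
def vecCoord (e : OpenPartialHomeomorph M E3) (x : M) (v : TangentSpace (𝓡 3) x) (i : Fin 3) : ℝ :=
  (show E3 from mfderiv (𝓡 3) (𝓡 3) e x v) i

/-! ### Sectional curvature -/

section Curvature

variable [RiemannianBundle (fun x : M => TangentSpace (𝓡 3) x)]

/-- The coefficients `g_{ij}` of the Riemannian metric in the chart `e`. -/
def metricCoeff (e : OpenPartialHomeomorph M E3) (y : E3) : Matrix (Fin 3) (Fin 3) ℝ :=
  Matrix.of fun i j => inner ℝ (coordVec e i y) (coordVec e j y)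

/-- The Christoffel symbols `Γᵏᵢⱼ` of the Levi-Civita connection in the chart `e`. -/
def christoffel (e : OpenPartialHomeomorph M E3) (k i j : Fin 3) (y : E3) : ℝ :=
  (1 / 2 : ℝ) * ∑ l, (metricCoeff e y)⁻¹ k l *
    (partialD i (fun z => metricCoeff e z j l) y + partialD j (fun z => metricCoeff e z i l) y
      - partialD l (fun z => metricCoeff e z i j) y)

/-- The curvature coefficients: `R(∂ᵢ, ∂ⱼ)∂ₖ = ∑ₗ (curvCoeff e i j k l) ∂ₗ`, where
`R(X, Y)Z = ∇_X ∇_Y Z - ∇_Y ∇_X Z - ∇_{[X, Y]} Z`. -/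
def curvCoeff (e : OpenPartialHomeomorph M E3) (i j k l : Fin 3) (y : E3) : ℝ :=
  partialD i (christoffel e l j k) y - partialD j (christoffel e l i k) y
    + ∑ m, (christoffel e l i m y * christoffel e m j k y
      - christoffel e l j m y * christoffel e m i k y)

/-- The inner product of the tangent vectors with components `a` and `b` in the chart `e`. -/
def coordInner (e : OpenPartialHomeomorph M E3) (y : E3) (a b : Fin 3 → ℝ) : ℝ :=
  ∑ i, ∑ j, metricCoeff e y i j * a i * b j

/-- The sectional curvature
`⟨R(a, b)b, a⟩ / (|a|² |b|² - ⟨a, b⟩²)` of the plane spanned by `∑ aⁱ ∂ᵢ` and `∑ bⁱ ∂ᵢ`. -/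
def sectionalCurvature (e : OpenPartialHomeomorph M E3) (y : E3) (a b : Fin 3 → ℝ) : ℝ :=
  coordInner e y (fun l => ∑ i, ∑ j, ∑ k, curvCoeff e i j k l y * a i * b j * b k) a /
    (coordInner e y a a * coordInner e y b b - coordInner e y a b ^ 2)

variable (M) in
/-- `sec(g) ≥ κ`: every tangent plane at every point has sectional curvature at least `κ`
(computed in any smooth chart around the point). -/
def SecGE (κ : ℝ) : Prop :=
  ∀ e ∈ IsManifold.maximalAtlas (𝓡 3) ∞ M, ∀ y ∈ e.target, ∀ a b : Fin 3 → ℝ,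
    LinearIndependent ℝ ![a, b] → κ ≤ sectionalCurvature e y a b

end Curvature

/-! ### Contact forms -/

/-- The component `αᵢ = α(∂ᵢ)` of a 1-form in the chart `e`. -/
def formCoeff (e : OpenPartialHomeomorph M E3) (α : ∀ x : M, TangentSpace (𝓡 3) x →ₗ[ℝ] ℝ)
    (i : Fin 3) (y : E3) : ℝ :=
  α (e.symm y) (coordVec e i y)

/-- The exterior derivative `dα(u, v) = ∑ᵢⱼ (∂ᵢ αⱼ - ∂ⱼ αᵢ) uⁱ vʲ` at `x` of a 1-form, computed in
the preferred chart at `x`. -/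
def dForm (α : ∀ x : M, TangentSpace (𝓡 3) x →ₗ[ℝ] ℝ) (x : M) (u v : TangentSpace (𝓡 3) x) : ℝ :=
  ∑ i, ∑ j, (partialD i (formCoeff (chartAt E3 x) α j) (chartAt E3 x x)
      - partialD j (formCoeff (chartAt E3 x) α i) (chartAt E3 x x))
    * vecCoord (chartAt E3 x) x u i * vecCoord (chartAt E3 x) x v j

/-- The 3-form `α ∧ dα`. -/
def contactVolume (α : ∀ x : M, TangentSpace (𝓡 3) x →ₗ[ℝ] ℝ) (x : M)
    (b : Fin 3 → TangentSpace (𝓡 3) x) : ℝ :=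
  α x (b 0) * dForm α x (b 1) (b 2) + α x (b 1) * dForm α x (b 2) (b 0)
    + α x (b 2) * dForm α x (b 0) (b 1)

/-- `α` is a contact form: a smooth 1-form with `α ∧ dα` nowhere zero. -/
structure IsContactForm (α : ∀ x : M, TangentSpace (𝓡 3) x →ₗ[ℝ] ℝ) : Prop where
  smooth : ∀ e ∈ IsManifold.maximalAtlas (𝓡 3) ∞ M, ∀ i, ContDiffOn ℝ ∞ (formCoeff e α i) e.target
  nondegenerate : ∀ x, ∃ b : Fin 3 → TangentSpace (𝓡 3) x, contactVolume α x b ≠ 0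

/-- The Reeb vector field `R` of a contact form: the unique vector field with `α(R) = 1` and
`dα(R, ·) = 0`. -/
def reeb (α : ∀ x : M, TangentSpace (𝓡 3) x →ₗ[ℝ] ℝ) (x : M) : TangentSpace (𝓡 3) x :=
  Classical.epsilon fun v => α x v = 1 ∧ ∀ w, dForm α x v w = 0

section ContactMetric

variable [RiemannianBundle (fun x : M => TangentSpace (𝓡 3) x)]

/-- `γ = ∗β` at the point `x`, for a 2-form `β`, with the Hodge star of the metric and of the
orientation given by `α ∧ dα`: one has `(∗β)(b₀) = β(b₁, b₂)` for every positively oriented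
orthonormal basis `(b₀, b₁, b₂)`. -/
def IsHodgeStar (α : ∀ x : M, TangentSpace (𝓡 3) x →ₗ[ℝ] ℝ) (x : M)
    (β : TangentSpace (𝓡 3) x → TangentSpace (𝓡 3) x → ℝ)
    (γ : TangentSpace (𝓡 3) x → ℝ) : Prop :=
  ∀ b : Fin 3 → TangentSpace (𝓡 3) x, Orthonormal ℝ b → 0 < contactVolume α x b →
    γ (b 0) = β (b 1) (b 2)

/-- `(M, α, g)` is a contact metric manifold: `‖R_α‖ = 1` and `∗dα = θ' α` for a positive
constant `θ'`. -/
structure IsContactMetric (α : ∀ x : M, TangentSpace (𝓡 3) x →ₗ[ℝ] ℝ) : Prop where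
  contact : IsContactForm α
  norm_reeb : ∀ x, ‖reeb α x‖ = 1
  star : ∃ θ' : ℝ, 0 < θ' ∧ ∀ x, IsHodgeStar α x (dForm α x) (fun v => θ' * α x v)

end ContactMetric

/-! ### The symplectization -/

variable (M) in
/-- The symplectization `ℝ₊ × M`, as an open subset of `ℝ × M`. -/
def symplectization : Set (ℝ × M) := {p | 0 < p.1}

/-- The symplectic form `ω = d(tα) = dt ∧ α + t dα`. A tangent vector of `ℝ₊ × M` at `p` is a pair
`(a, v)`, standing for `a ∂ₜ + v`. -/
def sympForm (α : ∀ x : M, TangentSpace (𝓡 3) x →ₗ[ℝ] ℝ) (p : ℝ × M)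
    (v w : ℝ × TangentSpace (𝓡 3) p.2) : ℝ :=
  v.1 * α p.2 w.2 - w.1 * α p.2 v.2 + p.1 * dForm α p.2 v.2 w.2

/-- `J` is a metric-preserving `ω`-compatible almost complex structure on the symplectization, with
`J ∂ₜ = R` and `J ξ = ξ`, where `ξ = ker α`; the metric is the product metric `dt² + g`.
(These conditions determine `J` pointwise, so that it is automatically smooth.) -/
structure IsAdaptedACS [RiemannianBundle (fun x : M => TangentSpace (𝓡 3) x)]
    (α : ∀ x : M, TangentSpace (𝓡 3) x →ₗ[ℝ] ℝ)
    (J : ∀ p : ℝ × M, (ℝ × TangentSpace (𝓡 3) p.2) →ₗ[ℝ] (ℝ × TangentSpace (𝓡 3) p.2)) :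
    Prop where
  sq : ∀ p ∈ symplectization M, ∀ v, J p (J p v) = -v
  map_dt : ∀ p ∈ symplectization M, J p (1, 0) = (0, reeb α p.2)
  map_xi : ∀ p ∈ symplectization M, ∀ v, α p.2 v = 0 →
    (J p (0, v)).1 = 0 ∧ α p.2 (J p (0, v)).2 = 0
  isometry : ∀ p ∈ symplectization M, ∀ v,
    (J p v).1 ^ 2 + ‖(J p v).2‖ ^ 2 = v.1 ^ 2 + ‖v.2‖ ^ 2
  invariant : ∀ p ∈ symplectization M, ∀ v w, sympForm α p (J p v) (J p w) = sympForm α p v w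
  tame : ∀ p ∈ symplectization M, ∀ v, v ≠ 0 → 0 < sympForm α p v (J p v)

end Manifold3

/-! ### Convex domains and the function `f` -/

/-- `D` is convex: any two points of `D` are joined by a minimal geodesic (a smooth unit speed curve
of length the distance of its end points) contained in `D`. -/
def GeodesicallyConvex {M : Type*} [MetricSpace M] [ChartedSpace E3 M] (D : Set M) : Prop :=
  ∀ x ∈ D, ∀ y ∈ D, ∃ γ : ℝ → M,
    ContMDiffOn 𝓘(ℝ, ℝ) (𝓡 3) ∞ γ (Icc 0 (dist x y)) ∧ γ 0 = x ∧ γ (dist x y) = y ∧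
    (∀ s ∈ Icc 0 (dist x y), ∀ t ∈ Icc 0 (dist x y), dist (γ s) (γ t) = |s - t|) ∧
    ∀ s ∈ Icc 0 (dist x y), γ s ∈ D

/-- `f(x) = exp(π/2 - d(x, ∂D))`, to be considered for `x ∈ D`. -/
def expDist {M : Type*} [MetricSpace M] (D : Set M) (x : M) : ℝ :=
  Real.exp (Real.pi / 2 - Metric.infDist x (frontier D))

/-- `Ωᶜ = ℝ₊ × f⁻¹((-∞, c])`. -/
def OmegaSet {M : Type*} [MetricSpace M] (D : Set M) (c : ℝ) : Set (ℝ × M) :=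
  {p | 0 < p.1 ∧ p.2 ∈ D ∧ expDist D p.2 ≤ c}

/-- `Σᶜ = ℝ₊ × f⁻¹(c)`. -/
def SigmaSet {M : Type*} [MetricSpace M] (D : Set M) (c : ℝ) : Set (ℝ × M) :=
  {p | 0 < p.1 ∧ p.2 ∈ D ∧ expDist D p.2 = c}

/-! ### Riemann surfaces with boundary and J-holomorphic curves -/

/-- The closed upper half plane. -/
abbrev ClosedHalfPlane : Type := {z : ℂ // 0 ≤ z.im}

/-- The inclusion of the closed upper half plane in `ℂ`. -/
def halfPlaneEquiv : PartialEquiv ClosedHalfPlane ℂ where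
  toFun := Subtype.val
  invFun z := ⟨⟨z.re, max z.im 0⟩, le_max_right _ _⟩
  source := univ
  target := {z | 0 ≤ z.im}
  map_source' z _ := z.2
  map_target' _ _ := mem_univ _
  left_inv' z _ := by
    apply Subtype.ext
    apply Complex.ext
    · rfl
    · exact max_eq_left z.2
  right_inv' z hz := by
    apply Complex.ext
    · rfl
    · exact max_eq_left hz

theorem continuous_halfPlaneEquiv : Continuous halfPlaneEquiv := continuous_subtype_val

theorem continuous_halfPlaneEquiv_symm : Continuous halfPlaneEquiv.symm := by
  refine Continuous.subtype_mk ?_ _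
  have h : (fun z : ℂ => (⟨z.re, max z.im 0⟩ : ℂ))
      = fun z : ℂ => (z.re : ℂ) + ((max z.im 0 : ℝ) : ℂ) * Complex.I := by
    funext z
    apply Complex.ext <;> simp
  rw [h]
  fun_prop

theorem range_halfPlaneEquiv : range halfPlaneEquiv = {z : ℂ | 0 ≤ z.im} :=
  Subtype.range_val

theorem nonempty_interior_halfPlane : (interior {z : ℂ | 0 ≤ z.im}).Nonempty :=
  ⟨Complex.I, mem_interior.2 ⟨{z | 0 < z.im}, fun z (hz : 0 < z.im) => (show 0 ≤ z.im from hz.le),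
    isOpen_lt continuous_const Complex.continuous_im, by simp⟩⟩

/-- The closed half plane as a model for surfaces with boundary. -/
def halfPlaneReal : ModelWithCorners ℝ ℂ ClosedHalfPlane :=
  ModelWithCorners.ofConvexRange halfPlaneEquiv rfl (convex_halfSpace_im_ge 0)
    continuous_halfPlaneEquiv continuous_halfPlaneEquiv_symm nonempty_interior_halfPlane

/-- The closed half plane as a model for Riemann surfaces with boundary: transition maps which are
smooth over `ℂ` are holomorphic. -/
def halfPlaneComplex : ModelWithCorners ℂ ℂ ClosedHalfPlane where
  toPartialEquiv := halfPlaneEquiv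
  source_eq := rfl
  convex_range' := by
    simp only [instIsRCLikeNormedField, ↓reduceDIte]
    apply Convex.convex_isRCLikeNormedField
    rw [range_halfPlaneEquiv]
    exact convex_halfSpace_im_ge 0
  nonempty_interior' := by
    rw [range_halfPlaneEquiv]
    exact nonempty_interior_halfPlane
  continuous_toFun := continuous_halfPlaneEquiv
  continuous_invFun := continuous_halfPlaneEquiv_symm

/-- The interior of a surface with (possibly empty) boundary. -/
def surfaceInterior (S : Type*) [TopologicalSpace S] [ChartedSpace ClosedHalfPlane S] : Set S :=
  halfPlaneReal.interior S

/-- `u : S → ℝ₊ × M` is a (parametrized, nonconstant) `J`-holomorphic curve: it is continuous, and on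
the interior of the Riemann surface `S` it is smooth and satisfies `J ∘ du = du ∘ i`. -/
structure IsJHolomorphicCurve {M : Type*} [TopologicalSpace M] [ChartedSpace E3 M]
    (J : ∀ p : ℝ × M, (ℝ × TangentSpace (𝓡 3) p.2) →ₗ[ℝ] (ℝ × TangentSpace (𝓡 3) p.2))
    {S : Type*} [TopologicalSpace S] [ChartedSpace ClosedHalfPlane S] (u : S → ℝ × M) : Prop where
  mem : ∀ z, u z ∈ symplectization M
  continuous : Continuous u
  smooth : ContMDiffOn halfPlaneReal (𝓘(ℝ, ℝ).prod (𝓡 3)) ∞ u (surfaceInterior S)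
  holomorphic : ∀ z ∈ surfaceInterior S, ∀ v : ℂ,
    J (u z) (mfderiv halfPlaneReal 𝓘(ℝ, ℝ) (fun w => (u w).1) z v,
        mfderiv halfPlaneReal (𝓡 3) (fun w => (u w).2) z v)
      = (mfderiv halfPlaneReal 𝓘(ℝ, ℝ) (fun w => (u w).1) z (Complex.I * v : ℂ),
        mfderiv halfPlaneReal (𝓡 3) (fun w => (u w).2) z (Complex.I * v : ℂ))
  nonconstant : ∃ z w, u z ≠ u w

end

/-!
The points of `Σᶜ` are those at the least distance `π/2 - log c > 0` from `∂D` allowed in `Ωᶜ`.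
So the theorem says that along a `J`-holomorphic curve `(a, m)` in `ℝ₊ × D` the function `h = ρ ∘ m`,
where `ρ` is the distance to `∂D`, has no positive minimum at an interior point unless the curve is
constant. This is the strong minimum principle, for which there are two ingredients.

*Concavity of the distance.* At a point at distance `l > 0` from `∂D`, the function `ρ` has Hessian at
most `-l/2` orthogonally to its gradient. As `ρ` need not be differentiable, this is stated in the
sense of barriers: `HasBarrier` is a second order upper bound by the expansion of a smooth function. As
`D` is complete and convex, `D` is proper, so that the point is joined to `∂D` by a minimal geodesic.
Minimal geodesics satisfy the geodesic equation (`isGeodesicOn_of_isometric`). At its foot on `∂D`, the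
convex set `D` has a supporting hyperplane to second order (`GeodesicallyConvex.hasPerpBarrier`), which
is a barrier with constant zero in the directions orthogonal to the geodesic. The second variation
formula propagates barriers along the geodesic, and the curvature makes them more concave
(`exists_hasBarrier_of_hasPerpBarrier`). The steps are short, so that parallel transport can be replaced
by a first order approximation in a chart, and no global Jacobi fields or focal points are needed. Any
positive concavity would do, and the constant `l/2` is not sharp. The result is
`GeodesicallyConvex.exists_hasBarrier`.

*Harmonicity up to first order.* The 2-form `dt ∧ α + dα / θ'` is a calibration of `ℝ₊ × M`, by the
normal form of a contact metric structure, and `J`-holomorphic curves are calibrated. The calibration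
is not closed, its differential being `-dt ∧ dα`, and the first order conditions for calibrated planes
yield the tension field of `m` as `-θ' (a₁ m₁ + a₂ m₂)`, where the indices denote partial derivatives
(`tension_of_calibrated`).

Both together give `Δh + θ' ⟨∇a, ∇h⟩ ≤ -(l/2) (|dm|² - |dh|²) ≤ 0`, in the sense of smooth functions
touching `h` from below. By Hopf's argument (`isOpen_setOf_eq_of_touching`), `h` is constant near a
positive minimum. There `dh = 0`, so that `dm = 0` by the same inequality, and then `da = 0` as the
calibrated curve has `a₁ = α(m₂)` and `a₂ = -α(m₁)`. Hence the curve is constant on a neighbourhood, and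
by connectedness on the whole surface (`IsJHolomorphicCurve.eq_of_infDist_minimum`).
-/

section

set_option maxSynthPendingDepth 3
set_option linter.unusedSectionVars false

/-! ### Riemannian metrics on open sets of a vector space -/

section LocalMetric

variable {E : Type*} [NormedAddCommGroup E] [NormedSpace ℝ E]

/-- `G` is a smooth Riemannian metric on the open set `U`, given as a field of bilinear forms. -/
structure IsMetricOn (G : E → E →L[ℝ] E →L[ℝ] ℝ) (U : Set E) : Prop where
  isOpen : IsOpen U
  smooth : ContDiffOn ℝ ∞ G U
  symm : ∀ y ∈ U, ∀ u v, G y u v = G y v u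
  pos : ∀ y ∈ U, ∀ u, u ≠ 0 → 0 < G y u u

/-- The Christoffel symbols of the first kind of the metric `G`, as a trilinear form:
`⟨∇_u v, w⟩` for constant vector fields `u`, `v`, `w`. -/
noncomputable def koszul (G : E → E →L[ℝ] E →L[ℝ] ℝ) (y : E) : E →L[ℝ] E →L[ℝ] E →L[ℝ] ℝ :=
  (1 / 2 : ℝ) • (fderiv ℝ G y + (fderiv ℝ G y).flip
    - ((ContinuousLinearMap.flipₗᵢ ℝ E E ℝ).toContinuousLinearEquiv.toContinuousLinearMap).comp
        (fderiv ℝ G y).flip)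

theorem koszul_apply (G : E → E →L[ℝ] E →L[ℝ] ℝ) (y u v w : E) :
    koszul G y u v w
      = (1 / 2) * (fderiv ℝ G y u v w + fderiv ℝ G y v u w - fderiv ℝ G y w u v) := by
  simp [koszul]

/-- The Christoffel symbols of the metric `G`: the bilinear map `(u, v) ↦ ∇_u v` for constant vector
fields. -/
noncomputable def christ (G : E → E →L[ℝ] E →L[ℝ] ℝ) (y : E) : E →L[ℝ] E →L[ℝ] E :=
  (ContinuousLinearMap.compL ℝ E (E →L[ℝ] ℝ) E (G y).inverse).comp (koszul G y)

/-- The quadratic form `⟨R(a, b)b, a⟩` of the curvature tensor of `G`, in terms of the second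
derivatives of the metric. -/
noncomputable def curvForm (G : E → E →L[ℝ] E →L[ℝ] ℝ) (y a b : E) : ℝ :=
  fderiv ℝ (fderiv ℝ G) y b a a b - (1 / 2) * fderiv ℝ (fderiv ℝ G) y b b a a
    - (1 / 2) * fderiv ℝ (fderiv ℝ G) y a a b b
    + G y (christ G y a b) (christ G y a b) - G y (christ G y a a) (christ G y b b)

namespace IsMetricOn

variable {G : E → E →L[ℝ] E →L[ℝ] ℝ} {U : Set E} {y : E}

theorem mem_nhds (h : IsMetricOn G U) (hy : y ∈ U) : U ∈ 𝓝 y := h.isOpen.mem_nhds hy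

theorem contDiffAt (h : IsMetricOn G U) (hy : y ∈ U) : ContDiffAt ℝ ∞ G y :=
  h.smooth.contDiffAt (h.mem_nhds hy)

theorem hasFDerivAt (h : IsMetricOn G U) (hy : y ∈ U) : HasFDerivAt G (fderiv ℝ G y) y :=
  ((h.contDiffAt hy).differentiableAt (by simp)).hasFDerivAt

theorem contDiffAt_fderiv (h : IsMetricOn G U) (hy : y ∈ U) : ContDiffAt ℝ ∞ (fderiv ℝ G) y :=
  (h.contDiffAt hy).fderiv_right (m := ∞) (by simp)

theorem hasFDerivAt_fderiv (h : IsMetricOn G U) (hy : y ∈ U) :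
    HasFDerivAt (fderiv ℝ G) (fderiv ℝ (fderiv ℝ G) y) y :=
  ((h.contDiffAt_fderiv hy).differentiableAt (by simp)).hasFDerivAt

theorem fderiv_symm (h : IsMetricOn G U) (hy : y ∈ U) (a u v : E) :
    fderiv ℝ G y a u v = fderiv ℝ G y a v u := by
  have h1 : HasFDerivAt (fun z => G z u v) (((fderiv ℝ G y).flip u).flip v) y := by
    have := ((h.hasFDerivAt hy).clm_apply (hasFDerivAt_const u y)).clm_apply (hasFDerivAt_const v y)
    refine this.congr_fderiv ?_
    ext; simp
  have h2 : HasFDerivAt (fun z => G z v u) (((fderiv ℝ G y).flip v).flip u) y := by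
    have := ((h.hasFDerivAt hy).clm_apply (hasFDerivAt_const v y)).clm_apply (hasFDerivAt_const u y)
    refine this.congr_fderiv ?_
    ext; simp
  have h3 : (fun z => G z u v) =ᶠ[𝓝 y] fun z => G z v u := by
    filter_upwards [h.mem_nhds hy] with z hz using h.symm z hz u v
  have := (h2.congr_of_eventuallyEq h3).unique h1
  simpa using (congrArg (fun L => L a) this).symm

theorem snd_symm (h : IsMetricOn G U) (hy : y ∈ U) (a b u v : E) :
    fderiv ℝ (fderiv ℝ G) y a b u v = fderiv ℝ (fderiv ℝ G) y b a u v := by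
  have := ((h.contDiffAt hy).isSymmSndFDerivAt
    (by rw [minSmoothness_of_isRCLikeNormedField]; exact ENat.LEInfty.out)).eq a b
  rw [this]

theorem snd_symm' (h : IsMetricOn G U) (hy : y ∈ U) (a b u v : E) :
    fderiv ℝ (fderiv ℝ G) y a b u v = fderiv ℝ (fderiv ℝ G) y a b v u := by
  have h1 : ∀ u v : E, HasFDerivAt (fun z => fderiv ℝ G z b u v)
      (((((fderiv ℝ (fderiv ℝ G) y).flip b).flip u)).flip v) y := by
    intro u v
    have := (((h.hasFDerivAt_fderiv hy).clm_apply (hasFDerivAt_const b y)).clm_apply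
      (hasFDerivAt_const u y)).clm_apply (hasFDerivAt_const v y)
    refine this.congr_fderiv ?_
    ext; simp
  have h3 : (fun z => fderiv ℝ G z b u v) =ᶠ[𝓝 y] fun z => fderiv ℝ G z b v u := by
    filter_upwards [h.mem_nhds hy] with z hz using h.fderiv_symm hz b u v
  have := ((h1 v u).congr_of_eventuallyEq h3).unique (h1 u v)
  simpa using (congrArg (fun L => L a) this).symm

theorem koszul_symm (h : IsMetricOn G U) (hy : y ∈ U) (u v w : E) :
    koszul G y u v w = koszul G y v u w := by
  rw [koszul_apply, koszul_apply, h.fderiv_symm hy w u v]; ring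

/-- Compatibility of the Levi-Civita connection with the metric. -/
theorem koszul_add (h : IsMetricOn G U) (hy : y ∈ U) (u v w : E) :
    koszul G y u v w + koszul G y u w v = fderiv ℝ G y u v w := by
  rw [koszul_apply, koszul_apply, h.fderiv_symm hy u w v, h.fderiv_symm hy v u w,
    h.fderiv_symm hy w u v]; ring

variable [FiniteDimensional ℝ E]

theorem exists_equiv (h : IsMetricOn G U) (hy : y ∈ U) :
    ∃ e : E ≃L[ℝ] (E →L[ℝ] ℝ), (e : E →L[ℝ] E →L[ℝ] ℝ) = G y := by
  have hinj : Function.Injective (G y : E →ₗ[ℝ] E →L[ℝ] ℝ) := by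
    rw [injective_iff_map_eq_zero]
    intro u hu
    by_contra h0
    have := h.pos y hy u h0
    have hu' : G y u = 0 := hu
    simp [hu'] at this
  have hfin : Module.finrank ℝ E = Module.finrank ℝ (E →L[ℝ] ℝ) := by
    rw [(LinearMap.toContinuousLinearMap (𝕜 := ℝ) (E := E) (F' := ℝ)).symm.finrank_eq]
    exact (Subspace.dual_finrank_eq (K := ℝ) (V := E)).symm
  refine ⟨(LinearEquiv.ofInjectiveOfFinrankEq _ hinj hfin).toContinuousLinearEquiv, ?_⟩
  ext u v
  rfl

theorem apply_inverse (h : IsMetricOn G U) (hy : y ∈ U) (f : E →L[ℝ] ℝ) :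
    G y ((G y).inverse f) = f := by
  obtain ⟨e, he⟩ := h.exists_equiv hy
  rw [← he, ContinuousLinearMap.inverse_equiv]
  simp

theorem metric_christ (h : IsMetricOn G U) (hy : y ∈ U) (u v w : E) :
    G y (christ G y u v) w = koszul G y u v w := by
  have : christ G y u v = (G y).inverse (koszul G y u v) := by simp [christ]
  rw [this, h.apply_inverse hy]

omit [FiniteDimensional ℝ E] in
theorem ext_of_metric (h : IsMetricOn G U) (hy : y ∈ U) {u v : E}
    (huv : ∀ w, G y u w = G y v w) : u = v := by
  by_contra hne
  have h1 := h.pos y hy (u - v) (sub_ne_zero.2 hne)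
  have h2 := huv (u - v)
  rw [show G y (u - v) (u - v) = G y u (u - v) - G y v (u - v) by simp] at h1
  linarith

theorem christ_symm (h : IsMetricOn G U) (hy : y ∈ U) (u v : E) :
    christ G y u v = christ G y v u :=
  h.ext_of_metric hy fun w => by
    rw [h.metric_christ hy, h.metric_christ hy, h.koszul_symm hy]

omit [FiniteDimensional ℝ E] in
theorem contDiffOn_koszul (h : IsMetricOn G U) : ContDiffOn ℝ ∞ (koszul G) U := by
  intro y hy
  apply ContDiffAt.contDiffWithinAt
  have h1 := h.contDiffAt_fderiv hy
  have h2 : ContDiffAt ℝ ∞ (fun z => (fderiv ℝ G z).flip) y :=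
    (ContinuousLinearMap.flipₗᵢ ℝ E E (E →L[ℝ] ℝ)).contDiff.contDiffAt.comp y h1
  exact (contDiffAt_const (c := (1 / 2 : ℝ))).smul
    ((h1.add h2).sub (contDiffAt_const.clm_comp h2))

theorem contDiffOn_christ (h : IsMetricOn G U) : ContDiffOn ℝ ∞ (christ G) U := by
  intro y hy
  apply ContDiffAt.contDiffWithinAt
  obtain ⟨e, he⟩ := h.exists_equiv hy
  have h1 : ContDiffAt ℝ ∞ (fun z => (G z).inverse) y := by
    have := contDiffAt_map_inverse (𝕜 := ℝ) (n := ∞) e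
    rw [he] at this
    exact this.comp y (h.contDiffAt hy)
  exact ((ContinuousLinearMap.compL ℝ E (E →L[ℝ] ℝ) E).contDiff.contDiffAt.comp y h1).clm_comp
    (h.contDiffOn_koszul.contDiffAt (h.mem_nhds hy))

/-- Compatibility of the metric and the connection, in terms of the Christoffel symbols. -/
theorem fderiv_eq (h : IsMetricOn G U) (hy : y ∈ U) (u v w : E) :
    fderiv ℝ G y u v w = G y (christ G y u v) w + G y v (christ G y u w) := by
  rw [h.symm y hy v, h.metric_christ hy, h.metric_christ hy, h.koszul_add hy]

/-- The product rule for the metric and the covariant derivative along a curve `c`. -/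
theorem hasDerivWithinAt_inner (h : IsMetricOn G U) {c V W : ℝ → E} {c' V' W' : E} {s : Set ℝ}
    {t : ℝ} (ht : c t ∈ U) (hc : HasDerivWithinAt c c' s t) (hV : HasDerivWithinAt V V' s t)
    (hW : HasDerivWithinAt W W' s t) :
    HasDerivWithinAt (fun r => G (c r) (V r) (W r))
      (G (c t) (V' + christ G (c t) c' (V t)) (W t)
        + G (c t) (V t) (W' + christ G (c t) c' (W t))) s t := by
  have h1 := (h.hasFDerivAt ht).comp_hasDerivWithinAt t hc
  have h2 := (h1.clm_apply hV).clm_apply hW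
  refine h2.congr_deriv ?_
  simp only [_root_.add_apply, map_add, Function.comp, h.fderiv_eq ht]
  ring

/-- The derivative of the first order part of the energy along a geodesic. -/
theorem hasDerivWithinAt_inner_velocity (h : IsMetricOn G U) {c u η : ℝ → E} {η' : E} {s : Set ℝ}
    {t : ℝ} (ht : c t ∈ U) (hc : HasDerivWithinAt c (u t) s t)
    (hu : HasDerivWithinAt u (-christ G (c t) (u t) (u t)) s t) (hη : HasDerivWithinAt η η' s t) :
    HasDerivWithinAt (fun r => G (c r) (u r) (η r))
      ((1 / 2) * fderiv ℝ G (c t) (η t) (u t) (u t) + G (c t) (u t) η') s t := by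
  refine (h.hasDerivWithinAt_inner ht hc hu hη).congr_deriv ?_
  rw [neg_add_cancel, map_add, h.symm _ ht (u t) (christ _ _ _ _), h.metric_christ ht,
    koszul_apply, h.fderiv_symm ht (u t) (u t) (η t)]
  simp
  ring

/-- The second variation formula, in infinitesimal form: the second order part of the energy density
of a variation field `η` along a geodesic is `|∇η|² - ⟨R(η, u)u, η⟩`, up to the derivative of
`⟨∇_η η, u⟩`. -/
theorem hasDerivWithinAt_koszul (h : IsMetricOn G U) {c u η : ℝ → E} {η' : E} {s : Set ℝ} {t : ℝ}
    (ht : c t ∈ U) (hc : HasDerivWithinAt c (u t) s t)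
    (hu : HasDerivWithinAt u (-christ G (c t) (u t) (u t)) s t) (hη : HasDerivWithinAt η η' s t) :
    HasDerivWithinAt (fun r => koszul G (c r) (η r) (η r) (u r))
      ((1 / 2) * fderiv ℝ (fderiv ℝ G) (c t) (η t) (η t) (u t) (u t)
        + 2 * fderiv ℝ G (c t) (η t) (u t) η' + G (c t) η' η'
        - G (c t) (η' + christ G (c t) (u t) (η t)) (η' + christ G (c t) (u t) (η t))
        + curvForm G (c t) (η t) (u t)) s t := by
  have h1 := (h.hasFDerivAt_fderiv ht).comp_hasDerivWithinAt t hc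
  have h2 := ((h1.clm_apply hη).clm_apply hη).clm_apply hu
  have h3 := ((h1.clm_apply hu).clm_apply hη).clm_apply hη
  have h4 := (h2.sub (h3.const_mul (1 / 2)))
  have h5 : (fun r => koszul G (c r) (η r) (η r) (u r)) = fun r =>
      fderiv ℝ G (c r) (η r) (η r) (u r) - 1 / 2 * fderiv ℝ G (c r) (u r) (η r) (η r) := by
    funext r
    rw [koszul_apply]; ring
  rw [h5]
  refine h4.congr_deriv ?_
  have e1 : G (c t) (christ G (c t) (η t) (η t)) (christ G (c t) (u t) (u t))
      = fderiv ℝ G (c t) (η t) (η t) (christ G (c t) (u t) (u t))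
        - 1 / 2 * fderiv ℝ G (c t) (christ G (c t) (u t) (u t)) (η t) (η t) := by
    rw [h.metric_christ ht, koszul_apply]; ring
  have e2 : G (c t) η' (christ G (c t) (u t) (η t)) = 1 / 2 * (fderiv ℝ G (c t) (u t) (η t) η'
      + fderiv ℝ G (c t) (η t) (u t) η' - fderiv ℝ G (c t) η' (u t) (η t)) := by
    rw [h.symm _ ht, h.metric_christ ht, koszul_apply]
  have e3 : G (c t) (christ G (c t) (u t) (η t)) η' = G (c t) η' (christ G (c t) (u t) (η t)) :=
    h.symm _ ht _ _
  simp only [curvForm, _root_.add_apply, map_add, Function.comp, map_neg, _root_.neg_apply, e1, e2,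
    e3, h.christ_symm ht (η t) (u t), h.fderiv_symm ht (η t) η' (u t),
    h.fderiv_symm ht η' (η t) (u t), h.fderiv_symm ht (u t) η' (η t),
    h.snd_symm' ht (u t) (η t) (η t) (u t)]
  ring

/-- The lowered curvature tensor, computed from the derivatives of the Christoffel symbols. -/
theorem metric_curv (h : IsMetricOn G U) (hy : y ∈ U) (a b : E) :
    G y (fderiv ℝ (christ G) y a b b - fderiv ℝ (christ G) y b a b
      + christ G y a (christ G y b b) - christ G y b (christ G y a b)) a = curvForm G y a b := by
  have hch : HasFDerivAt (christ G) (fderiv ℝ (christ G) y) y :=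
    ((h.contDiffOn_christ.contDiffAt (h.mem_nhds hy)).differentiableAt (by simp)).hasFDerivAt
  have key : ∀ e u v w : E, G y (fderiv ℝ (christ G) y e u v) w
      = 1 / 2 * (fderiv ℝ (fderiv ℝ G) y e u v w + fderiv ℝ (fderiv ℝ G) y e v u w
        - fderiv ℝ (fderiv ℝ G) y e w u v) - fderiv ℝ G y e (christ G y u v) w := by
    intro e u v w
    have h1 := ((h.hasFDerivAt hy).clm_apply ((hch.clm_apply (hasFDerivAt_const u y)).clm_apply
      (hasFDerivAt_const v y))).clm_apply (hasFDerivAt_const w y)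
    have hd : ∀ u v w : E, HasFDerivAt (fun z => fderiv ℝ G z u v w)
        (((((fderiv ℝ (fderiv ℝ G) y).flip u).flip v)).flip w) y := by
      intro u v w
      have := (((h.hasFDerivAt_fderiv hy).clm_apply (hasFDerivAt_const u y)).clm_apply
        (hasFDerivAt_const v y)).clm_apply (hasFDerivAt_const w y)
      refine this.congr_fderiv ?_
      ext; simp
    have h2 := (((hd u v w).add (hd v u w)).sub (hd w u v)).const_mul (1 / 2)
    have h3 : (fun z => G z (christ G z u v) w) =ᶠ[𝓝 y] fun z =>
        1 / 2 * (fderiv ℝ G z u v w + fderiv ℝ G z v u w - fderiv ℝ G z w u v) := by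
      filter_upwards [h.mem_nhds hy] with z hz
      rw [h.metric_christ hz, koszul_apply]
    have h4 := congrArg (fun L => L e) ((h2.congr_of_eventuallyEq h3).unique h1)
    simp at h4
    linarith
  have k1 := h.fderiv_eq hy
  have k2 := h.metric_christ hy
  simp only [_root_.add_apply, map_add, map_sub, _root_.sub_apply, key, curvForm, k1]
  rw [h.symm y hy (christ G y a b) (christ G y b a), h.christ_symm hy b a,
    h.symm y hy (christ G y b (christ G y a b)) a, h.snd_symm hy a b b a, h.snd_symm' hy b a b a,
    h.symm y hy (christ G y b b) (christ G y a a)]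
  ring

end IsMetricOn

end LocalMetric

/-! ### The metric and the distance in a chart -/

section ChartMetric

variable {M : Type*} [TopologicalSpace M] [ChartedSpace E3 M]

theorem E3.sum_stdVec (u : E3) : u = ∑ i, u i • stdVec i := by
  ext j
  simp [Finset.sum_apply, Pi.single_apply]

theorem E3.inner_map_map {F : Type*} [NormedAddCommGroup F] [InnerProductSpace ℝ F]
    (f : E3 →ₗ[ℝ] F) (u w : E3) :
    inner ℝ (f u) (f w) = ∑ i, ∑ j, u i * w j * inner ℝ (f (stdVec i)) (f (stdVec j)) := by
  conv_lhs => rw [E3.sum_stdVec u, E3.sum_stdVec w]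
  simp_rw [map_sum, sum_inner, inner_sum, map_smul, real_inner_smul_left, real_inner_smul_right,
    mul_assoc]

theorem E3.trilinear_eq_sum (T : E3 → E3 → E3 → ℝ) (h₁ : ∀ b c, IsLinearMap ℝ fun a => T a b c)
    (h₂ : ∀ a c, IsLinearMap ℝ fun b => T a b c) (h₃ : ∀ a b, IsLinearMap ℝ fun c => T a b c)
    (a b c : E3) :
    T a b c = ∑ i, ∑ j, ∑ k, T (stdVec i) (stdVec j) (stdVec k) * a i * b j * c k := by
  have h : ∀ f : E3 → ℝ, IsLinearMap ℝ f → ∀ x : E3, f x = ∑ i, f (stdVec i) * x i := by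
    intro f hf x
    have : f x = hf.mk' f (∑ i, x i • stdVec i) := by rw [← E3.sum_stdVec x]; rfl
    rw [this, map_sum]
    exact Finset.sum_congr rfl fun i _ => by rw [map_smul, smul_eq_mul, mul_comm]; rfl
  rw [h _ (h₁ b c) a]
  refine Finset.sum_congr rfl fun i _ => ?_
  rw [h _ (h₂ (stdVec i) c) b, Finset.sum_mul]
  refine Finset.sum_congr rfl fun j _ => ?_
  rw [h _ (h₃ (stdVec i) (stdVec j)) c, Finset.sum_mul, Finset.sum_mul]
  exact Finset.sum_congr rfl fun k _ => by ring

section Gram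

variable [RiemannianBundle (fun x : M => TangentSpace (𝓡 3) x)]

/-- The metric in the chart `e`, as a field of bilinear forms on the model space. -/
noncomputable def gram (e : OpenPartialHomeomorph M E3) (y : E3) : E3 →L[ℝ] E3 →L[ℝ] ℝ :=
  ∑ i, ∑ j, metricCoeff e y i j •
    (EuclideanSpace.proj i : E3 →L[ℝ] ℝ).smulRight (EuclideanSpace.proj j : E3 →L[ℝ] ℝ)

theorem gram_apply (e : OpenPartialHomeomorph M E3) (y u w : E3) :
    gram e y u w = ∑ i, ∑ j, metricCoeff e y i j * u i * w j := by
  simp [gram, mul_assoc]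

theorem gram_eq_inner (e : OpenPartialHomeomorph M E3) (y u w : E3) :
    gram e y u w = inner ℝ (mfderiv (𝓡 3) (𝓡 3) e.symm y u : TangentSpace (𝓡 3) (e.symm y))
      (mfderiv (𝓡 3) (𝓡 3) e.symm y w) := by
  have h := E3.inner_map_map (F := TangentSpace (𝓡 3) (e.symm y))
    (mfderiv (𝓡 3) (𝓡 3) e.symm y).toLinearMap u w
  refine Eq.trans ?_ h.symm
  rw [gram_apply]
  refine Finset.sum_congr rfl fun i _ => Finset.sum_congr rfl fun j _ => ?_
  rw [metricCoeff, mul_assoc, mul_comm]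
  rfl

theorem gram_self_eq_norm (e : OpenPartialHomeomorph M E3) (y u : E3) :
    gram e y u u = ‖(mfderiv (𝓡 3) (𝓡 3) e.symm y u : TangentSpace (𝓡 3) (e.symm y))‖ ^ 2 := by
  rw [gram_eq_inner, real_inner_self_eq_norm_sq]

variable [IsManifold (𝓡 3) ∞ M]

theorem mdifferentiable_of_mem_maximalAtlas {e : OpenPartialHomeomorph M E3}
    (he : e ∈ IsManifold.maximalAtlas (𝓡 3) ∞ M) : e.MDifferentiable (𝓡 3) (𝓡 3) :=
  ⟨(contMDiffOn_of_mem_maximalAtlas he).mdifferentiableOn (by simp),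
    (contMDiffOn_symm_of_mem_maximalAtlas he).mdifferentiableOn (by simp)⟩

theorem mfderiv_symm_injective {e : OpenPartialHomeomorph M E3}
    (he : e ∈ IsManifold.maximalAtlas (𝓡 3) ∞ M) {y : E3} (hy : y ∈ e.target) :
    Function.Injective (mfderiv (𝓡 3) (𝓡 3) e.symm y) :=
  (mdifferentiable_of_mem_maximalAtlas he).symm.mfderiv_injective hy

theorem contMDiffOn_coordVec {e : OpenPartialHomeomorph M E3}
    (he : e ∈ IsManifold.maximalAtlas (𝓡 3) ∞ M) (i : Fin 3) :
    ContMDiffOn (𝓡 3) (𝓡 3).tangent ∞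
      (fun y => (⟨e.symm y, coordVec e i y⟩ : TangentBundle (𝓡 3) M)) e.target := by
  have h1 := (contMDiffOn_symm_of_mem_maximalAtlas he).contMDiffOn_tangentMapWithin
    (m := ∞) (by simp) e.open_target.uniqueMDiffOn
  have h2 : ContMDiff (𝓡 3) (𝓡 3).tangent ∞
      (fun y : E3 => (⟨y, stdVec i⟩ : TangentBundle (𝓡 3) E3)) :=
    contMDiff_vectorSpace_iff_contDiff.2 contDiff_const
  have h3 := h1.comp (s := e.target) h2.contMDiffOn (fun y hy => hy)
  refine h3.congr fun y hy => ?_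
  simp only [Function.comp, tangentMapWithin, coordVec]
  rw [mfderivWithin_of_mem_nhds (e.open_target.mem_nhds hy)]

variable [IsContMDiffRiemannianBundle (𝓡 3) ∞ E3 (fun x : M => TangentSpace (𝓡 3) x)]

theorem contDiffOn_metricCoeff {e : OpenPartialHomeomorph M E3}
    (he : e ∈ IsManifold.maximalAtlas (𝓡 3) ∞ M) (i j : Fin 3) :
    ContDiffOn ℝ ∞ (fun y => metricCoeff e y i j) e.target := by
  rw [← contMDiffOn_iff_contDiffOn]
  exact (contMDiffOn_coordVec he i).inner_bundle (contMDiffOn_coordVec he j)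

theorem isMetricOn_gram {e : OpenPartialHomeomorph M E3}
    (he : e ∈ IsManifold.maximalAtlas (𝓡 3) ∞ M) : IsMetricOn (gram e) e.target where
  isOpen := e.open_target
  smooth := ContDiffOn.sum fun i _ => ContDiffOn.sum fun j _ =>
    (contDiffOn_metricCoeff he i j).smul contDiffOn_const
  symm y _ u v := by rw [gram_eq_inner, gram_eq_inner, real_inner_comm]
  pos y hy u hu := by
    rw [gram_eq_inner]
    refine real_inner_self_pos.2 fun h => hu ?_
    exact mfderiv_symm_injective he hy (h.trans (map_zero _).symm)

theorem christ_gram_eq {e : OpenPartialHomeomorph M E3}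
    (he : e ∈ IsManifold.maximalAtlas (𝓡 3) ∞ M) {y : E3} (hy : y ∈ e.target) (i j k : Fin 3) :
    christoffel e k i j y = christ (gram e) y (stdVec i) (stdVec j) k := by
  have hG := isMetricOn_gram he
  have hstd : ∀ z, ∀ i j, gram e z (stdVec i) (stdVec j) = metricCoeff e z i j := by
    intro z i j
    rw [gram_eq_inner]; rfl
  have hpart : ∀ a b c : Fin 3, partialD a (fun z => metricCoeff e z b c) y
      = fderiv ℝ (gram e) y (stdVec a) (stdVec b) (stdVec c) := by
    intro a b c
    have h1 := ((hG.hasFDerivAt hy).clm_apply (hasFDerivAt_const (stdVec b) y)).clm_apply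
      (hasFDerivAt_const (stdVec c) y)
    simp only [hstd] at h1
    rw [partialD, h1.fderiv]
    simp
  have hdet : IsUnit (metricCoeff e y).det := by
    rw [isUnit_iff_ne_zero]
    intro h0
    obtain ⟨v, hv, hv0⟩ := Matrix.exists_mulVec_eq_zero_iff.2 h0
    have hv' : (WithLp.toLp 2 v : E3) ≠ 0 := fun h => hv (by
      have := congrArg WithLp.ofLp h
      simpa using this)
    have := hG.pos y hy _ hv'
    rw [gram_apply] at this
    have h2 : ∑ i, v i * (metricCoeff e y).mulVec v i = 0 := by simp [hv0]
    simp only [Matrix.mulVec, dotProduct, Finset.mul_sum] at h2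
    have h3 : ∑ i, ∑ j, metricCoeff e y i j * v i * v j = 0 := by
      rw [← h2]
      exact Finset.sum_congr rfl fun i _ => Finset.sum_congr rfl fun j _ => by ring
    exact absurd h3 this.ne'
  set X : E3 := christ (gram e) y (stdVec i) (stdVec j) with hX
  have hK : ∀ l, ∑ m, metricCoeff e y l m * X m
      = 1 / 2 * (partialD i (fun z => metricCoeff e z j l) y
        + partialD j (fun z => metricCoeff e z i l) y
        - partialD l (fun z => metricCoeff e z i j) y) := by
    intro l
    have h1 := hG.metric_christ hy (stdVec i) (stdVec j) (stdVec l)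
    rw [← hX, koszul_apply, ← hpart, ← hpart, ← hpart] at h1
    rw [← h1, hG.symm y hy, gram_apply]
    simp
  have h4 : (metricCoeff e y).mulVec X.ofLp = fun l =>
      1 / 2 * (partialD i (fun z => metricCoeff e z j l) y
        + partialD j (fun z => metricCoeff e z i l) y
        - partialD l (fun z => metricCoeff e z i j) y) := funext hK
  have h5 : X.ofLp = (metricCoeff e y)⁻¹.mulVec fun l =>
      1 / 2 * (partialD i (fun z => metricCoeff e z j l) y
        + partialD j (fun z => metricCoeff e z i l) y
        - partialD l (fun z => metricCoeff e z i j) y) := by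
    rw [← h4, Matrix.mulVec_mulVec, Matrix.nonsing_inv_mul _ hdet, Matrix.one_mulVec]
  rw [h5, christoffel, Finset.mul_sum]
  simp only [Matrix.mulVec, dotProduct]
  exact Finset.sum_congr rfl fun l _ => by ring

theorem curvCoeff_sum {e : OpenPartialHomeomorph M E3}
    (he : e ∈ IsManifold.maximalAtlas (𝓡 3) ∞ M) {y : E3} (hy : y ∈ e.target) (a b : E3)
    (l : Fin 3) :
    ∑ i, ∑ j, ∑ k, curvCoeff e i j k l y * a i * b j * b k
      = (fderiv ℝ (christ (gram e)) y a b b - fderiv ℝ (christ (gram e)) y b a b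
        + christ (gram e) y a (christ (gram e) y b b)
        - christ (gram e) y b (christ (gram e) y a b)) l := by
  have hG := isMetricOn_gram he
  have hch : HasFDerivAt (christ (gram e)) (fderiv ℝ (christ (gram e)) y) y :=
    ((hG.contDiffOn_christ.contDiffAt (hG.mem_nhds hy)).differentiableAt (by simp)).hasFDerivAt
  have hpart : ∀ i j k l, partialD i (christoffel e l j k) y
      = fderiv ℝ (christ (gram e)) y (stdVec i) (stdVec j) (stdVec k) l := by
    intro i j k l
    have h1 := (hch.clm_apply (hasFDerivAt_const (stdVec j) y)).clm_apply
      (hasFDerivAt_const (stdVec k) y)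
    have h2 := (EuclideanSpace.proj l : E3 →L[ℝ] ℝ).hasFDerivAt.comp y h1
    have h3 : christoffel e l j k =ᶠ[𝓝 y]
        ((EuclideanSpace.proj l : E3 →L[ℝ] ℝ) ∘ fun z =>
          christ (gram e) z (stdVec j) (stdVec k)) := by
      filter_upwards [hG.mem_nhds hy] with z hz
      rw [christ_gram_eq he hz]
      rfl
    rw [partialD, (h2.congr_of_eventuallyEq h3).fderiv]
    simp
  have hc : ∀ i j k l, curvCoeff e i j k l y
      = (fderiv ℝ (christ (gram e)) y (stdVec i) (stdVec j) (stdVec k)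
        - fderiv ℝ (christ (gram e)) y (stdVec j) (stdVec i) (stdVec k)
        + christ (gram e) y (stdVec i) (christ (gram e) y (stdVec j) (stdVec k))
        - christ (gram e) y (stdVec j) (christ (gram e) y (stdVec i) (stdVec k))) l := by
    intro i j k l
    rw [curvCoeff, hpart, hpart]
    simp only [christ_gram_eq he hy]
    have h1 : ∀ p q r : Fin 3, christ (gram e) y (stdVec p)
        (christ (gram e) y (stdVec q) (stdVec r)) l
        = ∑ m, christ (gram e) y (stdVec p) (stdVec m) l
          * christ (gram e) y (stdVec q) (stdVec r) m := by
      intro p q r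
      conv_lhs => rw [E3.sum_stdVec (christ (gram e) y (stdVec q) (stdVec r))]
      rw [map_sum]
      simp [mul_comm]
    simp only [PiLp.sub_apply, PiLp.add_apply, h1, Finset.sum_sub_distrib]
    ring
  simp only [hc]
  refine (E3.trilinear_eq_sum (fun a b c => (fderiv ℝ (christ (gram e)) y a b c
    - fderiv ℝ (christ (gram e)) y b a c + christ (gram e) y a (christ (gram e) y b c)
    - christ (gram e) y b (christ (gram e) y a c)) l) ?_ ?_ ?_ a b b).symm
  all_goals
    intro p q
    constructor
    · intro v w
      simp only [map_add, _root_.add_apply, PiLp.sub_apply, PiLp.add_apply]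
      ring
    · intro r v
      simp only [map_smul, _root_.smul_apply, PiLp.sub_apply, PiLp.add_apply, PiLp.smul_apply,
        smul_eq_mul]
      ring

theorem curvForm_gram {e : OpenPartialHomeomorph M E3}
    (he : e ∈ IsManifold.maximalAtlas (𝓡 3) ∞ M) {y : E3} (hy : y ∈ e.target) (a b : E3) :
    coordInner e y (fun l => ∑ i, ∑ j, ∑ k, curvCoeff e i j k l y * a i * b j * b k) a
      = curvForm (gram e) y a b := by
  rw [← (isMetricOn_gram he).metric_curv hy, gram_apply, coordInner]
  simp only [curvCoeff_sum he hy]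

/-- A lower curvature bound, in terms of the curvature form of the metric in a chart. -/
theorem SecGE.le_curvForm {κ : ℝ} (h : SecGE M κ) {e : OpenPartialHomeomorph M E3}
    (he : e ∈ IsManifold.maximalAtlas (𝓡 3) ∞ M) {y : E3} (hy : y ∈ e.target) (a b : E3) :
    κ * (gram e y a a * gram e y b b - gram e y a b ^ 2) ≤ curvForm (gram e) y a b := by
  have hG := isMetricOn_gram he
  by_cases hab : LinearIndependent ℝ ![a, b]
  · have hab' : LinearIndependent ℝ ![a.ofLp, b.ofLp] := by
      have := hab.map' (WithLp.linearEquiv 2 ℝ (Fin 3 → ℝ)).toLinearMap (LinearEquiv.ker _)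
      have he : (![a.ofLp, b.ofLp] : Fin 2 → Fin 3 → ℝ)
          = (WithLp.linearEquiv 2 ℝ (Fin 3 → ℝ)).toLinearMap ∘ ![a, b] := by
        ext i j
        fin_cases i <;> rfl
      rw [he]
      exact this
    have h1 := h e he y hy a.ofLp b.ofLp hab'
    have hD : 0 < gram e y a a * gram e y b b - gram e y a b ^ 2 := by
      have hb : b ≠ 0 := hab.ne_zero 1
      have hb' := hG.pos y hy b hb
      have hne : gram e y b b • a - gram e y a b • b ≠ 0 := by
        intro h0
        have := LinearIndependent.pair_iff.1 hab (gram e y b b) (-gram e y a b)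
          (by rw [neg_smul, ← sub_eq_add_neg, h0])
        exact hb'.ne' this.1
      have h3 := hG.pos y hy _ hne
      have h4 : gram e y (gram e y b b • a - gram e y a b • b)
          (gram e y b b • a - gram e y a b • b)
          = gram e y b b * (gram e y a a * gram e y b b - gram e y a b ^ 2) := by
        simp only [map_sub, map_smul, _root_.sub_apply, _root_.smul_apply, smul_eq_mul,
          hG.symm y hy b a]
        ring
      rw [h4] at h3
      exact pos_of_mul_pos_right h3 hb'.le
    rw [sectionalCurvature, curvForm_gram he hy] at h1
    have e1 : ∀ u w : E3, coordInner e y u.ofLp w.ofLp = gram e y u w := fun u w => by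
      rw [coordInner, gram_apply]
    simp only [e1] at h1
    rwa [le_div_iff₀ hD] at h1
  · have hcol : ∃ (p : E3) (r s : ℝ), a = r • p ∧ b = s • p := by
      rw [LinearIndependent.pair_iff] at hab
      push Not at hab
      obtain ⟨s, t, h1, h2⟩ := hab
      by_cases hs : s = 0
      · have ht := h2 hs
        refine ⟨a, 1, 0, by simp, ?_⟩
        rw [hs, zero_smul, zero_add] at h1
        rw [zero_smul]
        exact (smul_eq_zero.1 h1).resolve_left ht
      · refine ⟨b, -t / s, 1, ?_, by simp⟩
        have : s • a = -(t • b) := eq_neg_of_add_eq_zero_left h1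
        rw [div_eq_inv_mul, mul_smul, neg_smul, ← this, smul_smul, inv_mul_cancel₀ hs, one_smul]
    obtain ⟨p, r, s, rfl, rfl⟩ := hcol
    simp only [curvForm, map_smul, _root_.smul_apply, smul_eq_mul]
    apply le_of_eq
    ring

/-- The chain rule for a curve given in a chart. -/
theorem mfderivWithin_symm_comp {e : OpenPartialHomeomorph M E3}
    (he : e ∈ IsManifold.maximalAtlas (𝓡 3) ∞ M) {c : ℝ → E3} {c' : E3} {s : Set ℝ} {t : ℝ}
    (ht : c t ∈ e.target) (hs : UniqueDiffWithinAt ℝ s t) (hc : HasDerivWithinAt c c' s t) :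
    mfderivWithin 𝓘(ℝ, ℝ) (𝓡 3) (e.symm ∘ c) s t (1 : ℝ)
      = mfderiv (𝓡 3) (𝓡 3) e.symm (c t) c' := by
  have h1 : MDifferentiableAt (𝓡 3) (𝓡 3) e.symm (c t) :=
    (mdifferentiable_of_mem_maximalAtlas he).mdifferentiableAt_symm ht
  have h2 : HasMFDerivWithinAt 𝓘(ℝ, ℝ) (𝓡 3) c s t (ContinuousLinearMap.toSpanSingleton ℝ c') :=
    hc.hasFDerivWithinAt.hasMFDerivWithinAt
  have h3 := h1.hasMFDerivAt.comp_hasMFDerivWithinAt t h2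
  rw [h3.mfderivWithin (uniqueMDiffWithinAt_iff_uniqueDiffWithinAt.2 hs)]
  show mfderiv (𝓡 3) (𝓡 3) e.symm (c t) (ContinuousLinearMap.toSpanSingleton ℝ c' (1 : ℝ)) = _
  rw [ContinuousLinearMap.toSpanSingleton_apply, one_smul]

end Gram

end ChartMetric

section Distance

variable {M : Type*} [MetricSpace M] [ChartedSpace E3 M] [IsManifold (𝓡 3) ∞ M]
  [RiemannianBundle (fun x : M => TangentSpace (𝓡 3) x)]
  [IsContMDiffRiemannianBundle (𝓡 3) ∞ E3 (fun x : M => TangentSpace (𝓡 3) x)]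
  [IsRiemannianManifold (𝓡 3) M]

theorem contDiffOn_one_of_hasDerivWithinAt {F : Type*} [NormedAddCommGroup F] [NormedSpace ℝ F]
    {a b : ℝ} (hab : a < b) {c c' : ℝ → F}
    (hc : ∀ t ∈ Icc a b, HasDerivWithinAt c (c' t) (Icc a b) t) (hc' : ContinuousOn c' (Icc a b)) :
    ContDiffOn ℝ 1 c (Icc a b) := by
  rw [contDiffOn_one_iff_derivWithin (uniqueDiffOn_Icc hab)]
  refine ⟨fun t ht => (hc t ht).differentiableWithinAt, hc'.congr fun t ht => ?_⟩
  exact (hc t ht).derivWithin (uniqueDiffOn_Icc hab t ht)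

/-- The distance of the end points of a curve in a chart is at most its length, which is estimated
by a primitive `Ψ` of an upper bound for the speed. -/
theorem dist_le_of_chart_curve {e : OpenPartialHomeomorph M E3}
    (he : e ∈ IsManifold.maximalAtlas (𝓡 3) ∞ M) {a b : ℝ} (hab : a ≤ b) {c c' : ℝ → E3}
    (hc : ∀ t ∈ Icc a b, HasDerivWithinAt c (c' t) (Icc a b) t) (hc' : ContinuousOn c' (Icc a b))
    (ht : ∀ t ∈ Icc a b, c t ∈ e.target) {Ψ Ψ' : ℝ → ℝ}
    (hΨ : ∀ t ∈ Icc a b, HasDerivWithinAt Ψ (Ψ' t) (Icc a b) t)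
    (hle : ∀ t ∈ Icc a b, √(gram e (c t) (c' t) (c' t)) ≤ Ψ' t) :
    dist (e.symm (c a)) (e.symm (c b)) ≤ Ψ b - Ψ a := by
  rcases hab.eq_or_lt with rfl | hab'
  · simp
  have hcd := contDiffOn_one_of_hasDerivWithinAt hab' hc hc'
  have hsm : ContMDiffOn 𝓘(ℝ, ℝ) (𝓡 3) 1 (e.symm ∘ c) (Icc a b) :=
    ((contMDiffOn_symm_of_mem_maximalAtlas he).of_le (by simp)).comp hcd.contMDiffOn ht
  have h1 := riemannianEDist_le_pathELength (I := 𝓡 3) hsm rfl rfl hab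
  rw [← IsRiemannianManifold.out, pathELength_eq_lintegral_mfderivWithin_Icc] at h1
  have h2 : ∫⁻ t in Icc a b, ‖mfderivWithin 𝓘(ℝ, ℝ) (𝓡 3) (e.symm ∘ c) (Icc a b) t (1 : ℝ)‖ₑ
      ≤ ∫⁻ t in Icc a b, ENNReal.ofReal (Ψ' t) := by
    refine MeasureTheory.setLIntegral_mono' measurableSet_Icc fun t htt => ?_
    rw [mfderivWithin_symm_comp he (ht t htt) (uniqueDiffOn_Icc hab' t htt) (hc t htt)]
    have h3 := hle t htt
    rw [gram_self_eq_norm, Real.sqrt_sq (norm_nonneg _)] at h3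
    rw [← ofReal_norm]
    exact ENNReal.ofReal_le_ofReal h3
  have h0 : ∀ t ∈ Icc a b, 0 ≤ Ψ' t := fun t htt => (Real.sqrt_nonneg _).trans (hle t htt)
  have h3 : ∫⁻ t in Icc a b, ENNReal.ofReal (Ψ' t) = ENNReal.ofReal (Ψ b - Ψ a) := by
    have hΨc : ContinuousOn Ψ (Icc a b) := fun t htt => (hΨ t htt).continuousWithinAt
    have hΨd : ∀ t ∈ Ioo a b, HasDerivAt Ψ (Ψ' t) t := fun t htt =>
      (hΨ t (Ioo_subset_Icc_self htt)).hasDerivAt (Icc_mem_nhds htt.1 htt.2)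
    have hint := intervalIntegral.integrableOn_deriv_of_nonneg hΨc hΨd
      fun t htt => h0 t (Ioo_subset_Icc_self htt)
    rw [← MeasureTheory.ofReal_integral_eq_lintegral_ofReal
        ((integrableOn_Icc_iff_integrableOn_Ioc).2 hint)
        ((MeasureTheory.ae_restrict_iff' measurableSet_Icc).2 (.of_forall h0)),
      MeasureTheory.integral_Icc_eq_integral_Ioc, ← intervalIntegral.integral_of_le hab,
      intervalIntegral.integral_eq_sub_of_hasDerivAt_of_le hab hΨc hΨd
        ((intervalIntegrable_iff_integrableOn_Ioc_of_le hab).2 hint)]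
  have h4 : 0 ≤ Ψ b - Ψ a := by
    have : MonotoneOn Ψ (Icc a b) := by
      refine monotoneOn_of_hasDerivWithinAt_nonneg (convex_Icc a b)
        (fun t htt => (hΨ t htt).continuousWithinAt) (f' := Ψ') (fun t htt => ?_) (fun t htt => ?_)
      · exact (hΨ t (interior_subset htt)).mono interior_subset
      · exact h0 t (interior_subset htt)
    exact sub_nonneg.2 (this (left_mem_Icc.2 hab) (right_mem_Icc.2 hab) hab)
  have h5 := h1.trans (h2.trans h3.le)
  rw [edist_dist, ENNReal.ofReal_le_ofReal_iff h4] at h5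
  exact h5

/-- A function with gradient bounded by `L` on a ball is `L`-Lipschitz with respect to the centre of
the ball. -/
theorem abs_sub_le_of_norm_mfderiv_le {h : M → ℝ} {x y : M} {δ L : ℝ} (hL : 0 ≤ L)
    (hh : ContMDiffOn (𝓡 3) 𝓘(ℝ, ℝ) 1 h (Metric.ball x δ))
    (hd : ∀ z ∈ Metric.ball x δ, ∀ v : TangentSpace (𝓡 3) z,
      |(show ℝ from mfderiv (𝓡 3) 𝓘(ℝ, ℝ) h z v)| ≤ L * ‖v‖) (hy : dist x y < δ) :
    |h y - h x| ≤ L * dist x y := by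
  have key : ∀ r : ℝ, dist x y < r → r < δ → |h y - h x| ≤ L * r := by
    intro r hr hrδ
    have hr0 : 0 < r := dist_nonneg.trans_lt hr
    have h1 : riemannianEDist (𝓡 3) x y < ENNReal.ofReal r := by
      rw [← IsRiemannianManifold.out, edist_dist]
      exact (ENNReal.ofReal_lt_ofReal_iff hr0).2 hr
    obtain ⟨γ, h0, h1, hsm, hlen⟩ := exists_lt_of_riemannianEDist_lt h1
    have hball : ∀ t ∈ Icc (0 : ℝ) 1, γ t ∈ Metric.ball x δ := by
      intro t ht
      have h2 := riemannianEDist_le_pathELength (I := 𝓡 3)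
        (hsm.mono (Icc_subset_Icc le_rfl ht.2)) h0 rfl ht.1
      have h3 := h2.trans (pathELength_mono (I := 𝓡 3) (γ := γ) le_rfl ht.2)
      rw [← IsRiemannianManifold.out, edist_dist] at h3
      have h4 := (ENNReal.ofReal_lt_ofReal_iff hr0).1 (h3.trans_lt hlen)
      rw [Metric.mem_ball, dist_comm]
      exact h4.trans hrδ
    have hcd : ContDiffOn ℝ 1 (h ∘ γ) (Icc 0 1) :=
      (hh.comp hsm hball).contDiffOn
    have h2 := enorm_sub_le_lintegral_derivWithin_Icc_of_contDiffOn_Icc hcd zero_le_one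
    have h3 : ∫⁻ t in Icc (0 : ℝ) 1, ‖derivWithin (h ∘ γ) (Icc 0 1) t‖ₑ
        ≤ ∫⁻ t in Icc (0 : ℝ) 1, ENNReal.ofReal L *
          ‖mfderivWithin 𝓘(ℝ, ℝ) (𝓡 3) γ (Icc 0 1) t (1 : ℝ)‖ₑ := by
      refine MeasureTheory.setLIntegral_mono' measurableSet_Icc fun t htt => ?_
      have d1 : MDifferentiableAt (𝓡 3) 𝓘(ℝ, ℝ) h (γ t) :=
        (hh.contMDiffAt (Metric.isOpen_ball.mem_nhds (hball t htt))).mdifferentiableAt one_ne_zero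
      have d2 := (hsm t htt).mdifferentiableWithinAt one_ne_zero
      have d3 := d1.hasMFDerivAt.comp_hasMFDerivWithinAt t d2.hasMFDerivWithinAt
      let T : ℝ →L[ℝ] ℝ := (mfderiv (𝓡 3) 𝓘(ℝ, ℝ) h (γ t)).comp
        (mfderivWithin 𝓘(ℝ, ℝ) (𝓡 3) γ (Icc 0 1) t)
      have d4 : derivWithin (h ∘ γ) (Icc 0 1) t = (show ℝ from mfderiv (𝓡 3) 𝓘(ℝ, ℝ) h (γ t)
          (mfderivWithin 𝓘(ℝ, ℝ) (𝓡 3) γ (Icc 0 1) t (1 : ℝ))) :=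
        (HasFDerivWithinAt.hasDerivWithinAt (𝕜 := ℝ) (F := ℝ) (f' := T)
          (hasMFDerivWithinAt_iff_hasFDerivWithinAt.1 d3)).derivWithin
          (uniqueDiffOn_Icc one_pos t htt)
      have d5 := hd _ (hball t htt) (mfderivWithin 𝓘(ℝ, ℝ) (𝓡 3) γ (Icc 0 1) t (1 : ℝ))
      rw [← d4, ← Real.norm_eq_abs] at d5
      refine (ofReal_norm (derivWithin (h ∘ γ) (Icc 0 1) t)).symm.le.trans ?_
      refine (ENNReal.ofReal_le_ofReal d5).trans ?_
      rw [ENNReal.ofReal_mul hL]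
      exact mul_le_mul_right (ofReal_norm (E := TangentSpace (𝓡 3) (γ t)) _).le _
    rw [MeasureTheory.lintegral_const_mul' _ _ ENNReal.ofReal_ne_top] at h3
    replace hlen := (pathELength_eq_lintegral_mfderivWithin_Icc (I := 𝓡 3) (γ := γ) (a := 0)
      (b := 1)).symm.le.trans hlen.le
    have h4 := h2.trans (h3.trans (mul_le_mul_right hlen _))
    rw [← ENNReal.ofReal_mul hL, ← ofReal_norm, ENNReal.ofReal_le_ofReal_iff (by positivity)] at h4
    simpa [h0, h1] using h4
  refine le_of_forall_pos_le_add fun ε hε => ?_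
  obtain ⟨r, h1, h2⟩ := exists_between (lt_min hy (show dist x y < dist x y + ε / (L + 1) from
    lt_add_of_pos_right _ (by positivity)))
  have h3 := key r h1 (h2.trans_le (min_le_left _ _))
  have h4 := (h2.trans_le (min_le_right _ _)).le
  have h5 : L * (ε / (L + 1)) ≤ ε := by
    rw [mul_div_assoc', div_le_iff₀ (by positivity)]; nlinarith
  nlinarith

end Distance

/-! ### Uniform Taylor estimates -/

section Taylor

variable {E F : Type*} [NormedAddCommGroup E] [NormedSpace ℝ E] [NormedAddCommGroup F]
  [NormedSpace ℝ F]

theorem norm_sub_le_pow_succ {φ : E → F} {φ' : E → E →L[ℝ] F} {y : E} {r C : ℝ} {k : ℕ}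
    (hφ : ∀ z ∈ Metric.closedBall y r, HasFDerivAt φ (φ' z) z)
    (hC : ∀ z ∈ Metric.closedBall y r, ‖φ' z‖ ≤ C * ‖z - y‖ ^ k) {z : E}
    (hz : z ∈ Metric.closedBall y r) (hC0 : 0 ≤ C) : ‖φ z - φ y‖ ≤ C * ‖z - y‖ ^ (k + 1) := by
  have hsub : Metric.closedBall y ‖z - y‖ ⊆ Metric.closedBall y r := by
    refine Metric.closedBall_subset_closedBall ?_
    rwa [← dist_eq_norm]
  have h := (convex_closedBall y ‖z - y‖).norm_image_sub_le_of_norm_hasFDerivWithin_le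
    (f := φ) (f' := φ') (C := C * ‖z - y‖ ^ k) (x := y) (y := z)
    (fun w hw => (hφ w (hsub hw)).hasFDerivWithinAt) (fun w hw => ?_)
    (Metric.mem_closedBall_self (norm_nonneg _)) (by rw [Metric.mem_closedBall, dist_eq_norm])
  · rwa [mul_assoc, ← pow_succ] at h
  · refine (hC w (hsub hw)).trans ?_
    gcongr
    rwa [← dist_eq_norm]

variable [FiniteDimensional ℝ E]

/-- Second order Taylor expansion, with a remainder that is uniform on compact sets. -/
theorem ContDiffOn.exists_taylor_bound {f : E → F} {U K : Set E} (hU : IsOpen U)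
    (hf : ContDiffOn ℝ ∞ f U) (hK : IsCompact K) (hKU : K ⊆ U) :
    ∃ C > 0, ∃ δ > 0, ∀ y ∈ K, ∀ η : E, ‖η‖ ≤ δ → y + η ∈ U ∧
      ‖fderiv ℝ f y‖ ≤ C ∧ ‖fderiv ℝ (fderiv ℝ f) y‖ ≤ C ∧
      ‖f (y + η) - f y‖ ≤ C * ‖η‖ ∧
      ‖f (y + η) - f y - fderiv ℝ f y η‖ ≤ C * ‖η‖ ^ 2 ∧
      ‖f (y + η) - f y - fderiv ℝ f y η - (1 / 2 : ℝ) • fderiv ℝ (fderiv ℝ f) y η η‖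
        ≤ C * ‖η‖ ^ 3 := by
  obtain ⟨δ, hδ, hδU⟩ := hK.exists_cthickening_subset_open hU hKU
  have hK' : IsCompact (Metric.cthickening δ K) := hK.cthickening
  have c0 : ∀ z ∈ U, ContDiffAt ℝ ∞ f z := fun z hz => hf.contDiffAt (hU.mem_nhds hz)
  have c1 : ∀ z ∈ U, ContDiffAt ℝ ∞ (fderiv ℝ f) z := fun z hz =>
    (c0 z hz).fderiv_right (m := ∞) (by simp)
  have c2 : ∀ z ∈ U, ContDiffAt ℝ ∞ (fderiv ℝ (fderiv ℝ f)) z := fun z hz =>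
    (c1 z hz).fderiv_right (m := ∞) (by simp)
  have c3 : ∀ z ∈ U, ContDiffAt ℝ ∞ (fderiv ℝ (fderiv ℝ (fderiv ℝ f))) z := fun z hz =>
    (c2 z hz).fderiv_right (m := ∞) (by simp)
  obtain ⟨C₁, h₁⟩ := hK'.exists_bound_of_continuousOn (f := fderiv ℝ f)
    fun z hz => (c1 z (hδU hz)).continuousAt.continuousWithinAt
  obtain ⟨C₂, h₂⟩ := hK'.exists_bound_of_continuousOn (f := fderiv ℝ (fderiv ℝ f))
    fun z hz => (c2 z (hδU hz)).continuousAt.continuousWithinAt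
  obtain ⟨C₃, h₃⟩ := hK'.exists_bound_of_continuousOn (f := fderiv ℝ (fderiv ℝ (fderiv ℝ f)))
    fun z hz => (c3 z (hδU hz)).continuousAt.continuousWithinAt
  set C : ℝ := max (max (max C₁ C₂) C₃) 1
  have hC : 0 < C := lt_of_lt_of_le one_pos (le_max_right _ _)
  have l₁ : C₁ ≤ C := (le_max_left _ _).trans ((le_max_left _ _).trans (le_max_left _ _))
  have l₂ : C₂ ≤ C := (le_max_right _ _).trans ((le_max_left _ _).trans (le_max_left _ _))
  have l₃ : C₃ ≤ C := (le_max_right _ _).trans (le_max_left _ _)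
  refine ⟨C, hC, δ, hδ, fun y hy η hη => ?_⟩
  have hball : Metric.closedBall y δ ⊆ Metric.cthickening δ K :=
    Metric.closedBall_subset_cthickening hy δ
  have hmem : y + η ∈ Metric.closedBall y δ := by simpa using hη
  have hyK := hball (Metric.mem_closedBall_self hδ.le)
  have d0 : ∀ z ∈ Metric.closedBall y δ, HasFDerivAt f (fderiv ℝ f z) z := fun z hz =>
    ((c0 z (hδU (hball hz))).differentiableAt (by simp)).hasFDerivAt
  have d1 : ∀ z ∈ Metric.closedBall y δ,
      HasFDerivAt (fderiv ℝ f) (fderiv ℝ (fderiv ℝ f) z) z := fun z hz =>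
    ((c1 z (hδU (hball hz))).differentiableAt (by simp)).hasFDerivAt
  have d2 : ∀ z ∈ Metric.closedBall y δ, HasFDerivAt (fderiv ℝ (fderiv ℝ f))
      (fderiv ℝ (fderiv ℝ (fderiv ℝ f)) z) z := fun z hz =>
    ((c2 z (hδU (hball hz))).differentiableAt (by simp)).hasFDerivAt
  -- the three Taylor estimates, each the integral of the preceding one
  have e0 : ∀ z ∈ Metric.closedBall y δ, ‖f z - f y‖ ≤ C * ‖z - y‖ ^ 1 := fun z hz =>
    norm_sub_le_pow_succ (k := 0) d0
      (fun w hw => by simpa using (h₁ w (hball hw)).trans l₁) hz hC.le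
  have e2 : ∀ z ∈ Metric.closedBall y δ,
      ‖fderiv ℝ (fderiv ℝ f) z - fderiv ℝ (fderiv ℝ f) y‖ ≤ C * ‖z - y‖ ^ 1 := fun z hz =>
    norm_sub_le_pow_succ (k := 0) d2
      (fun w hw => by simpa using (h₃ w (hball hw)).trans l₃) hz hC.le
  have e1 : ∀ z ∈ Metric.closedBall y δ,
      ‖fderiv ℝ f z - fderiv ℝ f y‖ ≤ C * ‖z - y‖ ^ 1 := fun z hz =>
    norm_sub_le_pow_succ (k := 0) d1
      (fun w hw => by simpa using (h₂ w (hball hw)).trans l₂) hz hC.le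
  have e3 : ∀ z ∈ Metric.closedBall y δ,
      ‖fderiv ℝ f z - fderiv ℝ f y - fderiv ℝ (fderiv ℝ f) y (z - y)‖ ≤ C * ‖z - y‖ ^ 2 := by
    intro z hz
    have := norm_sub_le_pow_succ (k := 1) (φ := fun z => fderiv ℝ f z
      - fderiv ℝ (fderiv ℝ f) y (z - y))
      (fun w hw => (d1 w hw).sub ((fderiv ℝ (fderiv ℝ f) y).hasFDerivAt.comp w
        ((hasFDerivAt_id w).sub_const y))) (C := C) (fun w hw => ?_) hz hC.le
    · simp only [sub_self, map_zero, sub_zero] at this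
      rwa [sub_right_comm] at this
    · exact e2 w hw
  have e4 : ∀ z ∈ Metric.closedBall y δ, ‖f z - f y - fderiv ℝ f y (z - y)‖ ≤ C * ‖z - y‖ ^ 2 := by
    intro z hz
    have := norm_sub_le_pow_succ (k := 1) (φ := fun z => f z - fderiv ℝ f y (z - y))
      (fun w hw => (d0 w hw).sub ((fderiv ℝ f y).hasFDerivAt.comp w
        ((hasFDerivAt_id w).sub_const y))) (C := C) (fun w hw => ?_) hz hC.le
    · simp only [sub_self, map_zero, sub_zero] at this
      rwa [sub_right_comm] at this
    · exact e1 w hw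
  have e5 : ∀ z ∈ Metric.closedBall y δ, ‖f z - f y - fderiv ℝ f y (z - y)
      - (1 / 2 : ℝ) • fderiv ℝ (fderiv ℝ f) y (z - y) (z - y)‖ ≤ C * ‖z - y‖ ^ 3 := by
    intro z hz
    have hs : IsSymmSndFDerivAt ℝ f y := (c0 y (hδU hyK)).isSymmSndFDerivAt
      (by rw [minSmoothness_of_isRCLikeNormedField]; exact ENat.LEInfty.out)
    have := norm_sub_le_pow_succ (k := 2) (φ := fun z => f z - fderiv ℝ f y (z - y)
      - (1 / 2 : ℝ) • fderiv ℝ (fderiv ℝ f) y (z - y) (z - y))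
      (φ' := fun w => fderiv ℝ f w - fderiv ℝ f y - fderiv ℝ (fderiv ℝ f) y (w - y))
      (fun w hw => ?_) (C := C) (fun w hw => ?_) hz hC.le
    · simp only [sub_self, map_zero, sub_zero, smul_zero] at this
      convert this using 2
      abel
    · have i1 := (hasFDerivAt_id (𝕜 := ℝ) w).sub_const y
      have i2 := ((fderiv ℝ (fderiv ℝ f) y).hasFDerivAt.comp w i1).clm_apply i1
      refine (((d0 w hw).sub ((fderiv ℝ f y).hasFDerivAt.comp w i1)).sub
        (i2.const_smul (1 / 2 : ℝ))).congr_fderiv ?_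
      ext v
      simp only [id_eq, _root_.sub_apply, _root_.smul_apply, _root_.add_apply,
        ContinuousLinearMap.comp_apply, ContinuousLinearMap.flip_apply,
        ContinuousLinearMap.id_apply, Function.comp, hs.eq v (w - y)]
      rw [← two_smul ℝ, smul_smul]
      norm_num
    · exact e3 w hw
  refine ⟨hδU (hball hmem), (h₁ y hyK).trans l₁, (h₂ y hyK).trans l₂, ?_, ?_, ?_⟩
  · simpa using e0 _ hmem
  · simpa using e4 _ hmem
  · simpa using e5 _ hmem

/-- A Riemannian metric is uniformly equivalent to the norm on compact sets. -/
theorem IsMetricOn.exists_bounds {G : E → E →L[ℝ] E →L[ℝ] ℝ} {U K : Set E} (h : IsMetricOn G U)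
    (hK : IsCompact K) (hKU : K ⊆ U) :
    ∃ m > 0, ∃ C > 0, ∀ y ∈ K, (∀ u, m * ‖u‖ ^ 2 ≤ G y u u) ∧ ‖G y‖ ≤ C ∧ ‖christ G y‖ ≤ C
      ∧ ‖koszul G y‖ ≤ C := by
  obtain ⟨C₁, h₁⟩ := hK.exists_bound_of_continuousOn (h.smooth.continuousOn.mono hKU)
  obtain ⟨C₂, h₂⟩ := hK.exists_bound_of_continuousOn (h.contDiffOn_christ.continuousOn.mono hKU)
  obtain ⟨C₃, h₃⟩ := hK.exists_bound_of_continuousOn (h.contDiffOn_koszul.continuousOn.mono hKU)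
  have hS : IsCompact (K ×ˢ Metric.sphere (0 : E) 1) := hK.prod (isCompact_sphere 0 1)
  have hcont : ContinuousOn (fun p : E × E => G p.1 p.2 p.2) (K ×ˢ Metric.sphere (0 : E) 1) := by
    have h4 : ContinuousOn (fun p : E × E => G p.1) (K ×ˢ Metric.sphere (0 : E) 1) :=
      (h.smooth.continuousOn.mono hKU).comp continuousOn_fst fun p hp => hp.1
    exact (h4.clm_apply continuousOn_snd).clm_apply continuousOn_snd
  have hm : ∃ m > 0, ∀ y ∈ K, ∀ u, m * ‖u‖ ^ 2 ≤ G y u u := by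
    rcases (K ×ˢ Metric.sphere (0 : E) 1).eq_empty_or_nonempty with h0 | h0
    · refine ⟨1, one_pos, fun y hy u => ?_⟩
      by_cases hu : u = 0
      · simp [hu]
      · exfalso
        have : (y, ‖u‖⁻¹ • u) ∈ K ×ˢ Metric.sphere (0 : E) 1 := by
          refine ⟨hy, ?_⟩
          simp [norm_smul, hu]
        rw [h0] at this
        exact this
    · obtain ⟨p, hp, hmin⟩ := hS.exists_isMinOn h0 hcont
      have hp2 : p.2 ≠ 0 := by
        intro h5
        have := hp.2
        simp [h5] at this
      refine ⟨G p.1 p.2 p.2, h.pos _ (hKU hp.1) _ hp2, fun y hy u => ?_⟩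
      by_cases hu : u = 0
      · simp [hu]
      · have h6 : (y, ‖u‖⁻¹ • u) ∈ K ×ˢ Metric.sphere (0 : E) 1 := by
          refine ⟨hy, ?_⟩
          simp [norm_smul, hu]
        have h7 := hmin h6
        simp only [mem_ofPred_eq, map_smul, _root_.smul_apply, smul_eq_mul] at h7
        have hn : 0 < ‖u‖ := norm_pos_iff.2 hu
        calc G p.1 p.2 p.2 * ‖u‖ ^ 2 ≤ (‖u‖⁻¹ * (‖u‖⁻¹ * G y u u)) * ‖u‖ ^ 2 := by gcongr
          _ = G y u u := by field_simp
  obtain ⟨m, hm0, hm⟩ := hm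
  refine ⟨m, hm0, max (max (max C₁ C₂) C₃) 1, lt_of_lt_of_le one_pos (le_max_right _ _),
    fun y hy => ⟨hm y hy, (h₁ y hy).trans ?_, (h₂ y hy).trans ?_, (h₃ y hy).trans ?_⟩⟩ <;> simp

end Taylor

section EnergyTaylor

variable {E : Type*} [NormedAddCommGroup E] [NormedSpace ℝ E]

theorem abs_bilin_le (L : E →L[ℝ] E →L[ℝ] ℝ) {a b : E} {k p q : ℝ} (hL : ‖L‖ ≤ k) (ha : ‖a‖ ≤ p)
    (hb : ‖b‖ ≤ q) : |L a b| ≤ k * p * q := by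
  have h := L.le_opNorm₂ a b
  rw [Real.norm_eq_abs] at h
  have hk := (norm_nonneg L).trans hL
  have hp := (norm_nonneg a).trans ha
  exact h.trans (by gcongr)

theorem norm_bilin_le {F : Type*} [NormedAddCommGroup F] [NormedSpace ℝ F] (L : E →L[ℝ] E →L[ℝ] F)
    {a b : E} {k p q : ℝ} (hL : ‖L‖ ≤ k) (ha : ‖a‖ ≤ p) (hb : ‖b‖ ≤ q) :
    ‖L a b‖ ≤ k * p * q := by
  have h := L.le_opNorm₂ a b
  have hk := (norm_nonneg L).trans hL
  have hp := (norm_nonneg a).trans ha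
  exact h.trans (by gcongr)

theorem norm_lin_le {F : Type*} [NormedAddCommGroup F] [NormedSpace ℝ F] (L : E →L[ℝ] F)
    {a : E} {k p : ℝ} (hL : ‖L‖ ≤ k) (ha : ‖a‖ ≤ p) : ‖L a‖ ≤ k * p := by
  have h := L.le_opNorm a
  have hk := (norm_nonneg L).trans hL
  exact h.trans (by gcongr)

variable [FiniteDimensional ℝ E]

/-- First and second order expansion of the energy density `|u + η'|²` at the point `y + η`. -/
theorem IsMetricOn.exists_energy_taylor {G : E → E →L[ℝ] E →L[ℝ] ℝ} {U K : Set E}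
    (h : IsMetricOn G U) (hK : IsCompact K) (hKU : K ⊆ U) (B : ℝ) :
    ∃ C > 0, ∃ δ > 0, ∀ y ∈ K, ∀ u : E, ‖u‖ ≤ B → ∀ ρ ≤ δ, ∀ η η' : E, ‖η‖ ≤ ρ → ‖η'‖ ≤ ρ →
      y + η ∈ U ∧
      |G (y + η) (u + η') (u + η') - G y u u - (fderiv ℝ G y η u u + 2 * G y u η')| ≤ C * ρ ^ 2 ∧
      |G (y + η) (u + η') (u + η') - G y u u - (fderiv ℝ G y η u u + 2 * G y u η')
        - ((1 / 2) * fderiv ℝ (fderiv ℝ G) y η η u u + 2 * fderiv ℝ G y η u η' + G y η' η')|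
          ≤ C * ρ ^ 3 := by
  obtain ⟨C₁, hC₁, δ, hδ, hT⟩ := h.smooth.exists_taylor_bound h.isOpen hK hKU
  obtain ⟨m, hm, C₂, hC₂, hb⟩ := h.exists_bounds hK hKU
  set B' : ℝ := max B 0 with hB'
  have hB0 : 0 ≤ B' := le_max_right _ _
  set C := max C₁ C₂
  have hC : 0 < C := lt_of_lt_of_le hC₁ (le_max_left _ _)
  refine ⟨C * ((B' + 1) ^ 2 + 2 * B' + 2), by positivity, min δ 1, by positivity, ?_⟩
  intro y hy u hu ρ hρ η η' hη hη'
  have hρ0 : 0 ≤ ρ := (norm_nonneg _).trans hη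
  have hρ1 : ρ ≤ 1 := hρ.trans (min_le_right _ _)
  obtain ⟨t0, t1, t2, -, t4, t5⟩ := hT y hy η (hη.trans (hρ.trans (min_le_left _ _)))
  obtain ⟨-, b2, -⟩ := hb y hy
  have hyU := hKU hy
  have hu' : ‖u‖ ≤ B' := hu.trans (le_max_left _ _)
  have huη : ‖u + η'‖ ≤ B' + 1 := (norm_add_le _ _).trans (by linarith)
  have k1 : ‖fderiv ℝ G y η‖ ≤ C * ρ := norm_lin_le _ (t1.trans (le_max_left _ _)) hη
  have k2 : ‖fderiv ℝ (fderiv ℝ G) y η η‖ ≤ C * ρ * ρ :=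
    norm_bilin_le _ (t2.trans (le_max_left _ _)) hη hη
  have k3 : ‖G y‖ ≤ C := b2.trans (le_max_right _ _)
  have k4 : ‖G (y + η) - G y - fderiv ℝ G y η‖ ≤ C * ρ ^ 2 := by
    refine t4.trans ?_
    gcongr
    exact le_max_left _ _
  have k5 : ‖G (y + η) - G y - fderiv ℝ G y η - (1 / 2 : ℝ) • fderiv ℝ (fderiv ℝ G) y η η‖
      ≤ C * ρ ^ 3 := by
    refine t5.trans ?_
    gcongr
    exact le_max_left _ _
  have hρ32 : ρ ^ 3 ≤ ρ ^ 2 := pow_le_pow_of_le_one hρ0 hρ1 (by norm_num)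
  have hρ43 : ρ ^ 4 ≤ ρ ^ 3 := pow_le_pow_of_le_one hρ0 hρ1 (by norm_num)
  have s1 := h.symm y hyU η' u
  have s2 := h.fderiv_symm hyU η η' u
  have a1 := abs_bilin_le _ k1 hu' hη'
  have a2 := abs_bilin_le _ k1 hη' hη'
  have a3 := abs_bilin_le _ k3 hη' hη'
  have a4 := abs_bilin_le _ k4 huη huη
  have a5 := abs_bilin_le _ k5 huη huη
  have a6 := abs_bilin_le _ k2 hu' hη'
  have a7 := abs_bilin_le _ k2 hη' hu'
  have a8 := abs_bilin_le _ k2 hη' hη'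
  simp only [map_add, _root_.add_apply, _root_.sub_apply, _root_.smul_apply, smul_eq_mul]
    at a4 a5 ⊢
  have hCρ : C * ρ ^ 3 ≤ C * ρ ^ 2 := by gcongr
  have hCρ4 : C * ρ ^ 4 ≤ C * ρ ^ 3 := by gcongr
  have hCB : 0 ≤ C * ρ ^ 3 * B' := by positivity
  have hC3 : 0 ≤ C * ρ ^ 3 := by positivity
  rw [abs_le] at a1 a2 a3 a4 a5 a6 a7 a8
  refine ⟨t0, ?_, ?_⟩
  · rw [abs_le]
    constructor
    · linarith only [a1.1, a2.1, a3.1, a4.1, s1, s2, hCρ]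
    · linarith only [a1.2, a2.2, a3.2, a4.2, s1, s2, hCρ]
  · rw [abs_le]
    constructor
    · linarith only [a2.1, a5.1, a6.1, a7.1, a8.1, s1, s2, hCρ4, hCB, hC3]
    · linarith only [a2.2, a5.2, a6.2, a7.2, a8.2, s1, s2, hCρ4, hCB, hC3]

end EnergyTaylor

/-! ### Minimal curves are geodesics -/

section MinimalCurves

variable {M : Type*} [MetricSpace M] [ChartedSpace E3 M] [IsManifold (𝓡 3) ∞ M]
  [RiemannianBundle (fun x : M => TangentSpace (𝓡 3) x)]
  [IsContMDiffRiemannianBundle (𝓡 3) ∞ E3 (fun x : M => TangentSpace (𝓡 3) x)]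
  [IsRiemannianManifold (𝓡 3) M]

/-- The tangent vector `v` in the coordinates of the chart `e`. -/
noncomputable def chartVec (e : OpenPartialHomeomorph M E3) (z : M) (v : TangentSpace (𝓡 3) z) :
    E3 :=
  mfderiv (𝓡 3) (𝓡 3) e z v

theorem mfderiv_symm_chartVec {e : OpenPartialHomeomorph M E3}
    (he : e ∈ IsManifold.maximalAtlas (𝓡 3) ∞ M) {z : M} (hz : z ∈ e.source)
    (v : TangentSpace (𝓡 3) z) :
    (show E3 from mfderiv (𝓡 3) (𝓡 3) e.symm (e z) (chartVec e z v)) = (show E3 from v) :=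
  congrArg (fun T => T v) ((mdifferentiable_of_mem_maximalAtlas he).symm_comp_deriv hz)

theorem gram_chartVec {e : OpenPartialHomeomorph M E3}
    (he : e ∈ IsManifold.maximalAtlas (𝓡 3) ∞ M) {z : M} (hz : z ∈ e.source)
    (v w : TangentSpace (𝓡 3) z) :
    gram e (e z) (chartVec e z v) (chartVec e z w) = inner ℝ v w := by
  have h : ∀ (x : M) (_ : x = z) (v₁ w₁ : TangentSpace (𝓡 3) x) (v₂ w₂ : TangentSpace (𝓡 3) z),
      (show E3 from v₁) = (show E3 from v₂) → (show E3 from w₁) = (show E3 from w₂) →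
        inner ℝ v₁ w₁ = inner ℝ v₂ w₂ := by
    rintro x rfl v₁ w₁ v₂ w₂ h1 h2
    exact congrArg₂ (fun a b : TangentSpace (𝓡 3) x => inner ℝ a b) h1 h2
  rw [gram_eq_inner]
  exact h _ (e.left_inv hz) _ _ _ _ (mfderiv_symm_chartVec he hz v)
    (mfderiv_symm_chartVec he hz w)

theorem gram_cauchy_schwarz (e : OpenPartialHomeomorph M E3) (y u w : E3) :
    gram e y u w ^ 2 ≤ gram e y u u * gram e y w w := by
  rw [gram_eq_inner, gram_eq_inner, gram_eq_inner]
  have := real_inner_mul_inner_self_le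
    (mfderiv (𝓡 3) (𝓡 3) e.symm y u : TangentSpace (𝓡 3) (e.symm y))
    (mfderiv (𝓡 3) (𝓡 3) e.symm y w)
  rwa [← sq] at this

/-- The speed of a distance-preserving curve is at least one. -/
theorem one_le_speed_of_isometric {e : OpenPartialHomeomorph M E3}
    (he : e ∈ IsManifold.maximalAtlas (𝓡 3) ∞ M) {γ : ℝ → M} {a b : ℝ} (hab : a < b)
    (hd : ∀ s ∈ Icc a b, ∀ t ∈ Icc a b, dist (γ s) (γ t) = |s - t|)
    (hsrc : ∀ t ∈ Icc a b, γ t ∈ e.source) {u : ℝ → E3}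
    (hu : ∀ t ∈ Icc a b, HasDerivWithinAt (e ∘ γ) (u t) (Icc a b) t)
    (huc : ContinuousOn u (Icc a b)) {t : ℝ} (ht : t ∈ Icc a b) :
    1 ≤ gram e (e (γ t)) (u t) (u t) := by
  by_contra! hlt
  have hG := isMetricOn_gram he
  have hfc : ContinuousOn (e ∘ γ) (Icc a b) := fun s hs => (hu s hs).continuousWithinAt
  have htar : ∀ s ∈ Icc a b, (e ∘ γ) s ∈ e.target := fun s hs => e.map_source (hsrc s hs)
  have hcont : ContinuousOn (fun s => √(gram e ((e ∘ γ) s) (u s) (u s))) (Icc a b) :=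
    (((hG.smooth.continuousOn.comp hfc htar).clm_apply huc).clm_apply huc).sqrt
  have hlt' : √(gram e ((e ∘ γ) t) (u t) (u t)) < 1 := by
    rw [Real.sqrt_lt' one_pos]; simpa using hlt
  obtain ⟨q, hq1, hq2⟩ := exists_between hlt'
  obtain ⟨r, hr, hball⟩ := Metric.mem_nhdsWithin_iff.1
    ((hcont t ht).eventually (gt_mem_nhds hq1))
  -- a small nontrivial subinterval `[p, p']` of `[a, b]` with end point `t`
  obtain ⟨p, p', hpp, hsub, hsub'⟩ : ∃ p p', p < p' ∧ Icc p p' ⊆ Icc a b ∧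
      Icc p p' ⊆ Metric.ball t r := by
    rcases ht.2.eq_or_lt with h1 | h1
    · refine ⟨max a (t - r / 2), t, max_lt (h1 ▸ hab) (by linarith),
        Icc_subset_Icc (le_max_left _ _) ht.2, fun s hs => ?_⟩
      rw [Metric.mem_ball, Real.dist_eq, abs_lt]
      have := (le_max_right _ _).trans hs.1
      constructor <;> linarith [hs.2]
    · refine ⟨t, min b (t + r / 2), lt_min h1 (by linarith),
        Icc_subset_Icc ht.1 (min_le_left _ _), fun s hs => ?_⟩
      rw [Metric.mem_ball, Real.dist_eq, abs_lt]
      have := hs.2.trans (min_le_right _ _)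
      constructor <;> linarith [hs.1]
  have hp := hsub (left_mem_Icc.2 hpp.le)
  have hp' := hsub (right_mem_Icc.2 hpp.le)
  have h1 := dist_le_of_chart_curve he hpp.le (c := e ∘ γ) (c' := u) (Ψ := fun s => q * s)
    (Ψ' := fun _ => q) (fun s hs => (hu s (hsub hs)).mono hsub) (huc.mono hsub)
    (fun s hs => htar s (hsub hs))
    (fun s _ => by simpa using ((hasDerivAt_id s).const_mul q).hasDerivWithinAt)
    (fun s hs => (hball ⟨hsub' hs, hsub hs⟩).le)
  simp only [Function.comp] at h1
  rw [e.left_inv (hsrc _ hp), e.left_inv (hsrc _ hp'), hd _ hp _ hp', abs_sub_comm,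
    abs_of_pos (sub_pos.2 hpp)] at h1
  nlinarith

/-- The speed of a distance-preserving curve is at most one: otherwise a linear function of the
coordinates would grow too fast along the curve. -/
theorem speed_le_one_of_isometric {e : OpenPartialHomeomorph M E3}
    (he : e ∈ IsManifold.maximalAtlas (𝓡 3) ∞ M) {γ : ℝ → M} {a b : ℝ} (hab : a < b)
    (hd : ∀ s ∈ Icc a b, ∀ t ∈ Icc a b, dist (γ s) (γ t) = |s - t|)
    (hsrc : ∀ t ∈ Icc a b, γ t ∈ e.source) {u : ℝ → E3}
    (hu : ∀ t ∈ Icc a b, HasDerivWithinAt (e ∘ γ) (u t) (Icc a b) t)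
    {t : ℝ} (ht : t ∈ Icc a b) :
    gram e (e (γ t)) (u t) (u t) ≤ 1 := by
  have hG := isMetricOn_gram he
  set y₀ := e (γ t) with hy₀
  have hy₀t : y₀ ∈ e.target := e.map_source (hsrc t ht)
  set N := gram e y₀ (u t) (u t) with hN
  obtain ⟨m, hm, _, _, hb⟩ := hG.exists_bounds isCompact_singleton (singleton_subset_iff.2 hy₀t)
  have hm' := (hb y₀ rfl).1
  have hmd := mdifferentiable_of_mem_maximalAtlas he
  have hN0 : 0 ≤ N := (by positivity : (0:ℝ) ≤ m * ‖u t‖ ^ 2).trans (hm' (u t))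
  suffices key : ∀ ε > 0, ε < 1 → N * (1 - ε) ≤ 1 by
    refine le_of_forall_pos_lt_add fun δ hδ => ?_
    have h1 := key (min (1 / 2) (δ / (2 * (N + 1)))) (by positivity)
      ((min_le_left _ _).trans_lt (by norm_num))
    have h2 : N * min (1 / 2) (δ / (2 * (N + 1))) ≤ δ / 2 := by
      calc N * min (1 / 2) (δ / (2 * (N + 1))) ≤ (N + 1) * (δ / (2 * (N + 1))) := by
            gcongr
            · linarith
            · exact min_le_right _ _
        _ = δ / 2 := by field_simp
    nlinarith
  intro ε hε hε1
  have h1ε : 0 < 1 - ε := by linarith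
  set L := √(N / (1 - ε)) with hL
  have hcont : ∀ᶠ y in 𝓝 y₀, ‖gram e y - gram e y₀‖ < ε * m := by
    have := (hG.contDiffAt hy₀t).continuousAt
    have h2 := Metric.continuousAt_iff'.1 this (ε * m) (by positivity)
    simpa only [dist_eq_norm] using h2
  have hnear : ∀ᶠ z in 𝓝 (γ t), z ∈ e.source ∧ ‖gram e (e z) - gram e y₀‖ < ε * m :=
    (e.open_source.eventually_mem (hsrc t ht)).and
      ((e.continuousAt (hsrc t ht)).eventually hcont)
  obtain ⟨δ, hδ, hball⟩ := Metric.eventually_nhds_iff_ball.1 hnear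
  have hbound : ∀ z ∈ Metric.ball (γ t) δ, ∀ w : E3,
      |gram e y₀ (u t) w| ≤ L * √(gram e (e z) w w) := by
    intro z hz w
    obtain ⟨-, h2⟩ := hball z hz
    have h3 : |(gram e (e z) - gram e y₀) w w| ≤ ε * m * ‖w‖ * ‖w‖ :=
      abs_bilin_le _ h2.le le_rfl le_rfl
    have h4 := (abs_le.1 h3).1
    simp only [_root_.sub_apply] at h4
    have h5 : (1 - ε) * gram e y₀ w w ≤ gram e (e z) w w := by nlinarith [hm' w]
    have h6 := gram_cauchy_schwarz e y₀ (u t) w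
    rw [← Real.sqrt_mul (by positivity), ← Real.sqrt_sq_eq_abs]
    refine Real.sqrt_le_sqrt (h6.trans ?_)
    rw [div_mul_eq_mul_div, le_div_iff₀ h1ε]
    nlinarith
  have hlip := fun y hy => abs_sub_le_of_norm_mfderiv_le (h := fun z => gram e y₀ (u t) (e z))
    (x := γ t) (y := y) (δ := δ) (L := L) (Real.sqrt_nonneg _)
    (((gram e y₀ (u t)).contDiff.contMDiff.comp_contMDiffOn
      ((contMDiffOn_of_mem_maximalAtlas he).of_le (by simp))).mono fun z hz => (hball z hz).1)
    (fun z hz v => by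
      have h2 : HasMFDerivAt (𝓡 3) 𝓘(ℝ, ℝ) (fun z => gram e y₀ (u t) (e z)) z
          ((gram e y₀ (u t)).comp (mfderiv (𝓡 3) (𝓡 3) e z)) :=
        HasMFDerivAt.comp z (gram e y₀ (u t)).hasFDerivAt.hasMFDerivAt
          (hmd.mdifferentiableAt (hball z hz).1).hasMFDerivAt
      rw [h2.mfderiv]
      refine (hbound z hz (chartVec e z v)).trans (le_of_eq ?_)
      rw [gram_chartVec he (hball z hz).1, real_inner_self_eq_norm_sq,
        Real.sqrt_sq (norm_nonneg _)]) hy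
  -- compare the derivative of the linear function along the curve with its Lipschitz constant
  have hder : HasDerivWithinAt (fun s => gram e y₀ (u t) (e (γ s))) N (Icc a b) t :=
    ((gram e y₀ (u t)).hasFDerivAt.comp_hasDerivWithinAt t (hu t ht))
  have hγc : ContinuousWithinAt γ (Icc a b) t := by
    rw [Metric.continuousWithinAt_iff]
    intro r hr
    exact ⟨r, hr, fun s hs hst => by rw [hd s hs t ht]; rwa [Real.dist_eq] at hst⟩
  have hNL : N ≤ L := by
    have h2 := hasDerivWithinAt_iff_tendsto_slope.1 hder
    have h3 : (𝓝[Icc a b \ {t}] t).NeBot := by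
      rw [← accPt_principal_iff_nhdsWithin]
      exact (uniqueDiffWithinAt_iff_accPt).1 (uniqueDiffOn_Icc hab t ht)
    refine le_of_tendsto h2 ?_
    have h4 : ∀ᶠ s in 𝓝[Icc a b] t, dist (γ t) (γ s) < δ := by
      have := (Metric.continuousWithinAt_iff'.1 hγc) δ hδ
      filter_upwards [this] with s hs
      rwa [dist_comm]
    filter_upwards [nhdsWithin_mono t sdiff_subset h4, self_mem_nhdsWithin] with s hs hs'
    have h5 := hlip (γ s) hs
    rw [hd t ht s hs'.1] at h5
    have hne : s ≠ t := hs'.2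
    rw [slope_def_field]
    refine (le_abs_self _).trans ?_
    rw [abs_div, div_le_iff₀ (abs_pos.2 (sub_ne_zero.2 hne)), abs_sub_comm s t]
    exact h5
  have h6 : N ^ 2 ≤ N / (1 - ε) := by
    have := pow_le_pow_left₀ hN0 hNL 2
    rwa [hL, Real.sq_sqrt (by positivity)] at this
  rw [le_div_iff₀ h1ε] at h6
  rcases hN0.eq_or_lt with h7 | h7
  · rw [← h7]; simp
  · nlinarith

end MinimalCurves

section Geodesics

/-- `c` is a geodesic with velocity `u` of the metric `G` on `U`, for times in `s`. -/
def IsGeodesicOn {E : Type*} [NormedAddCommGroup E] [NormedSpace ℝ E]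
    (G : E → E →L[ℝ] E →L[ℝ] ℝ) (U : Set E) (c u : ℝ → E) (s : Set ℝ) : Prop :=
  ∀ t ∈ s, c t ∈ U ∧ HasDerivWithinAt c (u t) s t ∧
    HasDerivWithinAt u (-christ G (c t) (u t) (u t)) s t

theorem exists_Icc_subset_of_mem_nhdsWithin {a b t : ℝ} (hab : a < b) (ht : t ∈ Icc a b)
    {V : Set ℝ} (hV : V ∈ 𝓝[Icc a b] t) :
    ∃ p q, p < q ∧ Icc p q ⊆ Icc a b ∧ Icc p q ⊆ V ∧ t ∈ Icc p q := by
  obtain ⟨r, hr, hball⟩ := Metric.mem_nhdsWithin_iff.1 hV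
  have hsub : ∀ p q, t - r < p → q < t + r → Icc p q ⊆ Icc a b → Icc p q ⊆ V := by
    intro p q hp hq h s hs
    refine hball ⟨?_, h hs⟩
    rw [Metric.mem_ball, Real.dist_eq, abs_lt]
    constructor <;> linarith [hs.1, hs.2]
  rcases ht.2.eq_or_lt with h1 | h1
  · have h2 : Icc (max a (t - r / 2)) t ⊆ Icc a b := Icc_subset_Icc (le_max_left _ _) ht.2
    refine ⟨max a (t - r / 2), t, max_lt (h1 ▸ hab) (by linarith), h2, hsub _ _ ?_ (by linarith) h2,
      max_le ht.1 (by linarith), le_rfl⟩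
    exact lt_of_lt_of_le (by linarith) (le_max_right _ _)
  · have h2 : Icc t (min b (t + r / 2)) ⊆ Icc a b := Icc_subset_Icc ht.1 (min_le_left _ _)
    refine ⟨t, min b (t + r / 2), lt_min h1 (by linarith), h2, hsub _ _ (by linarith) ?_ h2,
      le_rfl, le_min ht.2 (by linarith)⟩
    exact lt_of_le_of_lt (min_le_right _ _) (by linarith)

theorem sqrt_le_half_add_one {x : ℝ} (h : 0 ≤ x) : √x ≤ (x + 1) / 2 := by
  nlinarith [sq_nonneg (√x - 1), Real.sq_sqrt h]

theorem gram_self_nonneg {M : Type*} [TopologicalSpace M] [ChartedSpace E3 M]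
    [RiemannianBundle (fun x : M => TangentSpace (𝓡 3) x)]
    (e : OpenPartialHomeomorph M E3) (y u : E3) : 0 ≤ gram e y u u := by
  rw [gram_eq_inner]
  exact real_inner_self_nonneg

variable {M : Type*} [MetricSpace M] [ChartedSpace E3 M] [IsManifold (𝓡 3) ∞ M]
  [RiemannianBundle (fun x : M => TangentSpace (𝓡 3) x)]
  [IsContMDiffRiemannianBundle (𝓡 3) ∞ E3 (fun x : M => TangentSpace (𝓡 3) x)]
  [IsRiemannianManifold (𝓡 3) M]

/-- A smooth distance-preserving curve is a unit speed geodesic: if the acceleration `A` does not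
vanish, then moving the curve in the direction of `A` makes it shorter. -/
theorem isGeodesicOn_of_isometric {e : OpenPartialHomeomorph M E3}
    (he : e ∈ IsManifold.maximalAtlas (𝓡 3) ∞ M) {γ : ℝ → M} {a b : ℝ} (hab : a < b)
    (hγ : ContMDiffOn 𝓘(ℝ, ℝ) (𝓡 3) ∞ γ (Icc a b))
    (hd : ∀ s ∈ Icc a b, ∀ t ∈ Icc a b, dist (γ s) (γ t) = |s - t|)
    (hsrc : ∀ t ∈ Icc a b, γ t ∈ e.source) :
    ∃ u : ℝ → E3, IsGeodesicOn (gram e) e.target (e ∘ γ) u (Icc a b) ∧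
      ∀ t ∈ Icc a b, gram e (e (γ t)) (u t) (u t) = 1 := by
  have hG := isMetricOn_gram he
  have hud := uniqueDiffOn_Icc hab
  set f : ℝ → E3 := e ∘ γ with hf
  have hfs : ContDiffOn ℝ ∞ f (Icc a b) :=
    ((contMDiffOn_of_mem_maximalAtlas he).comp hγ hsrc).contDiffOn
  have htar : ∀ t ∈ Icc a b, f t ∈ e.target := fun t ht => e.map_source (hsrc t ht)
  set u : ℝ → E3 := derivWithin f (Icc a b) with hu
  have hus : ContDiffOn ℝ ∞ u (Icc a b) := hfs.derivWithin hud (by simp)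
  have hfu : ∀ t ∈ Icc a b, HasDerivWithinAt f (u t) (Icc a b) t := fun t ht =>
    ((hfs t ht).differentiableWithinAt (by simp)).hasDerivWithinAt
  set u' : ℝ → E3 := derivWithin u (Icc a b) with hu'
  have hus' : ContDiffOn ℝ ∞ u' (Icc a b) := hus.derivWithin hud (by simp)
  have huu : ∀ t ∈ Icc a b, HasDerivWithinAt u (u' t) (Icc a b) t := fun t ht =>
    ((hus t ht).differentiableWithinAt (by simp)).hasDerivWithinAt
  have hone : ∀ t ∈ Icc a b, gram e (f t) (u t) (u t) = 1 := fun t ht =>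
    le_antisymm (speed_le_one_of_isometric he hab hd hsrc hfu ht)
      (one_le_speed_of_isometric he hab hd hsrc hfu hus.continuousOn ht)
  set A : ℝ → E3 := fun t => u' t + christ (gram e) (f t) (u t) (u t) with hA
  have hAs : ContDiffOn ℝ ∞ A (Icc a b) :=
    hus'.add (((hG.contDiffOn_christ.comp hfs htar).clm_apply hus).clm_apply hus)
  set A' : ℝ → E3 := derivWithin A (Icc a b) with hA'
  have hAA : ∀ t ∈ Icc a b, HasDerivWithinAt A (A' t) (Icc a b) t := fun t ht =>
    ((hAs t ht).differentiableWithinAt (by simp)).hasDerivWithinAt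
  suffices hzero : ∀ t ∈ Icc a b, A t = 0 by
    refine ⟨u, fun t ht => ⟨htar t ht, hfu t ht, ?_⟩, hone⟩
    rw [← eq_neg_of_add_eq_zero_left (hzero t ht)]
    exact huu t ht
  intro t ht
  by_contra hne
  have hpos := hG.pos _ (htar t ht) _ hne
  obtain ⟨κ, hκ, hκ'⟩ := exists_between hpos
  have hGA : ContinuousOn (fun s => gram e (f s) (A s) (A s)) (Icc a b) :=
    ((hG.smooth.continuousOn.comp hfs.continuousOn htar).clm_apply hAs.continuousOn).clm_apply
      hAs.continuousOn
  obtain ⟨p, q, hpq, hsub, hV, -⟩ := exists_Icc_subset_of_mem_nhdsWithin hab ht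
    ((hGA t ht).eventually (lt_mem_nhds hκ'))
  have hKc : IsCompact (f '' Icc a b) := isCompact_Icc.image_of_continuousOn hfs.continuousOn
  obtain ⟨B, hB⟩ := isCompact_Icc.exists_bound_of_continuousOn hus.continuousOn
  obtain ⟨C, hC, δ, hδ, hT⟩ := hG.exists_energy_taylor hKc
    (by rintro _ ⟨s, hs, rfl⟩; exact htar s hs) B
  -- the variation field
  set η : ℝ → E3 := fun s => ((s - p) * (q - s)) • A s with hη
  set η' : ℝ → E3 := fun s => ((s - p) * (q - s)) • A' s + ((q - s) - (s - p)) • A s with hη'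
  have hηd : ∀ s ∈ Icc a b, HasDerivWithinAt η (η' s) (Icc a b) s := by
    intro s hs
    have h1 : HasDerivWithinAt (fun s : ℝ => (s - p) * (q - s)) ((q - s) - (s - p)) (Icc a b) s := by
      have := (((hasDerivAt_id s).sub_const p).mul ((hasDerivAt_id s).const_sub q)).hasDerivWithinAt
        (s := Icc a b)
      refine this.congr_deriv ?_
      simp; ring
    exact h1.smul (hAA s hs)
  have hA'c : ContinuousOn A' (Icc a b) := (hAs.derivWithin hud (m := ∞) (by simp)).continuousOn
  have hηc : ContinuousOn η (Icc a b) := fun s hs => (hηd s hs).continuousWithinAt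
  have hη'c : ContinuousOn η' (Icc a b) := by
    have h1 : Continuous fun s : ℝ => (s - p) * (q - s) := by fun_prop
    have h2 : Continuous fun s : ℝ => (q - s) - (s - p) := by fun_prop
    exact (h1.continuousOn.smul hA'c).add (h2.continuousOn.smul hAs.continuousOn)
  obtain ⟨R₁, hR₁⟩ := isCompact_Icc.exists_bound_of_continuousOn hηc
  obtain ⟨R₂, hR₂⟩ := isCompact_Icc.exists_bound_of_continuousOn hη'c
  set R := max (max R₁ R₂) 1 with hR
  have hR0 : 0 < R := lt_of_lt_of_le one_pos (le_max_right _ _)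
  have hR₁' : ∀ s ∈ Icc a b, ‖η s‖ ≤ R := fun s hs =>
    (hR₁ s hs).trans ((le_max_left _ _).trans (le_max_left _ _))
  have hR₂' : ∀ s ∈ Icc a b, ‖η' s‖ ≤ R := fun s hs =>
    (hR₂ s hs).trans ((le_max_right _ _).trans (le_max_left _ _))
  -- the variation shortens the curve to first order, against a second order error
  have hmain : ∀ τ > 0, τ * R ≤ δ → κ * (q - p) ^ 2 / 6 ≤ C * R ^ 2 / 2 * τ := by
    intro τ hτ hτR
    have hT' := fun s (hs : s ∈ Icc a b) => hT (f s) (mem_image_of_mem f hs) (u s) (hB s hs)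
      (τ * R) hτR (τ • η s) (τ • η' s)
      (by rw [norm_smul, Real.norm_of_nonneg hτ.le]; gcongr; exact hR₁' s hs)
      (by rw [norm_smul, Real.norm_of_nonneg hτ.le]; gcongr; exact hR₂' s hs)
    have h1 := dist_le_of_chart_curve he hpq.le (c := fun s => f s + τ • η s)
      (c' := fun s => u s + τ • η' s)
      (Ψ := fun s => s * (1 + C * (τ * R) ^ 2 / 2) + τ * gram e (f s) (u s) (η s)
        - τ * κ * ((q - p) / 2 * (s - p) ^ 2 - (s - p) ^ 3 / 3))
      (Ψ' := fun s => (1 + C * (τ * R) ^ 2 / 2) + τ * (gram e (f s) (A s) (η s)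
        + gram e (f s) (u s) (η' s + christ (gram e) (f s) (u s) (η s)))
        - τ * κ * ((s - p) * (q - s)))
      (fun s hs => ((hfu s (hsub hs)).add ((hηd s (hsub hs)).const_smul τ)).mono hsub)
      (((hus.continuousOn).add (hη'c.const_smul τ)).mono hsub)
      (fun s hs => (hT' s (hsub hs)).1) ?_ ?_
    · have hηp : η p = 0 := by simp [hη]
      have hηq : η q = 0 := by simp [hη]
      have hp := hsub (left_mem_Icc.2 hpq.le)
      have hq := hsub (right_mem_Icc.2 hpq.le)
      simp only [hηp, hηq, smul_zero, add_zero, map_zero, mul_zero] at h1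
      rw [show f p = e (γ p) from rfl, show f q = e (γ q) from rfl, e.left_inv (hsrc _ hp),
        e.left_inv (hsrc _ hq), hd _ hp _ hq, abs_sub_comm, abs_of_pos (sub_pos.2 hpq)] at h1
      have h2 : τ * (q - p) * (κ * (q - p) ^ 2 / 6) ≤ τ * (q - p) * (C * R ^ 2 / 2 * τ) := by
        nlinarith
      exact le_of_mul_le_mul_left h2 (mul_pos hτ (sub_pos.2 hpq))
    · intro s hs
      have d1 := hG.hasDerivWithinAt_inner (htar s (hsub hs)) (hfu s (hsub hs)) (huu s (hsub hs))
        (hηd s (hsub hs))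
      have d2 : HasDerivAt (fun s : ℝ => τ * κ * ((q - p) / 2 * (s - p) ^ 2 - (s - p) ^ 3 / 3))
          (τ * κ * ((s - p) * (q - s))) s := by
        have i1 := (hasDerivAt_id s).sub_const p
        refine (((i1.pow 2).const_mul ((q - p) / 2)).sub ((i1.pow 3).div_const 3)).const_mul
          (τ * κ) |>.congr_deriv ?_
        simp only [id]
        norm_num
        left
        ring
      have d3 := ((hasDerivAt_id s).mul_const (1 + C * (τ * R) ^ 2 / 2)).hasDerivWithinAt
        (s := Icc a b)
      refine (((d3.add (d1.const_mul τ)).sub d2.hasDerivWithinAt).mono hsub).congr_deriv ?_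
      simp [hA]
    · intro s hs
      have h3 := (abs_le.1 (hT' s (hsub hs)).2.1).2
      rw [hone s (hsub hs)] at h3
      refine (sqrt_le_half_add_one (gram_self_nonneg _ _ _)).trans ?_
      have h4 : gram e (f s) (u s) (christ (gram e) (f s) (u s) (η s))
          = (1 / 2) * fderiv ℝ (gram e) (f s) (η s) (u s) (u s) := by
        have hfs := htar s (hsub hs)
        rw [hG.symm _ hfs, hG.metric_christ hfs, koszul_apply,
          hG.fderiv_symm hfs (u s) (u s) (η s)]
        ring
      have h5 : κ * ((s - p) * (q - s)) ≤ gram e (f s) (A s) (η s) := by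
        simp only [hη, map_smul, smul_eq_mul]
        rw [mul_comm]
        exact mul_le_mul_of_nonneg_left (hV hs).le
          (mul_nonneg (sub_nonneg.2 hs.1) (sub_nonneg.2 hs.2))
      have h6 : fderiv ℝ (gram e) (f s) (τ • η s) (u s) (u s)
          = τ * fderiv ℝ (gram e) (f s) (η s) (u s) (u s) := by
        rw [map_smul]; rfl
      have h7 : gram e (f s) (u s) (τ • η' s) = τ * gram e (f s) (u s) (η' s) := by
        rw [map_smul]; rfl
      have h8 := mul_le_mul_of_nonneg_left h5 hτ.le
      rw [h6, h7] at h3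
      rw [map_add (gram e (f s) (u s)), h4]
      linarith only [h3, h8]
  have hτ0 : 0 < min (δ / R) (κ * (q - p) ^ 2 / 6 / (C * R ^ 2)) := by
    have : 0 < q - p := sub_pos.2 hpq
    positivity
  have h1 := hmain _ hτ0 (by
    calc _ ≤ δ / R * R := by gcongr; exact min_le_left _ _
      _ = δ := by field_simp)
  have h2 : C * R ^ 2 / 2 * min (δ / R) (κ * (q - p) ^ 2 / 6 / (C * R ^ 2))
      ≤ C * R ^ 2 / 2 * (κ * (q - p) ^ 2 / 6 / (C * R ^ 2)) := by
    gcongr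
    exact min_le_right _ _
  have h3 : C * R ^ 2 / 2 * (κ * (q - p) ^ 2 / 6 / (C * R ^ 2)) = κ * (q - p) ^ 2 / 12 := by
    field_simp; ring
  have h4 : 0 < κ * (q - p) ^ 2 := by
    have : 0 < q - p := sub_pos.2 hpq
    positivity
  linarith

end Geodesics

/-! ### Variations of geodesics -/

section Transport

variable {E : Type*} [NormedAddCommGroup E] [NormedSpace ℝ E] [FiniteDimensional ℝ E]

/-- A substitute for parallel transport along a geodesic: the field `X σ = ξ - (σ - s') Γ(u, ξ)`,
where the Christoffel symbols are taken at the time `s'`, is parallel up to an error of the order of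
the length of the interval. -/
theorem IsMetricOn.exists_transport_bounds {G : E → E →L[ℝ] E →L[ℝ] ℝ} {U : Set E}
    (h : IsMetricOn G U) {c u : ℝ → E} {p q : ℝ} (hc : IsGeodesicOn G U c u (Icc p q)) :
    ∃ A ≥ 1, (∀ σ ∈ Icc p q, ‖u σ‖ ≤ A ∧ ‖christ G (c σ)‖ ≤ A ∧ ‖G (c σ)‖ ≤ A ∧
        ‖koszul G (c σ)‖ ≤ A ∧ ∀ v, ‖v‖ ^ 2 ≤ A * G (c σ) v v) ∧
      ∀ s ∈ Icc p q, ∀ s' ∈ Icc p q, s' - s ≤ 1 → ∀ ξ : E, ∀ X X' : ℝ → E,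
        (∀ σ, X σ = ξ - (σ - s') • christ G (c s') (u s') ξ) →
        (∀ σ, X' σ = -christ G (c s') (u s') ξ + christ G (c σ) (u σ) (X σ)) →
        ∀ σ ∈ Icc s s', ‖X σ‖ ≤ A * ‖ξ‖ ∧ ‖christ G (c s') (u s') ξ‖ ≤ A * ‖ξ‖ ∧
          G (c σ) (X' σ) (X' σ) ≤ A * (s' - s) ^ 2 * ‖ξ‖ ^ 2 ∧
          |G (c σ) (u σ) (X σ) - G (c s') (u s') ξ| ≤ A * (s' - s) ^ 2 * ‖ξ‖ ∧
          |G (c σ) (X σ) (X σ) - G (c s') ξ ξ| ≤ A * (s' - s) ^ 2 * ‖ξ‖ ^ 2 := by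
  have hcc : ContinuousOn c (Icc p q) := fun t ht => (hc t ht).2.1.continuousWithinAt
  have huc : ContinuousOn u (Icc p q) := fun t ht => (hc t ht).2.2.continuousWithinAt
  have hcU : ∀ t ∈ Icc p q, c t ∈ U := fun t ht => (hc t ht).1
  obtain ⟨m, hm, B₁, hB₁, hb⟩ := h.exists_bounds (isCompact_Icc.image_of_continuousOn hcc)
    (by rintro _ ⟨t, ht, rfl⟩; exact hcU t ht)
  obtain ⟨B₂, hB₂⟩ := isCompact_Icc.exists_bound_of_continuousOn huc
  have hch := h.contDiffOn_christ
  -- the Christoffel symbols along the curve are Lipschitz continuous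
  set Λ : ℝ → E →L[ℝ] E := fun t => christ G (c t) (u t) with hΛ
  set Λ' : ℝ → E →L[ℝ] E := fun t => fderiv ℝ (christ G) (c t) (u t) (u t)
    + christ G (c t) (-christ G (c t) (u t) (u t)) with hΛ'
  have hΛd : ∀ t ∈ Icc p q, HasDerivWithinAt Λ (Λ' t) (Icc p q) t := by
    intro t ht
    have h1 : HasFDerivAt (christ G) (fderiv ℝ (christ G) (c t)) (c t) :=
      ((hch.contDiffAt (h.mem_nhds (hcU t ht))).differentiableAt (by simp)).hasFDerivAt
    exact (h1.comp_hasDerivWithinAt t (hc t ht).2.1).clm_apply (hc t ht).2.2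
  have hΛc : ContinuousOn Λ' (Icc p q) := by
    have h1 : ContinuousOn (fun t => fderiv ℝ (christ G) (c t)) (Icc p q) :=
      (hch.continuousOn_fderiv_of_isOpen h.isOpen (by simp)).comp hcc hcU
    have h2 : ContinuousOn (fun t => christ G (c t)) (Icc p q) := hch.continuousOn.comp hcc hcU
    exact ((h1.clm_apply huc).clm_apply huc).add
      (h2.clm_apply ((h2.clm_apply huc).clm_apply huc).neg)
  obtain ⟨B₃, hB₃⟩ := isCompact_Icc.exists_bound_of_continuousOn hΛc
  have hlip : ∀ s ∈ Icc p q, ∀ t ∈ Icc p q, ‖Λ t - Λ s‖ ≤ B₃ * |t - s| := fun s hs t ht =>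
    (convex_Icc p q).norm_image_sub_le_of_norm_hasDerivWithin_le hΛd hB₃ hs ht
  obtain ⟨B, hB1, hBB₁, hBB₂, hBB₃⟩ : ∃ B ≥ 1, B₁ ≤ B ∧ B₂ ≤ B ∧ B₃ ≤ B :=
    ⟨max (max B₁ B₂) (max B₃ 1), le_max_of_le_right (le_max_right _ _),
      le_max_of_le_left (le_max_left _ _), le_max_of_le_left (le_max_right _ _),
      le_max_of_le_right (le_max_left _ _)⟩
  have hpow : ∀ i j : ℕ, i ≤ j → B ^ i ≤ B ^ j := fun i j hij => pow_le_pow_right₀ hB1 hij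
  have hAB : ∀ i ≤ 9, B ^ i ≤ 8 * B ^ 9 + 1 / m := fun i hi => by
    have h1 := hpow i 9 hi
    have h2 : 0 < 1 / m := by positivity
    have h3 : 0 < B ^ 9 := by positivity
    linarith
  have hA8 : ∀ i ≤ 9, 8 * B ^ i ≤ 8 * B ^ 9 + 1 / m := fun i hi => by
    have h1 := hpow i 9 hi
    have h2 : 0 < 1 / m := by positivity
    linarith
  have hB0 : 0 ≤ B := by linarith
  set A := 8 * B ^ 9 + 1 / m with hA
  have hA1 : 1 ≤ A := by simpa using hAB 0 (by norm_num)
  have hBA : B ≤ A := by simpa using hAB 1 (by norm_num)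
  refine ⟨A, hA1, fun σ hσ => ?_, ?_⟩
  · obtain ⟨b1, b2, b3, b4⟩ := hb (c σ) (mem_image_of_mem c hσ)
    refine ⟨(hB₂ σ hσ).trans (hBB₂.trans hBA), b3.trans (hBB₁.trans hBA),
      b2.trans (hBB₁.trans hBA), b4.trans (hBB₁.trans hBA), fun v => ?_⟩
    have h1 := b1 v
    have h2 : ‖v‖ ^ 2 ≤ 1 / m * G (c σ) v v := by
      rw [one_div, ← div_eq_inv_mul, le_div_iff₀ hm, mul_comm]; exact h1
    have h3 : 0 ≤ G (c σ) v v := le_trans (by positivity) h1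
    refine h2.trans ?_
    gcongr
    have : 0 < 8 * B ^ 9 := by positivity
    linarith
  intro s hs s' hs' hss ξ X X' hX hX' σ hσ
  have hsub : ∀ τ ∈ Icc s s', τ ∈ Icc p q := fun τ hτ => ⟨hs.1.trans hτ.1, hτ.2.trans hs'.2⟩
  set n := ‖ξ‖ with hn
  have hn0 : 0 ≤ n := norm_nonneg _
  set d := s' - s with hd
  have hd0 : 0 ≤ d := sub_nonneg.2 (hσ.1.trans hσ.2)
  have bd : ∀ τ ∈ Icc s s', ‖u τ‖ ≤ B ∧ ‖christ G (c τ)‖ ≤ B ∧ ‖G (c τ)‖ ≤ B := fun τ hτ => by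
    obtain ⟨-, b2, b3, -⟩ := hb (c τ) (mem_image_of_mem c (hsub τ hτ))
    exact ⟨(hB₂ τ (hsub τ hτ)).trans hBB₂, b3.trans hBB₁, b2.trans hBB₁⟩
  have hs's : s' ∈ Icc s s' := ⟨sub_nonneg.1 hd0, le_rfl⟩
  have hΓ : ‖christ G (c s') (u s') ξ‖ ≤ B ^ 2 * n := by
    have := norm_bilin_le (christ G (c s')) (bd s' hs's).2.1 (bd s' hs's).1 hn.ge
    linarith
  have habs : ∀ τ ∈ Icc s s', |τ - s'| ≤ d := fun τ hτ => by
    rw [abs_le]; constructor <;> linarith [hτ.1, hτ.2]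
  have hXn : ∀ τ ∈ Icc s s', ‖X τ‖ ≤ 2 * B ^ 2 * n := fun τ hτ => by
    rw [hX]
    refine (norm_sub_le _ _).trans ?_
    rw [norm_smul, Real.norm_eq_abs]
    have h1 : |τ - s'| * ‖christ G (c s') (u s') ξ‖ ≤ 1 * (B ^ 2 * n) := by
      gcongr
      exact (habs τ hτ).trans hss
    have h2 : 1 * n ≤ B ^ 2 * n := by
      gcongr; simpa using hpow 0 2 (by norm_num)
    linarith
  have hX'n : ∀ τ ∈ Icc s s', ‖X' τ‖ ≤ 2 * B ^ 4 * d * n := fun τ hτ => by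
    have e1 : X' τ = (Λ τ - Λ s') ξ - (τ - s') • Λ τ (Λ s' ξ) := by
      rw [hX', hX]
      simp only [hΛ, map_sub, map_smul, _root_.sub_apply]
      abel
    rw [e1]
    refine (norm_sub_le _ _).trans ?_
    have h1 : ‖(Λ τ - Λ s') ξ‖ ≤ (B * d) * n := by
      refine norm_lin_le _ ((hlip s' hs' τ (hsub τ hτ)).trans ?_) le_rfl
      exact mul_le_mul hBB₃ (habs τ hτ) (abs_nonneg _) hB0
    have h2 : ‖Λ τ (Λ s' ξ)‖ ≤ B * B * (B ^ 2 * n) :=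
      norm_bilin_le _ (bd τ hτ).2.1 (bd τ hτ).1 hΓ
    have h3 : ‖(τ - s') • Λ τ (Λ s' ξ)‖ ≤ d * (B * B * (B ^ 2 * n)) := by
      rw [norm_smul, Real.norm_eq_abs]
      gcongr
      exact habs τ hτ
    have h4 : B * (d * n) ≤ B ^ 4 * (d * n) := by
      gcongr; simpa using hpow 1 4 (by norm_num)
    linarith
  have hXd : ∀ τ ∈ Icc s s', HasDerivWithinAt X (-christ G (c s') (u s') ξ) (Icc s s') τ := by
    intro τ hτ
    have h1 := (((hasDerivAt_id τ).sub_const s').smul_const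
      (christ G (c s') (u s') ξ)).const_sub ξ
    rw [show X = fun σ => ξ - (id σ - s') • christ G (c s') (u s') ξ from funext hX]
    simpa using h1.hasDerivWithinAt
  have hXs' : X s' = ξ := by rw [hX]; simp
  refine ⟨(hXn σ hσ).trans ?_, hΓ.trans ?_, ?_, ?_, ?_⟩
  · gcongr
    have := hA8 2 (by norm_num)
    have : 0 ≤ B ^ 2 := by positivity
    linarith
  · gcongr
    exact hAB 2 (by norm_num)
  · have h1 := (abs_le.1 (abs_bilin_le (G (c σ)) (bd σ hσ).2.2 (hX'n σ hσ) (hX'n σ hσ))).2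
    have h2 : 0 ≤ d ^ 2 * n ^ 2 := by positivity
    have h3 := mul_le_mul_of_nonneg_right (hA8 9 le_rfl) h2
    have h4 : 0 ≤ B ^ 9 * (d ^ 2 * n ^ 2) := by positivity
    linarith
  · have h1 : ∀ τ ∈ Icc s s', HasDerivWithinAt (fun τ => G (c τ) (u τ) (X τ))
        (G (c τ) (u τ) (X' τ)) (Icc s s') τ := fun τ hτ => by
      obtain ⟨g1, g2, g3⟩ := hc τ (hsub τ hτ)
      refine (h.hasDerivWithinAt_inner g1 (g2.mono hsub) (g3.mono hsub) (hXd τ hτ)).congr_deriv ?_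
      rw [neg_add_cancel, hX']
      simp
    have h2 := (convex_Icc s s').norm_image_sub_le_of_norm_hasDerivWithin_le
      (C := 2 * B ^ 6 * d * n) h1 (fun τ hτ => by
        have := abs_bilin_le (G (c τ)) (bd τ hτ).2.2 (bd τ hτ).1 (hX'n τ hτ)
        rw [Real.norm_eq_abs]
        linarith) hs's hσ
    simp only [hXs', Real.norm_eq_abs] at h2
    refine h2.trans ?_
    have h3 : 2 * B ^ 6 * d * n * |σ - s'| ≤ 2 * B ^ 6 * d * n * d := by
      gcongr; exact habs σ hσ
    have h4 : 0 ≤ d ^ 2 * n := by positivity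
    have h5 := mul_le_mul_of_nonneg_right (hA8 6 (by norm_num)) h4
    have h6 : 0 ≤ B ^ 6 * (d ^ 2 * n) := by positivity
    linarith
  · have h1 : ∀ τ ∈ Icc s s', HasDerivWithinAt (fun τ => G (c τ) (X τ) (X τ))
        (2 * G (c τ) (X τ) (X' τ)) (Icc s s') τ := fun τ hτ => by
      obtain ⟨g1, g2, g3⟩ := hc τ (hsub τ hτ)
      refine (h.hasDerivWithinAt_inner g1 (g2.mono hsub) (hXd τ hτ) (hXd τ hτ)).congr_deriv ?_
      rw [← hX', h.symm _ g1 (X' τ)]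
      ring
    have h2 := (convex_Icc s s').norm_image_sub_le_of_norm_hasDerivWithin_le
      (C := 8 * B ^ 7 * d * n ^ 2) h1 (fun τ hτ => by
        have := abs_bilin_le (G (c τ)) (bd τ hτ).2.2 (hXn τ hτ) (hX'n τ hτ)
        rw [Real.norm_eq_abs, abs_mul, abs_two]
        linarith) hs's hσ
    simp only [hXs', Real.norm_eq_abs] at h2
    refine h2.trans ?_
    have h3 : 8 * B ^ 7 * d * n ^ 2 * |σ - s'| ≤ 8 * B ^ 7 * d * n ^ 2 * d := by
      gcongr; exact habs σ hσ
    have h4 : 0 ≤ d ^ 2 * n ^ 2 := by positivity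
    have h5 := mul_le_mul_of_nonneg_right (hA8 7 (by norm_num)) h4
    linarith

end Transport

section Variation

variable {E : Type*} [NormedAddCommGroup E] [NormedSpace ℝ E] [FiniteDimensional ℝ E]

theorem sq_le_of_abs_sub_le {x y t : ℝ} (h : |x - y| ≤ t) : x ^ 2 ≤ 2 * y ^ 2 + 2 * t ^ 2 := by
  have h1 : (x - y) ^ 2 ≤ t ^ 2 := by
    rw [← sq_abs]
    gcongr
  nlinarith [sq_nonneg (x - 2 * y)]

theorem sub_sub_sq_le (x y z : ℝ) : (x - y - z) ^ 2 ≤ 3 * (x ^ 2 + y ^ 2 + z ^ 2) := by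
  nlinarith [sq_nonneg (x + y), sq_nonneg (x + z), sq_nonneg (y - z)]

/-- A quadratic form which is positive semidefinite satisfies these weak triangle inequalities. -/
theorem IsMetricOn.triangle {G : E → E →L[ℝ] E →L[ℝ] ℝ} {U : Set E} (h : IsMetricOn G U) {y : E}
    (hy : y ∈ U) (a b c : E) :
    G y (a + b + c) (a + b + c) ≤ 3 * (G y a a + G y b b + G y c c) ∧
      G y (a + b) (a + b) ≤ 2 * (G y a a + G y b b) ∧
      7 / 8 * G y a a - 7 * G y b b ≤ G y (a - b) (a - b) := by
  have hnn : ∀ v, 0 ≤ G y v v := fun v => by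
    by_cases hv : v = 0
    · simp [hv]
    · exact (h.pos y hy v hv).le
  have h1 := hnn (a - b)
  have h2 := hnn (a - c)
  have h3 := hnn (b - c)
  have h4 := hnn ((1 / 8 : ℝ) • a - b)
  have s1 := h.symm y hy a b
  have s2 := h.symm y hy a c
  have s3 := h.symm y hy b c
  simp only [map_add, map_sub, map_smul, _root_.add_apply, _root_.sub_apply, _root_.smul_apply,
    smul_eq_mul] at h1 h2 h3 h4 ⊢
  refine ⟨?_, ?_, ?_⟩ <;> linarith

set_option maxHeartbeats 1600000 in
/-- Every displacement `ξ` of the end point of a short piece of a geodesic extends to a variation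
field `η` which at the initial point is tangent, to second order, to the orthogonal complement of
the geodesic, and whose index form is negative definite in curvature one up to errors which are small
compared with the length of the piece or which involve the tangential component of `ξ`. -/
theorem IsMetricOn.exists_variation {G : E → E →L[ℝ] E →L[ℝ] ℝ} {U : Set E}
    (h : IsMetricOn G U) {c u : ℝ → E} {p q : ℝ} (hc : IsGeodesicOn G U c u (Icc p q))
    (hone : ∀ t ∈ Icc p q, G (c t) (u t) (u t) = 1) :
    ∃ A ≥ 1, (∀ σ ∈ Icc p q, ∀ v, ‖v‖ ^ 2 ≤ A * G (c σ) v v) ∧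
      ∀ s ∈ Icc p q, ∀ s' ∈ Icc p q, s < s' → s' - s ≤ 1 → ∀ ξ : E, ‖ξ‖ ≤ 1 →
      ∃ w, ∃ η η' : ℝ → E, η s = w - (1 / 2 : ℝ) • christ G (c s) w w ∧ η s' = ξ ∧
        G (c s) (u s) w = 0 ∧ ‖w‖ ≤ A * ‖ξ‖ ∧
        G (c s') ξ ξ ≤ G (c s) w w + A * ((s' - s) ^ 2 * ‖ξ‖ ^ 2 + G (c s') (u s') ξ ^ 2) ∧
        |G (c s) (u s) (η s) + 1 / 2 * koszul G (c s) (η s) (η s) (u s)| ≤ A * ‖ξ‖ ^ 3 ∧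
        ContinuousOn η' (Icc s s') ∧ ∀ σ ∈ Icc s s', HasDerivWithinAt η (η' σ) (Icc s s') σ ∧
          ‖η σ‖ ≤ A / (s' - s) * ‖ξ‖ ∧ ‖η' σ‖ ≤ A / (s' - s) * ‖ξ‖ ∧
          G (c σ) (η' σ + christ G (c σ) (u σ) (η σ)) (η' σ + christ G (c σ) (u σ) (η σ))
            - G (c σ) (η σ) (η σ) + G (c σ) (η σ) (u σ) ^ 2
            ≤ -(7 / 8) * G (c s') ξ ξ + A * (s' - s) ^ 2 * ‖ξ‖ ^ 2
              + A / (s' - s) ^ 2 * (G (c s') (u s') ξ ^ 2 + ‖ξ‖ ^ 3) := by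
  obtain ⟨A, hA1, hb, hT⟩ := h.exists_transport_bounds hc
  have hA0 : 0 ≤ A := by linarith
  have hpow : ∀ i ≤ 24, A ^ i ≤ A ^ 24 := fun i hi => pow_le_pow_right₀ hA1 hi
  have hpow1 : 1 ≤ A ^ 24 := by simpa using hpow 0 (by norm_num)
  have hA24 : A ≤ A ^ 24 := by simpa using hpow 1 (by norm_num)
  refine ⟨200 * A ^ 24, by linarith, fun σ hσ v => ?_, ?_⟩
  · have h1 := (hb σ hσ).2.2.2.2 v
    have h2 : 0 ≤ G (c σ) v v := by
      by_contra! h3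
      nlinarith [sq_nonneg ‖v‖]
    exact h1.trans (by gcongr; linarith)
  intro s hs s' hs' hlt hle ξ hξ
  set d := s' - s with hd
  have hd0 : 0 < d := sub_pos.2 hlt
  set n := ‖ξ‖ with hn
  have hn0 : 0 ≤ n := norm_nonneg _
  set a := G (c s') (u s') ξ with ha
  set Γ := christ G (c s') (u s') ξ with hΓ
  set X : ℝ → E := fun σ => ξ - (σ - s') • Γ with hX
  set X' : ℝ → E := fun σ => -Γ + christ G (c σ) (u σ) (X σ) with hX'
  have hT' := hT s hs s' hs' hle ξ X X' (fun _ => rfl) (fun _ => rfl)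
  simp only [← hd, ← hn, ← ha] at hT'
  clear_value d n a
  have hss : s ∈ Icc s s' := left_mem_Icc.2 hlt.le
  have hsub : ∀ τ ∈ Icc s s', τ ∈ Icc p q := fun τ hτ => ⟨hs.1.trans hτ.1, hτ.2.trans hs'.2⟩
  obtain ⟨us, chs, Gs, Ks, -⟩ := hb s hs
  obtain ⟨x1, xΓ, -, x3, x4⟩ := hT' s hss
  -- `b` is the tangential component of `X s`. The field `η` differs from `X` by a multiple of `Z` which
  -- is cut off linearly by `φ`, to remove this component at the time `s` and to add the second order
  -- term `-χ / 2`, so that the initial point moves along a geodesic.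
  set b := G (c s) (u s) (X s) with hbdef
  set w := X s - b • u s with hw
  set χ := christ G (c s) w w with hχ
  set Z : ℝ → E := fun σ => b • u σ + (1 / 2 : ℝ) • χ with hZ
  have hd1 : 1 ≤ 1 / d := by rw [le_div_iff₀ hd0]; linarith
  have hbn : |b| ≤ A ^ 3 * n := by
    have := abs_bilin_le _ Gs us x1
    linarith
  have hwn : ‖w‖ ≤ 2 * A ^ 4 * n := by
    refine (norm_sub_le _ _).trans ?_
    rw [norm_smul, Real.norm_eq_abs]
    have h1 : |b| * ‖u s‖ ≤ A ^ 3 * n * A := by gcongr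
    have h2 : A * n ≤ A ^ 4 * n := by
      gcongr; simpa using pow_le_pow_right₀ hA1 (show 1 ≤ 4 by norm_num)
    linarith
  have hχn : ‖χ‖ ≤ 4 * A ^ 9 * n ^ 2 := by
    have := norm_bilin_le _ chs hwn hwn
    linarith
  have hn2 : n ^ 2 ≤ n := by nlinarith
  have hn43 : n ^ 4 ≤ n ^ 3 := pow_le_pow_of_le_one hn0 hξ (by norm_num)
  have hχ1 : ‖χ‖ ≤ 4 * A ^ 9 * n := hχn.trans (by gcongr)
  have hb2 : b ^ 2 ≤ 2 * a ^ 2 + 2 * A ^ 2 * d ^ 2 * n ^ 2 := by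
    have h1 := sq_le_of_abs_sub_le x3
    have h2 : d ^ 4 ≤ d ^ 2 := pow_le_pow_of_le_one hd0.le hle (by norm_num)
    have h3 : A ^ 2 * n ^ 2 * d ^ 4 ≤ A ^ 2 * n ^ 2 * d ^ 2 := by gcongr
    linarith only [h1, h3]
  have hZn : ∀ σ ∈ Icc s s', ‖Z σ‖ ≤ 3 * A ^ 9 * n := fun σ hσ => by
    refine (norm_add_le _ _).trans ?_
    rw [norm_smul, norm_smul, Real.norm_eq_abs]
    have h1 : |b| * ‖u σ‖ ≤ A ^ 3 * n * A := by
      gcongr; exact (hb σ (hsub σ hσ)).1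
    have h2 : A ^ 4 * n ≤ A ^ 9 * n := by
      gcongr
      · norm_num
    have h3 : ‖(1 / 2 : ℝ)‖ = 1 / 2 := by norm_num
    rw [h3]
    linarith
  set φ : ℝ → ℝ := fun σ => (s' - σ) / d with hφ
  have hφ01 : ∀ σ ∈ Icc s s', 0 ≤ φ σ ∧ φ σ ≤ 1 := fun σ hσ =>
    ⟨div_nonneg (sub_nonneg.2 hσ.2) hd0.le, by rw [div_le_one hd0]; linarith [hσ.1]⟩
  set Z' : ℝ → E := fun σ => -(1 / d) • Z σ + φ σ • (b • -christ G (c σ) (u σ) (u σ)) with hZ'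
  set η : ℝ → E := fun σ => X σ - φ σ • Z σ with hη
  set η' : ℝ → E := fun σ => -Γ - Z' σ with hη'
  have hηs : η s = w - (1 / 2 : ℝ) • χ := by
    simp only [hη, hφ, hZ, hw, div_self hd0.ne', ← hd, one_smul]
    abel
  have hηs' : η s' = ξ := by simp [hη, hφ, hX]
  have hηn : ∀ σ ∈ Icc s s', ‖η σ‖ ≤ 4 * A ^ 9 * n := fun σ hσ => by
    refine (norm_sub_le _ _).trans ?_
    rw [norm_smul, Real.norm_eq_abs, abs_of_nonneg (hφ01 σ hσ).1]
    have h1 : φ σ * ‖Z σ‖ ≤ 1 * (3 * A ^ 9 * n) := by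
      gcongr
      · exact (hφ01 σ hσ).2
      · exact hZn σ hσ
    have h2 : A * n ≤ A ^ 9 * n := by
      gcongr; simpa using pow_le_pow_right₀ hA1 (show 1 ≤ 9 by norm_num)
    have := (hT' σ hσ).1
    linarith
  have hGw : G (c s) (u s) w = 0 := by
    rw [hw, map_sub, map_smul, hone s hs, ← hbdef]
    simp
  refine ⟨w, η, η', hηs, hηs', hGw, ?_, ?_, ?_, ?_, fun σ hσ => ⟨?_, ?_, ?_, ?_⟩⟩
  · have h1 := mul_le_mul_of_nonneg_right (hpow 4 (by norm_num)) hn0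
    have h2 : 0 ≤ A ^ 24 * n := by positivity
    linarith
  · have h1 : G (c s) w w = G (c s) (X s) (X s) - b ^ 2 := by
      rw [hw]
      simp only [map_sub, map_smul, _root_.sub_apply, _root_.smul_apply, smul_eq_mul, hone s hs,
        h.symm _ (hc s hs).1 (X s) (u s), ← hbdef]
      ring
    have h2 := (abs_le.1 x4).1
    have h3 := mul_le_mul_of_nonneg_right (hpow 2 (by norm_num))
      (by positivity : 0 ≤ d ^ 2 * n ^ 2)
    have h4 := mul_le_mul_of_nonneg_right hA24 (by positivity : 0 ≤ d ^ 2 * n ^ 2)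
    have h5 := mul_le_mul_of_nonneg_right hpow1 (sq_nonneg a)
    have h6 : 0 ≤ A ^ 24 * (d ^ 2 * n ^ 2) := by positivity
    have h7 : 0 ≤ A ^ 24 * a ^ 2 := by positivity
    rw [h1]
    linarith
  · have e1 : G (c s) (u s) χ = koszul G (c s) w w (u s) := by
      rw [h.symm _ (hc s hs).1, hχ, h.metric_christ (hc s hs).1]
    have e2 : G (c s) (u s) (η s) + 1 / 2 * koszul G (c s) (η s) (η s) (u s)
        = -(1 / 4) * (koszul G (c s) χ (η s) (u s) + koszul G (c s) w χ (u s)) := by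
      have e3 : koszul G (c s) (η s) (η s) (u s) - koszul G (c s) w w (u s)
          = -(1 / 2) * (koszul G (c s) χ (η s) (u s) + koszul G (c s) w χ (u s)) := by
        rw [hηs]
        simp only [map_sub, map_smul, _root_.sub_apply, _root_.smul_apply, smul_eq_mul]
        ring
      have e4 : G (c s) (u s) (η s) = -(1 / 2) * koszul G (c s) w w (u s) := by
        rw [hηs, map_sub, hGw, map_smul, e1, smul_eq_mul]; ring
      linarith
    have k1 : ∀ v₁ v₂ : E, ∀ r₁ r₂ : ℝ, ‖v₁‖ ≤ r₁ → ‖v₂‖ ≤ r₂ →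
        |koszul G (c s) v₁ v₂ (u s)| ≤ A * r₁ * r₂ * A := fun v₁ v₂ r₁ r₂ h1 h2 =>
      norm_lin_le (koszul G (c s) v₁ v₂) (norm_bilin_le _ Ks h1 h2) us
    have k2 := k1 _ _ _ _ hχn (hηn s hss)
    have k3 := k1 _ _ _ _ hwn hχn
    rw [e2, abs_mul]
    have k4 := abs_add_le (koszul G (c s) χ (η s) (u s)) (koszul G (c s) w χ (u s))
    have h1 := mul_le_mul_of_nonneg_right (hpow 20 (by norm_num)) (by positivity : 0 ≤ n ^ 3)
    have h2 := mul_le_mul_of_nonneg_right (hpow 15 (by norm_num)) (by positivity : 0 ≤ n ^ 3)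
    have h3 : 0 ≤ A ^ 24 * n ^ 3 := by positivity
    have h4 : |(-(1 / 4) : ℝ)| = 1 / 4 := by norm_num
    rw [h4]
    linarith
  · have c1 : ContinuousOn u (Icc s s') := fun t ht =>
      ((hc t (hsub t ht)).2.2.mono hsub).continuousWithinAt
    have c2 : ContinuousOn (fun t => christ G (c t)) (Icc s s') :=
      h.contDiffOn_christ.continuousOn.comp
        (fun t ht => ((hc t (hsub t ht)).2.1.mono hsub).continuousWithinAt)
        fun t ht => (hc t (hsub t ht)).1
    have c3 : ContinuousOn φ (Icc s s') := by fun_prop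
    exact continuousOn_const.sub (((((c1.const_smul b).add continuousOn_const).const_smul _)).add
      (c3.smul (((c2.clm_apply c1).clm_apply c1).neg.const_smul b)))
  · have i1 : HasDerivWithinAt X (-Γ) (Icc s s') σ := by
      have h1 := (((hasDerivAt_id σ).sub_const s').smul_const Γ).const_sub ξ
      simpa using h1.hasDerivWithinAt
    have i2 : HasDerivWithinAt φ (-(1 / d)) (Icc s s') σ := by
      have h1 := (((hasDerivAt_id σ).const_sub s').div_const d)
      refine (h1.congr_deriv ?_).hasDerivWithinAt
      ring
    have i3 : HasDerivWithinAt Z (b • -christ G (c σ) (u σ) (u σ)) (Icc s s') σ :=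
      (((hc σ (hsub σ hσ)).2.2.mono hsub).const_smul b).add_const _
    refine (i1.sub (i2.smul i3)).congr_deriv ?_
    simp only [hη', hZ']
    abel
  · refine (hηn σ hσ).trans ?_
    gcongr
    rw [div_eq_mul_one_div]
    have h2 := hpow 9 (by norm_num)
    have h3 : 200 * A ^ 24 ≤ 200 * A ^ 24 * (1 / d) := le_mul_of_one_le_right (by positivity) hd1
    linarith only [h2, h3, hpow1]
  · have h1 : ‖Z' σ‖ ≤ 1 / d * (3 * A ^ 9 * n) + A ^ 3 * n * (A * A * A) := by
      refine (norm_add_le _ _).trans ?_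
      rw [norm_smul, norm_smul, norm_smul, norm_neg, norm_neg, Real.norm_eq_abs, Real.norm_eq_abs,
        Real.norm_eq_abs, abs_of_nonneg (hφ01 σ hσ).1, abs_of_pos (by positivity)]
      obtain ⟨us', chs', -⟩ := hb σ (hsub σ hσ)
      have h2 := norm_bilin_le _ chs' us' us'
      have h3 : φ σ * (|b| * ‖christ G (c σ) (u σ) (u σ)‖) ≤ 1 * (A ^ 3 * n * (A * A * A)) := by
        gcongr
        exact (hφ01 σ hσ).2
      have h4 : 1 / d * ‖Z σ‖ ≤ 1 / d * (3 * A ^ 9 * n) := by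
        gcongr; exact hZn σ hσ
      linarith
    have h2 : ‖η' σ‖ ≤ A * n + (1 / d * (3 * A ^ 9 * n) + A ^ 3 * n * (A * A * A)) := by
      refine (norm_sub_le _ _).trans ?_
      rw [norm_neg]
      exact add_le_add xΓ h1
    refine h2.trans ?_
    have h3 := mul_le_mul_of_nonneg_right hA24 hn0
    have h4 := mul_le_mul_of_nonneg_right (hpow 9 (by norm_num)) hn0
    have h5 := mul_le_mul_of_nonneg_right (hpow 6 (by norm_num)) hn0
    have h6 : 0 ≤ A ^ 24 * n := by positivity
    have h7 := mul_le_mul_of_nonneg_right hd1 h6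
    have h8 := mul_le_mul_of_nonneg_left h4 (by positivity : 0 ≤ 1 / d)
    rw [div_eq_mul_one_div (200 * A ^ 24) d]
    linarith only [h3, h4, h5, h6, h7, h8]
  · have hσ' := hsub σ hσ
    obtain ⟨us', chs', Gs', -⟩ := hb σ hσ'
    obtain ⟨y1, -, y2, y3, y4⟩ := hT' σ hσ
    have hcU := (hc σ hσ').1
    set T := (1 / (2 * d)) • χ - (φ σ / 2) • christ G (c σ) (u σ) χ with hTdef
    have e1 : η' σ + christ G (c σ) (u σ) (η σ) = X' σ + (b / d) • u σ + T := by
      simp only [hη', hη, hZ', hZ, hX', hTdef, map_sub, map_add, map_smul]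
      module
    have hTn : ‖T‖ ≤ 1 / d * (4 * A ^ 11 * n ^ 2) := by
      refine (norm_sub_le _ _).trans ?_
      rw [norm_smul, norm_smul, Real.norm_eq_abs, Real.norm_eq_abs,
        abs_of_nonneg (div_nonneg (hφ01 σ hσ).1 zero_le_two), abs_of_pos (by positivity)]
      have h1 := norm_bilin_le _ chs' us' hχn
      have h2 : φ σ / 2 * ‖christ G (c σ) (u σ) χ‖ ≤ 1 / 2 * (A * A * (4 * A ^ 9 * n ^ 2)) := by
        gcongr
        exact (hφ01 σ hσ).2
      have h3 : 1 / (2 * d) * ‖χ‖ ≤ 1 / (2 * d) * (4 * A ^ 9 * n ^ 2) := by gcongr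
      have h4 : A ^ 9 * n ^ 2 ≤ A ^ 11 * n ^ 2 := by
        gcongr
        · norm_num
      have h5 : 0 ≤ A ^ 11 * n ^ 2 := by positivity
      have h6 := mul_le_mul_of_nonneg_right hd1 h5
      have h7 := mul_le_mul_of_nonneg_left h4 (by positivity : 0 ≤ 1 / d)
      have h8 : 1 / (2 * d) * (4 * A ^ 9 * n ^ 2) = 2 * (1 / d * (A ^ 9 * n ^ 2)) := by
        field_simp; ring
      linarith
    have hqT : G (c σ) T T ≤ 16 * A ^ 23 * n ^ 4 * (1 / d ^ 2) := by
      have := (abs_le.1 (abs_bilin_le _ Gs' hTn hTn)).2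
      refine this.trans (le_of_eq ?_)
      field_simp; ring
    have t1 := (h.triangle hcU (X' σ) ((b / d) • u σ) T).1
    have t2 := (h.triangle hcU (X σ) (φ σ • Z σ) 0).2.2
    have hqu : G (c σ) ((b / d) • u σ) ((b / d) • u σ) = b ^ 2 * (1 / d ^ 2) := by
      simp only [map_smul, _root_.smul_apply, smul_eq_mul, hone σ hσ']
      field_simp
    have hqχ : G (c σ) χ χ ≤ 16 * A ^ 19 * n ^ 4 := by
      have := (abs_le.1 (abs_bilin_le _ Gs' hχn hχn)).2
      linarith
    have hqZ : G (c σ) (φ σ • Z σ) (φ σ • Z σ) ≤ 2 * b ^ 2 + 8 * A ^ 19 * n ^ 4 := by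
      have h1 := (h.triangle hcU (b • u σ) ((1 / 2 : ℝ) • χ) 0).2.1
      have h2 : G (c σ) (φ σ • Z σ) (φ σ • Z σ) = φ σ ^ 2 * G (c σ) (Z σ) (Z σ) := by
        simp only [map_smul, _root_.smul_apply, smul_eq_mul]; ring
      simp only [map_smul, _root_.smul_apply, smul_eq_mul, hone σ hσ'] at h1
      have h3 : G (c σ) (Z σ) (Z σ) ≤ 2 * b ^ 2 + 8 * A ^ 19 * n ^ 4 := by
        refine h1.trans ?_
        linarith only [hqχ]
      have h4 : 0 ≤ 2 * b ^ 2 + 8 * A ^ 19 * n ^ 4 := by positivity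
      have h5 : φ σ ^ 2 ≤ 1 := pow_le_one₀ (hφ01 σ hσ).1 (hφ01 σ hσ).2
      rw [h2]
      exact (mul_le_mul_of_nonneg_left h3 (sq_nonneg _)).trans (mul_le_of_le_one_left h4 h5)
    have hGη : G (c σ) (η σ) (u σ) ^ 2
        ≤ 3 * ((G (c σ) (u σ) (X σ)) ^ 2 + b ^ 2 + 4 * A ^ 22 * n ^ 4) := by
      have h1 : G (c σ) (η σ) (u σ) = G (c σ) (u σ) (X σ) - φ σ * b
          - φ σ * (1 / 2 * G (c σ) (u σ) χ) := by
        rw [h.symm _ hcU]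
        simp only [hη, hZ, map_sub, map_smul, map_add, smul_eq_mul, hone σ hσ']
        ring
      have h2 : G (c σ) (u σ) χ ^ 2 ≤ (A * A * (4 * A ^ 9 * n ^ 2)) ^ 2 := by
        rw [← sq_abs]
        gcongr
        exact abs_bilin_le _ Gs' us' hχn
      have h5 : φ σ ^ 2 ≤ 1 := pow_le_one₀ (hφ01 σ hσ).1 (hφ01 σ hσ).2
      have h6 : (φ σ * b) ^ 2 ≤ b ^ 2 := by
        rw [mul_pow]; exact mul_le_of_le_one_left (sq_nonneg b) h5
      have h7 : (φ σ * (1 / 2 * G (c σ) (u σ) χ)) ^ 2 ≤ 4 * A ^ 22 * n ^ 4 := by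
        rw [mul_pow]
        refine (mul_le_of_le_one_left (sq_nonneg _) h5).trans ?_
        linarith only [h2]
      rw [h1]
      refine (sub_sub_sq_le _ _ _).trans ?_
      linarith only [h6, h7]
    have hGX : G (c σ) (u σ) (X σ) ^ 2 ≤ 2 * a ^ 2 + 2 * A ^ 2 * d ^ 2 * n ^ 2 := by
      have h1 := sq_le_of_abs_sub_le y3
      have h2 : d ^ 4 ≤ d ^ 2 := pow_le_pow_of_le_one hd0.le hle (by norm_num)
      have h3 : A ^ 2 * n ^ 2 * d ^ 4 ≤ A ^ 2 * n ^ 2 * d ^ 2 := by gcongr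
      linarith only [h1, h3]
    have hbd : b ^ 2 * (1 / d ^ 2) ≤ 2 * a ^ 2 * (1 / d ^ 2) + 2 * A ^ 2 * d ^ 2 * n ^ 2 := by
      have h2 := sq_le_of_abs_sub_le x3
      calc b ^ 2 * (1 / d ^ 2) ≤ (2 * a ^ 2 + 2 * (A * d ^ 2 * n) ^ 2) * (1 / d ^ 2) := by gcongr
        _ = _ := by field_simp
    have hηdef : η σ = X σ - φ σ • Z σ := rfl
    rw [← hηdef] at t2
    rw [← e1, hqu] at t1
    -- collect the errors
    set D := 1 / d ^ 2 with hD
    have hD1 : 1 ≤ D := by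
      rw [hD, le_div_iff₀ (by positivity)]
      have := pow_le_one₀ (n := 2) hd0.le hle
      linarith
    set P := A ^ 24 with hP
    set N := d ^ 2 * n ^ 2 with hN
    have hN0 : 0 ≤ N := by positivity
    have q1 : A * N ≤ P * N := by gcongr
    have q2 : A ^ 2 * N ≤ P * N := by gcongr; exact hpow 2 (by norm_num)
    have hnD : n ^ 3 ≤ n ^ 3 * D := le_mul_of_one_le_right (by positivity) hD1
    have haD : a ^ 2 ≤ a ^ 2 * D := le_mul_of_one_le_right (by positivity) hD1
    have hPa : a ^ 2 * D ≤ P * (a ^ 2 * D) := le_mul_of_one_le_left (by positivity) hpow1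
    have m1 : ∀ i ≤ 24, A ^ i * n ^ 4 ≤ P * (n ^ 3 * D) := fun i hi =>
      mul_le_mul (hpow i hi) (hn43.trans hnD) (by positivity) (by positivity)
    have m2 : A ^ 23 * n ^ 4 * D ≤ P * (n ^ 3 * D) := by
      have h1 : A ^ 23 * n ^ 4 ≤ P * n ^ 3 :=
        mul_le_mul (hpow 23 (by norm_num)) hn43 (by positivity) (by positivity)
      calc _ ≤ P * n ^ 3 * D := by gcongr
        _ = _ := by ring
    have m3 := m1 19 (by norm_num)
    have m4 := m1 22 (by norm_num)
    have y4' := (abs_le.1 y4).1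
    have w1 : 0 ≤ P * N := by positivity
    have w2 : 0 ≤ P * (a ^ 2 * D) := by positivity
    have w3 : 0 ≤ P * (n ^ 3 * D) := by positivity
    have g1 : 200 * P / d ^ 2 * (a ^ 2 + n ^ 3) = 200 * (P * (a ^ 2 * D)) + 200 * (P * (n ^ 3 * D)) := by
      rw [hD]; ring
    rw [g1]
    have r1 : A * d ^ 2 * n ^ 2 = A * N := by rw [hN]; ring
    have r2 : 2 * A ^ 2 * d ^ 2 * n ^ 2 = 2 * (A ^ 2 * N) := by rw [hN]; ring
    have r3 : 200 * P * d ^ 2 * n ^ 2 = 200 * (P * N) := by rw [hN]; ring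
    rw [r1] at y4' y2
    rw [r2] at hb2 hGX hbd
    rw [r3]
    linarith only [t1, t2, y2, hqT, hqZ, hGη, hGX, hbd, hb2, q1, q2, haD, hPa, m2, m3, m4, y4', w1,
      w2, w3]

end Variation

/-! ### First and second variation, and barriers -/

section Barriers

variable {M : Type*} [MetricSpace M] [ChartedSpace E3 M] [IsManifold (𝓡 3) ∞ M]
  [RiemannianBundle (fun x : M => TangentSpace (𝓡 3) x)]
  [IsContMDiffRiemannianBundle (𝓡 3) ∞ E3 (fun x : M => TangentSpace (𝓡 3) x)]
  [IsRiemannianManifold (𝓡 3) M]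

theorem IsGeodesicOn.isCompact_image {G : E3 → E3 →L[ℝ] E3 →L[ℝ] ℝ} {U : Set E3} {c u : ℝ → E3}
    {p q : ℝ} (hc : IsGeodesicOn G U c u (Icc p q)) : IsCompact (c '' Icc p q) :=
  isCompact_Icc.image_of_continuousOn fun t ht => (hc t ht).2.1.continuousWithinAt

theorem IsGeodesicOn.image_subset {G : E3 → E3 →L[ℝ] E3 →L[ℝ] ℝ} {U : Set E3} {c u : ℝ → E3}
    {p q : ℝ} (hc : IsGeodesicOn G U c u (Icc p q)) : c '' Icc p q ⊆ U := by
  rintro _ ⟨t, ht, rfl⟩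
  exact (hc t ht).1

theorem IsGeodesicOn.exists_bound {G : E3 → E3 →L[ℝ] E3 →L[ℝ] ℝ} {U : Set E3} {c u : ℝ → E3}
    {p q : ℝ} (hc : IsGeodesicOn G U c u (Icc p q)) : ∃ B, ∀ t ∈ Icc p q, ‖u t‖ ≤ B :=
  isCompact_Icc.exists_bound_of_continuousOn fun t ht => (hc t ht).2.2.continuousWithinAt

/-- First variation: an upper bound for the distance of the end points of a curve close to a unit
speed geodesic. -/
theorem exists_dist_le_first_variation {e : OpenPartialHomeomorph M E3}
    (he : e ∈ IsManifold.maximalAtlas (𝓡 3) ∞ M) {c u : ℝ → E3} {p q : ℝ}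
    (hc : IsGeodesicOn (gram e) e.target c u (Icc p q))
    (hone : ∀ t ∈ Icc p q, gram e (c t) (u t) (u t) = 1) :
    ∃ C > 0, ∃ δ > 0, ∀ s ∈ Icc p q, ∀ s' ∈ Icc p q, s ≤ s' → ∀ η η' : ℝ → E3, ∀ R ≤ δ,
      (∀ σ ∈ Icc s s', HasDerivWithinAt η (η' σ) (Icc s s') σ ∧ ‖η σ‖ ≤ R ∧ ‖η' σ‖ ≤ R) →
      ContinuousOn η' (Icc s s') →
      dist (e.symm (c s + η s)) (e.symm (c s' + η s')) ≤ (s' - s) +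
        (gram e (c s') (u s') (η s') - gram e (c s) (u s) (η s)) + (s' - s) * (C * R ^ 2) := by
  have hG := isMetricOn_gram he
  obtain ⟨B, hB⟩ := hc.exists_bound
  obtain ⟨C, hC, δ, hδ, hT⟩ := hG.exists_energy_taylor hc.isCompact_image hc.image_subset B
  refine ⟨C, hC, δ, hδ, fun s hs s' hs' hss η η' R hR hη hη'c => ?_⟩
  have hsub : Icc s s' ⊆ Icc p q := fun τ hτ => ⟨hs.1.trans hτ.1, hτ.2.trans hs'.2⟩
  have hT' := fun σ (hσ : σ ∈ Icc s s') => hT (c σ) (mem_image_of_mem c (hsub hσ)) (u σ)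
    (hB σ (hsub hσ)) R hR (η σ) (η' σ) (hη σ hσ).2.1 (hη σ hσ).2.2
  have huc : ContinuousOn u (Icc p q) := fun t ht => (hc t ht).2.2.continuousWithinAt
  have h1 := dist_le_of_chart_curve he hss (c := fun σ => c σ + η σ) (c' := fun σ => u σ + η' σ)
    (Ψ := fun σ => σ * (1 + C * R ^ 2) + gram e (c σ) (u σ) (η σ))
    (Ψ' := fun σ => (1 + C * R ^ 2) + (1 / 2 * fderiv ℝ (gram e) (c σ) (η σ) (u σ) (u σ)
      + gram e (c σ) (u σ) (η' σ)))
    (fun σ hσ => ((hc σ (hsub hσ)).2.1.mono hsub).add (hη σ hσ).1)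
    ((huc.mono hsub).add hη'c) (fun σ hσ => (hT' σ hσ).1) ?_ ?_
  · linarith only [h1]
  · intro σ hσ
    obtain ⟨g1, g2, g3⟩ := hc σ (hsub hσ)
    have d1 := hG.hasDerivWithinAt_inner_velocity g1 (g2.mono hsub) (g3.mono hsub) (hη σ hσ).1
    have d2 := ((hasDerivAt_id σ).mul_const (1 + C * R ^ 2)).hasDerivWithinAt (s := Icc s s')
    exact (d2.add d1).congr_deriv (by rw [one_mul])
  · intro σ hσ
    refine (sqrt_le_half_add_one (gram_self_nonneg _ _ _)).trans ?_
    have h2 := (abs_le.1 (hT' σ hσ).2.1).2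
    rw [hone σ (hsub hσ)] at h2
    have h3 : 0 ≤ C * R ^ 2 := by positivity
    linarith only [h2, h3]

/-- Second variation in curvature at least one: `Φ` is an upper bound for the integrand of the index
form. -/
theorem exists_dist_le_second_variation (hsec : SecGE M 1) {e : OpenPartialHomeomorph M E3}
    (he : e ∈ IsManifold.maximalAtlas (𝓡 3) ∞ M) {c u : ℝ → E3} {p q : ℝ}
    (hc : IsGeodesicOn (gram e) e.target c u (Icc p q))
    (hone : ∀ t ∈ Icc p q, gram e (c t) (u t) (u t) = 1) :
    ∃ C > 0, ∃ δ > 0, ∀ s ∈ Icc p q, ∀ s' ∈ Icc p q, s ≤ s' → ∀ η η' : ℝ → E3, ∀ R ≤ δ, ∀ Φ : ℝ,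
      (∀ σ ∈ Icc s s', HasDerivWithinAt η (η' σ) (Icc s s') σ ∧ ‖η σ‖ ≤ R ∧ ‖η' σ‖ ≤ R ∧
        gram e (c σ) (η' σ + christ (gram e) (c σ) (u σ) (η σ))
            (η' σ + christ (gram e) (c σ) (u σ) (η σ))
          - gram e (c σ) (η σ) (η σ) + gram e (c σ) (η σ) (u σ) ^ 2 ≤ Φ) →
      ContinuousOn η' (Icc s s') →
      dist (e.symm (c s + η s)) (e.symm (c s' + η s')) ≤ (s' - s)
        + ((gram e (c s') (u s') (η s')
            + 1 / 2 * koszul (gram e) (c s') (η s') (η s') (u s'))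
          - (gram e (c s) (u s) (η s) + 1 / 2 * koszul (gram e) (c s) (η s) (η s) (u s)))
        + (s' - s) / 2 * (Φ + C * R ^ 3) := by
  have hG := isMetricOn_gram he
  obtain ⟨B, hB⟩ := hc.exists_bound
  obtain ⟨C, hC, δ, hδ, hT⟩ := hG.exists_energy_taylor hc.isCompact_image hc.image_subset B
  refine ⟨C, hC, δ, hδ, fun s hs s' hs' hss η η' R hR Φ hη hη'c => ?_⟩
  have hsub : Icc s s' ⊆ Icc p q := fun τ hτ => ⟨hs.1.trans hτ.1, hτ.2.trans hs'.2⟩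
  have hT' := fun σ (hσ : σ ∈ Icc s s') => hT (c σ) (mem_image_of_mem c (hsub hσ)) (u σ)
    (hB σ (hsub hσ)) R hR (η σ) (η' σ) (hη σ hσ).2.1 (hη σ hσ).2.2.1
  have huc : ContinuousOn u (Icc p q) := fun t ht => (hc t ht).2.2.continuousWithinAt
  have h1 := dist_le_of_chart_curve he hss (c := fun σ => c σ + η σ) (c' := fun σ => u σ + η' σ)
    (Ψ := fun σ => σ * (1 + (Φ + C * R ^ 3) / 2) + (gram e (c σ) (u σ) (η σ)
      + 1 / 2 * koszul (gram e) (c σ) (η σ) (η σ) (u σ)))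
    (Ψ' := fun σ => (1 + (Φ + C * R ^ 3) / 2) + ((1 / 2 * fderiv ℝ (gram e) (c σ) (η σ) (u σ) (u σ)
      + gram e (c σ) (u σ) (η' σ)) + 1 / 2 *
      ((1 / 2) * fderiv ℝ (fderiv ℝ (gram e)) (c σ) (η σ) (η σ) (u σ) (u σ)
        + 2 * fderiv ℝ (gram e) (c σ) (η σ) (u σ) (η' σ) + gram e (c σ) (η' σ) (η' σ)
        - gram e (c σ) (η' σ + christ (gram e) (c σ) (u σ) (η σ))
          (η' σ + christ (gram e) (c σ) (u σ) (η σ))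
        + curvForm (gram e) (c σ) (η σ) (u σ))))
    (fun σ hσ => ((hc σ (hsub hσ)).2.1.mono hsub).add (hη σ hσ).1)
    ((huc.mono hsub).add hη'c) (fun σ hσ => (hT' σ hσ).1) ?_ ?_
  · linarith only [h1]
  · intro σ hσ
    obtain ⟨g1, g2, g3⟩ := hc σ (hsub hσ)
    have d1 := hG.hasDerivWithinAt_inner_velocity g1 (g2.mono hsub) (g3.mono hsub) (hη σ hσ).1
    have d2 := ((hasDerivAt_id σ).mul_const (1 + (Φ + C * R ^ 3) / 2)).hasDerivWithinAt
      (s := Icc s s')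
    have d3 := hG.hasDerivWithinAt_koszul g1 (g2.mono hsub) (g3.mono hsub) (hη σ hσ).1
    exact (d2.add (d1.add (d3.const_mul (1 / 2)))).congr_deriv (by rw [one_mul])
  · intro σ hσ
    refine (sqrt_le_half_add_one (gram_self_nonneg _ _ _)).trans ?_
    have h2 := (abs_le.1 (hT' σ hσ).2.2).2
    have h3 := (hη σ hσ).2.2.2
    have h4 := hsec.le_curvForm he (hc σ (hsub hσ)).1 (η σ) (u σ)
    rw [hone σ (hsub hσ)] at h2 h4
    linarith only [h2, h3, h4]

/-- The second order upper bound `r - k |w|² / 2` for the function `ρ` along the (approximate)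
geodesics with initial vectors `w` orthogonal to `ν`, in the chart `e` at the point with coordinates
`y`. -/
def HasPerpBarrier (e : OpenPartialHomeomorph M E3) (ρ : M → ℝ) (y ν : E3) (r k : ℝ) : Prop :=
  ∀ ε > 0, ∀ᶠ w in 𝓝 (0 : E3), gram e y ν w = 0 →
    ρ (e.symm (y + (w - (1 / 2 : ℝ) • christ (gram e) y w w)))
      ≤ r - k / 2 * gram e y w w + ε * ‖w‖ ^ 2

/-- A second order upper bound for the function `ρ` at the point with coordinates `y` in the chart
`e`, with value `r` and gradient `ν`, and with Hessian at most `-k` orthogonally to `ν`. The terms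
involving `ν` are the second order expansion of a function whose Hessian vanishes; the constant `C`
leaves the Hessian in the direction of `ν` unrestricted. -/
def HasBarrier (e : OpenPartialHomeomorph M E3) (ρ : M → ℝ) (y ν : E3) (r k : ℝ) : Prop :=
  ∃ C, ∀ ε > 0, ∀ᶠ ξ in 𝓝 (0 : E3), ρ (e.symm (y + ξ)) ≤ r + gram e y ν ξ
    + 1 / 2 * koszul (gram e) y ξ ξ ν - k / 2 * gram e y ξ ξ + C * gram e y ν ξ ^ 2 + ε * ‖ξ‖ ^ 2

/-- Barriers propagate along geodesics, and their concavity grows. -/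
theorem exists_hasBarrier_of_hasPerpBarrier (hsec : SecGE M 1) {e : OpenPartialHomeomorph M E3}
    (he : e ∈ IsManifold.maximalAtlas (𝓡 3) ∞ M) {c u : ℝ → E3} {p q : ℝ}
    (hc : IsGeodesicOn (gram e) e.target c u (Icc p q))
    (hone : ∀ t ∈ Icc p q, gram e (c t) (u t) (u t) = 1) {ρ : M → ℝ}
    (hρ : ∀ x y, ρ y ≤ ρ x + dist x y) {K : ℝ} (hK : 0 ≤ K) :
    ∃ δ > 0, ∀ s ∈ Icc p q, ∀ s' ∈ Icc p q, s < s' → s' - s ≤ δ → ∀ k r, 0 ≤ k → k ≤ K →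
      HasPerpBarrier e ρ (c s) (u s) r k →
        HasBarrier e ρ (c s') (u s') (r + (s' - s)) (k + (s' - s) / 2) := by
  obtain ⟨C, hC, δ, hδ, hdist⟩ := exists_dist_le_second_variation hsec he hc hone
  obtain ⟨A, hA1, hA, hvar⟩ := (isMetricOn_gram he).exists_variation hc hone
  have hA0 : 0 < A := by linarith
  refine ⟨min 1 (3 / 16 / (A * (K * A + A))), by positivity, ?_⟩
  intro s hs s' hs' hlt hle k r hk0 hkK hperp
  set d := s' - s with hd
  have hd0 : 0 < d := sub_pos.2 hlt
  have hd1 : d ≤ 1 := hle.trans (min_le_left _ _)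
  have hd2 : d * (A * (K * A + A)) ≤ 3 / 16 := by
    rw [← le_div_iff₀ (by positivity)]
    exact hle.trans (min_le_right _ _)
  refine ⟨K / 2 * A + d / 2 * (A / d ^ 2), fun ε hε => ?_⟩
  set Cn := A + d / 2 * (A / d ^ 2 + C * (A / d) ^ 3) with hCn
  have hCn0 : 0 < Cn := by positivity
  obtain ⟨r₀, hr₀, hball⟩ := Metric.eventually_nhds_iff.1 (hperp (ε / (2 * A ^ 2)) (by positivity))
  have hn1 : ∀ᶠ ξ in 𝓝 (0 : E3), ‖ξ‖ < min (min 1 (r₀ / A)) (min (δ * d / A) (ε / (2 * Cn))) := by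
    have := Metric.ball_mem_nhds (0 : E3)
      (by positivity : 0 < min (min 1 (r₀ / A)) (min (δ * d / A) (ε / (2 * Cn))))
    filter_upwards [this] with ξ hξ using by simpa using hξ
  filter_upwards [hn1] with ξ hξ
  simp only [lt_min_iff] at hξ
  obtain ⟨⟨hξ1, hξ2⟩, hξ3, hξ4⟩ := hξ
  obtain ⟨w, η, η', hηs, hηs', hGw, hwn, hww, hF, hη'c, hσ⟩ := hvar s hs s' hs' hlt hd1 ξ hξ1.le
  have hww' : dist w 0 < r₀ := by
    rw [dist_zero_right]
    rw [lt_div_iff₀ hA0] at hξ2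
    linarith
  have h1 := hball hww' hGw
  have h2 := hdist s hs s' hs' hlt.le η η' (A / d * ‖ξ‖)
    (by
      rw [lt_div_iff₀ hA0] at hξ3
      rw [div_mul_eq_mul_div, div_le_iff₀ hd0]
      linarith) _ (fun σ hσ' => hσ σ hσ') hη'c
  rw [hηs', hηs] at h2
  rw [hηs] at hF
  have h3 := hρ (e.symm (c s + (w - (1 / 2 : ℝ) • christ (gram e) (c s) w w)))
    (e.symm (c s' + ξ))
  have hF' := (abs_le.1 hF).1
  set n := ‖ξ‖ with hn
  have hn0 : 0 ≤ n := norm_nonneg _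
  set Q := gram e (c s') ξ ξ with hQ
  have hQ0 : 0 ≤ Q := gram_self_nonneg _ _ _
  have hnQ : n ^ 2 ≤ A * Q := hA s' hs' ξ
  set a := gram e (c s') (u s') ξ
  -- the error terms quadratic in `ξ`, for `s' - s` small
  have e1 : k / 2 * (A * (d ^ 2 * n ^ 2)) + d / 2 * (A * d ^ 2 * n ^ 2) ≤ 3 / 16 * d * Q := by
    have i1 : k * (A * (d ^ 2 * n ^ 2)) ≤ K * (A * (d ^ 2 * n ^ 2)) := by gcongr
    have i2 : d * (A * d ^ 2 * n ^ 2) ≤ 1 * (A * d ^ 2 * n ^ 2) := by gcongr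
    have i3 : (K * A + A) * d ^ 2 * n ^ 2 ≤ (K * A + A) * d ^ 2 * (A * Q) := by gcongr
    have i4 := mul_le_mul_of_nonneg_right hd2 (by positivity : 0 ≤ d * Q)
    have i5 : 0 ≤ d * Q := by positivity
    linarith only [i1, i2, i3, i4, i5]
  have e2 : ε / (2 * A ^ 2) * ‖w‖ ^ 2 ≤ ε / 2 * n ^ 2 := by
    calc ε / (2 * A ^ 2) * ‖w‖ ^ 2 ≤ ε / (2 * A ^ 2) * (A * n) ^ 2 := by gcongr
      _ = ε / 2 * n ^ 2 := by field_simp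
  have e3 : Cn * n ^ 3 ≤ ε / 2 * n ^ 2 := by
    have i1 : Cn * n ≤ ε / 2 := by
      rw [lt_div_iff₀ (by positivity)] at hξ4
      linarith
    calc Cn * n ^ 3 = Cn * n * n ^ 2 := by ring
      _ ≤ ε / 2 * n ^ 2 := by gcongr
  have e4 : k / 2 * (A * a ^ 2) ≤ K / 2 * A * a ^ 2 := by
    have : k / 2 * (A * a ^ 2) ≤ K / 2 * (A * a ^ 2) := by gcongr
    linarith only [this]
  have e5 := mul_le_mul_of_nonneg_left hww (by linarith : 0 ≤ k / 2)
  have e6 : 0 ≤ d * Q := by positivity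
  have e7 : Cn * n ^ 3 = A * n ^ 3 + d / 2 * (A / d ^ 2 * n ^ 3) + d / 2 * (C * (A / d * n) ^ 3) := by
    rw [hCn]; ring
  linarith only [h1, h2, h3, hF', e1, e2, e3, e4, e5, e6, e7]

end Barriers

/-! ### Independence of the chart -/

section Jets

variable {E F : Type*} [NormedAddCommGroup E] [NormedSpace ℝ E] [NormedAddCommGroup F]
  [NormedSpace ℝ F]

/-- Second order upper bounds can be composed with second order expansions. -/
theorem eventually_le_comp_of_expansion {f : E → ℝ} {r : ℝ} {ℓ : E →L[ℝ] ℝ}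
    {Q : E →L[ℝ] E →L[ℝ] ℝ}
    (hf : ∀ ε > 0, ∀ᶠ ξ in 𝓝 (0 : E), f ξ ≤ r + ℓ ξ + Q ξ ξ + ε * ‖ξ‖ ^ 2)
    {φ : F → E} {A : F →L[ℝ] E} {S : F →L[ℝ] F →L[ℝ] E}
    (hφ : ∀ ε > 0, ∀ᶠ w in 𝓝 (0 : F), ‖φ w - A w - S w w‖ ≤ ε * ‖w‖ ^ 2) {ε : ℝ} (hε : 0 < ε) :
    ∀ᶠ w in 𝓝 (0 : F), f (φ w) ≤ r + ℓ (A w + S w w) + Q (A w) (A w) + ε * ‖w‖ ^ 2 := by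
  set B := ‖A‖ + ‖S‖ + 1 with hB
  have hB1 : 1 ≤ B := by linarith [norm_nonneg A, norm_nonneg S]
  have hB0 : 0 < B := by linarith
  have hL0 : 0 < ‖ℓ‖ + 1 := by positivity
  have hQ0 : 0 < ‖Q‖ + 1 := by positivity
  set ε₁ := min 1 (ε / 3 / (‖ℓ‖ + 1)) with hε₁
  have hε₁0 : 0 < ε₁ := by positivity
  set ε₂ := ε / 3 / B ^ 2 with hε₂
  obtain ⟨δ, hδ, hball⟩ := Metric.eventually_nhds_iff.1 (hf ε₂ (by positivity))
  have hsmall : ∀ᶠ w in 𝓝 (0 : F), ‖w‖ < min (min 1 (δ / B)) (ε / 3 / (2 * (‖Q‖ + 1) * B ^ 2)) := by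
    have := Metric.ball_mem_nhds (0 : F)
      (by positivity : 0 < min (min 1 (δ / B)) (ε / 3 / (2 * (‖Q‖ + 1) * B ^ 2)))
    filter_upwards [this] with w hw using by simpa using hw
  filter_upwards [hsmall, hφ ε₁ hε₁0] with w hw h2
  simp only [lt_min_iff] at hw
  obtain ⟨⟨w1, w2⟩, w3⟩ := hw
  set n := ‖w‖ with hn
  have hn0 : 0 ≤ n := norm_nonneg _
  have hn2 : n ^ 2 ≤ n := by nlinarith
  set R := φ w - A w - S w w with hR
  have hA : ‖A w‖ ≤ ‖A‖ * n := A.le_opNorm w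
  have hS : ‖S w w‖ ≤ ‖S‖ * n ^ 2 := by
    have := norm_bilin_le S (a := w) (b := w) le_rfl le_rfl le_rfl
    linarith
  have hRn : ‖R‖ ≤ 1 * n ^ 2 := h2.trans (by gcongr; exact min_le_left _ _)
  have hAB : ‖A w‖ ≤ B * n := hA.trans (by
    gcongr
    linarith [norm_nonneg S])
  have hd : ‖φ w - A w‖ ≤ B * n ^ 2 := by
    have h3 : φ w - A w = S w w + R := by rw [hR]; abel
    rw [h3]
    refine (norm_add_le _ _).trans ?_
    have : 0 ≤ ‖A‖ * n ^ 2 := by positivity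
    rw [hB]
    linarith
  have hφB : ‖φ w‖ ≤ B * n := by
    have h3 : φ w = A w + (S w w + R) := by rw [hR]; abel
    rw [h3]
    refine (norm_add_le _ _).trans ?_
    have h4 := norm_add_le (S w w) R
    have h5 : ‖S‖ * n ^ 2 ≤ ‖S‖ * n := by gcongr
    rw [hB]
    linarith
  have h3 : dist (φ w) 0 < δ := by
    rw [dist_zero_right]
    rw [lt_div_iff₀ hB0] at w2
    linarith
  refine (hball h3).trans ?_
  have e1 : ℓ (φ w) ≤ ℓ (A w + S w w) + ε / 3 * n ^ 2 := by
    have h4 : ℓ (φ w) = ℓ (A w + S w w) + ℓ R := by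
      rw [← map_add]
      congr 1
      rw [hR]; abel
    have h5 : ℓ R ≤ ‖ℓ‖ * (ε₁ * n ^ 2) := (le_abs_self _).trans ((ℓ.le_opNorm R).trans (by gcongr))
    have h6 : ‖ℓ‖ * (ε₁ * n ^ 2) ≤ (‖ℓ‖ + 1) * (ε / 3 / (‖ℓ‖ + 1) * n ^ 2) := by
      gcongr
      · linarith
      · exact min_le_right _ _
    have h7 : (‖ℓ‖ + 1) * (ε / 3 / (‖ℓ‖ + 1) * n ^ 2) = ε / 3 * n ^ 2 := by field_simp
    linarith
  have e2 : Q (φ w) (φ w) ≤ Q (A w) (A w) + ε / 3 * n ^ 2 := by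
    have h4 : Q (φ w) (φ w) = Q (A w) (A w) + (Q (φ w) (φ w - A w) + Q (φ w - A w) (A w)) := by
      simp only [map_sub, _root_.sub_apply]; ring
    have h5 := (abs_le.1 (abs_bilin_le Q le_rfl hφB hd)).2
    have h6 := (abs_le.1 (abs_bilin_le Q le_rfl hd hAB)).2
    have h7 : 2 * (‖Q‖ + 1) * B ^ 2 * n * n ^ 2 ≤ ε / 3 * n ^ 2 := by
      gcongr
      rw [lt_div_iff₀ (by positivity)] at w3
      linarith
    have h8 : 0 ≤ B ^ 2 * n * n ^ 2 := by positivity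
    linarith
  have e3 : ε₂ * ‖φ w‖ ^ 2 ≤ ε / 3 * n ^ 2 := by
    calc ε₂ * ‖φ w‖ ^ 2 ≤ ε₂ * (B * n) ^ 2 := by gcongr
      _ = ε / 3 * n ^ 2 := by rw [hε₂]; field_simp
  linarith

theorem ContDiffOn.eventually_expansion [FiniteDimensional ℝ F] {φ : F → E} {U : Set F}
    (hU : IsOpen U) (hφ : ContDiffOn ℝ ∞ φ U) {y : F} (hy : y ∈ U) {ε : ℝ} (hε : 0 < ε) :
    ∀ᶠ w in 𝓝 (0 : F), ‖φ (y + w) - φ y - fderiv ℝ φ y w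
      - ((1 / 2 : ℝ) • fderiv ℝ (fderiv ℝ φ) y) w w‖ ≤ ε * ‖w‖ ^ 2 := by
  obtain ⟨C, hC, δ, hδ, hT⟩ := hφ.exists_taylor_bound hU isCompact_singleton
    (singleton_subset_iff.2 hy)
  have := Metric.ball_mem_nhds (0 : F) (by positivity : 0 < min δ (ε / C))
  filter_upwards [this] with w hw
  rw [Metric.mem_ball, dist_zero_right, lt_min_iff, lt_div_iff₀ hC] at hw
  obtain ⟨-, -, -, -, -, h⟩ := hT y rfl w hw.1.le
  refine h.trans ?_
  calc C * ‖w‖ ^ 3 = ‖w‖ * C * ‖w‖ ^ 2 := by ring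
    _ ≤ ε * ‖w‖ ^ 2 := by gcongr; exact hw.2.le

/-- The transformation law of the Christoffel symbols of the first kind. -/
theorem koszul_of_pullback {G : E → E →L[ℝ] E →L[ℝ] ℝ} {G' : F → F →L[ℝ] F →L[ℝ] ℝ} {U : Set E}
    (h : IsMetricOn G U) {σ : F → E} {y : F} (hσ : ContDiffAt ℝ ∞ σ y) (hy : σ y ∈ U)
    (hG : ∀ᶠ z in 𝓝 y, ∀ a b, G' z a b = G (σ z) (fderiv ℝ σ z a) (fderiv ℝ σ z b)) (a b l : F)
    (hG' : DifferentiableAt ℝ G' y) :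
    koszul G' y a b l = koszul G (σ y) (fderiv ℝ σ y a) (fderiv ℝ σ y b) (fderiv ℝ σ y l)
      + G (σ y) (fderiv ℝ (fderiv ℝ σ) y a b) (fderiv ℝ σ y l) := by
  have h1 : HasFDerivAt σ (fderiv ℝ σ y) y := (hσ.differentiableAt (by simp)).hasFDerivAt
  have h2 : HasFDerivAt (fderiv ℝ σ) (fderiv ℝ (fderiv ℝ σ) y) y :=
    ((hσ.fderiv_right (m := ∞) (by simp)).differentiableAt (by simp)).hasFDerivAt
  have hs : IsSymmSndFDerivAt ℝ σ y := hσ.isSymmSndFDerivAt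
    (by rw [minSmoothness_of_isRCLikeNormedField]; exact ENat.LEInfty.out)
  have key : ∀ a b l : F, fderiv ℝ G' y a b l
      = fderiv ℝ G (σ y) (fderiv ℝ σ y a) (fderiv ℝ σ y b) (fderiv ℝ σ y l)
        + G (σ y) (fderiv ℝ (fderiv ℝ σ) y a b) (fderiv ℝ σ y l)
        + G (σ y) (fderiv ℝ σ y b) (fderiv ℝ (fderiv ℝ σ) y a l) := by
    intro a b l
    have i1 := (hG'.hasFDerivAt.clm_apply (hasFDerivAt_const b y)).clm_apply (hasFDerivAt_const l y)
    have i2 := (((h.hasFDerivAt hy).comp y h1).clm_apply (h2.clm_apply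
      (hasFDerivAt_const b y))).clm_apply (h2.clm_apply (hasFDerivAt_const l y))
    have i3 : (fun z => G' z b l) =ᶠ[𝓝 y]
        fun z => G (σ z) (fderiv ℝ σ z b) (fderiv ℝ σ z l) := by
      filter_upwards [hG] with z hz using hz b l
    have i4 := congrArg (fun L => L a) (i1.unique (i2.congr_of_eventuallyEq i3))
    simp at i4
    linarith
  rw [koszul_apply, koszul_apply, key, key, key, hs.eq l a, hs.eq l b, hs.eq b a,
    h.symm _ hy (fderiv ℝ σ y b), h.symm _ hy (fderiv ℝ σ y a)]
  ring

end Jets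

section ChartChange

variable {M : Type*} [MetricSpace M] [ChartedSpace E3 M] [IsManifold (𝓡 3) ∞ M]
  [RiemannianBundle (fun x : M => TangentSpace (𝓡 3) x)]
  [IsContMDiffRiemannianBundle (𝓡 3) ∞ E3 (fun x : M => TangentSpace (𝓡 3) x)]
  [IsRiemannianManifold (𝓡 3) M]

theorem contDiffOn_transition {e e' : OpenPartialHomeomorph M E3}
    (he : e ∈ IsManifold.maximalAtlas (𝓡 3) ∞ M) (he' : e' ∈ IsManifold.maximalAtlas (𝓡 3) ∞ M) :
    ContDiffOn ℝ ∞ (e ∘ e'.symm) (e'.symm.trans e).source := by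
  have h1 : ContMDiffOn (𝓡 3) (𝓡 3) ∞ e'.symm (e'.symm.trans e).source :=
    (contMDiffOn_symm_of_mem_maximalAtlas he').mono fun z hz => hz.1
  exact ((contMDiffOn_of_mem_maximalAtlas he).comp h1 fun z hz => hz.2).contDiffOn

theorem chartVec_mfderiv_symm {e e' : OpenPartialHomeomorph M E3}
    (he : e ∈ IsManifold.maximalAtlas (𝓡 3) ∞ M) (he' : e' ∈ IsManifold.maximalAtlas (𝓡 3) ∞ M)
    {z : E3} (hz : z ∈ (e'.symm.trans e).source) (v : E3) :
    chartVec e (e'.symm z) (mfderiv (𝓡 3) (𝓡 3) e'.symm z v) = fderiv ℝ (e ∘ e'.symm) z v := by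
  have i1 := ((mdifferentiable_of_mem_maximalAtlas he').symm).mdifferentiableAt (x := z) hz.1
  have i2 := (mdifferentiable_of_mem_maximalAtlas he).mdifferentiableAt (x := e'.symm z) hz.2
  have i3 := mfderiv_comp z i2 i1
  rw [mfderiv_eq_fderiv] at i3
  exact (congrArg (fun T => T v) i3).symm

theorem gram_transition {e e' : OpenPartialHomeomorph M E3}
    (he : e ∈ IsManifold.maximalAtlas (𝓡 3) ∞ M) (he' : e' ∈ IsManifold.maximalAtlas (𝓡 3) ∞ M)
    {z : E3} (hz : z ∈ (e'.symm.trans e).source) (a b : E3) :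
    gram e' z a b = gram e ((e ∘ e'.symm) z) (fderiv ℝ (e ∘ e'.symm) z a)
      (fderiv ℝ (e ∘ e'.symm) z b) := by
  refine (gram_eq_inner e' z a b).trans ((gram_chartVec he hz.2 _ _).symm.trans ?_)
  exact congrArg₂ (fun v w : E3 => gram e (e (e'.symm z)) v w) (chartVec_mfderiv_symm he he' hz a)
    (chartVec_mfderiv_symm he he' hz b)

/-- The quadratic part of a barrier, as a bilinear form. -/
theorem exists_bilin_eq (e : OpenPartialHomeomorph M E3) (y ν : E3) (k C : ℝ) :
    ∃ Q : E3 →L[ℝ] E3 →L[ℝ] ℝ, ∀ ξ, Q ξ ξ = 1 / 2 * koszul (gram e) y ξ ξ ν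
      - k / 2 * gram e y ξ ξ + C * gram e y ν ξ ^ 2 := by
  refine ⟨(1 / 2 : ℝ) • ((ContinuousLinearMap.compL ℝ E3 (E3 →L[ℝ] ℝ) ℝ
    (ContinuousLinearMap.apply ℝ ℝ ν)).comp (koszul (gram e) y)) - (k / 2) • gram e y
    + C • (gram e y ν).smulRight (gram e y ν), fun ξ => ?_⟩
  change (1 / 2 : ℝ) * koszul (gram e) y ξ ξ ν - k / 2 * gram e y ξ ξ
    + C * (gram e y ν ξ * gram e y ν ξ) = _
  ring

theorem HasBarrier.hasPerpBarrier {e : OpenPartialHomeomorph M E3}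
    (he : e ∈ IsManifold.maximalAtlas (𝓡 3) ∞ M) {ρ : M → ℝ} {y ν : E3} (hy : y ∈ e.target)
    {r k : ℝ} (h : HasBarrier e ρ y ν r k) : HasPerpBarrier e ρ y ν r k := by
  obtain ⟨C, hC⟩ := h
  obtain ⟨Q, hQ⟩ := exists_bilin_eq e y ν k C
  intro ε hε
  have h1 := eventually_le_comp_of_expansion (f := fun ξ => ρ (e.symm (y + ξ))) (r := r)
    (ℓ := gram e y ν) (Q := Q) (fun ε hε => ?_)
    (φ := fun w => w - (1 / 2 : ℝ) • christ (gram e) y w w) (A := ContinuousLinearMap.id ℝ E3)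
    (S := -((1 / 2 : ℝ) • christ (gram e) y)) (fun ε hε => ?_) hε
  · filter_upwards [h1] with w hw hνw
    refine hw.trans (le_of_eq ?_)
    have hG := isMetricOn_gram he
    simp only [ContinuousLinearMap.id_apply, hQ, map_add, hνw, _root_.neg_apply, _root_.smul_apply,
      map_neg, map_smul, smul_eq_mul, hG.symm y hy ν (christ (gram e) y w w),
      hG.metric_christ hy]
    ring
  · filter_upwards [hC ε hε] with ξ hξ
    rw [hQ]
    linarith
  · refine .of_forall fun w => ?_
    have : w - (1 / 2 : ℝ) • christ (gram e) y w w - ContinuousLinearMap.id ℝ E3 w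
        - (-((1 / 2 : ℝ) • christ (gram e) y)) w w = 0 := by
      simp only [ContinuousLinearMap.id_apply, _root_.neg_apply, _root_.smul_apply]
      abel
    rw [this, norm_zero]
    positivity

/-- Barriers do not depend on the chart. -/
theorem HasBarrier.change_chart {e e' : OpenPartialHomeomorph M E3}
    (he : e ∈ IsManifold.maximalAtlas (𝓡 3) ∞ M) (he' : e' ∈ IsManifold.maximalAtlas (𝓡 3) ∞ M)
    {x : M} (hx : x ∈ e.source) (hx' : x ∈ e'.source) {ρ : M → ℝ} {ν : E3} {r k : ℝ}
    (h : HasBarrier e ρ (e x) (fderiv ℝ (e ∘ e'.symm) (e' x) ν) r k) :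
    HasBarrier e' ρ (e' x) ν r k := by
  obtain ⟨C, hC⟩ := h
  have hσs := contDiffOn_transition he he'
  have hgr := fun z (hz : z ∈ (e'.symm.trans e).source) a b => gram_transition he he' hz a b
  obtain ⟨σ, hσ⟩ : ∃ σ, σ = e ∘ e'.symm := ⟨_, rfl⟩
  rw [← hσ] at hC hσs hgr
  have hy : e' x ∈ (e'.symm.trans e).source := by
    refine ⟨e'.map_source hx', ?_⟩
    rw [mem_preimage]
    exact (congrArg (· ∈ e.source) (e'.left_inv hx')).mpr hx
  have hσy : σ (e' x) = e x := by simp [hσ, e'.left_inv hx']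
  have hopen := (e'.symm.trans e).open_source
  obtain ⟨Q, hQ⟩ := exists_bilin_eq e (e x) (fderiv ℝ σ (e' x) ν) k C
  refine ⟨C, fun ε hε => ?_⟩
  have h1 := eventually_le_comp_of_expansion (f := fun ξ => ρ (e.symm (e x + ξ))) (r := r)
    (ℓ := gram e (e x) (fderiv ℝ σ (e' x) ν)) (Q := Q) (fun ε hε => ?_)
    (φ := fun w => σ (e' x + w) - e x) (A := fderiv ℝ σ (e' x))
    (S := (1 / 2 : ℝ) • fderiv ℝ (fderiv ℝ σ) (e' x)) (fun ε hε => ?_) hε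
  · have h2 : ∀ᶠ w in 𝓝 (0 : E3), e' x + w ∈ (e'.symm.trans e).source := by
      have : Filter.Tendsto (fun w : E3 => e' x + w) (𝓝 0) (𝓝 (e' x)) := by
        have : Continuous fun w : E3 => e' x + w := by fun_prop
        simpa using this.tendsto 0
      exact this.eventually (hopen.mem_nhds hy)
    filter_upwards [h1, h2] with w hw hw2
    have e1 : e.symm (e x + (σ (e' x + w) - e x)) = e'.symm (e' x + w) := by
      rw [add_sub_cancel, hσ]
      exact e.left_inv hw2.2
    rw [e1] at hw
    refine hw.trans (le_of_eq ?_)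
    have hG := isMetricOn_gram he
    have hex : e x ∈ e.target := e.map_source hx
    have hev : ∀ᶠ z in 𝓝 (e' x), ∀ a b, gram e' z a b
        = gram e (σ z) (fderiv ℝ σ z a) (fderiv ℝ σ z b) := by
      filter_upwards [hopen.mem_nhds hy] with z hz a b using hgr z hz a b
    have e2 := koszul_of_pullback hG (hσs.contDiffAt (hopen.mem_nhds hy)) (by rwa [hσy]) hev w w ν
      ((isMetricOn_gram he').hasFDerivAt (e'.map_source hx')).differentiableAt
    rw [hσy] at e2
    have e3 := fun a b => hgr _ hy a b
    rw [hσy] at e3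
    rw [hQ, e2, e3, e3, map_add, _root_.smul_apply, _root_.smul_apply, map_smul, smul_eq_mul,
      hG.symm _ hex (fderiv ℝ σ (e' x) ν) (fderiv ℝ (fderiv ℝ σ) (e' x) w w)]
    ring
  · filter_upwards [hC ε hε] with ξ hξ
    rw [hQ]
    linarith
  · have := hσs.eventually_expansion hopen hy hε
    rwa [hσy] at this

end ChartChange

/-! ### Short geodesics -/

section GeodesicEquation

/-- Local flow of a vector field, staying in a prescribed neighbourhood. -/
theorem ContDiffAt.exists_integralCurve_mem_nhds {E : Type*} [NormedAddCommGroup E]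
    [NormedSpace ℝ E] [CompleteSpace E] {f : E → E} {x₀ : E} (hf : ContDiffAt ℝ 1 f x₀) {V : Set E}
    (hV : V ∈ 𝓝 x₀) :
    ∃ r > 0, ∃ ε > 0, ∀ x ∈ Metric.closedBall x₀ r, ∃ α : ℝ → E, α 0 = x ∧
      ∀ t ∈ Icc (-ε) ε, HasDerivWithinAt α (f (α t)) (Icc (-ε) ε) t ∧ α t ∈ V := by
  obtain ⟨ε, hε, a, r, L, K, hr, hpl⟩ := IsPicardLindelof.of_contDiffAt_one hf
  obtain ⟨α, hα, hcont⟩ := (hpl 0).exists_forall_mem_closedBall_eq_hasDerivWithinAt_continuousOn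
  simp only [zero_sub, zero_add] at hα hcont
  have hr' : (0 : ℝ) < r := hr
  have hmem : Metric.closedBall x₀ (r : ℝ) ×ˢ Icc (-ε) ε ∈ 𝓝 (x₀, (0 : ℝ)) :=
    prod_mem_nhds (Metric.closedBall_mem_nhds x₀ hr')
      (Icc_mem_nhds (by linarith) hε)
  have h0 : α (x₀, 0) = x₀ := (hα x₀ (Metric.mem_closedBall_self hr'.le)).1
  have h1 : α ⁻¹' V ∈ 𝓝 (x₀, (0 : ℝ)) :=
    (hcont.continuousAt hmem).preimage_mem_nhds (by rwa [h0])
  obtain ⟨ρ, hρ, hball⟩ := Metric.mem_nhds_iff.1 (Filter.inter_mem h1 hmem)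
  refine ⟨ρ / 2, by positivity, ρ / 2, by positivity, fun x hx => ⟨fun t => α (x, t), ?_, ?_⟩⟩
  · refine (hα x ?_).1
    have : (x, (0 : ℝ)) ∈ Metric.ball (x₀, (0 : ℝ)) ρ := by
      rw [Metric.mem_ball, Prod.dist_eq]
      rw [Metric.mem_closedBall] at hx
      exact max_lt (by linarith) (by simpa using hρ)
    exact (hball this).2.1
  · intro t ht
    have key : ∀ t ∈ Icc (-(ρ / 2)) (ρ / 2), (x, t) ∈ Metric.ball (x₀, (0 : ℝ)) ρ := fun t ht => by
      rw [Metric.mem_ball, Prod.dist_eq]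
      rw [Metric.mem_closedBall] at hx
      refine max_lt (by linarith) ?_
      rw [Real.dist_eq, sub_zero, abs_lt]
      constructor <;> linarith [ht.1, ht.2]
    have h2 := hball (key t ht)
    exact ⟨((hα x h2.2.1).2 t h2.2.2).mono fun s hs => (hball (key s hs)).2.2, h2.1⟩

variable {E : Type*} [NormedAddCommGroup E] [NormedSpace ℝ E] [FiniteDimensional ℝ E]

/-- The geodesics with small initial velocity `v` exist up to time one, with uniform estimates. -/
theorem IsMetricOn.exists_geodesic {G : E → E →L[ℝ] E →L[ℝ] ℝ} {U : Set E} (h : IsMetricOn G U)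
    {y₀ : E} (hy₀ : y₀ ∈ U) {V : Set E} (hV : V ∈ 𝓝 y₀) :
    ∃ r > 0, ∃ C ≥ 1, ∀ y, ‖y - y₀‖ ≤ r → ∀ v : E, ‖v‖ ≤ r → ∃ c u : ℝ → E, c 0 = y ∧
      IsGeodesicOn G U c u (Icc (-1) 1) ∧ ∀ t ∈ Icc (-1 : ℝ) 1, c t ∈ V ∧ ‖u t‖ ≤ C * ‖v‖ ∧
        ‖c t - y - t • v‖ ≤ C * ‖v‖ ^ 2 * t ^ 2 ∧
        ‖c t - y - t • v + (t ^ 2 / 2) • christ G y v v‖ ≤ C * ‖v‖ ^ 3 := by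
  have hch := h.contDiffOn_christ
  obtain ⟨δ₀, hδ₀, hball⟩ := Metric.nhds_basis_closedBall.mem_iff.1
    (Filter.inter_mem hV (h.mem_nhds hy₀))
  have hK : IsCompact (Metric.closedBall y₀ δ₀) := isCompact_closedBall _ _
  obtain ⟨C₁, hC₁, δ₁, hδ₁, hT⟩ := hch.exists_taylor_bound h.isOpen hK
    (fun y hy => (hball hy).2)
  obtain ⟨_, _, L, hL, hb⟩ := h.exists_bounds hK (fun y hy => (hball hy).2)
  set δ := min δ₀ (δ₁ / 2) with hδ
  have hδ0 : 0 < δ := by positivity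
  set f : E × E → E × E := fun p => (p.2, -christ G p.1 p.2 p.2) with hf
  have hfs : ContDiffAt ℝ 1 f (y₀, 0) := by
    have h1 : ContDiffAt ℝ 1 (fun p : E × E => christ G p.1) (y₀, 0) :=
      ((hch.contDiffAt (h.mem_nhds hy₀)).of_le (by simp)).comp (y₀, (0 : E)) contDiffAt_fst
    exact contDiffAt_snd.prodMk ((h1.clm_apply contDiffAt_snd).clm_apply contDiffAt_snd).neg
  obtain ⟨r, hr, ε, hε, hα⟩ := hfs.exists_integralCurve_mem_nhds
    (V := Metric.ball y₀ δ ×ˢ Metric.ball (0 : E) 1)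
    (prod_mem_nhds (Metric.ball_mem_nhds _ hδ0) (Metric.ball_mem_nhds _ one_pos))
  set B := max 1 (1 / r) with hB
  have hB1 : 1 ≤ B := le_max_left _ _
  have hBr : 1 / r ≤ B := le_max_right _ _
  refine ⟨min r (r * ε), by positivity,
    max (max B (L * B ^ 2)) (max 1 (C₁ * B ^ 3 + 2 * L ^ 2 * B ^ 3)), by simp, ?_⟩
  intro y hy v hv
  set n := ‖v‖ with hn
  have hn0 : 0 ≤ n := norm_nonneg _
  have hyr : ‖y - y₀‖ ≤ r := hy.trans (min_le_left _ _)
  have hnr : n ≤ r * ε := hv.trans (min_le_right _ _)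
  set lam := n / r with hlam
  have hlam0 : 0 ≤ lam := by positivity
  have hlamε : lam ≤ ε := by rw [hlam, div_le_iff₀ hr]; linarith
  have hlamB : lam ≤ B * n := by
    rw [hlam, div_eq_mul_one_div, mul_comm]
    gcongr
  have hx : (y, (r / n) • v) ∈ Metric.closedBall (y₀, (0 : E)) r := by
    rw [Metric.mem_closedBall, Prod.dist_eq, dist_eq_norm, dist_zero_right, norm_smul]
    refine max_le hyr ?_
    rw [Real.norm_of_nonneg (by positivity), ← hn]
    rcases hn0.eq_or_lt with h0 | h0
    · simp [← h0, hr.le]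
    · rw [div_mul_cancel₀ _ h0.ne']
  obtain ⟨α, hα0, hαd⟩ := hα _ hx
  have hmaps : MapsTo (fun t : ℝ => lam * t) (Icc (-1) 1) (Icc (-ε) ε) := fun t ht => by
    have h1 : |lam * t| ≤ ε := by
      rw [abs_mul, abs_of_nonneg hlam0]
      calc lam * |t| ≤ lam * 1 := by gcongr; exact abs_le.2 ht
        _ ≤ ε := by rwa [mul_one]
    exact abs_le.1 h1
  set c : ℝ → E := fun t => (α (lam * t)).1 with hc
  set u : ℝ → E := fun t => lam • (α (lam * t)).2 with hu
  have hc0 : c 0 = y := by simp [hc, hα0]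
  have hu0 : u 0 = v := by
    simp only [hu, mul_zero, hα0, smul_smul, hlam]
    rcases hn0.eq_or_lt with h0 | h0
    · have : v = 0 := norm_eq_zero.1 h0.symm
      simp [this]
    · rw [div_mul_div_cancel₀ hr.ne', div_self h0.ne', one_smul]
  have hmem : ∀ t ∈ Icc (-1 : ℝ) 1, c t ∈ Metric.ball y₀ δ ∧ ‖u t‖ ≤ B * n := fun t ht => by
    have h1 := (hαd _ (hmaps ht)).2
    refine ⟨h1.1, ?_⟩
    have h2 : ‖(α (lam * t)).2‖ ≤ 1 := by
      have := h1.2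
      rw [Metric.mem_ball, dist_zero_right] at this
      exact this.le
    simp only [hu, norm_smul, Real.norm_of_nonneg hlam0]
    calc lam * ‖(α (lam * t)).2‖ ≤ lam * 1 := by gcongr
      _ ≤ B * n := by rwa [mul_one]
  have hδδ₀ : Metric.ball y₀ δ ⊆ Metric.closedBall y₀ δ₀ :=
    Metric.ball_subset_closedBall.trans (Metric.closedBall_subset_closedBall (min_le_left _ _))
  have hcd : ∀ t ∈ Icc (-1 : ℝ) 1, HasDerivWithinAt c (u t) (Icc (-1) 1) t ∧
      HasDerivWithinAt u (-christ G (c t) (u t) (u t)) (Icc (-1) 1) t := fun t ht => by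
    have h1 := (hαd _ (hmaps ht)).1
    have h2 : HasDerivWithinAt (fun t : ℝ => lam * t) lam (Icc (-1) 1) t := by
      simpa using ((hasDerivAt_id t).const_mul lam).hasDerivWithinAt
    have h3 := h1.scomp t h2 hmaps
    have h4 : HasDerivWithinAt c (lam • (α (lam * t)).2) (Icc (-1) 1) t :=
      (ContinuousLinearMap.fst ℝ E E).hasFDerivAt.comp_hasDerivWithinAt t h3
    have h5 : HasDerivWithinAt (fun t => (α (lam * t)).2)
        (lam • -christ G (c t) (α (lam * t)).2 (α (lam * t)).2) (Icc (-1) 1) t :=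
      (ContinuousLinearMap.snd ℝ E E).hasFDerivAt.comp_hasDerivWithinAt t h3
    refine ⟨h4, (h5.const_smul lam).congr_deriv ?_⟩
    simp only [hu, map_smul, _root_.smul_apply, smul_neg, smul_smul]
  have h0mem : (0 : ℝ) ∈ Icc (-1 : ℝ) 1 := by norm_num
  have hcy : y ∈ Metric.ball y₀ δ := by rw [← hc0]; exact (hmem 0 h0mem).1
  have hyK := hδδ₀ hcy
  have hchb : ∀ z ∈ Metric.closedBall y₀ δ₀, ‖christ G z‖ ≤ L := fun z hz => (hb z hz).2.2.1
  have hvB : n ≤ B * n := le_mul_of_one_le_left hn0 hB1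
  -- integrate the geodesic equation
  have hconv : ∀ t ∈ Icc (-1 : ℝ) 1, Icc (-|t|) |t| ⊆ Icc (-1) 1 ∧ t ∈ Icc (-|t|) |t| ∧
      (0 : ℝ) ∈ Icc (-|t|) |t| := fun t ht => by
    have h1 : |t| ≤ 1 := abs_le.2 ht
    exact ⟨Icc_subset_Icc (by linarith) h1, ⟨neg_abs_le t, le_abs_self t⟩,
      ⟨by linarith [abs_nonneg t], abs_nonneg t⟩⟩
  have hut : ∀ t ∈ Icc (-1 : ℝ) 1, ‖u t - v‖ ≤ L * B ^ 2 * n ^ 2 * |t| := fun t ht => by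
    have h1 := (convex_Icc (-1 : ℝ) 1).norm_image_sub_le_of_norm_hasDerivWithin_le
      (C := L * B ^ 2 * n ^ 2) (fun s hs => (hcd s hs).2) (fun s hs => by
        have := norm_bilin_le (christ G (c s)) (hchb _ (hδδ₀ (hmem s hs).1)) (hmem s hs).2
          (hmem s hs).2
        rw [norm_neg]; linarith) h0mem ht
    simpa [hu0] using h1
  have hct : ∀ t ∈ Icc (-1 : ℝ) 1, ‖c t - y‖ ≤ B * n := fun t ht => by
    have h1 := (convex_Icc (-1 : ℝ) 1).norm_image_sub_le_of_norm_hasDerivWithin_le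
      (C := B * n) (fun s hs => (hcd s hs).1) (fun s hs => (hmem s hs).2) h0mem ht
    rw [hc0, sub_zero, Real.norm_eq_abs] at h1
    refine h1.trans (mul_le_of_le_one_right (by positivity) (abs_le.2 ht))
  have hsm : ∀ t : ℝ, HasDerivAt (fun t : ℝ => t • v) v t := fun t => by
    simpa using (hasDerivAt_id t).smul_const v
  have h2nd : ∀ t ∈ Icc (-1 : ℝ) 1, ‖c t - y - t • v‖ ≤ L * B ^ 2 * n ^ 2 * t ^ 2 := fun t ht => by
    obtain ⟨s1, s2, s3⟩ := hconv t ht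
    have h1 := (convex_Icc (-|t|) |t|).norm_image_sub_le_of_norm_hasDerivWithin_le
      (f := fun s => c s - y - s • v) (f' := fun s => u s - v)
      (C := L * B ^ 2 * n ^ 2 * |t|)
      (fun s hs => (((hcd s (s1 hs)).1.mono s1).sub_const y).sub (hsm s).hasDerivWithinAt)
      (fun s hs => (hut s (s1 hs)).trans (mul_le_mul_of_nonneg_left (abs_le.2 hs) (by positivity))) s3 s2
    simp only [hc0, sub_self, zero_smul, sub_zero, Real.norm_eq_abs] at h1
    rw [← sq_abs t]
    linarith
  have hchd : ∀ t ∈ Icc (-1 : ℝ) 1, ‖-christ G (c t) (u t) (u t) + christ G y v v‖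
      ≤ (C₁ * B ^ 3 + 2 * L ^ 2 * B ^ 3) * n ^ 3 := fun t ht => by
    obtain ⟨m1, m2⟩ := hmem t ht
    have k1 : ‖christ G (c t) - christ G y‖ ≤ C₁ * (B * n) := by
      have h1 : ‖c t - y‖ ≤ δ₁ := by
        have i1 : dist (c t) y ≤ dist (c t) y₀ + dist y y₀ := dist_triangle_right _ _ _
        have i2 : δ ≤ δ₁ / 2 := min_le_right _ _
        rw [Metric.mem_ball] at m1 hcy
        rw [← dist_eq_norm]
        linarith
      have h2 := (hT y hyK (c t - y) h1).2.2.2.1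
      rw [add_sub_cancel] at h2
      exact h2.trans (by gcongr; exact hct t ht)
    have k2 : ‖u t - v‖ ≤ L * B ^ 2 * n ^ 2 := (hut t ht).trans
      (mul_le_of_le_one_right (by positivity) (abs_le.2 ht))
    have e1 : -christ G (c t) (u t) (u t) + christ G y v v
        = -((christ G (c t) - christ G y) (u t) (u t) + (christ G y (u t - v) (u t)
          + christ G y v (u t - v))) := by
      simp only [map_sub, _root_.sub_apply]; abel
    rw [e1, norm_neg]
    refine (norm_add_le _ _).trans ?_
    have i1 := norm_bilin_le _ k1 m2 m2
    have i2 := norm_bilin_le _ (hchb y hyK) k2 m2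
    have i3 := norm_bilin_le _ (hchb y hyK) (hvB.trans' hn.ge) k2
    have i4 := norm_add_le (christ G y (u t - v) (u t)) (christ G y v (u t - v))
    linarith
  have hut3 : ∀ t ∈ Icc (-1 : ℝ) 1, ‖u t - v + t • christ G y v v‖
      ≤ (C₁ * B ^ 3 + 2 * L ^ 2 * B ^ 3) * n ^ 3 := fun t ht => by
    have h1 := (convex_Icc (-1 : ℝ) 1).norm_image_sub_le_of_norm_hasDerivWithin_le
      (f := fun s => u s - v + s • christ G y v v)
      (fun s hs => ((hcd s hs).2.sub_const v).add
        (((hasDerivAt_id s).smul_const (christ G y v v)).congr_deriv (one_smul _ _)).hasDerivWithinAt)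
      hchd h0mem ht
    simp only [hu0, sub_self, zero_smul, add_zero, sub_zero, Real.norm_eq_abs] at h1
    exact h1.trans (mul_le_of_le_one_right (by positivity) (abs_le.2 ht))
  have h3rd : ∀ t ∈ Icc (-1 : ℝ) 1, ‖c t - y - t • v + (t ^ 2 / 2) • christ G y v v‖
      ≤ (C₁ * B ^ 3 + 2 * L ^ 2 * B ^ 3) * n ^ 3 := fun t ht => by
    have hq : ∀ s : ℝ, HasDerivAt (fun s : ℝ => (s ^ 2 / 2) • christ G y v v)
        (s • christ G y v v) s := fun s => by
      have := (((hasDerivAt_id s).pow 2).div_const 2).smul_const (christ G y v v)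
      refine this.congr_deriv ?_
      congr 1
      simp
    have h1 := (convex_Icc (-1 : ℝ) 1).norm_image_sub_le_of_norm_hasDerivWithin_le
      (f := fun s => c s - y - s • v + (s ^ 2 / 2) • christ G y v v)
      (fun s hs => (((hcd s hs).1.sub_const y).sub (hsm s).hasDerivWithinAt).add
        (hq s).hasDerivWithinAt) hut3 h0mem ht
    simp only [hc0, sub_self, zero_smul, add_zero, sub_zero, Real.norm_eq_abs, ne_eq,
      OfNat.ofNat_ne_zero, not_false_eq_true, zero_pow, zero_div] at h1
    exact h1.trans (mul_le_of_le_one_right (by positivity) (abs_le.2 ht))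
  refine ⟨c, u, hc0, fun t ht => ⟨(hball (hδδ₀ (hmem t ht).1)).2, hcd t ht⟩, fun t ht =>
    ⟨(hball (hδδ₀ (hmem t ht).1)).1, (hmem t ht).2.trans ?_, (h2nd t ht).trans ?_,
      (h3rd t ht).trans ?_⟩⟩
  · gcongr
    exact (le_max_left _ _).trans (le_max_left _ _)
  · gcongr
    exact (le_max_right _ _).trans (le_max_left _ _)
  · gcongr
    exact (le_max_right _ _).trans (le_max_right _ _)

/-- Short geodesics are determined by their end points. -/
theorem IsMetricOn.exists_geodesic_unique {G : E → E →L[ℝ] E →L[ℝ] ℝ} {U : Set E}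
    (h : IsMetricOn G U) {y₀ : E} (hy₀ : y₀ ∈ U) :
    ∃ δ > 0, ∀ c₁ u₁ c₂ u₂ : ℝ → E, IsGeodesicOn G U c₁ u₁ (Icc 0 1) →
      IsGeodesicOn G U c₂ u₂ (Icc 0 1) →
      (∀ t ∈ Icc (0 : ℝ) 1, ‖c₁ t - y₀‖ ≤ δ ∧ ‖u₁ t‖ ≤ δ ∧ ‖c₂ t - y₀‖ ≤ δ ∧ ‖u₂ t‖ ≤ δ) →
      c₁ 0 = c₂ 0 → c₁ 1 = c₂ 1 → ∀ t ∈ Icc (0 : ℝ) 1, c₁ t = c₂ t := by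
  have hch := h.contDiffOn_christ
  obtain ⟨δ₀, hδ₀, hball⟩ := Metric.nhds_basis_closedBall.mem_iff.1 (h.mem_nhds hy₀)
  have hK : IsCompact (Metric.closedBall y₀ δ₀) := isCompact_closedBall _ _
  obtain ⟨C₁, hC₁, δ₁, hδ₁, hT⟩ := hch.exists_taylor_bound h.isOpen hK hball
  obtain ⟨_, _, L, hL, hb⟩ := h.exists_bounds hK hball
  refine ⟨min (min δ₀ (δ₁ / 2)) (min 1 (1 / (2 * (C₁ + 2 * L)))), by positivity, ?_⟩
  set δ := min (min δ₀ (δ₁ / 2)) (min 1 (1 / (2 * (C₁ + 2 * L)))) with hδ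
  have hδ0 : 0 < δ := by positivity
  have d1 : δ ≤ δ₀ := (min_le_left _ _).trans (min_le_left _ _)
  have d2 : δ ≤ δ₁ / 2 := (min_le_left _ _).trans (min_le_right _ _)
  have d3 : δ ≤ 1 := (min_le_right _ _).trans (min_le_left _ _)
  have d4 : δ * (C₁ + 2 * L) ≤ 1 / 2 := by
    have : δ ≤ 1 / (2 * (C₁ + 2 * L)) := (min_le_right _ _).trans (min_le_right _ _)
    rw [le_div_iff₀ (by positivity)] at this
    linarith
  intro c₁ u₁ c₂ u₂ h₁ h₂ hmem he0 he1
  have hwc : ContinuousOn (fun t => ‖u₁ t - u₂ t‖) (Icc (0 : ℝ) 1) := ContinuousOn.norm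
    (ContinuousOn.sub (fun t ht => (h₁ t ht).2.2.continuousWithinAt)
      (fun t ht => (h₂ t ht).2.2.continuousWithinAt))
  obtain ⟨t₀, ht₀, hmax⟩ := isCompact_Icc.exists_isMaxOn (nonempty_Icc.2 zero_le_one) hwc
  set N := ‖u₁ t₀ - u₂ t₀‖ with hN
  have hN' : ∀ t ∈ Icc (0 : ℝ) 1, ‖u₁ t - u₂ t‖ ≤ N := fun t ht => hmax ht
  have hN0 : 0 ≤ N := norm_nonneg _
  have z0 : (0 : ℝ) ∈ Icc (0 : ℝ) 1 := by norm_num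
  have z1 : (1 : ℝ) ∈ Icc (0 : ℝ) 1 := by norm_num
  have hd : ∀ t ∈ Icc (0 : ℝ) 1, ‖c₁ t - c₂ t‖ ≤ N := fun t ht => by
    have h1 := (convex_Icc (0 : ℝ) 1).norm_image_sub_le_of_norm_hasDerivWithin_le
      (f := fun s => c₁ s - c₂ s) (fun s hs => (h₁ s hs).2.1.sub (h₂ s hs).2.1) hN' z0 ht
    simp only [he0, sub_self, sub_zero, Real.norm_eq_abs] at h1
    exact h1.trans (mul_le_of_le_one_right hN0 (abs_le.2 ⟨by linarith [ht.1], ht.2⟩))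
  have hacc : ∀ t ∈ Icc (0 : ℝ) 1,
      ‖-christ G (c₁ t) (u₁ t) (u₁ t) - -christ G (c₂ t) (u₂ t) (u₂ t)‖ ≤ 1 / 2 * N := fun t ht => by
    obtain ⟨m1, m2, m3, m4⟩ := hmem t ht
    have k0 : c₂ t ∈ Metric.closedBall y₀ δ₀ := by
      rw [Metric.mem_closedBall, dist_eq_norm]; exact m3.trans d1
    have k1 : ‖christ G (c₁ t) - christ G (c₂ t)‖ ≤ C₁ * N := by
      have h1 : ‖c₁ t - c₂ t‖ ≤ δ₁ := by
        have := norm_sub_le (c₁ t - y₀) (c₂ t - y₀)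
        rw [sub_sub_sub_cancel_right] at this
        linarith
      have h2 := (hT (c₂ t) k0 (c₁ t - c₂ t) h1).2.2.2.1
      rw [add_sub_cancel] at h2
      exact h2.trans (by gcongr; exact hd t ht)
    have e1 : -christ G (c₁ t) (u₁ t) (u₁ t) - -christ G (c₂ t) (u₂ t) (u₂ t)
        = -((christ G (c₁ t) - christ G (c₂ t)) (u₁ t) (u₁ t)
          + (christ G (c₂ t) (u₁ t - u₂ t) (u₁ t) + christ G (c₂ t) (u₂ t) (u₁ t - u₂ t))) := by
      simp only [map_sub, _root_.sub_apply]; abel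
    rw [e1, norm_neg]
    refine (norm_add_le _ _).trans ?_
    have hb' := (hb _ k0).2.2.1
    have i1 := norm_bilin_le _ k1 m2 m2
    have i2 := norm_bilin_le _ hb' (hN' t ht) m2
    have i3 := norm_bilin_le _ hb' m4 (hN' t ht)
    have i4 := norm_add_le (christ G (c₂ t) (u₁ t - u₂ t) (u₁ t))
      (christ G (c₂ t) (u₂ t) (u₁ t - u₂ t))
    have i5 : C₁ * N * δ * δ ≤ C₁ * N * δ * 1 := by gcongr
    have i6 := mul_le_mul_of_nonneg_right d4 hN0
    linarith
  have hvel : ∀ t ∈ Icc (0 : ℝ) 1, ‖(u₁ t - u₂ t) - (u₁ t₀ - u₂ t₀)‖ ≤ 1 / 2 * N := fun t ht => by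
    have h1 := (convex_Icc (0 : ℝ) 1).norm_image_sub_le_of_norm_hasDerivWithin_le
      (f := fun s => u₁ s - u₂ s) (fun s hs => (h₁ s hs).2.2.sub (h₂ s hs).2.2) hacc ht₀ ht
    refine h1.trans (mul_le_of_le_one_right (by positivity) ?_)
    rw [Real.norm_eq_abs, abs_le]
    constructor <;> linarith [ht.1, ht.2, ht₀.1, ht₀.2]
  -- the difference of the geodesics vanishes at both ends, so its velocity cannot be almost constant
  have hN2 : N ≤ 1 / 2 * N := by
    have h1 := (convex_Icc (0 : ℝ) 1).norm_image_sub_le_of_norm_hasDerivWithin_le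
      (f := fun s => (c₁ s - c₂ s) - s • (u₁ t₀ - u₂ t₀))
      (fun s hs => ((h₁ s hs).2.1.sub (h₂ s hs).2.1).sub
        (((hasDerivAt_id s).smul_const (u₁ t₀ - u₂ t₀)).congr_deriv
          (one_smul _ _)).hasDerivWithinAt) hvel z0 z1
    simpa [he0, he1, hN, norm_sub_rev (u₂ t₀)] using h1
  have hN00 : N = 0 := by linarith
  intro t ht
  have := hd t ht
  rw [hN00] at this
  exact sub_eq_zero.1 (norm_le_zero_iff.1 this)

end GeodesicEquation

/-! ### Supporting hyperplanes of convex sets -/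

section SupportingHyperplane

variable {M : Type*} [MetricSpace M] [ChartedSpace E3 M] [IsManifold (𝓡 3) ∞ M]
  [RiemannianBundle (fun x : M => TangentSpace (𝓡 3) x)]
  [IsContMDiffRiemannianBundle (𝓡 3) ∞ E3 (fun x : M => TangentSpace (𝓡 3) x)]
  [IsRiemannianManifold (𝓡 3) M]

/-- The inverse of a chart is locally Lipschitz. -/
theorem exists_dist_symm_le {e : OpenPartialHomeomorph M E3}
    (he : e ∈ IsManifold.maximalAtlas (𝓡 3) ∞ M) {y₀ : E3} (hy₀ : y₀ ∈ e.target) :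
    ∃ δ > 0, ∃ L > 0, ∀ y y', ‖y - y₀‖ ≤ δ → ‖y' - y₀‖ ≤ δ →
      dist (e.symm y) (e.symm y') ≤ L * ‖y' - y‖ := by
  have hG := isMetricOn_gram he
  obtain ⟨δ, hδ, hball⟩ := Metric.nhds_basis_closedBall.mem_iff.1 (hG.mem_nhds hy₀)
  obtain ⟨_, _, C, hC, hb⟩ := hG.exists_bounds (isCompact_closedBall y₀ δ) hball
  refine ⟨δ, hδ, √C, by positivity, fun y y' hy hy' => ?_⟩
  have hmem : ∀ t ∈ Icc (0 : ℝ) 1, y + t • (y' - y) ∈ Metric.closedBall y₀ δ := fun t ht =>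
    (convex_closedBall y₀ δ).add_smul_sub_mem (by rwa [Metric.mem_closedBall, dist_eq_norm])
      (by rwa [Metric.mem_closedBall, dist_eq_norm]) ht
  have h1 := dist_le_of_chart_curve he zero_le_one (c := fun t : ℝ => y + t • (y' - y))
    (c' := fun _ => y' - y) (Ψ := fun t => t * (√C * ‖y' - y‖)) (Ψ' := fun _ => √C * ‖y' - y‖)
    (fun t _ => by
      simpa using (((hasDerivAt_id t).smul_const (y' - y)).const_add y).hasDerivWithinAt)
    continuousOn_const (fun t ht => hball (hmem t ht))
    (fun t _ => by simpa using ((hasDerivAt_id t).mul_const (√C * ‖y' - y‖)).hasDerivWithinAt)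
    (fun t ht => by
      have h2 := (abs_le.1 (abs_bilin_le (gram e (y + t • (y' - y))) (a := y' - y) (b := y' - y)
        (hb _ (hmem t ht)).2.1 le_rfl le_rfl)).2
      calc √(gram e (y + t • (y' - y)) (y' - y) (y' - y)) ≤ √(C * ‖y' - y‖ ^ 2) :=
            Real.sqrt_le_sqrt (by linarith)
        _ = √C * ‖y' - y‖ := by rw [Real.sqrt_mul hC.le, Real.sqrt_sq (norm_nonneg _)])
  simpa using h1

/-- In a chart, the minimal geodesics joining nearby points of a convex set are short solutions of
the geodesic equation. -/
theorem GeodesicallyConvex.exists_geodesic {D : Set M} (hconv : GeodesicallyConvex D)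
    {e : OpenPartialHomeomorph M E3} (he : e ∈ IsManifold.maximalAtlas (𝓡 3) ∞ M) {p : M}
    (hp : p ∈ e.source) {δ : ℝ} (hδ : 0 < δ) :
    ∃ r > 0, ∀ x₁ ∈ D, ∀ x₂ ∈ D, dist x₁ p < r → dist x₂ p < r → ∃ g w : ℝ → E3,
      IsGeodesicOn (gram e) e.target g w (Icc 0 1) ∧ g 0 = e x₁ ∧ g 1 = e x₂ ∧
      ∀ t ∈ Icc (0 : ℝ) 1, e.symm (g t) ∈ D ∧ ‖g t - e p‖ ≤ δ ∧ ‖w t‖ ≤ δ := by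
  have hG := isMetricOn_gram he
  have hy₀ := e.map_source hp
  obtain ⟨δ₀, hδ₀, hball⟩ := Metric.nhds_basis_closedBall.mem_iff.1 (hG.mem_nhds hy₀)
  obtain ⟨m, hm, _, _, hb⟩ := hG.exists_bounds (isCompact_closedBall (e p) δ₀) hball
  have hnear : ∀ᶠ x in 𝓝 p, x ∈ e.source ∧ e x ∈ Metric.closedBall (e p) (min δ δ₀) :=
    (e.open_source.eventually_mem hp).and ((e.continuousAt hp).eventually
      (Metric.closedBall_mem_nhds _ (by positivity)))
  obtain ⟨r, hr, hrball⟩ := Metric.eventually_nhds_iff_ball.1 hnear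
  refine ⟨min (r / 3) (δ * √m / 2), by positivity, fun x₁ h₁ x₂ h₂ hd₁ hd₂ => ?_⟩
  obtain ⟨γ, hγs, hγ0, hγ1, hγd, hγD⟩ := hconv x₁ h₁ x₂ h₂
  set d := dist x₁ x₂ with hd
  have hd0 : 0 ≤ d := dist_nonneg
  have hdr : d < 2 * min (r / 3) (δ * √m / 2) := by
    have := dist_triangle_right x₁ x₂ p
    linarith
  have hd1 : d < 2 * (r / 3) := hdr.trans_le (by gcongr; exact min_le_left _ _)
  have hd2 : d < δ * √m := by
    have : 2 * min (r / 3) (δ * √m / 2) ≤ 2 * (δ * √m / 2) := by gcongr; exact min_le_right _ _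
    linarith
  have hγr : ∀ s ∈ Icc 0 d, γ s ∈ e.source ∧ e (γ s) ∈ Metric.closedBall (e p) (min δ δ₀) := by
    intro s hs
    refine hrball _ ?_
    have h3 := hγd s hs 0 (left_mem_Icc.2 hd0)
    rw [hγ0, sub_zero, abs_of_nonneg hs.1] at h3
    have h4 := dist_triangle (γ s) x₁ p
    have h5 : min (r / 3) (δ * √m / 2) ≤ r / 3 := min_le_left _ _
    rw [Metric.mem_ball]
    linarith [hs.2]
  have hmaps : MapsTo (fun t : ℝ => d * t) (Icc 0 1) (Icc 0 d) := fun t ht =>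
    ⟨mul_nonneg hd0 ht.1, mul_le_of_le_one_right hd0 ht.2⟩
  -- the velocity, also if the end points coincide
  obtain ⟨u, hu⟩ : ∃ u : ℝ → E3, ∀ t ∈ Icc (0 : ℝ) 1,
      HasDerivWithinAt (fun t => e (γ (d * t))) (d • u (d * t)) (Icc 0 1) t ∧
      HasDerivWithinAt (fun t => d • u (d * t))
        (-christ (gram e) (e (γ (d * t))) (d • u (d * t)) (d • u (d * t))) (Icc 0 1) t ∧
      ‖d • u (d * t)‖ ≤ δ := by
    rcases hd0.eq_or_lt with h0 | h0
    · refine ⟨fun _ => 0, fun t _ => ?_⟩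
      simp only [← h0, zero_mul, zero_smul, map_zero, neg_zero, norm_zero]
      exact ⟨hasDerivWithinAt_const _ _ _, hasDerivWithinAt_const _ _ _, hδ.le⟩
    obtain ⟨u, hu, hone⟩ := isGeodesicOn_of_isometric he h0 hγs hγd fun s hs => (hγr s hs).1
    refine ⟨u, fun t ht => ?_⟩
    have hs := hmaps ht
    have h2 : HasDerivWithinAt (fun t : ℝ => d * t) d (Icc 0 1) t := by
      simpa using ((hasDerivAt_id t).const_mul d).hasDerivWithinAt
    refine ⟨(hu _ hs).2.1.scomp t h2 hmaps,
      (((hu _ hs).2.2.scomp t h2 hmaps).const_smul d).congr_deriv ?_, ?_⟩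
    · simp only [map_smul, _root_.smul_apply, smul_neg, smul_smul, Function.comp]
    · rw [norm_smul, Real.norm_of_nonneg hd0]
      have h3 := (hb _ (Metric.closedBall_subset_closedBall (min_le_right _ _)
        (hγr _ hs).2)).1 (u (d * t))
      rw [hone _ hs] at h3
      have h4 : √m * ‖u (d * t)‖ ≤ 1 := by
        have h5 : √(m * ‖u (d * t)‖ ^ 2) ≤ √1 := Real.sqrt_le_sqrt h3
        rwa [Real.sqrt_mul hm.le, Real.sqrt_sq (norm_nonneg _), Real.sqrt_one] at h5
      calc d * ‖u (d * t)‖ ≤ δ * √m * ‖u (d * t)‖ := by gcongr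
        _ = δ * (√m * ‖u (d * t)‖) := by ring
        _ ≤ δ * 1 := by gcongr
        _ = δ := mul_one δ
  refine ⟨fun t => e (γ (d * t)), fun t => d • u (d * t), fun t ht => ?_, ?_, ?_, fun t ht => ?_⟩
  · exact ⟨e.map_source (hγr _ (hmaps ht)).1, (hu t ht).1, (hu t ht).2.1⟩
  · simp only [mul_zero, hγ0]
  · simp only [mul_one, hγ1]
  · have h3 := hγr _ (hmaps ht)
    refine ⟨?_, ?_, (hu t ht).2.2⟩
    · simp only [e.left_inv h3.1]
      exact hγD _ (hmaps ht)
    · rw [← dist_eq_norm]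
      exact (Metric.mem_closedBall.1 h3.2).trans (min_le_left _ _)

/-- A convex set contains the short geodesics between its points. -/
theorem GeodesicallyConvex.exists_geodesic_through {D : Set M} (hconv : GeodesicallyConvex D)
    {e : OpenPartialHomeomorph M E3} (he : e ∈ IsManifold.maximalAtlas (𝓡 3) ∞ M) {p : M}
    (hp : p ∈ e.source) :
    ∃ r > 0, ∃ C ≥ 1, ∀ y, ‖y - e p‖ ≤ r → ∀ v, ‖v‖ ≤ r → ∃ c : ℝ → E3,
      (∀ t ∈ Icc (-1 : ℝ) 1, ‖c t - y - t • v‖ ≤ C * ‖v‖ ^ 2 * t ^ 2 ∧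
        ‖c t - y - t • v + (t ^ 2 / 2) • christ (gram e) y v v‖ ≤ C * ‖v‖ ^ 3) ∧
      ∀ θ ∈ Icc (0 : ℝ) 1, e.symm (c (-θ)) ∈ D → e.symm (c 1) ∈ D → e.symm y ∈ D := by
  have hG := isMetricOn_gram he
  have hy₀ := e.map_source hp
  obtain ⟨δ, hδ, huniq⟩ := hG.exists_geodesic_unique hy₀
  obtain ⟨r₁, hr₁, hgeo⟩ := hconv.exists_geodesic he hp hδ
  have hV : Metric.closedBall (e p) δ ∩ (e.target ∩ e.symm ⁻¹' Metric.ball p r₁) ∈ 𝓝 (e p) := by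
    refine Filter.inter_mem (Metric.closedBall_mem_nhds _ hδ)
      (Filter.inter_mem (hG.mem_nhds hy₀) ?_)
    refine (e.symm.continuousAt hy₀).preimage_mem_nhds ?_
    rw [e.left_inv hp]
    exact Metric.ball_mem_nhds _ hr₁
  obtain ⟨r, hr, C, hC, hex⟩ := hG.exists_geodesic hy₀ hV
  refine ⟨min r (δ / (2 * C)), by positivity, C, hC, fun y hy v hv => ?_⟩
  obtain ⟨c, u, hc0, hcg, hct⟩ := hex y (hy.trans (min_le_left _ _)) v (hv.trans (min_le_left _ _))
  refine ⟨c, fun t ht => (hct t ht).2.2, fun θ hθ h1 h2 => ?_⟩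
  have hθ' : -θ ∈ Icc (-1 : ℝ) 1 := ⟨by linarith [hθ.2], by linarith [hθ.1]⟩
  have h1' : (1 : ℝ) ∈ Icc (-1 : ℝ) 1 := by norm_num
  obtain ⟨⟨-, q1, q2⟩, -⟩ := hct _ hθ'
  obtain ⟨⟨-, q3, q4⟩, -⟩ := hct _ h1'
  obtain ⟨g, w, hg, hg0, hg1, hgD⟩ := hgeo _ h1 _ h2 q2 q4
  rw [e.right_inv q1] at hg0
  rw [e.right_inv q3] at hg1
  have hθ1 : 0 < 1 + θ := by linarith [hθ.1]
  set φ : ℝ → ℝ := fun t => -θ + (1 + θ) * t with hφ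
  have hmaps : MapsTo φ (Icc 0 1) (Icc (-1) 1) := fun t ht => by
    constructor <;> simp only [hφ] <;> nlinarith [ht.1, ht.2, hθ.1, hθ.2]
  have hφd : ∀ t, HasDerivWithinAt φ (1 + θ) (Icc 0 1) t := fun t => by
    exact ((((hasDerivAt_id t).const_mul (1 + θ)).const_add (-θ)).congr_deriv
      (mul_one _)).hasDerivWithinAt
  have hv2 : C * ‖v‖ ≤ δ / 2 := by
    have := hv.trans (min_le_right _ _)
    rw [le_div_iff₀ (by positivity)] at this
    linarith
  have key := huniq (c ∘ φ) (fun t => (1 + θ) • u (φ t)) g w (fun t ht => ?_) hg (fun t ht => ?_)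
    (by simp [hφ, hg0]) (by simp [hφ, hg1]) (θ / (1 + θ))
    ⟨div_nonneg hθ.1 hθ1.le, by rw [div_le_one hθ1]; linarith⟩
  · have h3 : φ (θ / (1 + θ)) = 0 := by
      simp only [hφ]
      field_simp
      ring
    rw [Function.comp, h3, hc0] at key
    rw [key]
    exact (hgD _ ⟨div_nonneg hθ.1 hθ1.le, by rw [div_le_one hθ1]; linarith⟩).1
  · obtain ⟨g1, g2, g3⟩ := hcg _ (hmaps ht)
    refine ⟨g1, g2.scomp t (hφd t) hmaps, ((g3.scomp t (hφd t) hmaps).const_smul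
      (1 + θ)).congr_deriv ?_⟩
    simp only [map_smul, _root_.smul_apply, smul_neg, smul_smul, Function.comp]
  · obtain ⟨⟨k1, -⟩, k2, -⟩ := hct _ (hmaps ht)
    refine ⟨by rwa [Metric.mem_closedBall, dist_eq_norm] at k1, ?_, (hgD t ht).2⟩
    rw [norm_smul, Real.norm_of_nonneg hθ1.le]
    calc (1 + θ) * ‖u (φ t)‖ ≤ 2 * (C * ‖v‖) := by
          gcongr
          linarith [hθ.2]
      _ ≤ δ := by linarith

/-- If a ball is contained in a set and touches its boundary at the initial point of a radius, then
the points close to that point and sufficiently far on the inner side belong to the set. -/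
theorem exists_mem_of_ball_subset {D : Set M} {γ : ℝ → M} {l : ℝ} (hl : 0 < l)
    (hγ : ContMDiffOn 𝓘(ℝ, ℝ) (𝓡 3) ∞ γ (Icc 0 l))
    (hd : ∀ s ∈ Icc 0 l, ∀ t ∈ Icc 0 l, dist (γ s) (γ t) = |s - t|)
    (hD : Metric.ball (γ l) l ⊆ D) {e : OpenPartialHomeomorph M E3}
    (he : e ∈ IsManifold.maximalAtlas (𝓡 3) ∞ M) (hp : γ 0 ∈ e.source) {ν : E3}
    (hν : HasDerivWithinAt (e ∘ γ) ν (Icc 0 l) 0) :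
    gram e (e (γ 0)) ν ν = 1 ∧ ∃ δ > 0, ∃ C > 0, ∀ ξ : E3, ‖ξ‖ ≤ δ →
      C * ‖ξ‖ ^ 2 < gram e (e (γ 0)) ν ξ → e.symm (e (γ 0) + ξ) ∈ D := by
  have hγc : ContinuousWithinAt γ (Icc 0 l) 0 := (hγ 0 (left_mem_Icc.2 hl.le)).continuousWithinAt
  obtain ⟨q', q, hq', hsub, hsrc, h0⟩ := exists_Icc_subset_of_mem_nhdsWithin hl
    (left_mem_Icc.2 hl.le) (hγc.preimage_mem_nhdsWithin (e.open_source.mem_nhds hp))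
  have hq0 : q' = 0 := le_antisymm h0.1 (hsub (left_mem_Icc.2 hq'.le)).1
  subst hq0
  have hql : q ∈ Icc 0 l := hsub (right_mem_Icc.2 hq'.le)
  obtain ⟨u, hu, hone⟩ := isGeodesicOn_of_isometric he hq' (hγ.mono hsub)
    (fun s hs t ht => hd s (hsub hs) t (hsub ht)) hsrc
  have hu0 : u 0 = ν := (uniqueDiffOn_Icc hq' 0 h0).eq_deriv _ (hu 0 h0).2.1 (hν.mono hsub)
  obtain ⟨C, hC, δ, hδ, hvar⟩ := exists_dist_le_first_variation he hu hone
  set B := max 1 (1 / q) with hB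
  have hB1 : 1 ≤ B := le_max_left _ _
  refine ⟨hu0 ▸ hone 0 h0, δ / B, by positivity, q * (C * B ^ 2), by positivity, fun ξ hξ hξν => ?_⟩
  rw [le_div_iff₀ (by positivity)] at hξ
  have h1 := hvar 0 h0 q (right_mem_Icc.2 hq'.le) hq'.le (fun σ => ξ - (σ / q) • ξ)
    (fun _ => -((1 / q) • ξ)) (B * ‖ξ‖) (by linarith) (fun σ hσ => ⟨?_, ?_, ?_⟩) continuousOn_const
  · have e1 : ξ - (q / q) • ξ = 0 := by rw [div_self hq'.ne', one_smul, sub_self]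
    have e2 : ξ - ((0 : ℝ) / q) • ξ = ξ := by simp
    simp only [e1, e2, map_zero, add_zero, hu0, Function.comp] at h1
    rw [e.left_inv (hsrc (right_mem_Icc.2 hq'.le))] at h1
    have h2 := hd q hql l (right_mem_Icc.2 hl.le)
    rw [abs_sub_comm, abs_of_nonneg (sub_nonneg.2 hql.2)] at h2
    refine hD ?_
    rw [Metric.mem_ball]
    have h3 := dist_triangle (e.symm (e (γ 0) + ξ)) (γ q) (γ l)
    linarith
  · have := (((hasDerivAt_id σ).div_const q).smul_const ξ).const_sub ξ
    exact this.hasDerivWithinAt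
  · have h2 : ξ - (σ / q) • ξ = (1 - σ / q) • ξ := by rw [sub_smul, one_smul]
    have h3 : σ / q ≤ 1 := by rw [div_le_one hq']; exact hσ.2
    rw [h2, norm_smul, Real.norm_of_nonneg (by linarith)]
    gcongr
    have : 0 ≤ σ / q := div_nonneg hσ.1 hq'.le
    linarith
  · rw [norm_neg, norm_smul, Real.norm_of_nonneg (by positivity)]
    gcongr
    exact le_max_right _ _

end SupportingHyperplane

section SupportingHyperplane

variable {M : Type*} [MetricSpace M] [ChartedSpace E3 M] [IsManifold (𝓡 3) ∞ M]
  [RiemannianBundle (fun x : M => TangentSpace (𝓡 3) x)]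
  [IsContMDiffRiemannianBundle (𝓡 3) ∞ E3 (fun x : M => TangentSpace (𝓡 3) x)]
  [IsRiemannianManifold (𝓡 3) M]

set_option maxHeartbeats 1600000 in
/-- A convex set has a supporting hyperplane, to second order, at the initial point `p` of a radius
of an inner ball touching the boundary. If the set contained a ball of radius `ε |w|²` around a point
at distance `|w|` from `p` in a direction `w` tangent to the ball, then the geodesics from this ball
through the points near `p` would enter the inner ball, so that `p` would be an interior point. -/
theorem GeodesicallyConvex.hasPerpBarrier {D : Set M} (hconv : GeodesicallyConvex D)
    {γ : ℝ → M} {l : ℝ} (hl : 0 < l) (hγ : ContMDiffOn 𝓘(ℝ, ℝ) (𝓡 3) ∞ γ (Icc 0 l))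
    (hd : ∀ s ∈ Icc 0 l, ∀ t ∈ Icc 0 l, dist (γ s) (γ t) = |s - t|)
    (hD : Metric.ball (γ l) l ⊆ D) (hp0 : γ 0 ∉ interior D) {e : OpenPartialHomeomorph M E3}
    (he : e ∈ IsManifold.maximalAtlas (𝓡 3) ∞ M) (hp : γ 0 ∈ e.source) {ν : E3}
    (hν : HasDerivWithinAt (e ∘ γ) ν (Icc 0 l) 0) :
    HasPerpBarrier e (fun x => Metric.infDist x (interior D)ᶜ) (e (γ 0)) ν 0 0 := by
  have hG := isMetricOn_gram he
  have hy₀ : e (γ 0) ∈ e.target := e.map_source hp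
  obtain ⟨hνν, δ₁, hδ₁, C₁, hC₁, hball⟩ := exists_mem_of_ball_subset hl hγ hd hD he hp hν
  obtain ⟨δ₂, hδ₂, L, hL, hlip⟩ := exists_dist_symm_le he hy₀
  obtain ⟨r, hr, C, hC1, hgeo⟩ := hconv.exists_geodesic_through he hp
  set y₀ := e (γ 0) with hy₀def
  intro ε hε
  set B := ‖gram e y₀ ν‖ with hB
  have hB0 : 0 ≤ B := norm_nonneg _
  set b := ‖ν‖ with hb
  have hb0 : 0 ≤ b := norm_nonneg _
  set K := ‖christ (gram e) y₀‖ with hK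
  have hK0 : 0 ≤ K := norm_nonneg _
  set κ := ε / (4 * L * (b + 1)) with hκ
  have hκ0 : 0 < κ := by positivity
  set θ := min 1 (κ / (2 * (4 * B * C + 18 * C₁))) with hθ
  have hθ0 : 0 < θ := by positivity
  have hθ1 : θ ≤ 1 := min_le_left _ _
  have hθκ : θ * (4 * B * C + 18 * C₁) ≤ κ / 2 := by
    have : θ ≤ κ / (2 * (4 * B * C + 18 * C₁)) := min_le_right _ _
    rw [le_div_iff₀ (by positivity)] at this
    linarith
  -- a bound for `|w|`
  set n₀ := min (min 1 (1 / (κ * b + 1))) (min (min (r / 2) (1 / (4 * C)))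
    (min (min (δ₁ / 6) (δ₂ / (1 + K + 1 + ε / L))) (ε / (4 * L) / (8 * C + 2 * K * κ * b))))
    with hn₀
  have hsmall : ∀ᶠ w in 𝓝 (0 : E3), ‖w‖ < n₀ := by
    filter_upwards [Metric.ball_mem_nhds (0 : E3) (by positivity : 0 < n₀)] with w hw
      using by simpa using hw
  filter_upwards [hsmall] with w hw hνw
  rw [hn₀] at hw
  simp only [lt_min_iff] at hw
  obtain ⟨⟨w1, w2⟩, ⟨w3, w4⟩, ⟨w5, w6⟩, w7⟩ := hw
  rw [lt_div_iff₀ (by positivity)] at w2 w4 w6 w7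
  by_contra! hcon
  simp only [zero_div, zero_mul, sub_zero, zero_add] at hcon
  set n := ‖w‖ with hn
  have hn0' : 0 ≤ n := norm_nonneg _
  have hn0 : 0 < n := by
    rcases hn0'.eq_or_lt with h0 | h0
    · exfalso
      have : w = 0 := norm_eq_zero.1 h0.symm
      simp only [this, map_zero, smul_zero, sub_zero, add_zero, hy₀def, e.left_inv hp] at hcon
      have h2 : Metric.infDist (γ 0) (interior D)ᶜ = 0 := Metric.infDist_zero_of_mem hp0
      rw [h2, ← h0] at hcon
      simp at hcon
    · exact h0
  have hn2 : n ^ 2 ≤ n := by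
    have := mul_le_of_le_one_left hn0' w1.le
    linarith only [this]
  set P := w - (1 / 2 : ℝ) • christ (gram e) y₀ w w with hP
  have hcww : ‖christ (gram e) y₀ w w‖ ≤ K * n ^ 2 := by
    have := norm_bilin_le (christ (gram e) y₀) (a := w) (b := w) le_rfl le_rfl le_rfl
    linarith
  have hPn : ‖P‖ ≤ (1 + K) * n := by
    refine (norm_sub_le _ _).trans ?_
    rw [norm_smul, Real.norm_of_nonneg (by norm_num)]
    have : K * n ^ 2 ≤ K * n := by gcongr
    linarith [norm_nonneg (christ (gram e) y₀ w w)]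
  -- the points close to the point with coordinates `y₀ + P` belong to `D`
  have hfar : ∀ y : E3, ‖y - (y₀ + P)‖ ≤ ε / (2 * L) * n ^ 2 → e.symm y ∈ D := by
    intro y hy
    by_contra hyD
    have h2 : ε / L * n ^ 2 ≤ ε / L * n := by gcongr
    have h3 : ε / (2 * L) * n ^ 2 = (ε / L * n ^ 2) / 2 := by field_simp
    have h4 : 0 ≤ ε / L * n ^ 2 := by positivity
    have h5 := hlip (y₀ + P) y (by
      rw [add_sub_cancel_left]
      linarith) (by
      have h6 : y - y₀ = P + (y - (y₀ + P)) := by abel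
      rw [h6]
      refine (norm_add_le _ _).trans ?_
      linarith)
    have h10 : e.symm y ∈ (interior D)ᶜ := fun hi => hyD (interior_subset hi)
    have h6 := (Metric.infDist_le_dist_of_mem (x := e.symm (y₀ + P)) h10).trans h5
    have h7 : L * ‖y - (y₀ + P)‖ ≤ L * (ε / (2 * L) * n ^ 2) := by gcongr
    have h8 : L * (ε / (2 * L) * n ^ 2) = ε * n ^ 2 / 2 := by field_simp
    have h9 : 0 < ε * n ^ 2 := by positivity
    linarith
  set v := w - (κ * n ^ 2) • ν with hv
  have hκb : κ * n ^ 2 * b ≤ n := by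
    have : n * (κ * b + 1) * n ≤ 1 * n := by gcongr
    linarith only [this, hn2, sq_nonneg n]
  have hvw : ‖v - w‖ ≤ κ * b * n ^ 2 := by
    rw [hv, sub_sub_cancel_left, norm_neg, norm_smul, Real.norm_of_nonneg (by positivity)]
    exact le_of_eq (by ring)
  have hvn : ‖v‖ ≤ 2 * n := by
    have h1 : v = w + (v - w) := by abel
    rw [h1]
    refine (norm_add_le _ _).trans ?_
    linarith
  have hcv : ‖christ (gram e) y₀ v v - christ (gram e) y₀ w w‖ ≤ 3 * K * κ * b * n ^ 3 := by
    have h1 : christ (gram e) y₀ v v - christ (gram e) y₀ w w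
        = christ (gram e) y₀ v (v - w) + christ (gram e) y₀ (v - w) w := by
      simp only [map_sub, _root_.sub_apply]; abel
    rw [h1]
    refine (norm_add_le _ _).trans ?_
    have h2 := norm_bilin_le (christ (gram e) y₀) le_rfl hvn hvw
    have h3 := norm_bilin_le (christ (gram e) y₀) (b := w) le_rfl hvw le_rfl
    linarith
  -- the displacements of the base point that are allowed
  have hev : ∀ᶠ ζ in 𝓝 (0 : E3), ‖ζ‖ < min (min 1 r) (min (δ₁ / 2) (θ * κ * n ^ 2 / 2 / (B + 2 * C₁ + 1))) ∧
      ‖ζ‖ + ‖christ (gram e) (y₀ + ζ) v v - christ (gram e) y₀ v v‖ < κ * n ^ 2 := by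
    refine Filter.Eventually.and ?_ ?_
    · filter_upwards [Metric.ball_mem_nhds (0 : E3) (by positivity : 0 < min (min 1 r)
        (min (δ₁ / 2) (θ * κ * n ^ 2 / 2 / (B + 2 * C₁ + 1))))] with ζ hζ using by simpa using hζ
    · have h1 : ContinuousAt (fun ζ : E3 => christ (gram e) (y₀ + ζ) v v) 0 := by
        have h2 : ContinuousAt (christ (gram e)) (y₀ + 0) := by
          rw [add_zero]
          exact (hG.contDiffOn_christ.contDiffAt (hG.mem_nhds hy₀)).continuousAt
        have h3 : ContinuousAt (fun ζ : E3 => christ (gram e) (y₀ + ζ)) 0 :=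
          ContinuousAt.comp (g := christ (gram e)) h2 (by fun_prop)
        exact (h3.clm_apply continuousAt_const).clm_apply continuousAt_const
      have h4 : Filter.Tendsto
          (fun ζ : E3 => ‖ζ‖ + ‖christ (gram e) (y₀ + ζ) v v - christ (gram e) y₀ v v‖)
          (𝓝 0) (𝓝 0) := by
        have h5 : ContinuousAt (fun ζ : E3 => ‖ζ‖) 0 := continuous_norm.continuousAt
        have h6 := h5.tendsto.add (h1.sub_const (christ (gram e) y₀ v v)).norm
        simpa only [add_zero, sub_self, norm_zero] using h6
      exact h4.eventually (gt_mem_nhds (by positivity))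
  have hmemD : ∀ᶠ ζ in 𝓝 (0 : E3), e.symm (y₀ + ζ) ∈ D := by
    filter_upwards [hev] with ζ hζ
    obtain ⟨hζ', hζ5⟩ := hζ
    simp only [lt_min_iff] at hζ'
    obtain ⟨⟨hζ1, hζ2⟩, hζ3, hζ4⟩ := hζ'
    rw [lt_div_iff₀ (by positivity)] at hζ4
    obtain ⟨c, hc, hcD⟩ := hgeo (y₀ + ζ) (by rw [add_sub_cancel_left]; exact hζ2.le) v
      (by linarith)
    refine hcD θ ⟨hθ0.le, hθ1⟩ ?_ (hfar _ ?_)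
    · -- the initial point lies in the inner ball
      have h1 := (hc (-θ) ⟨by linarith, by linarith⟩).1
      set R := c (-θ) - (y₀ + ζ) - (-θ) • v with hR
      have hRn : ‖R‖ ≤ 4 * C * n ^ 2 * θ ^ 2 := by
        refine h1.trans ?_
        have : ‖v‖ ^ 2 ≤ (2 * n) ^ 2 := by gcongr
        calc C * ‖v‖ ^ 2 * (-θ) ^ 2 ≤ C * (2 * n) ^ 2 * (-θ) ^ 2 := by gcongr
          _ = _ := by ring
      set ξ := ζ - θ • v + R with hξ
      have e1 : c (-θ) = y₀ + ξ := by
        rw [hξ, hR, neg_smul]; abel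
      have hξn : ‖ξ‖ ≤ ‖ζ‖ + 3 * n * θ := by
        refine (norm_add_le _ _).trans ?_
        have i1 := norm_sub_le ζ (θ • v)
        rw [norm_smul, Real.norm_of_nonneg hθ0.le] at i1
        have i2 : θ * ‖v‖ ≤ θ * (2 * n) := by gcongr
        have i3 : 4 * C * n ^ 2 * θ ^ 2 ≤ n * θ := by
          have i4 : n * (4 * C) * (n * θ * θ) ≤ 1 * (n * θ * 1) := by gcongr
          linarith
        linarith
      rw [e1]
      refine hball ξ ?_ ?_
      · have : n * θ ≤ n := mul_le_of_le_one_right hn0' hθ1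
        linarith
      · have i1 : gram e y₀ ν ξ = gram e y₀ ν ζ + θ * (κ * n ^ 2 * gram e y₀ ν ν)
            + gram e y₀ ν R := by
          rw [hξ, hv]
          simp only [map_add, map_sub, map_smul, smul_eq_mul, hνw]
          ring
        have i2 := (abs_le.1 ((gram e y₀ ν).le_opNorm ζ)).1
        have i3 := (abs_le.1 (norm_lin_le (gram e y₀ ν) le_rfl hRn)).1
        have i4 : ‖ξ‖ ^ 2 ≤ 2 * ‖ζ‖ ^ 2 + 18 * n ^ 2 * θ ^ 2 := by
          have j1 : ‖ξ‖ ^ 2 ≤ (‖ζ‖ + 3 * n * θ) ^ 2 := by gcongr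
          linarith only [j1, sq_nonneg (‖ζ‖ - 3 * n * θ)]
        have i5 : ‖ζ‖ ^ 2 ≤ ‖ζ‖ := by
          have := mul_le_of_le_one_left (norm_nonneg ζ) hζ1.le
          linarith only [this]
        have i6 : C₁ * ‖ξ‖ ^ 2 ≤ C₁ * (2 * ‖ζ‖ + 18 * n ^ 2 * θ ^ 2) := by
          gcongr
          linarith
        have i7 := mul_le_mul_of_nonneg_right hθκ (by positivity : 0 ≤ θ * n ^ 2)
        rw [i1, hνν]
        linarith [norm_nonneg ζ]
    · -- the end point is close to `y₀ + P`
      have h1 := (hc 1 (by norm_num)).2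
      simp only [one_smul, one_pow] at h1
      have e1 : c 1 - (y₀ + P) = (c 1 - (y₀ + ζ) - v
          + (1 / 2 : ℝ) • christ (gram e) (y₀ + ζ) v v) + (ζ
          - (1 / 2 : ℝ) • (christ (gram e) (y₀ + ζ) v v - christ (gram e) y₀ v v)) + (v - w)
          - (1 / 2 : ℝ) • (christ (gram e) y₀ v v - christ (gram e) y₀ w w) := by
        rw [hP]
        module
      have hhalf : ‖(1 / 2 : ℝ)‖ = 1 / 2 := by norm_num
      have i1 : ‖c 1 - (y₀ + P)‖ ≤ C * ‖v‖ ^ 3 + (‖ζ‖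
          + 1 / 2 * ‖christ (gram e) (y₀ + ζ) v v - christ (gram e) y₀ v v‖) + κ * b * n ^ 2
          + 1 / 2 * (3 * K * κ * b * n ^ 3) := by
        rw [e1]
        refine (norm_sub_le _ _).trans (add_le_add ((norm_add_le _ _).trans (add_le_add
          ((norm_add_le _ _).trans (add_le_add h1 ((norm_sub_le _ _).trans ?_))) hvw)) ?_)
        · rw [norm_smul, hhalf]
        · rw [norm_smul, hhalf]
          gcongr
      refine i1.trans ?_
      have i2 : C * ‖v‖ ^ 3 ≤ C * (2 * n) ^ 3 := by gcongr
      have i3 : κ * (b + 1) * n ^ 2 = ε / (4 * L) * n ^ 2 := by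
        rw [hκ]; field_simp
      have i4 : n * (8 * C + 2 * K * κ * b) * n ^ 2 ≤ ε / (4 * L) * n ^ 2 := by gcongr
      have i5 : ε / (2 * L) * n ^ 2 = 2 * (ε / (4 * L) * n ^ 2) := by field_simp; ring
      have i6 : 0 ≤ K * κ * b * n ^ 3 := by positivity
      have i7 := norm_nonneg (christ (gram e) (y₀ + ζ) v v - christ (gram e) y₀ v v)
      linarith
  refine hp0 (mem_interior_iff_mem_nhds.2 ?_)
  have h1 : Filter.Tendsto (fun x => e x - y₀) (𝓝 (γ 0)) (𝓝 0) := by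
    have := (e.continuousAt hp).sub_const y₀
    simpa only [ContinuousAt, ← hy₀def, sub_self] using this
  filter_upwards [h1.eventually hmemD, e.open_source.mem_nhds hp] with x hx hxs
  simpa [e.left_inv hxs] using hx

end SupportingHyperplane

/-! ### Propagation of barriers along minimal geodesics -/

section BarriersAlongGeodesics

variable {M : Type*} [MetricSpace M] [ChartedSpace E3 M] [IsManifold (𝓡 3) ∞ M]
  [RiemannianBundle (fun x : M => TangentSpace (𝓡 3) x)]
  [IsContMDiffRiemannianBundle (𝓡 3) ∞ E3 (fun x : M => TangentSpace (𝓡 3) x)]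
  [IsRiemannianManifold (𝓡 3) M]

/-- The coordinate expressions of the velocity of a curve in two charts. -/
theorem HasDerivWithinAt.change_chart {e e' : OpenPartialHomeomorph M E3}
    (he : e ∈ IsManifold.maximalAtlas (𝓡 3) ∞ M) (he' : e' ∈ IsManifold.maximalAtlas (𝓡 3) ∞ M)
    {γ : ℝ → M} {s : Set ℝ} {t : ℝ} (hγ : ContinuousWithinAt γ s t) (ht : γ t ∈ e.source)
    (ht' : γ t ∈ e'.source) {ν : E3} (hν : HasDerivWithinAt (e' ∘ γ) ν s t) :
    HasDerivWithinAt (e ∘ γ) (fderiv ℝ (e ∘ e'.symm) (e' (γ t)) ν) s t := by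
  have hy : e' (γ t) ∈ (e'.symm.trans e).source := by
    refine ⟨e'.map_source ht', ?_⟩
    rw [mem_preimage]
    exact (congrArg (· ∈ e.source) (e'.left_inv ht')).mpr ht
  have h1 : DifferentiableAt ℝ (e ∘ e'.symm) (e' (γ t)) :=
    ((contDiffOn_transition he he').contDiffAt
      ((e'.symm.trans e).open_source.mem_nhds hy)).differentiableAt (by norm_num)
  refine (h1.hasFDerivAt.comp_hasDerivWithinAt t hν).congr_of_eventuallyEq ?_ ?_
  · filter_upwards [hγ.preimage_mem_nhdsWithin (e'.open_source.mem_nhds ht')] with τ hτ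
    exact (congrArg e (e'.left_inv hτ)).symm
  · exact (congrArg e (e'.left_inv ht')).symm

/-- A second order bound at the initial point of a minimal geodesic, in the directions orthogonal to
the geodesic, propagates to the end point, where it acquires a concavity from the curvature. -/
theorem hasBarrier_of_hasPerpBarrier_zero (hsec : SecGE M 1) {γ : ℝ → M} {l : ℝ} (hl : 0 < l)
    (hγ : ContMDiffOn 𝓘(ℝ, ℝ) (𝓡 3) ∞ γ (Icc 0 l))
    (hd : ∀ s ∈ Icc 0 l, ∀ t ∈ Icc 0 l, dist (γ s) (γ t) = |s - t|) {ρ : M → ℝ}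
    (hρ : ∀ x y, ρ y ≤ ρ x + dist x y)
    (h0 : ∀ e ∈ IsManifold.maximalAtlas (𝓡 3) ∞ M, γ 0 ∈ e.source → ∀ ν,
      HasDerivWithinAt (e ∘ γ) ν (Icc 0 l) 0 → HasPerpBarrier e ρ (e (γ 0)) ν 0 0) :
    ∀ e ∈ IsManifold.maximalAtlas (𝓡 3) ∞ M, γ l ∈ e.source → ∀ ν,
      HasDerivWithinAt (e ∘ γ) ν (Icc 0 l) l → HasBarrier e ρ (e (γ l)) ν l (l / 2) := by
  have hγc : ContinuousOn γ (Icc 0 l) := hγ.continuousOn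
  have hloc : ∀ σ ∈ Icc 0 l, ∃ δ > 0, ∀ s ∈ Icc 0 l, ∀ s' ∈ Icc 0 l, |s - σ| ≤ δ → |s' - σ| ≤ δ →
      s < s' →
      (∀ e ∈ IsManifold.maximalAtlas (𝓡 3) ∞ M, γ s ∈ e.source → ∀ ν,
        HasDerivWithinAt (e ∘ γ) ν (Icc 0 l) s → HasPerpBarrier e ρ (e (γ s)) ν s (s / 2)) →
      (∀ e ∈ IsManifold.maximalAtlas (𝓡 3) ∞ M, γ s' ∈ e.source → ∀ ν,
        HasDerivWithinAt (e ∘ γ) ν (Icc 0 l) s' → HasBarrier e ρ (e (γ s')) ν s' (s' / 2)) := by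
    intro σ hσ
    set e := chartAt E3 (γ σ) with he_def
    have he : e ∈ IsManifold.maximalAtlas (𝓡 3) ∞ M := IsManifold.chart_mem_maximalAtlas _
    have hsrc := (hγc σ hσ).preimage_mem_nhdsWithin
      (e.open_source.mem_nhds (mem_chart_source E3 (γ σ)))
    rw [Metric.mem_nhdsWithin_iff] at hsrc
    obtain ⟨δ₀, hδ₀, hsub⟩ := hsrc
    set p := max 0 (σ - δ₀ / 2) with hp
    set q := min l (σ + δ₀ / 2) with hq
    have hpq : p < q := by
      rw [max_lt_iff, lt_min_iff, lt_min_iff]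
      exact ⟨⟨hl, by linarith [hσ.1]⟩, by linarith [hσ.2], by linarith⟩
    have hsub' : Icc p q ⊆ Icc 0 l := Icc_subset_Icc (le_max_left _ _) (min_le_left _ _)
    have hsrc : ∀ s ∈ Icc p q, γ s ∈ e.source := fun s hs => by
      refine hsub ⟨?_, hsub' hs⟩
      have h1 := (le_max_right _ _).trans hs.1
      have h2 := hs.2.trans (min_le_right _ _)
      rw [Metric.mem_ball, Real.dist_eq, abs_lt]
      constructor <;> linarith
    obtain ⟨u, hu, hone⟩ := isGeodesicOn_of_isometric he hpq (hγ.mono hsub')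
      (fun s hs t ht => hd s (hsub' hs) t (hsub' ht)) hsrc
    obtain ⟨δ, hδ, hstep⟩ := exists_hasBarrier_of_hasPerpBarrier hsec he hu hone hρ
      (K := l / 2) (by linarith)
    refine ⟨min (δ / 2) (δ₀ / 2), by positivity, fun s hs s' hs' h1 h2 hlt hP e' he' hx' ν hν => ?_⟩
    have hmem : ∀ t ∈ Icc 0 l, |t - σ| ≤ min (δ / 2) (δ₀ / 2) → t ∈ Icc p q := fun t ht h => by
      have := abs_le.1 (h.trans (min_le_right _ _))
      exact ⟨max_le ht.1 (by linarith), le_min ht.2 (by linarith)⟩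
    have hsm := hmem s hs h1
    have hsm' := hmem s' hs' h2
    -- the velocity within the shorter interval is the velocity within the longer one
    have huniq : ∀ t ∈ Icc p q, HasDerivWithinAt (e ∘ γ) (u t) (Icc 0 l) t := by
      intro t ht
      have h3 : ContMDiffWithinAt 𝓘(ℝ, ℝ) 𝓘(ℝ, E3) ∞ (e ∘ γ) (Icc 0 l) t :=
        ((contMDiffOn_of_mem_maximalAtlas he).contMDiffAt
          (e.open_source.mem_nhds (hsrc t ht))).comp_contMDiffWithinAt t (hγ t (hsub' ht))
      have h4 := (h3.contDiffWithinAt.differentiableWithinAt (by norm_num)).hasDerivWithinAt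
      have h5 := (uniqueDiffOn_Icc hpq t ht).eq_deriv _ (h4.mono hsub') (hu t ht).2.1
      rwa [h5] at h4
    have h3 := hstep s hsm s' hsm' hlt (by
      have := abs_le.1 (h1.trans (min_le_left _ _))
      have := abs_le.1 (h2.trans (min_le_left _ _))
      linarith) (s / 2) s (by linarith [hs.1]) (by linarith [hs.2])
      (hP e he (hsrc s hsm) _ (huniq s hsm))
    have e1 : s + (s' - s) = s' := by ring
    have e2 : s / 2 + (s' - s) / 2 = s' / 2 := by ring
    rw [e1, e2] at h3
    have h4 := hν.change_chart he he' (hγc s' hs') (hsrc s' hsm') hx'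
    have h5 := (uniqueDiffOn_Icc hl s' hs').eq_deriv _ h4 (huniq s' hsm')
    refine HasBarrier.change_chart he he' (hsrc s' hsm') hx' ?_
    rw [h5]
    exact h3
  choose! δ hδ hloc using hloc
  obtain ⟨t, ht0, htm, ⟨m, hm⟩, hcov⟩ := exists_monotone_Icc_subset_open_cover_Icc hl.le
    (ι := Icc 0 l) (c := fun i => {x | dist (x : ℝ) i < δ i})
    (fun i => isOpen_lt (by fun_prop) continuous_const)
    (fun x _ => mem_iUnion.2 ⟨x, by simpa using hδ x x.2⟩)
  have hind : ∀ n, (t n : ℝ) = 0 ∨ ∀ e ∈ IsManifold.maximalAtlas (𝓡 3) ∞ M, γ (t n) ∈ e.source →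
      ∀ ν, HasDerivWithinAt (e ∘ γ) ν (Icc 0 l) (t n) →
        HasBarrier e ρ (e (γ (t n))) ν (t n) (t n / 2) := by
    intro n
    induction n with
    | zero => exact Or.inl ht0
    | succ n ih =>
      rcases (show (t n : ℝ) ≤ t (n + 1) from htm n.le_succ).eq_or_lt with heq | hlt
      · rw [← heq]
        exact ih
      refine Or.inr ?_
      obtain ⟨i, hi⟩ := hcov n
      have k1 := hi (left_mem_Icc.2 (htm n.le_succ))
      have k2 := hi (right_mem_Icc.2 (htm n.le_succ))
      rw [Set.mem_ofPred_eq, Real.dist_eq] at k1 k2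
      refine hloc i i.2 _ (t n).2 _ (t (n + 1)).2 k1.le k2.le hlt fun e he hx ν hν => ?_
      rcases ih with h | h
      · rw [h] at hx hν ⊢
        simpa using h0 e he hx ν hν
      · exact (h e he hx ν hν).hasPerpBarrier he (e.map_source hx)
  have h1 := hind m
  rw [hm m le_rfl] at h1
  exact h1.resolve_left hl.ne'

end BarriersAlongGeodesics

/-! ### The distance to the boundary of a convex set -/

section ConvexSets

variable {M : Type*} [MetricSpace M] [ChartedSpace E3 M]

theorem GeodesicallyConvex.exists_dist_eq {D : Set M} (hconv : GeodesicallyConvex D) {x y : M}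
    (hx : x ∈ D) (hy : y ∈ D) {t : ℝ} (ht : t ∈ Icc 0 (dist x y)) :
    ∃ z ∈ D, dist x z = t ∧ dist z y = dist x y - t := by
  obtain ⟨γ, -, h0, h1, hd, hγD⟩ := hconv x hx y hy
  have k1 := hd 0 (left_mem_Icc.2 dist_nonneg) t ht
  have k2 := hd t ht _ (right_mem_Icc.2 dist_nonneg)
  rw [h0, zero_sub, abs_neg, abs_of_nonneg ht.1] at k1
  rw [h1, abs_sub_comm, abs_of_nonneg (sub_nonneg.2 ht.2)] at k2
  exact ⟨γ t, hγD t ht, k1, k2⟩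

/-- A complete convex set is proper (the theorem of Hopf and Rinow). -/
theorem GeodesicallyConvex.isCompact_inter_closedBall {D : Set M} (hconv : GeodesicallyConvex D)
    (hD : IsComplete D) {x : M} (hx : x ∈ D) (r : ℝ) : IsCompact (D ∩ Metric.closedBall x r) := by
  have : LocallyCompactSpace M := ChartedSpace.locallyCompactSpace E3 M
  by_contra hr
  have hmono : ∀ r s, r ≤ s → IsCompact (D ∩ Metric.closedBall x s) →
      IsCompact (D ∩ Metric.closedBall x r) := fun r s hrs h =>
    h.of_isClosed_subset (hD.isClosed.inter Metric.isClosed_closedBall)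
      (inter_subset_inter_right _ (Metric.closedBall_subset_closedBall hrs))
  set A := {s : ℝ | 0 ≤ s ∧ IsCompact (D ∩ Metric.closedBall x s)} with hA
  have hA0 : (0 : ℝ) ∈ A := ⟨le_rfl, by
    rw [Metric.closedBall_zero]
    exact (isCompact_singleton.inter_left hD.isClosed)⟩
  have hAr : BddAbove A := ⟨r, fun s hs => by
    by_contra! h
    exact hr (hmono _ _ h.le hs.2)⟩
  set s := sSup A with hs
  have hs0 : 0 ≤ s := le_csSup hAr hA0
  -- points at a larger distance are close to points at a smaller one
  have hback : ∀ y ∈ D, ∀ s' ≥ 0, ∀ ε ≥ 0, dist y x ≤ s' + ε →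
      ∃ z ∈ D ∩ Metric.closedBall x s', dist y z ≤ ε := by
    intro y hy s' hs' ε hε h
    rcases le_total (dist y x) s' with h1 | h1
    · exact ⟨y, ⟨hy, h1⟩, by simpa using hε⟩
    rw [dist_comm] at h h1
    obtain ⟨z, hz, h2, h3⟩ := hconv.exists_dist_eq hx hy (t := s') ⟨hs', h1⟩
    refine ⟨z, ⟨hz, ?_⟩, ?_⟩
    · rw [Metric.mem_closedBall, dist_comm]
      exact h2.le
    · rw [dist_comm]
      linarith
  have hcs : IsCompact (D ∩ Metric.closedBall x s) := by
    rw [isCompact_iff_totallyBounded_isComplete]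
    refine ⟨Metric.totallyBounded_iff.2 fun ε hε => ?_, fun f hf hle => ?_⟩
    · obtain ⟨s', hs'A, hs'⟩ := exists_lt_of_lt_csSup ⟨0, hA0⟩ (sub_lt_self s (half_pos hε))
      obtain ⟨F, hF, hcov⟩ := Metric.totallyBounded_iff.1
        (isCompact_iff_totallyBounded_isComplete.1 hs'A.2).1 (ε / 2) (half_pos hε)
      refine ⟨F, hF, fun y hy => ?_⟩
      obtain ⟨z, hz, hyz⟩ := hback y hy.1 s' hs'A.1 (ε / 2) (half_pos hε).le
        ((Metric.mem_closedBall.1 hy.2).trans (by linarith))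
      obtain ⟨w, hw, hzw⟩ := mem_iUnion₂.1 (hcov hz)
      refine mem_iUnion₂.2 ⟨w, hw, ?_⟩
      rw [Metric.mem_ball] at hzw ⊢
      linarith [dist_triangle y z w]
    · obtain ⟨y, hy, hfy⟩ := hD f hf (hle.trans (Filter.principal_mono.2 inter_subset_left))
      have := hf.1
      exact ⟨y, ⟨hy, Metric.isClosed_closedBall.mem_of_tendsto (f := id) hfy
        (hle.trans (Filter.principal_mono.2 inter_subset_right) (Filter.mem_principal_self _))⟩, hfy⟩
  obtain ⟨δ, hδ, hcomp⟩ := hcs.exists_isCompact_cthickening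
  have hmem : s + δ ∈ A := ⟨by linarith, hcomp.of_isClosed_subset
    (hD.isClosed.inter Metric.isClosed_closedBall) fun y hy => by
      obtain ⟨z, hz, hyz⟩ := hback y hy.1 s hs0 δ hδ.le hy.2
      exact Metric.mem_cthickening_of_dist_le y z δ _ hz hyz⟩
  linarith [le_csSup hAr hmem]

/-- The distance to the boundary of a complete convex set is attained. -/
theorem GeodesicallyConvex.exists_infDist_frontier_eq_dist {D : Set M}
    (hconv : GeodesicallyConvex D) (hD : IsComplete D) (hbd : (frontier D).Nonempty) {x : M}
    (hx : x ∈ D) : ∃ p ∈ frontier D, Metric.infDist x (frontier D) = dist x p := by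
  obtain ⟨p₀, hp₀⟩ := hbd
  have hsub : frontier D ⊆ D := hD.isClosed.frontier_subset
  have hK : IsCompact (frontier D ∩ Metric.closedBall x (dist x p₀)) :=
    (hconv.isCompact_inter_closedBall hD hx (dist x p₀)).of_isClosed_subset
      (isClosed_frontier.inter Metric.isClosed_closedBall) (inter_subset_inter_left _ hsub)
  obtain ⟨p, hp, hmin⟩ := hK.exists_isMinOn ⟨p₀, hp₀, by simp [dist_comm]⟩
    (continuous_const.dist continuous_id : Continuous fun p => dist x p).continuousOn
  refine ⟨p, hp.1, le_antisymm (Metric.infDist_le_dist_of_mem hp.1) ?_⟩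
  refine (Metric.le_infDist ⟨p₀, hp₀⟩).2 fun q hq => ?_
  rcases le_total (dist x q) (dist x p₀) with h | h
  · exact hmin ⟨hq, by rwa [Metric.mem_closedBall, dist_comm]⟩
  · exact (hmin ⟨hp₀, by simp [dist_comm]⟩ : dist x p ≤ dist x p₀).trans h

/-- The points of a complete convex set at positive distance `l` from its boundary are joined to the
boundary by a minimal geodesic. -/
theorem GeodesicallyConvex.exists_minimal_geodesic_from_frontier {D : Set M}
    (hconv : GeodesicallyConvex D) (hD : IsComplete D) (hbd : (frontier D).Nonempty) {x : M}
    (hx : x ∈ D) : ∃ γ : ℝ → M,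
      ContMDiffOn 𝓘(ℝ, ℝ) (𝓡 3) ∞ γ (Icc 0 (Metric.infDist x (frontier D))) ∧
      γ 0 ∈ frontier D ∧ γ (Metric.infDist x (frontier D)) = x ∧
      (∀ s ∈ Icc 0 (Metric.infDist x (frontier D)), ∀ t ∈ Icc 0 (Metric.infDist x (frontier D)),
        dist (γ s) (γ t) = |s - t|) ∧
      ∀ s ∈ Icc 0 (Metric.infDist x (frontier D)), γ s ∈ D := by
  obtain ⟨p, hp, hxp⟩ := hconv.exists_infDist_frontier_eq_dist hD hbd hx
  obtain ⟨γ, h1, h2, h3, h4, h5⟩ := hconv p (hD.isClosed.frontier_subset hp) x hx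
  rw [hxp, dist_comm]
  exact ⟨γ, h1, h2 ▸ hp, h3, h4, h5⟩

/-- A point at distance exactly `π/2 - log c` from `∂D` is a limit of points closer to `∂D`, on a minimal
geodesic to `∂D`, and the points at a greater distance are interior points of `Ωᶜ`. -/
theorem frontier_OmegaSet {D : Set M} (hD : IsComplete D) (hconv : GeodesicallyConvex D)
    (hbd : (frontier D).Nonempty) {c : ℝ} (hc : c < Real.exp (Real.pi / 2)) :
    frontier (OmegaSet D c) ∩ symplectization M = SigmaSet D c := by
  rcases le_or_gt c 0 with hc0 | hc0
  · have h1 : OmegaSet D c = ∅ := eq_empty_of_forall_notMem fun p hp =>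
      absurd hp.2.2 (not_le.2 (hc0.trans_lt (Real.exp_pos _)))
    have h2 : SigmaSet D c = ∅ := eq_empty_of_forall_notMem fun p hp =>
      absurd hp.2.2.le (not_le.2 (hc0.trans_lt (Real.exp_pos _)))
    rw [h1, h2, frontier_empty, empty_inter]
  set l := Real.pi / 2 - Real.log c with hl
  have hl0 : 0 < l := by
    have := (Real.log_lt_iff_lt_exp hc0).2 hc
    linarith
  have hle : ∀ x, expDist D x ≤ c ↔ l ≤ Metric.infDist x (frontier D) := fun x => by
    rw [expDist, ← Real.le_log_iff_exp_le hc0, hl, sub_le_comm]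
  have heq : ∀ x, expDist D x = c ↔ l = Metric.infDist x (frontier D) := fun x => by
    rw [expDist, hl]
    nth_rw 1 [← Real.exp_log hc0]
    rw [Real.exp_eq_exp]
    constructor <;> intro h <;> linarith
  have hcont : Continuous fun p : ℝ × M => Metric.infDist p.2 (frontier D) :=
    (Metric.continuous_infDist_pt _).comp continuous_snd
  ext ⟨t, x⟩
  constructor
  · rintro ⟨⟨hcl, hint⟩, ht⟩
    have h1 : (t, x) ∈ {p : ℝ × M | p.2 ∈ D ∧ l ≤ Metric.infDist p.2 (frontier D)} := by
      refine closure_minimal ?_ ?_ hcl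
      · exact fun p hp => ⟨hp.2.1, (hle _).1 hp.2.2⟩
      · exact (hD.isClosed.preimage continuous_snd).inter (isClosed_le continuous_const hcont)
    refine ⟨ht, h1.1, (heq x).2 (h1.2.eq_or_lt.resolve_right fun hlt => hint ?_)⟩
    have hopen : IsOpen {p : ℝ × M | 0 < p.1 ∧ p.2 ∈ interior D ∧
        l < Metric.infDist p.2 (frontier D)} :=
      (isOpen_lt continuous_const continuous_fst).inter
        ((isOpen_interior.preimage continuous_snd).inter (isOpen_lt continuous_const hcont))
    refine interior_maximal ?_ hopen ⟨ht, ?_, hlt⟩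
    · exact fun p hp => ⟨hp.1, interior_subset hp.2.1, (hle _).2 hp.2.2.le⟩
    · by_contra h
      have h2 : x ∈ frontier D := ⟨subset_closure h1.1, h⟩
      have h3 := Metric.infDist_zero_of_mem h2
      have h4 : l < Metric.infDist x (frontier D) := hlt
      linarith
  · rintro ⟨ht, hx, hxc⟩
    change 0 < t at ht
    change x ∈ D at hx
    change expDist D x = c at hxc
    refine ⟨⟨subset_closure ⟨ht, hx, hxc.le⟩, fun hint => ?_⟩, ht⟩
    have hxl := (heq x).1 hxc
    obtain ⟨p, hp, hpx⟩ := hconv.exists_infDist_frontier_eq_dist hD hbd hx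
    have h1 : (fun z => (t, z)) ⁻¹' OmegaSet D c ∈ 𝓝 x :=
      (Continuous.prodMk_right t).continuousAt.preimage_mem_nhds (mem_interior_iff_mem_nhds.1 hint)
    obtain ⟨ε, hε, hball⟩ := Metric.mem_nhds_iff.1 h1
    have hd : 0 < min (ε / 2) l := by positivity
    obtain ⟨z, hz, h2, h3⟩ := hconv.exists_dist_eq hx (hD.isClosed.frontier_subset hp)
      (t := min (ε / 2) l) ⟨hd.le, by rw [← hpx, ← hxl]; exact min_le_right _ _⟩
    have h4 : z ∈ Metric.ball x ε := by
      rw [Metric.mem_ball, dist_comm, h2]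
      exact (min_le_left _ _).trans_lt (half_lt_self hε)
    have h5 := (hle z).1 (hball h4).2.2
    have h6 := Metric.infDist_le_dist_of_mem (x := z) hp
    linarith

variable [IsManifold (𝓡 3) ∞ M]
  [RiemannianBundle (fun x : M => TangentSpace (𝓡 3) x)]
  [IsContMDiffRiemannianBundle (𝓡 3) ∞ E3 (fun x : M => TangentSpace (𝓡 3) x)]
  [IsRiemannianManifold (𝓡 3) M]

/-- The distance from a point of a closed set to its boundary is the distance to the complement of
its interior, as short paths leaving the set cross the boundary. -/
theorem infDist_frontier_eq {D : Set M} (hD : IsClosed D) (hbd : (frontier D).Nonempty) {x : M}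
    (hx : x ∈ D) : Metric.infDist x (frontier D) = Metric.infDist x (interior D)ᶜ := by
  have hsub : frontier D ⊆ (interior D)ᶜ := fun p hp => hp.2
  refine le_antisymm ?_ (Metric.infDist_le_infDist_of_subset hsub hbd)
  refine (Metric.le_infDist (hbd.mono hsub)).2 fun y hy => le_of_forall_gt fun r hr => ?_
  have hr0 : 0 < r := dist_nonneg.trans_lt hr
  have h1 : riemannianEDist (𝓡 3) x y < ENNReal.ofReal r := by
    rw [← IsRiemannianManifold.out, edist_dist]
    exact (ENNReal.ofReal_lt_ofReal_iff hr0).2 hr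
  obtain ⟨γ, h0, h1, hsm, hlen⟩ := exists_lt_of_riemannianEDist_lt h1
  have hcross : ∃ t ∈ Icc (0 : ℝ) 1, γ t ∈ frontier D := by
    by_contra! hno
    have hpre : IsPreconnected (γ '' Icc 0 1) := isPreconnected_Icc.image _ hsm.continuousOn
    have hsub : γ '' Icc 0 1 ⊆ interior D ∪ Dᶜ := by
      rintro _ ⟨t, ht, rfl⟩
      by_cases h : γ t ∈ D
      · exact Or.inl (by_contra fun hi => hno t ht ⟨subset_closure h, hi⟩)
      · exact Or.inr h
    have h2 := hpre.subset_left_of_subset_union isOpen_interior hD.isOpen_compl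
      (disjoint_compl_right.mono_left interior_subset) hsub ⟨x, ⟨0, by simp, h0⟩, by
        rw [← h0]
        exact by_contra fun hi => hno 0 (by simp) ⟨subset_closure (h0 ▸ hx), hi⟩⟩
    exact hy (h2 ⟨1, by simp, h1⟩)
  obtain ⟨t, ht, htD⟩ := hcross
  have h2 := riemannianEDist_le_pathELength (I := 𝓡 3)
    (hsm.mono (Icc_subset_Icc le_rfl ht.2)) h0 rfl ht.1
  have h3 := h2.trans (pathELength_mono (I := 𝓡 3) (γ := γ) le_rfl ht.2)
  rw [← IsRiemannianManifold.out, edist_dist] at h3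
  have h4 := (ENNReal.ofReal_lt_ofReal_iff hr0).1 (h3.trans_lt hlen)
  exact (Metric.infDist_le_dist_of_mem htD).trans_lt h4

/-- The distance to the boundary of a convex set in a manifold of sectional curvature at least one
has Hessian at most `-l / 2` at distance `l` from the boundary, in the sense of barriers. -/
theorem GeodesicallyConvex.exists_hasBarrier (hsec : SecGE M 1) {D : Set M}
    (hconv : GeodesicallyConvex D) (hD : IsComplete D) (hbd : (frontier D).Nonempty) {x : M}
    (hx : x ∈ D) (hl : 0 < Metric.infDist x (interior D)ᶜ) {e : OpenPartialHomeomorph M E3}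
    (he : e ∈ IsManifold.maximalAtlas (𝓡 3) ∞ M) (hxe : x ∈ e.source) :
    ∃ ν, gram e (e x) ν ν = 1 ∧ HasBarrier e (fun x => Metric.infDist x (interior D)ᶜ) (e x) ν
      (Metric.infDist x (interior D)ᶜ) (Metric.infDist x (interior D)ᶜ / 2) := by
  obtain ⟨γ, hγ, h0, h1, hd, -⟩ := hconv.exists_minimal_geodesic_from_frontier hD hbd hx
  rw [infDist_frontier_eq hD.isClosed hbd hx] at hγ h1 hd
  set ρ : M → ℝ := fun x => Metric.infDist x (interior D)ᶜ with hρ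
  set l := Metric.infDist x (interior D)ᶜ with hl_def
  have hball : Metric.ball (γ l) l ⊆ D := by
    rw [h1]
    intro y hy
    by_contra hyD
    have h2 : y ∈ (interior D)ᶜ := fun h => hyD (interior_subset h)
    have := Metric.infDist_le_dist_of_mem (x := x) h2
    rw [Metric.mem_ball, dist_comm] at hy
    linarith
  have h2 := hasBarrier_of_hasPerpBarrier_zero hsec hl hγ hd (ρ := ρ)
    (fun x y => by
      have := Metric.infDist_le_infDist_add_dist (x := y) (y := x) (s := (interior D)ᶜ)
      rwa [dist_comm] at this)
    (fun e he hp ν hν => hconv.hasPerpBarrier hl hγ hd hball h0.2 he hp hν)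
  have hlm : l ∈ Icc 0 l := right_mem_Icc.2 hl.le
  rw [← h1] at hxe
  have h3 : ContMDiffWithinAt 𝓘(ℝ, ℝ) 𝓘(ℝ, E3) ∞ (e ∘ γ) (Icc 0 l) l :=
    ((contMDiffOn_of_mem_maximalAtlas he).contMDiffAt
      (e.open_source.mem_nhds hxe)).comp_contMDiffWithinAt l (hγ l hlm)
  have h4 := (h3.contDiffWithinAt.differentiableWithinAt (by norm_num)).hasDerivWithinAt
  have h5 := h2 e he hxe _ h4
  obtain ⟨p, q, hpq, hsub, hsrc, hlpq⟩ := exists_Icc_subset_of_mem_nhdsWithin hl hlm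
    ((hγ l hlm).continuousWithinAt.preimage_mem_nhdsWithin (e.open_source.mem_nhds hxe))
  obtain ⟨u, hu, hone⟩ := isGeodesicOn_of_isometric he hpq (hγ.mono hsub)
    (fun s hs t ht => hd s (hsub hs) t (hsub ht)) hsrc
  have h6 := hone l hlpq
  rw [← (uniqueDiffOn_Icc hpq l hlpq).eq_deriv _ (h4.mono hsub) (hu l hlpq).2.1] at h6
  rw [h1] at h5 h6
  exact ⟨_, h6, h5⟩

end ConvexSets

/-! ### The strong minimum principle -/

section SecondDerivativeTest

/-- The second derivative test on a half-line. -/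
theorem nonneg_of_eventually_nonneg_taylor {a b : ℝ}
    (h : ∀ ε > 0, ∀ᶠ t in 𝓝[>] (0 : ℝ), 0 ≤ t * a + t ^ 2 * b + ε * t ^ 2) :
    0 ≤ a ∧ (a = 0 → 0 ≤ b) := by
  constructor
  · by_contra! ha
    have h1 : ∀ᶠ t in 𝓝[>] (0 : ℝ), t < -a / (|b| + 1) / 2 :=
      (gt_mem_nhds (by have : 0 < -a := by linarith
                       positivity)).filter_mono nhdsWithin_le_nhds
    obtain ⟨t, ⟨h2, h3⟩, ht⟩ := (((h 1 one_pos).and h1).and self_mem_nhdsWithin).exists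
    have ht0 : 0 < t := ht
    have h4 : t * (|b| + 1) < -a / 2 := by
      rw [div_div, lt_div_iff₀ (by positivity)] at h3
      linarith
    have h5 : t * (t * (|b| + 1)) < t * (-a / 2) := mul_lt_mul_of_pos_left h4 ht0
    have h6 : t ^ 2 * b ≤ t ^ 2 * |b| := by gcongr; exact le_abs_self b
    have h7 : t * a < 0 := mul_neg_of_pos_of_neg ht0 ha
    linarith
  · rintro rfl
    refine le_of_forall_pos_le_add fun ε hε => ?_
    obtain ⟨t, h2, ht⟩ := ((h ε hε).and self_mem_nhdsWithin).exists
    have ht0 : 0 < t := ht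
    have h3 : 0 ≤ t ^ 2 * (b + ε) := by linarith
    exact nonneg_of_mul_nonneg_right h3 (by positivity)

variable {M : Type*} [MetricSpace M] [ChartedSpace E3 M] [IsManifold (𝓡 3) ∞ M]
  [RiemannianBundle (fun x : M => TangentSpace (𝓡 3) x)]
  [IsContMDiffRiemannianBundle (𝓡 3) ∞ E3 (fun x : M => TangentSpace (𝓡 3) x)]
  [IsRiemannianManifold (𝓡 3) M]

/-- On the side to which the gradient points, the second order bound holds with the constant that
corresponds to a vanishing second derivative in the direction of the gradient. This follows from the
bound in the orthogonal directions and the triangle inequality. -/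
theorem HasBarrier.eventually_le_of_nonneg {e : OpenPartialHomeomorph M E3}
    (he : e ∈ IsManifold.maximalAtlas (𝓡 3) ∞ M) {ρ : M → ℝ} (hρ : ∀ x y, ρ y ≤ ρ x + dist x y)
    {y ν : E3} (hy : y ∈ e.target) (hone : gram e y ν ν = 1) {r k : ℝ}
    (h : HasBarrier e ρ y ν r k) {ε : ℝ} (hε : 0 < ε) :
    ∀ᶠ ξ in 𝓝 (0 : E3), 0 ≤ gram e y ν ξ → ρ (e.symm (y + ξ)) ≤ r + gram e y ν ξ
      + 1 / 2 * koszul (gram e) y ξ ξ ν - k / 2 * gram e y ξ ξ + k / 2 * gram e y ν ξ ^ 2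
      + ε * ‖ξ‖ ^ 2 := by
  obtain ⟨C, hC⟩ := h
  have hG := isMetricOn_gram he
  set ℓ := gram e y ν with hℓ
  set B := 1 + ‖ℓ‖ * ‖ν‖ with hB
  have hB1 : 1 ≤ B := by
    have : 0 ≤ ‖ℓ‖ * ‖ν‖ := by positivity
    linarith
  set ε₁ := ε / 2 / B ^ 2 with hε₁
  have hε₁0 : 0 < ε₁ := by positivity
  set ε₂ := ε / (‖ℓ‖ + 1) / B with hε₂
  have hε₂0 : 0 < ε₂ := by positivity
  -- the first order expansion of the metric
  have hDG : HasFDerivAt (fun z => gram e z ν ν)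
      ((fderiv ℝ (gram e) y).flip ν |>.flip ν) y := by
    have h1 : HasFDerivAt (gram e) (fderiv ℝ (gram e) y) y :=
      ((hG.smooth.contDiffAt (hG.mem_nhds hy)).differentiableAt (by norm_num)).hasFDerivAt
    have h2 := (h1.clm_apply (hasFDerivAt_const ν y)).clm_apply (hasFDerivAt_const ν y)
    refine h2.congr_fderiv ?_
    ext ξ
    simp
  rw [hasFDerivAt_iff_isLittleO_nhds_zero] at hDG
  have hmem : ∀ᶠ ξ in 𝓝 (0 : E3), y + ξ ∈ e.target := by
    have h1 : Filter.Tendsto (fun ξ : E3 => y + ξ) (𝓝 0) (𝓝 y) := by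
      have : Continuous fun ξ : E3 => y + ξ := by fun_prop
      simpa using this.tendsto 0
    exact h1.eventually (e.open_target.mem_nhds hy)
  have hall := ((hDG.bound hε₂0).and hmem).and (hC ε₁ hε₁0)
  obtain ⟨δ, hδ, hball⟩ := Metric.eventually_nhds_iff.1 hall
  filter_upwards [Metric.ball_mem_nhds (0 : E3) (by positivity : 0 < δ / B)] with ξ hξ ha
  rw [Metric.mem_ball, dist_zero_right, lt_div_iff₀ (by positivity)] at hξ
  set a := ℓ ξ with ha_def
  have haξ : a ≤ ‖ℓ‖ * ‖ξ‖ := (le_abs_self _).trans (ℓ.le_opNorm ξ)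
  have hseg : ∀ τ ∈ Icc (0 : ℝ) 1, ‖ξ - (τ * a) • ν‖ ≤ B * ‖ξ‖ := by
    intro τ hτ
    refine (norm_sub_le _ _).trans ?_
    rw [norm_smul, Real.norm_of_nonneg (mul_nonneg hτ.1 ha)]
    have h1 : τ * a ≤ 1 * (‖ℓ‖ * ‖ξ‖) := by gcongr; exact hτ.2
    have h2 : τ * a * ‖ν‖ ≤ 1 * (‖ℓ‖ * ‖ξ‖) * ‖ν‖ := by gcongr
    rw [hB]
    linarith
  have hseg' : ∀ τ ∈ Icc (0 : ℝ) 1, dist (ξ - (τ * a) • ν) 0 < δ := fun τ hτ => by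
    rw [dist_zero_right]
    exact (hseg τ hτ).trans_lt (by linarith)
  -- the bound at the end point of the orthogonal displacement
  set ξ' := ξ - a • ν with hξ'
  have hone' : ℓ ν = 1 := hone
  have hp := (hball (hseg' 1 (by norm_num))).2
  rw [one_mul, ← hξ'] at hp
  have hperp : ℓ ξ' = 0 := by
    rw [hξ', map_sub, map_smul, hone', smul_eq_mul, mul_one, ← ha_def, sub_self]
  have hn : ε₁ * ‖ξ'‖ ^ 2 ≤ ε / 2 * ‖ξ‖ ^ 2 := by
    have h1 := hseg 1 (by norm_num)
    rw [one_mul, ← hξ'] at h1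
    calc ε₁ * ‖ξ'‖ ^ 2 ≤ ε₁ * (B * ‖ξ‖) ^ 2 := by gcongr
      _ = ε / 2 * ‖ξ‖ ^ 2 := by rw [hε₁]; field_simp
  -- the length of the segment in the direction of the gradient
  set D := fderiv ℝ (gram e) y with hD
  have hlen := dist_le_of_chart_curve he zero_le_one (c := fun t : ℝ => y + (ξ' + (t * a) • ν))
    (c' := fun _ => a • ν) (Ψ := fun t => t * (a * (1 + 1 / 2 * D ξ' ν ν + ε₂ * B * ‖ξ‖ / 2))
      + t ^ 2 * (a ^ 2 * D ν ν ν / 4))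
    (Ψ' := fun t => a * (1 + 1 / 2 * D ξ' ν ν + ε₂ * B * ‖ξ‖ / 2) + t * (a ^ 2 * D ν ν ν / 2))
    (fun t _ => by
      have := ((((hasDerivAt_id t).mul_const a).smul_const ν).const_add ξ').const_add y
      simpa using this.hasDerivWithinAt)
    continuousOn_const
    (fun t ht => by
      have h1 := (hball (hseg' (1 - t) ⟨by linarith [ht.2], by linarith [ht.1]⟩)).1.2
      convert h1 using 2
      rw [hξ']
      module)
    (fun t _ => by
      have := ((hasDerivAt_id t).mul_const
        (a * (1 + 1 / 2 * D ξ' ν ν + ε₂ * B * ‖ξ‖ / 2))).add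
        (((hasDerivAt_id t).pow 2).mul_const (a ^ 2 * D ν ν ν / 4))
      refine (this.congr_deriv ?_).hasDerivWithinAt
      simp
      ring)
    (fun t ht => by
      have hτ : 1 - t ∈ Icc (0 : ℝ) 1 := ⟨by linarith [ht.2], by linarith [ht.1]⟩
      have e1 : ξ - ((1 - t) * a) • ν = ξ' + (t * a) • ν := by rw [hξ']; module
      have h1 := (hball (hseg' (1 - t) hτ)).1.1
      have h2 := hseg (1 - t) hτ
      have h3 := (hball (hseg' (1 - t) hτ)).1.2
      rw [e1] at h1 h2 h3
      have h4 := (abs_le.1 h1).2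
      have e2 : ((D.flip ν).flip ν) (ξ' + (t * a) • ν) = D ξ' ν ν + t * a * D ν ν ν := by
        simp
      rw [e2, hone] at h4
      have e3 : gram e (y + (ξ' + (t * a) • ν)) (a • ν) (a • ν)
          = a ^ 2 * gram e (y + (ξ' + (t * a) • ν)) ν ν := by
        simp only [map_smul, _root_.smul_apply, smul_eq_mul]
        ring
      have h5 := sqrt_le_half_add_one (gram_self_nonneg (e := e) (y + (ξ' + (t * a) • ν)) ν)
      have h6 : ε₂ * ‖ξ' + (t * a) • ν‖ ≤ ε₂ * (B * ‖ξ‖) := by gcongr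
      rw [e3, Real.sqrt_mul (sq_nonneg a), Real.sqrt_sq ha]
      have h7 : √(gram e (y + (ξ' + (t * a) • ν)) ν ν) ≤ 1 + 1 / 2 * D ξ' ν ν
          + ε₂ * B * ‖ξ‖ / 2 + t * (a * D ν ν ν / 2) := by linarith
      calc _ ≤ a * (1 + 1 / 2 * D ξ' ν ν + ε₂ * B * ‖ξ‖ / 2 + t * (a * D ν ν ν / 2)) := by gcongr
        _ = _ := by ring)
  simp only [zero_mul, zero_smul, add_zero, one_mul, one_pow, ne_eq, OfNat.ofNat_ne_zero,
    not_false_eq_true, zero_pow, sub_zero] at hlen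
  have e1 : ξ' + a • ν = ξ := by rw [hξ']; abel
  rw [e1] at hlen
  have h1 := hρ (e.symm (y + ξ')) (e.symm (y + ξ))
  have h2 : a * (ε₂ * B * ‖ξ‖ / 2) ≤ ε / 2 * ‖ξ‖ ^ 2 := by
    calc a * (ε₂ * B * ‖ξ‖ / 2) ≤ (‖ℓ‖ * ‖ξ‖) * (ε₂ * B * ‖ξ‖ / 2) := by gcongr
      _ ≤ ((‖ℓ‖ + 1) * ‖ξ‖) * (ε₂ * B * ‖ξ‖ / 2) := by gcongr; linarith
      _ = ε / 2 * ‖ξ‖ ^ 2 := by rw [hε₂]; field_simp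
  have e2 : gram e y ξ ξ = gram e y ξ' ξ' + a ^ 2 := by
    have i0 : gram e y ν ξ' = 0 := hperp
    have i1 : gram e y ξ' ν = 0 := (hG.symm y hy ξ' ν).trans hperp
    have i2 : gram e y ν ν = 1 := hone
    rw [← e1]
    simp only [map_add, map_smul, _root_.add_apply, _root_.smul_apply, smul_eq_mul, i0, i1, i2]
    ring
  have e3 : koszul (gram e) y ξ ξ ν = koszul (gram e) y ξ' ξ' ν + a * D ξ' ν ν
      + a ^ 2 * (D ν ν ν / 2) := by
    have i1 := hG.koszul_symm hy ν ξ' ν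
    have i2 : koszul (gram e) y ξ' ν ν = 1 / 2 * D ξ' ν ν := by
      rw [koszul_apply, hG.fderiv_symm hy ν ξ' ν]; ring
    have i3 : koszul (gram e) y ν ν ν = 1 / 2 * D ν ν ν := by
      rw [koszul_apply]; ring
    rw [← e1]
    simp only [map_add, map_smul, _root_.add_apply, _root_.smul_apply, smul_eq_mul, i1, i2, i3]
    ring
  rw [hperp] at hp
  rw [e2, e3]
  linarith

/-- The first and second derivative tests for a function with a second order upper bound, composed
with a map `v` from the plane, and a smooth function `w` touching it from below. -/
theorem HasBarrier.le_of_eventually_le {e : OpenPartialHomeomorph M E3}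
    (he : e ∈ IsManifold.maximalAtlas (𝓡 3) ∞ M) {ρ : M → ℝ} (hρ : ∀ x y, ρ y ≤ ρ x + dist x y)
    {ν : E3} {r k : ℝ} {v : ℂ → E3} {V : Set ℂ} (hV : IsOpen V) (hv : ContDiffOn ℝ ∞ v V) {z : ℂ}
    (hz : z ∈ V) (hvz : v z ∈ e.target) (hone : gram e (v z) ν ν = 1)
    (h : HasBarrier e ρ (v z) ν r k) {w : ℂ → ℝ} (hw : ContDiffOn ℝ ∞ w V)
    (hmin : ∀ᶠ ζ in 𝓝 z, r + (w ζ - w z) ≤ ρ (e.symm (v ζ))) :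
    (∀ η, gram e (v z) ν (fderiv ℝ v z η) = fderiv ℝ w z η) ∧
    ∀ η, fderiv ℝ (fderiv ℝ w) z η η ≤ gram e (v z) ν (fderiv ℝ (fderiv ℝ v) z η η)
      + koszul (gram e) (v z) (fderiv ℝ v z η) (fderiv ℝ v z η) ν
      - k * (gram e (v z) (fderiv ℝ v z η) (fderiv ℝ v z η) - fderiv ℝ w z η ^ 2) := by
  set y := v z with hy
  set A := fderiv ℝ v z with hA
  set S := (1 / 2 : ℝ) • fderiv ℝ (fderiv ℝ v) z with hS
  set ℓ := gram e y ν with hℓ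
  have hvexp : ∀ ε > 0, ∀ᶠ ζ in 𝓝 (0 : ℂ), ‖(v (z + ζ) - y) - A ζ - S ζ ζ‖ ≤ ε * ‖ζ‖ ^ 2 :=
    fun ε hε => hv.eventually_expansion hV hz hε
  have htend : Filter.Tendsto (fun ζ : ℂ => z + ζ) (𝓝 0) (𝓝 z) := by
    have : Continuous fun ζ : ℂ => z + ζ := by fun_prop
    simpa using this.tendsto 0
  have hray : ∀ η : ℂ, Filter.Tendsto (fun t : ℝ => t • η) (𝓝[>] 0) (𝓝 0) := fun η => by
    have : Continuous fun t : ℝ => t • η := by fun_prop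
    have h1 := this.tendsto 0
    rw [zero_smul] at h1
    exact h1.mono_left nhdsWithin_le_nhds
  -- the consequence of a second order bound along a ray
  have hkey : ∀ (Q : E3 →L[ℝ] E3 →L[ℝ] ℝ) (f : E3 → ℝ),
      (∀ ε > 0, ∀ᶠ ξ in 𝓝 (0 : E3), f ξ ≤ r + ℓ ξ + Q ξ ξ + ε * ‖ξ‖ ^ 2) → ∀ η : ℂ,
      (∀ᶠ t : ℝ in 𝓝[>] 0, ρ (e.symm (v (z + t • η))) = f (v (z + t • η) - y)) →
      0 ≤ ℓ (A η) - fderiv ℝ w z η ∧ (ℓ (A η) - fderiv ℝ w z η = 0 →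
        0 ≤ ℓ (S η η) + Q (A η) (A η) - 1 / 2 * fderiv ℝ (fderiv ℝ w) z η η) := by
    intro Q f hf η hfη
    refine nonneg_of_eventually_nonneg_taylor fun ε hε => ?_
    set ε' := ε / (2 * (‖η‖ ^ 2 + 1)) with hε'
    have hε'0 : 0 < ε' := by positivity
    have h1 := (hray η).eventually (eventually_le_comp_of_expansion hf hvexp hε'0)
    have h2 := (hray η).eventually (hw.eventually_expansion hV hz hε'0)
    have h3 := (hray η).eventually (htend.eventually hmin)
    filter_upwards [h1, h2, h3, hfη] with t k1 k2 k3 k4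
    have k5 := (abs_le.1 k2).1
    rw [k4] at k3
    have e1 : ‖t • η‖ ^ 2 = t ^ 2 * ‖η‖ ^ 2 := by rw [norm_smul, mul_pow, Real.norm_eq_abs, sq_abs]
    simp only [map_smul, map_add, _root_.smul_apply, smul_eq_mul, e1] at k1 k5
    have k6 : 2 * ε' * (t ^ 2 * ‖η‖ ^ 2) ≤ ε * t ^ 2 := by
      have : 2 * ε' * (‖η‖ ^ 2 + 1) = ε := by rw [hε']; field_simp
      have i1 : 2 * ε' * (t ^ 2 * ‖η‖ ^ 2) ≤ 2 * ε' * (t ^ 2 * (‖η‖ ^ 2 + 1)) := by gcongr; linarith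
      calc _ ≤ _ := i1
        _ = 2 * ε' * (‖η‖ ^ 2 + 1) * t ^ 2 := by ring
        _ = _ := by rw [this]
    linarith
  obtain ⟨C, hC⟩ := id h
  obtain ⟨Q, hQ⟩ := exists_bilin_eq e y ν k C
  have hf : ∀ ε > 0, ∀ᶠ ξ in 𝓝 (0 : E3), ρ (e.symm (y + ξ)) ≤ r + ℓ ξ + Q ξ ξ + ε * ‖ξ‖ ^ 2 := by
    intro ε hε
    filter_upwards [hC ε hε] with ξ hξ
    rw [hQ]
    linarith
  have hfη : ∀ η : ℂ, ∀ᶠ t : ℝ in 𝓝[>] 0, ρ (e.symm (v (z + t • η)))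
      = ρ (e.symm (y + (v (z + t • η) - y))) := fun η =>
    Filter.Eventually.of_forall fun t => by rw [add_sub_cancel]
  have hfirst : ∀ η, ℓ (A η) = fderiv ℝ w z η := by
    intro η
    have h1 := (hkey Q (fun ξ => ρ (e.symm (y + ξ))) hf η (hfη η)).1
    have h2 := (hkey Q (fun ξ => ρ (e.symm (y + ξ))) hf (-η) (hfη (-η))).1
    simp only [map_neg] at h2
    linarith
  refine ⟨hfirst, ?_⟩
  have hpos : ∀ η, 0 < ℓ (A η) → 0 ≤ ℓ (S η η) + (1 / 2 * koszul (gram e) y (A η) (A η) ν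
      - k / 2 * gram e y (A η) (A η) + k / 2 * ℓ (A η) ^ 2)
      - 1 / 2 * fderiv ℝ (fderiv ℝ w) z η η := by
    intro η hη
    obtain ⟨Q', hQ'⟩ := exists_bilin_eq e y ν k (k / 2)
    rw [← hQ']
    classical
    refine (hkey Q' (fun ξ => if 0 ≤ ℓ ξ then ρ (e.symm (y + ξ)) else r + ℓ ξ + Q' ξ ξ)
      (fun ε hε => ?_) η ?_).2 (by rw [hfirst η, sub_self])
    · filter_upwards [h.eventually_le_of_nonneg he hρ hvz hone hε] with ξ hξ
      split_ifs with h0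
      · have := hξ h0
        rw [hQ']
        linarith
      · have : 0 ≤ ε * ‖ξ‖ ^ 2 := by positivity
        linarith
    · have h1 := (hray η).eventually (hvexp 1 one_pos)
      set c := ‖ℓ‖ * ((‖S‖ + 1) * ‖η‖ ^ 2) with hc
      have hc0 : 0 ≤ c := by positivity
      have h2 : ∀ᶠ t in 𝓝[>] (0 : ℝ), t < ℓ (A η) / (c + 1) :=
        (gt_mem_nhds (by positivity)).filter_mono nhdsWithin_le_nhds
      filter_upwards [h1, h2, self_mem_nhdsWithin] with t k1 k2 k3
      have ht0 : 0 < t := k3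
      rw [lt_div_iff₀ (by positivity)] at k2
      rw [if_pos, add_sub_cancel]
      set R := (v (z + t • η) - y) - A (t • η) - S (t • η) (t • η) with hR
      have e1 : ‖t • η‖ ^ 2 = t ^ 2 * ‖η‖ ^ 2 := by
        rw [norm_smul, mul_pow, Real.norm_eq_abs, sq_abs]
      have e2 : v (z + t • η) - y = t • A η + (S (t • η) (t • η) + R) := by
        rw [hR, ← map_smul]; abel
      have k4 : ‖S (t • η) (t • η) + R‖ ≤ (‖S‖ + 1) * (t ^ 2 * ‖η‖ ^ 2) := by
        refine (norm_add_le _ _).trans ?_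
        have i1 := norm_bilin_le S (a := t • η) (b := t • η) le_rfl le_rfl le_rfl
        rw [← e1]
        linarith
      have k5 := (abs_le.1 (norm_lin_le ℓ le_rfl k4)).1
      have k6 : t * (t * (c + 1)) ≤ t * ℓ (A η) := mul_le_mul_of_nonneg_left k2.le ht0.le
      rw [e2, map_add, map_smul, smul_eq_mul]
      have k7 : ‖ℓ‖ * ((‖S‖ + 1) * (t ^ 2 * ‖η‖ ^ 2)) = t * (t * c) := by rw [hc]; ring
      have k8 := sq_nonneg t
      linarith
  intro η
  have e1 : ℓ (S η η) = 1 / 2 * ℓ (fderiv ℝ (fderiv ℝ v) z η η) := by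
    rw [hS]
    simp only [_root_.smul_apply, map_smul, smul_eq_mul]
  rw [← hfirst η]
  rcases lt_trichotomy (ℓ (A η)) 0 with hlt | heq | hgt
  · have h1 := hpos (-η) (by rw [map_neg, map_neg]; linarith)
    simp only [map_neg, _root_.neg_apply, neg_neg, neg_sq] at h1
    linarith
  · have h1 := (hkey Q (fun ξ => ρ (e.symm (y + ξ))) hf η (hfη η)).2
      (by rw [hfirst η, sub_self])
    have h2 : gram e y ν (A η) = 0 := heq
    rw [hQ, h2] at h1
    rw [heq]
    linarith
  · have h1 := hpos η hgt
    linarith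

end SecondDerivativeTest

section StrongMaximumPrinciple

theorem hasFDerivAt_exp_neg_norm_sq (κ : ℝ) (z₁ ζ : ℂ) :
    HasFDerivAt (fun ζ : ℂ => Real.exp (-κ * ‖ζ - z₁‖ ^ 2))
      ((-2 * κ * Real.exp (-κ * ‖ζ - z₁‖ ^ 2)) • innerSL ℝ (ζ - z₁)) ζ := by
  have h1 : HasFDerivAt (fun ζ : ℂ => ‖ζ - z₁‖ ^ 2) (2 • innerSL ℝ (ζ - z₁)) ζ := by
    have := (hasStrictFDerivAt_norm_sq (ζ - z₁)).hasFDerivAt.comp ζ ((hasFDerivAt_id ζ).sub_const z₁)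
    exact this
  refine (h1.const_mul (-κ)).exp.congr_fderiv ?_
  ext
  all_goals
    simp
    ring

theorem fderiv_fderiv_exp_neg_norm_sq (κ : ℝ) (z₁ ζ η : ℂ) :
    fderiv ℝ (fderiv ℝ fun ζ : ℂ => Real.exp (-κ * ‖ζ - z₁‖ ^ 2)) ζ η η
      = (4 * κ ^ 2 * inner ℝ (ζ - z₁) η ^ 2 - 2 * κ * ‖η‖ ^ 2)
        * Real.exp (-κ * ‖ζ - z₁‖ ^ 2) := by
  have h1 : fderiv ℝ (fun ζ : ℂ => Real.exp (-κ * ‖ζ - z₁‖ ^ 2))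
      = fun ζ => (-2 * κ * Real.exp (-κ * ‖ζ - z₁‖ ^ 2)) • innerSL ℝ (ζ - z₁) :=
    funext fun ζ => (hasFDerivAt_exp_neg_norm_sq κ z₁ ζ).fderiv
  have h2 : HasFDerivAt (fun ζ : ℂ => innerSL ℝ (ζ - z₁)) (innerSL ℝ (E := ℂ)) ζ :=
    (innerSL ℝ (E := ℂ)).hasFDerivAt.comp ζ ((hasFDerivAt_id ζ).sub_const z₁)
  have h3 := ((hasFDerivAt_exp_neg_norm_sq κ z₁ ζ).const_mul (-2 * κ)).smul h2
  rw [h1]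
  refine (congrArg (fun L : ℂ →L[ℝ] ℂ →L[ℝ] ℝ => L η η) h3.fderiv).trans ?_
  simp only [_root_.add_apply, _root_.smul_apply, ContinuousLinearMap.smulRight_apply, smul_eq_mul,
    innerSL_apply_apply]
  have h4 : innerSL ℝ (E := ℂ) η η = ‖η‖ ^ 2 := real_inner_self_eq_norm_sq η
  linear_combination (-2 * κ * Real.exp (-κ * ‖ζ - z₁‖ ^ 2)) * h4

/-- The strong minimum principle of Hopf, for functions satisfying a differential inequality in the
sense of smooth functions touching from below: the set where such a function attains a lower bound
is open. -/
theorem isOpen_setOf_eq_of_touching {V : Set ℂ} (hV : IsOpen V) {h : ℂ → ℝ} (hh : ContinuousOn h V)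
    {r : ℝ} (hr : ∀ z ∈ V, r ≤ h z) {b₁ b₂ : ℂ → ℝ} (hb₁ : ContinuousOn b₁ V)
    (hb₂ : ContinuousOn b₂ V)
    (hmp : ∀ z ∈ V, ∀ w : ℂ → ℝ, ContDiff ℝ ∞ w → (∀ᶠ ζ in 𝓝 z, h z + (w ζ - w z) ≤ h ζ) →
      fderiv ℝ (fderiv ℝ w) z 1 1 + fderiv ℝ (fderiv ℝ w) z Complex.I Complex.I
        + (b₁ z * fderiv ℝ w z 1 + b₂ z * fderiv ℝ w z Complex.I) ≤ 0) :
    IsOpen {z | z ∈ V ∧ h z = r} := by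
  rw [isOpen_iff_mem_nhds]
  by_contra! hcon
  obtain ⟨z₀, ⟨hz₀V, hz₀⟩, hz₀n⟩ := hcon
  obtain ⟨δ, hδ, hball⟩ := Metric.isOpen_iff.1 hV z₀ hz₀V
  have h1 : ¬ Metric.ball z₀ (δ / 4) ⊆ {z | z ∈ V ∧ h z = r} := fun h =>
    hz₀n (Filter.mem_of_superset (Metric.ball_mem_nhds _ (by positivity)) h)
  obtain ⟨z₁, hz₁, hz₁n⟩ := not_subset.1 h1
  rw [Metric.mem_ball] at hz₁
  -- a disc around `z₁` whose boundary meets the set where the bound is attained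
  have hVball : Metric.closedBall z₁ (δ / 4) ⊆ V := fun z hz => hball (by
    rw [Metric.mem_closedBall] at hz
    rw [Metric.mem_ball]
    linarith [dist_triangle z z₁ z₀])
  have hz₁V : z₁ ∈ V := hVball (Metric.mem_closedBall_self (by positivity))
  have hK : IsCompact (Metric.closedBall z₁ (δ / 4) ∩ h ⁻¹' {r}) :=
    (isCompact_closedBall z₁ (δ / 4)).of_isClosed_subset
      ((hh.mono hVball).preimage_isClosed_of_isClosed Metric.isClosed_closedBall isClosed_singleton)
      inter_subset_left
  obtain ⟨p, ⟨hpb, hpr⟩, hpmin⟩ := hK.exists_isMinOn (f := fun z => dist z z₁)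
    ⟨z₀, by rw [Metric.mem_closedBall, dist_comm]; exact hz₁.le, hz₀⟩ (by fun_prop)
  have hpr' : h p = r := hpr
  have hpV : p ∈ V := hVball hpb
  set R := dist p z₁ with hR
  have hR0 : 0 < R := by
    refine dist_pos.2 fun hp => hz₁n ⟨hz₁V, ?_⟩
    rw [← hp, hpr']
  have hRδ : R ≤ δ / 4 := hpb
  have hins : ∀ ζ, dist ζ z₁ < R → r < h ζ := by
    intro ζ hζ
    have hζb : ζ ∈ Metric.closedBall z₁ (δ / 4) := (hζ.trans_le hRδ).le
    refine (hr ζ (hVball hζb)).lt_of_ne' fun heq => ?_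
    have : R ≤ dist ζ z₁ := hpmin ⟨hζb, heq⟩
    linarith
  -- a smaller disc, whose closure meets this set in `p` only
  set z₂ := midpoint ℝ z₁ p with hz₂
  have hd1 : dist p z₂ = R / 2 := by
    rw [hz₂, dist_right_midpoint, Real.norm_of_nonneg (by norm_num), dist_comm z₁ p]
    ring
  have hin : ∀ ζ, dist ζ z₂ ≤ R / 2 → ζ ≠ p → r < h ζ := by
    intro ζ hζ hne
    refine hins ζ ?_
    have e1 := parallelogram_law_with_norm ℝ (ζ - z₁) (ζ - p)
    have e2 : (ζ - z₁) + (ζ - p) = (2 : ℝ) • (ζ - z₂) := by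
      rw [hz₂, midpoint_eq_smul_add, invOf_eq_inv]; module
    have e3 : (ζ - z₁) - (ζ - p) = p - z₁ := by abel
    rw [e2, e3, norm_smul, ← dist_eq_norm, ← dist_eq_norm, ← dist_eq_norm, ← dist_eq_norm,
      Real.norm_of_nonneg (by norm_num), ← hR] at e1
    have h2 : 0 < dist ζ p := dist_pos.2 hne
    have h3 : dist ζ z₂ ^ 2 ≤ (R / 2) ^ 2 := by gcongr
    have h4 : 0 < dist ζ p ^ 2 := by positivity
    exact lt_of_pow_lt_pow_left₀ 2 hR0.le (by linarith)
  have hsub : Metric.closedBall p (R / 4) ⊆ V := fun z hz => hball (by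
    rw [Metric.mem_closedBall] at hz
    rw [Metric.mem_ball]
    linarith [dist_triangle z p z₀, dist_triangle p z₁ z₀])
  have hpc : IsCompact (Metric.closedBall p (R / 4)) := isCompact_closedBall _ _
  obtain ⟨B₁, hB₁⟩ := hpc.exists_bound_of_continuousOn (hb₁.mono hsub)
  obtain ⟨B₂, hB₂⟩ := hpc.exists_bound_of_continuousOn (hb₂.mono hsub)
  have hpm : p ∈ Metric.closedBall p (R / 4) := Metric.mem_closedBall_self (by positivity)
  have hB₁0 : 0 ≤ B₁ := (norm_nonneg _).trans (hB₁ p hpm)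
  have hB₂0 : 0 ≤ B₂ := (norm_nonneg _).trans (hB₂ p hpm)
  -- the function exceeds the bound on the part of the circle in the smaller disc
  obtain ⟨m, hm0, hm⟩ : ∃ m > 0, ∀ ζ ∈ Metric.sphere p (R / 4), dist ζ z₂ ≤ R / 2 →
      r + m ≤ h ζ := by
    have hKc : IsCompact (Metric.sphere p (R / 4) ∩ Metric.closedBall z₂ (R / 2)) :=
      (isCompact_sphere p (R / 4)).inter_right Metric.isClosed_closedBall
    rcases (Metric.sphere p (R / 4) ∩ Metric.closedBall z₂ (R / 2)).eq_empty_or_nonempty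
      with hemp | hne
    · refine ⟨1, one_pos, fun ζ h2 h3 => ?_⟩
      have : ζ ∈ (∅ : Set ℂ) := hemp ▸ ⟨h2, h3⟩
      exact this.elim
    · obtain ⟨q, hq, hqmin⟩ := hKc.exists_isMinOn hne
        (hh.mono fun z hz => hsub (Metric.sphere_subset_closedBall hz.1))
      refine ⟨h q - r, sub_pos.2 (hin q hq.2 ?_), fun ζ h2 h3 => ?_⟩
      · rintro rfl
        have := hq.1
        rw [Metric.mem_sphere, dist_self] at this
        linarith
      · rw [add_sub_cancel]
        exact hqmin ⟨h2, h3⟩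
  -- `κ` is large, so that the second derivatives of the comparison function prevail
  set κ := (2 + (B₁ + B₂) * (3 / 4 * R)) / (R / 4) ^ 2 with hκ
  have hκ0 : 0 < κ := by positivity
  set g : ℂ → ℝ := fun ζ => Real.exp (-κ * ‖ζ - z₂‖ ^ 2) with hg
  set w : ℂ → ℝ := fun ζ => m * g ζ with hw
  have hwp : w p = m * Real.exp (-κ * (R / 2) ^ 2) := by
    simp only [hw, hg, ← dist_eq_norm, hd1]
  have hgs : ContDiff ℝ ∞ g := by
    refine Real.contDiff_exp.comp (contDiff_const.mul ?_)
    exact (contDiff_id.sub contDiff_const).norm_sq ℝ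
  have hws : ContDiff ℝ ∞ w := contDiff_const.mul hgs
  have hcirc : ∀ ζ ∈ Metric.sphere p (R / 4), h p - w p ≤ h ζ - w ζ := by
    intro ζ hζ
    rw [hpr']
    rcases le_total (dist ζ z₂) (R / 2) with h2 | h2
    · have h3 := hm ζ hζ h2
      have h4 : g ζ ≤ 1 := Real.exp_le_one_iff.2 (by
        have := mul_nonneg hκ0.le (sq_nonneg ‖ζ - z₂‖)
        linarith)
      have h5 : w ζ ≤ m * 1 := by simp only [hw]; gcongr
      have h6 : 0 ≤ w p := by rw [hwp]; positivity
      linarith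
    · have h3 := hr ζ (hsub (Metric.sphere_subset_closedBall hζ))
      have h4 : w ζ ≤ w p := by
        rw [hwp]
        simp only [hw, hg, ← dist_eq_norm]
        refine mul_le_mul_of_nonneg_left (Real.exp_le_exp.2 ?_) hm0.le
        rw [neg_mul, neg_mul, neg_le_neg_iff]
        gcongr
      linarith
  obtain ⟨q, hq, hqmin⟩ : ∃ q ∈ Metric.ball p (R / 4),
      ∀ ζ ∈ Metric.closedBall p (R / 4), h q - w q ≤ h ζ - w ζ := by
    obtain ⟨q, hq, hqmin⟩ := hpc.exists_isMinOn ⟨p, hpm⟩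
      ((hh.mono hsub).sub hws.continuous.continuousOn)
    rcases (Metric.mem_closedBall.1 hq).eq_or_lt with h2 | h2
    · exact ⟨p, Metric.mem_ball_self (by positivity), fun ζ hζ => (hcirc q h2).trans (hqmin hζ)⟩
    · exact ⟨q, h2, fun ζ hζ => hqmin hζ⟩
  have hqV := hsub (Metric.ball_subset_closedBall hq)
  have key := hmp q hqV w hws (by
    filter_upwards [Metric.isOpen_ball.mem_nhds hq] with ζ hζ
    linarith [hqmin ζ (Metric.ball_subset_closedBall hζ)])
  -- the comparison function is a strict subsolution
  have hfg : ∀ ζ, HasFDerivAt w (m • fderiv ℝ g ζ) ζ := fun ζ =>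
    ((hasFDerivAt_exp_neg_norm_sq κ z₂ ζ).differentiableAt.hasFDerivAt).const_mul m
  have hfw : fderiv ℝ w = fun ζ => m • fderiv ℝ g ζ := funext fun ζ => (hfg ζ).fderiv
  have hfd : DifferentiableAt ℝ (fderiv ℝ g) q :=
    (hgs.fderiv_right (m := ∞) (by norm_num)).differentiable (by norm_num) q
  have hfw2 : fderiv ℝ (fderiv ℝ w) q = m • fderiv ℝ (fderiv ℝ g) q := by
    rw [hfw]
    exact (hfd.hasFDerivAt.const_smul m).fderiv
  have hg0 : 0 < g q := Real.exp_pos _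
  have i1 := fderiv_fderiv_exp_neg_norm_sq κ z₂ q 1
  have i2 := fderiv_fderiv_exp_neg_norm_sq κ z₂ q Complex.I
  have i3 : fderiv ℝ g q = _ := (hasFDerivAt_exp_neg_norm_sq κ z₂ q).fderiv
  change fderiv ℝ (fderiv ℝ g) q 1 1 = _ * g q at i1
  change fderiv ℝ (fderiv ℝ g) q Complex.I Complex.I = _ * g q at i2
  change _ = (-2 * κ * g q) • _ at i3
  set x := (q - z₂).re with hx
  set y := (q - z₂).im with hy
  have j1 : inner ℝ (q - z₂) (1 : ℂ) = x := by simp [Complex.inner, hx]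
  have j2 : inner ℝ (q - z₂) Complex.I = y := by
    simp only [Complex.inner, hy, Complex.mul_re, Complex.conj_re, Complex.conj_im, Complex.I_re,
      Complex.I_im]
    ring
  have j3 : ‖q - z₂‖ ^ 2 = x ^ 2 + y ^ 2 := by
    rw [Complex.sq_norm, Complex.normSq_apply]; ring
  have hqd := hq
  rw [Metric.mem_ball] at hqd
  have j4 : R / 4 ≤ ‖q - z₂‖ := by
    rw [← dist_eq_norm]
    have := dist_triangle_left p z₂ q
    linarith
  have j5 : ‖q - z₂‖ ≤ 3 / 4 * R := by
    rw [← dist_eq_norm]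
    linarith [dist_triangle q p z₂]
  have j6 : |x| ≤ 3 / 4 * R := (Complex.abs_re_le_norm _).trans j5
  have j7 : |y| ≤ 3 / 4 * R := (Complex.abs_im_le_norm _).trans j5
  rw [hfw2, (hfg q).fderiv, i3] at key
  simp only [_root_.smul_apply, smul_eq_mul, i1, i2, innerSL_apply_apply, j1, j2, norm_one,
    Complex.norm_I] at key
  have k1 : b₁ q * x ≤ B₁ * (3 / 4 * R) := by
    refine (le_abs_self _).trans ?_
    rw [abs_mul]
    have := hB₁ q (Metric.ball_subset_closedBall hq)
    rw [Real.norm_eq_abs] at this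
    gcongr
  have k2 : b₂ q * y ≤ B₂ * (3 / 4 * R) := by
    refine (le_abs_self _).trans ?_
    rw [abs_mul]
    have := hB₂ q (Metric.ball_subset_closedBall hq)
    rw [Real.norm_eq_abs] at this
    gcongr
  have k3 : 2 + (B₁ + B₂) * (3 / 4 * R) ≤ κ * (x ^ 2 + y ^ 2) := by
    have l1 : κ * (R / 4) ^ 2 = 2 + (B₁ + B₂) * (3 / 4 * R) := by
      rw [hκ]; field_simp
    rw [← l1, ← j3]
    gcongr
  have k4 : 0 < 2 * κ * m * g q * (2 * (κ * (x ^ 2 + y ^ 2)) - 2 - (b₁ q * x + b₂ q * y)) := by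
    refine mul_pos (by positivity) ?_
    have : 0 ≤ (B₁ + B₂) * (3 / 4 * R) := by positivity
    linarith
  linarith

end StrongMaximumPrinciple

/-! ### Contact forms in charts -/

section ExteriorDerivative

variable {E F : Type*} [NormedAddCommGroup E] [NormedSpace ℝ E] [NormedAddCommGroup F]
  [NormedSpace ℝ F]

/-- The exterior derivative of a 1-form on a vector space. -/
noncomputable def formDeriv (A : E → E →L[ℝ] ℝ) (y : E) : E →L[ℝ] E →L[ℝ] ℝ :=
  fderiv ℝ A y - (fderiv ℝ A y).flip

theorem formDeriv_apply (A : E → E →L[ℝ] ℝ) (y u w : E) :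
    formDeriv A y u w = fderiv ℝ A y u w - fderiv ℝ A y w u := rfl

theorem formDeriv_swap (A : E → E →L[ℝ] ℝ) (y u w : E) :
    formDeriv A y u w = -formDeriv A y w u := by
  rw [formDeriv_apply, formDeriv_apply]; ring

theorem formDeriv_of_pullback {A : E → E →L[ℝ] ℝ} {A' : F → F →L[ℝ] ℝ} {σ : F → E} {y : F}
    (hσ : ContDiffAt ℝ ∞ σ y) (hA : DifferentiableAt ℝ A (σ y)) (hA' : DifferentiableAt ℝ A' y)
    (hAA' : ∀ᶠ z in 𝓝 y, ∀ u, A' z u = A (σ z) (fderiv ℝ σ z u)) (u w : F) :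
    formDeriv A' y u w = formDeriv A (σ y) (fderiv ℝ σ y u) (fderiv ℝ σ y w) := by
  have h1 : HasFDerivAt σ (fderiv ℝ σ y) y := (hσ.differentiableAt (by simp)).hasFDerivAt
  have h2 : HasFDerivAt (fderiv ℝ σ) (fderiv ℝ (fderiv ℝ σ) y) y :=
    ((hσ.fderiv_right (m := ∞) (by simp)).differentiableAt (by simp)).hasFDerivAt
  have hs : IsSymmSndFDerivAt ℝ σ y := hσ.isSymmSndFDerivAt
    (by rw [minSmoothness_of_isRCLikeNormedField]; exact ENat.LEInfty.out)
  have key : ∀ a b : F, fderiv ℝ A' y a b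
      = fderiv ℝ A (σ y) (fderiv ℝ σ y a) (fderiv ℝ σ y b)
        + A (σ y) (fderiv ℝ (fderiv ℝ σ) y a b) := by
    intro a b
    have i1 := hA'.hasFDerivAt.clm_apply (hasFDerivAt_const b y)
    have i2 := (hA.hasFDerivAt.comp y h1).clm_apply (h2.clm_apply (hasFDerivAt_const b y))
    have i3 : (fun z => A' z b) =ᶠ[𝓝 y] fun z => A (σ z) (fderiv ℝ σ z b) := by
      filter_upwards [hAA'] with z hz using hz b
    have i4 := congrArg (fun L => L a) (i1.unique (i2.congr_of_eventuallyEq i3))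
    simp at i4
    linarith
  rw [formDeriv_apply, formDeriv_apply, key, key, hs.eq w u]
  ring

/-- The exterior derivative of an exterior derivative vanishes. -/
theorem fderiv_formDeriv_cyclic {A : E → E →L[ℝ] ℝ} {y : E} (hA : ContDiffAt ℝ ∞ A y) (u v w : E) :
    fderiv ℝ (formDeriv A) y u v w + fderiv ℝ (formDeriv A) y v w u
      + fderiv ℝ (formDeriv A) y w u v = 0 := by
  have h2 : HasFDerivAt (fderiv ℝ A) (fderiv ℝ (fderiv ℝ A) y) y :=
    ((hA.fderiv_right (m := ∞) (by simp)).differentiableAt (by simp)).hasFDerivAt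
  have hs : IsSymmSndFDerivAt ℝ A y := hA.isSymmSndFDerivAt
    (by rw [minSmoothness_of_isRCLikeNormedField]; exact ENat.LEInfty.out)
  have h3 : HasFDerivAt (formDeriv A) (fderiv ℝ (fderiv ℝ A) y
      - ((ContinuousLinearMap.flipₗᵢ ℝ E E ℝ).toContinuousLinearEquiv.toContinuousLinearMap).comp
        (fderiv ℝ (fderiv ℝ A) y)) y :=
    h2.sub ((ContinuousLinearMap.flipₗᵢ ℝ E E
      ℝ).toContinuousLinearEquiv.toContinuousLinearMap.hasFDerivAt.comp y h2)
  have key : ∀ a b c : E, fderiv ℝ (formDeriv A) y a b c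
      = fderiv ℝ (fderiv ℝ A) y a b c - fderiv ℝ (fderiv ℝ A) y a c b := by
    intro a b c
    rw [h3.fderiv]
    rfl
  rw [key, key, key, hs.eq v u, hs.eq w u, hs.eq w v]
  ring

end ExteriorDerivative

section ContactForm

variable {M : Type*} [MetricSpace M] [ChartedSpace E3 M]

/-- The 1-form `α` in the coordinates of the chart `e`. -/
noncomputable def chartForm (e : OpenPartialHomeomorph M E3)
    (α : ∀ x : M, TangentSpace (𝓡 3) x →ₗ[ℝ] ℝ) (y : E3) : E3 →L[ℝ] ℝ :=
  ∑ i, formCoeff e α i y • (EuclideanSpace.proj i : E3 →L[ℝ] ℝ)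

theorem chartForm_apply (e : OpenPartialHomeomorph M E3)
    (α : ∀ x : M, TangentSpace (𝓡 3) x →ₗ[ℝ] ℝ) (y u : E3) :
    chartForm e α y u = α (e.symm y) (mfderiv (𝓡 3) (𝓡 3) e.symm y u) := by
  have h1 : ∀ f : E3 →ₗ[ℝ] ℝ, f u = ∑ i, f (stdVec i) * u i := by
    intro f
    conv_lhs => rw [E3.sum_stdVec u]
    rw [map_sum]
    exact Finset.sum_congr rfl fun i _ => by rw [map_smul, smul_eq_mul, mul_comm]
  have h2 := h1 ((α (e.symm y)).comp (mfderiv (𝓡 3) (𝓡 3) e.symm y).toLinearMap)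
  refine Eq.trans ?_ h2.symm
  simp only [chartForm, formCoeff, coordVec, _root_.sum_apply, _root_.smul_apply, smul_eq_mul]
  rfl

theorem fderiv_chartForm_stdVec {e : OpenPartialHomeomorph M E3}
    {α : ∀ x : M, TangentSpace (𝓡 3) x →ₗ[ℝ] ℝ} {y : E3}
    (hA : DifferentiableAt ℝ (chartForm e α) y) (i j : Fin 3) :
    fderiv ℝ (chartForm e α) y (stdVec i) (stdVec j) = partialD i (formCoeff e α j) y := by
  have h1 : formCoeff e α j = fun z => chartForm e α z (stdVec j) := by
    funext z
    rw [chartForm_apply]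
    rfl
  have h2 := hA.hasFDerivAt.clm_apply (hasFDerivAt_const (stdVec j) y)
  rw [partialD, h1, h2.fderiv]
  simp

variable [IsManifold (𝓡 3) ∞ M] [RiemannianBundle (fun x : M => TangentSpace (𝓡 3) x)]
  [IsContMDiffRiemannianBundle (𝓡 3) ∞ E3 (fun x : M => TangentSpace (𝓡 3) x)]
  [IsRiemannianManifold (𝓡 3) M]

theorem IsContactForm.contDiffOn_chartForm {α : ∀ x : M, TangentSpace (𝓡 3) x →ₗ[ℝ] ℝ}
    (hα : IsContactForm α) {e : OpenPartialHomeomorph M E3}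
    (he : e ∈ IsManifold.maximalAtlas (𝓡 3) ∞ M) : ContDiffOn ℝ ∞ (chartForm e α) e.target :=
  ContDiffOn.sum fun i _ => (hα.smooth e he i).smul contDiffOn_const

theorem IsContactForm.differentiableAt_chartForm {α : ∀ x : M, TangentSpace (𝓡 3) x →ₗ[ℝ] ℝ}
    (hα : IsContactForm α) {e : OpenPartialHomeomorph M E3}
    (he : e ∈ IsManifold.maximalAtlas (𝓡 3) ∞ M) {y : E3} (hy : y ∈ e.target) :
    DifferentiableAt ℝ (chartForm e α) y :=
  ((hα.contDiffOn_chartForm he).contDiffAt (e.open_target.mem_nhds hy)).differentiableAt (by simp)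

theorem chartForm_chartVec {e : OpenPartialHomeomorph M E3}
    (he : e ∈ IsManifold.maximalAtlas (𝓡 3) ∞ M) {α : ∀ x : M, TangentSpace (𝓡 3) x →ₗ[ℝ] ℝ}
    {x : M} (hx : x ∈ e.source) (v : TangentSpace (𝓡 3) x) :
    chartForm e α (e x) (chartVec e x v) = α x v := by
  have h : ∀ (z : M) (_ : z = x) (v₁ : TangentSpace (𝓡 3) z) (v₂ : TangentSpace (𝓡 3) x),
      (show E3 from v₁) = (show E3 from v₂) → α z v₁ = α x v₂ := by
    rintro z rfl v₁ v₂ h1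
    exact congrArg (fun a : TangentSpace (𝓡 3) z => α z a) h1
  exact (chartForm_apply e α _ _).trans (h _ (e.left_inv hx) _ _ (mfderiv_symm_chartVec he hx v))

theorem chartForm_transition {e e' : OpenPartialHomeomorph M E3}
    (he : e ∈ IsManifold.maximalAtlas (𝓡 3) ∞ M) (he' : e' ∈ IsManifold.maximalAtlas (𝓡 3) ∞ M)
    (α : ∀ x : M, TangentSpace (𝓡 3) x →ₗ[ℝ] ℝ) {z : E3} (hz : z ∈ (e'.symm.trans e).source)
    (u : E3) :
    chartForm e' α z u = chartForm e α ((e ∘ e'.symm) z) (fderiv ℝ (e ∘ e'.symm) z u) :=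
  (chartForm_apply e' α z u).trans ((chartForm_chartVec he hz.2 _).symm.trans
    (congrArg (fun v : E3 => chartForm e α (e (e'.symm z)) v) (chartVec_mfderiv_symm he he' hz u)))

/-- The exterior derivative of a contact form can be computed in any chart. -/
theorem IsContactForm.dForm_eq {α : ∀ x : M, TangentSpace (𝓡 3) x →ₗ[ℝ] ℝ} (hα : IsContactForm α)
    {e : OpenPartialHomeomorph M E3} (he : e ∈ IsManifold.maximalAtlas (𝓡 3) ∞ M) {x : M}
    (hx : x ∈ e.source) (v w : TangentSpace (𝓡 3) x) :
    dForm α x v w = formDeriv (chartForm e α) (e x) (chartVec e x v) (chartVec e x w) := by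
  set e' := chartAt E3 x with he'_def
  have he' : e' ∈ IsManifold.maximalAtlas (𝓡 3) ∞ M := IsManifold.chart_mem_maximalAtlas x
  have hx' : x ∈ e'.source := mem_chart_source E3 x
  have hy' : e' x ∈ e'.target := e'.map_source hx'
  have hA' := hα.differentiableAt_chartForm he' hy'
  have h1 : dForm α x v w
      = formDeriv (chartForm e' α) (e' x) (chartVec e' x v) (chartVec e' x w) := by
    have h2 : ∀ B : E3 →L[ℝ] E3 →L[ℝ] ℝ, ∀ a b : E3,
        B a b = ∑ i, ∑ j, B (stdVec i) (stdVec j) * a i * b j := by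
      intro B a b
      conv_lhs => rw [E3.sum_stdVec a, E3.sum_stdVec b]
      simp only [map_sum, map_smul, _root_.sum_apply, _root_.smul_apply, smul_eq_mul,
        Finset.mul_sum]
      rw [Finset.sum_comm]
      exact Finset.sum_congr rfl fun i _ => Finset.sum_congr rfl fun j _ => by ring
    rw [h2]
    refine Finset.sum_congr rfl fun i _ => Finset.sum_congr rfl fun j _ => ?_
    rw [formDeriv_apply, fderiv_chartForm_stdVec hA', fderiv_chartForm_stdVec hA']
    rfl
  have hz : e' x ∈ (e'.symm.trans e).source := by
    refine ⟨hy', ?_⟩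
    rw [mem_preimage]
    exact (congrArg (· ∈ e.source) (e'.left_inv hx')).mpr hx
  have hσ : ContDiffAt ℝ ∞ (e ∘ e'.symm) (e' x) :=
    (contDiffOn_transition he he').contDiffAt ((e'.symm.trans e).open_source.mem_nhds hz)
  have hσx : (e ∘ e'.symm) (e' x) = e x := congrArg e (e'.left_inv hx')
  have hy : (e ∘ e'.symm) (e' x) ∈ e.target := by
    rw [hσx]
    exact e.map_source hx
  have h2 : ∀ a : TangentSpace (𝓡 3) x,
      fderiv ℝ (e ∘ e'.symm) (e' x) (chartVec e' x a) = chartVec e x a := by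
    intro a
    refine (chartVec_mfderiv_symm he he' hz _).symm.trans ?_
    have h : ∀ (z : M) (_ : z = x) (v₁ : TangentSpace (𝓡 3) z) (v₂ : TangentSpace (𝓡 3) x),
        (show E3 from v₁) = (show E3 from v₂) → chartVec e z v₁ = chartVec e x v₂ := by
      rintro z rfl v₁ v₂ h1
      exact congrArg (fun a : TangentSpace (𝓡 3) z => chartVec e z a) h1
    exact h _ (e'.left_inv hx') _ _ (mfderiv_symm_chartVec he' hx' a)
  rw [h1, formDeriv_of_pullback hσ (hα.differentiableAt_chartForm he hy) hA'
    (Filter.eventually_of_mem ((e'.symm.trans e).open_source.mem_nhds hz)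
      fun z hz u => chartForm_transition he he' α hz u), h2, h2, hσx]

end ContactForm

/-! ### Calibrations -/

section ContactAlgebra

variable {F : Type*} [NormedAddCommGroup F] [InnerProductSpace ℝ F]

theorem OrthonormalBasis.norm_sq_fin_three (b : OrthonormalBasis (Fin 3) ℝ F) (v : F) :
    ‖v‖ ^ 2 = inner ℝ (b 0) v ^ 2 + inner ℝ (b 1) v ^ 2 + inner ℝ (b 2) v ^ 2 := by
  rw [← b.sum_sq_norm_inner_right v, Fin.sum_univ_three]
  simp only [Real.norm_eq_abs, sq_abs]

theorem OrthonormalBasis.sum_fin_three (b : OrthonormalBasis (Fin 3) ℝ F) (v : F) :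
    v = inner ℝ (b 0) v • b 0 + inner ℝ (b 1) v • b 1 + inner ℝ (b 2) v • b 2 := by
  conv_lhs => rw [← b.sum_repr' v, Fin.sum_univ_three]

theorem OrthonormalBasis.bilin_eq (b : OrthonormalBasis (Fin 3) ℝ F) (β : F →ₗ[ℝ] F →ₗ[ℝ] ℝ)
    (hβ : ∀ v, β v v = 0) (v w : F) :
    β v w = β (b 0) (b 1) * (inner ℝ (b 0) v * inner ℝ (b 1) w - inner ℝ (b 1) v * inner ℝ (b 0) w)
      + β (b 1) (b 2) * (inner ℝ (b 1) v * inner ℝ (b 2) w - inner ℝ (b 2) v * inner ℝ (b 1) w)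
      + β (b 2) (b 0) * (inner ℝ (b 2) v * inner ℝ (b 0) w
        - inner ℝ (b 0) v * inner ℝ (b 2) w) := by
  have hs : ∀ v w, β v w = -β w v := fun v w => by
    have h := hβ (v + w)
    simp only [map_add, LinearMap.add_apply, hβ] at h
    linarith
  conv_lhs => rw [b.sum_fin_three v, b.sum_fin_three w]
  simp only [map_add, map_smul, LinearMap.add_apply, LinearMap.smul_apply, smul_eq_mul, hβ]
  rw [hs (b 1) (b 0), hs (b 2) (b 1), hs (b 0) (b 2)]
  ring

/-- A contact metric structure on an oriented Euclidean vector space of dimension three has the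
normal form `α = b₀*`, `β = θ' b₁* ∧ b₂*` in some orthonormal basis. -/
theorem exists_adapted_basis (hF : Module.finrank ℝ F = 3) {α : F →ₗ[ℝ] ℝ}
    {β : F →ₗ[ℝ] F →ₗ[ℝ] ℝ} (hβ : ∀ v, β v v = 0) {θ' : ℝ}
    (hnd : ∃ b : Fin 3 → F,
      α (b 0) * β (b 1) (b 2) + α (b 1) * β (b 2) (b 0) + α (b 2) * β (b 0) (b 1) ≠ 0)
    (hstar : ∀ b : Fin 3 → F, Orthonormal ℝ b →
      0 < α (b 0) * β (b 1) (b 2) + α (b 1) * β (b 2) (b 0) + α (b 2) * β (b 0) (b 1) →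
      θ' * α (b 0) = β (b 1) (b 2)) {R : F}
    (hR : ∀ v, α v = 1 → (∀ w, β v w = 0) → α R = 1 ∧ ∀ w, β R w = 0) (hR1 : ‖R‖ = 1) :
    ∃ b : OrthonormalBasis (Fin 3) ℝ F, (∀ v, α v = inner ℝ (b 0) v) ∧
      (∀ v w, β v w = θ' * (inner ℝ (b 1) v * inner ℝ (b 2) w - inner ℝ (b 2) v * inner ℝ (b 1) w)) ∧
      R = b 0 := by
  have : FiniteDimensional ℝ F := Module.finite_of_finrank_pos (by rw [hF]; norm_num)
  have hs : ∀ v w, β v w = -β w v := fun v w => by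
    have h := hβ (v + w)
    simp only [map_add, LinearMap.add_apply, hβ] at h
    linarith
  -- the vector dual to `α`
  obtain ⟨A, hA⟩ : ∃ A : F, ∀ v, α v = inner ℝ A v := by
    refine ⟨(InnerProductSpace.toDual ℝ F).symm (LinearMap.toContinuousLinearMap α), fun v => ?_⟩
    rw [InnerProductSpace.toDual_symm_apply]
    rfl
  have hA0 : A ≠ 0 := by
    rintro rfl
    obtain ⟨b, hb⟩ := hnd
    simp [hA] at hb
  set c := ‖A‖ with hc
  have hc0 : 0 < c := norm_pos_iff.2 hA0
  have hAn : A = c • (c⁻¹ • A) := by rw [smul_smul, mul_inv_cancel₀ hc0.ne', one_smul]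
  obtain ⟨b, hb0, hb12⟩ : ∃ b : OrthonormalBasis (Fin 3) ℝ F, b 0 = c⁻¹ • A ∧
      0 < β (b 1) (b 2) := by
    obtain ⟨b, hb⟩ := Orthonormal.exists_orthonormalBasis_extension_of_card_eq (𝕜 := ℝ) (E := F)
      (ι := Fin 3) (by simp [hF]) (v := fun _ => c⁻¹ • A) (s := {0}) (by
        rw [orthonormal_iff_ite]
        rintro ⟨i, hi⟩ ⟨j, hj⟩
        have hij : i = j := hi.trans hj.symm
        subst hij
        simp only [Set.domRestrict_apply, if_true, real_inner_self_eq_norm_sq, norm_smul, norm_inv,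
          norm_norm, hc]
        rw [inv_mul_cancel₀ hc0.ne', one_pow])
    have hb0 := hb 0 rfl
    have hα : ∀ v, α v = c * inner ℝ (b 0) v := fun v => by
      rw [hA, hb0, ← real_inner_smul_left, ← hAn]
    have hne : β (b 1) (b 2) ≠ 0 := by
      intro h0
      obtain ⟨d, hd⟩ := hnd
      refine hd ?_
      rw [hα, hα, hα, b.bilin_eq β hβ (d 1) (d 2), b.bilin_eq β hβ (d 2) (d 0),
        b.bilin_eq β hβ (d 0) (d 1), h0]
      ring
    rcases hne.lt_or_gt with hlt | hgt
    · refine ⟨b.reindex (Equiv.swap 1 2), ?_, ?_⟩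
      · rw [OrthonormalBasis.reindex_apply, Equiv.symm_swap,
          Equiv.swap_apply_of_ne_of_ne (by decide) (by decide), hb0]
      · rw [OrthonormalBasis.reindex_apply, OrthonormalBasis.reindex_apply, Equiv.symm_swap,
          Equiv.swap_apply_left, Equiv.swap_apply_right, hs]
        linarith
    · exact ⟨b, hb0, hgt⟩
  have hα : ∀ v, α v = c * inner ℝ (b 0) v := fun v => by
    rw [hA, hb0, ← real_inner_smul_left, ← hAn]
  have hij : ∀ i j, inner ℝ (b i) (b j) = if i = j then (1 : ℝ) else 0 :=
    orthonormal_iff_ite.1 b.orthonormal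
  have hα0 : α (b 0) = c := by simp [hα]
  have hα1 : α (b 1) = 0 := by simp [hα, hij]
  have hα2 : α (b 2) = 0 := by simp [hα, hij]
  have hpos : 0 < c * β (b 1) (b 2) := mul_pos hc0 hb12
  -- the Hodge star in the three cyclic permutations of the basis
  have s0 := hstar b b.orthonormal (by simpa [hα0, hα1, hα2] using hpos)
  have s1 := hstar (fun i => b (i + 1)) (b.orthonormal.comp _ (add_left_injective 1)) (by
    simpa [hα0, hα1, hα2] using hpos)
  have s2 := hstar (fun i => b (i + 2)) (b.orthonormal.comp _ (add_left_injective 2)) (by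
    simpa [hα0, hα1, hα2] using hpos)
  simp [hα0, hα1, hα2] at s0 s1 s2
  have hβ' : ∀ v w, β v w
      = θ' * c * (inner ℝ (b 1) v * inner ℝ (b 2) w - inner ℝ (b 2) v * inner ℝ (b 1) w) := by
    intro v w
    rw [b.bilin_eq β hβ v w, ← s0, ← s1, ← s2]
    ring
  have hθc : θ' * c ≠ 0 := by rw [s0]; exact hb12.ne'
  -- the Reeb vector
  obtain ⟨r1, r2⟩ := hR (c⁻¹ • b 0) (by rw [map_smul, hα0, smul_eq_mul, inv_mul_cancel₀ hc0.ne'])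
    (fun w => by
      rw [hβ']
      simp [inner_smul_right, hij])
  have q1 := r2 (b 2)
  have q2 := r2 (b 1)
  rw [hβ'] at q1 q2
  simp [hij] at q1 q2
  have hR1' : inner ℝ (b 1) R = 0 := q1.resolve_left fun h => hθc (mul_eq_zero.2 h)
  have hR2' : inner ℝ (b 2) R = 0 := q2.resolve_left fun h => hθc (mul_eq_zero.2 h)
  have hn := b.norm_sq_fin_three R
  rw [hR1, hR1', hR2'] at hn
  rw [hα] at r1
  have hc1 : c = 1 := by
    have h1 : c ^ 2 = 1 := by
      have : (c * inner ℝ (b 0) R) ^ 2 = 1 := by rw [r1, one_pow]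
      rw [mul_pow] at this
      have h2 : inner ℝ (b 0) R ^ 2 = (1 : ℝ) := by linarith
      rwa [h2, mul_one] at this
    exact (pow_eq_one_iff_of_nonneg hc0.le (by norm_num)).1 h1
  rw [hc1, one_mul] at r1
  refine ⟨b, fun v => by rw [hα, hc1, one_mul], fun v w => by rw [hβ', hc1, mul_one], ?_⟩
  have h3 := b.sum_fin_three R
  rw [r1, hR1', hR2'] at h3
  simpa using h3

/-- In the normal form, `dt ∧ α + β / θ'` is a calibration: it is bounded by the area. -/
theorem calibration_le (b : OrthonormalBasis (Fin 3) ℝ F) (s s' : ℝ) (v v' : F) :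
    s * inner ℝ (b 0) v' - s' * inner ℝ (b 0) v + (inner ℝ (b 1) v * inner ℝ (b 2) v'
      - inner ℝ (b 2) v * inner ℝ (b 1) v')
      ≤ 1 / 2 * (s ^ 2 + ‖v‖ ^ 2 + s' ^ 2 + ‖v'‖ ^ 2) := by
  rw [b.norm_sq_fin_three v, b.norm_sq_fin_three v']
  linarith [sq_nonneg (s - inner ℝ (b 0) v'), sq_nonneg (s' + inner ℝ (b 0) v),
    sq_nonneg (inner ℝ (b 1) v - inner ℝ (b 2) v'), sq_nonneg (inner ℝ (b 2) v + inner ℝ (b 1) v')]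

/-- The complex lines are calibrated. -/
theorem calibration_eq (b : OrthonormalBasis (Fin 3) ℝ F) {J : (ℝ × F) →ₗ[ℝ] (ℝ × F)}
    (hsq : ∀ v, J (J v) = -v) (hdt : J (1, 0) = (0, b 0))
    (hxi : ∀ v, inner ℝ (b 0) v = 0 → (J (0, v)).1 = 0 ∧ inner ℝ (b 0) (J (0, v)).2 = 0)
    (hiso : ∀ v, (J v).1 ^ 2 + ‖(J v).2‖ ^ 2 = v.1 ^ 2 + ‖v.2‖ ^ 2)
    (hpos : 0 < inner ℝ (b 2) (J (0, b 1)).2) (s : ℝ) (v : F) :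
    s * inner ℝ (b 0) (J (s, v)).2 - (J (s, v)).1 * inner ℝ (b 0) v
      + (inner ℝ (b 1) v * inner ℝ (b 2) (J (s, v)).2
        - inner ℝ (b 2) v * inner ℝ (b 1) (J (s, v)).2)
      = 1 / 2 * (s ^ 2 + ‖v‖ ^ 2 + (J (s, v)).1 ^ 2 + ‖(J (s, v)).2‖ ^ 2) := by
  have hij : ∀ i j, inner ℝ (b i) (b j) = if i = j then (1 : ℝ) else 0 :=
    orthonormal_iff_ite.1 b.orthonormal
  obtain ⟨x1, x2⟩ := hxi (b 1) (by simp [hij])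
  obtain ⟨y1, y2⟩ := hxi (b 2) (by simp [hij])
  obtain ⟨A, hA⟩ : ∃ A, A = inner ℝ (b 1) (J (0, b 1)).2 := ⟨_, rfl⟩
  obtain ⟨B, hB⟩ : ∃ B, B = inner ℝ (b 2) (J (0, b 1)).2 := ⟨_, rfl⟩
  obtain ⟨C, hC⟩ : ∃ C, C = inner ℝ (b 1) (J (0, b 2)).2 := ⟨_, rfl⟩
  obtain ⟨E, hE⟩ : ∃ E, E = inner ℝ (b 2) (J (0, b 2)).2 := ⟨_, rfl⟩
  have j1 : J (0, b 1) = (0, A • b 1 + B • b 2) := by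
    refine Prod.ext x1 ?_
    have := b.sum_fin_three (J (0, b 1)).2
    rwa [x2, zero_smul, zero_add, ← hA, ← hB] at this
  have j2 : J (0, b 2) = (0, C • b 1 + E • b 2) := by
    refine Prod.ext y1 ?_
    have := b.sum_fin_three (J (0, b 2)).2
    rwa [y2, zero_smul, zero_add, ← hC, ← hE] at this
  have hlin : ∀ (p q : ℝ), J (0, p • b 1 + q • b 2) = p • J (0, b 1) + q • J (0, b 2) := by
    intro p q
    have h1 : ((0 : ℝ), p • b 1 + q • b 2) = p • ((0 : ℝ), b 1) + q • ((0 : ℝ), b 2) := by simp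
    rw [h1, map_add, J.map_smul, J.map_smul]
  -- `J` maps `b₁` to `b₂`
  have k1 := hsq (0, b 1)
  rw [j1, hlin, j1, j2] at k1
  have k2 := congrArg (fun p : ℝ × F => inner ℝ (b 1) p.2) k1
  have k3 := congrArg (fun p : ℝ × F => inner ℝ (b 2) p.2) k1
  simp [inner_add_right, inner_smul_right, hij] at k2 k3
  have k4 := hiso (0, b 1)
  have k5 := hiso (0, b 2)
  rw [j1, b.norm_sq_fin_three] at k4
  rw [j2, b.norm_sq_fin_three] at k5
  simp [inner_add_right, inner_smul_right, hij] at k4 k5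
  rw [← hB] at hpos
  have hEA : E = -A := by
    have : B * (A + E) = 0 := by linarith
    rcases mul_eq_zero.1 this with h | h <;> linarith
  have hCB : C = -B := by
    have h1 : (C - B) * (C + B) = 0 := by rw [hEA] at k5; linarith
    rcases mul_eq_zero.1 h1 with h | h
    · exfalso
      have h2 : C = B := by linarith
      rw [h2] at k2
      linarith [mul_self_nonneg A, mul_self_nonneg B]
    · linarith
  have hA0 : A = 0 := by
    rw [hCB] at k2
    have : A ^ 2 = 0 := by linarith
    exact pow_eq_zero_iff (two_ne_zero) |>.1 this
  have hB1 : B = 1 := by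
    rw [hA0] at k4
    have : (B - 1) * (B + 1) = 0 := by linarith
    rcases mul_eq_zero.1 this with h | h <;> linarith
  rw [hA0, hB1, zero_smul, zero_add, one_smul] at j1
  rw [hEA, hCB, hA0, hB1, neg_zero, zero_smul, add_zero, neg_one_smul] at j2
  have j0 : J (0, b 0) = (-1, 0) := by
    rw [← hdt, hsq]
    simp
  have hJ : J (s, v) = (-inner ℝ (b 0) v, s • b 0 + inner ℝ (b 1) v • b 2
      - inner ℝ (b 2) v • b 1) := by
    have h1 : (s, v) = s • ((1 : ℝ), (0 : F)) + inner ℝ (b 0) v • ((0 : ℝ), b 0)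
        + inner ℝ (b 1) v • ((0 : ℝ), b 1) + inner ℝ (b 2) v • ((0 : ℝ), b 2) := by
      refine Prod.ext (by simp) ?_
      have := b.sum_fin_three v
      simpa using this
    conv_lhs => rw [h1]
    simp only [map_add, map_smul, hdt, j0, j1, j2]
    refine Prod.ext (by simp) ?_
    simp [sub_eq_add_neg]
  rw [hJ]
  simp only [b.norm_sq_fin_three, inner_add_right, inner_sub_right, inner_smul_right, hij]
  simp
  ring

end ContactAlgebra

section Calibration

variable {M : Type*} [MetricSpace M] [ChartedSpace E3 M] [IsManifold (𝓡 3) ∞ M]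
  [RiemannianBundle (fun x : M => TangentSpace (𝓡 3) x)]
  [IsContMDiffRiemannianBundle (𝓡 3) ∞ E3 (fun x : M => TangentSpace (𝓡 3) x)]
  [IsRiemannianManifold (𝓡 3) M]

/-- The exterior derivative of a 1-form at a point, as a bilinear form. -/
noncomputable def dFormBilin (α : ∀ x : M, TangentSpace (𝓡 3) x →ₗ[ℝ] ℝ) (x : M) :
    TangentSpace (𝓡 3) x →ₗ[ℝ] TangentSpace (𝓡 3) x →ₗ[ℝ] ℝ :=
  ∑ i, ∑ j, (partialD i (formCoeff (chartAt E3 x) α j) (chartAt E3 x x)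
      - partialD j (formCoeff (chartAt E3 x) α i) (chartAt E3 x x)) •
    ((EuclideanSpace.proj i : E3 →L[ℝ] ℝ).toLinearMap.comp
      (mfderiv (𝓡 3) (𝓡 3) (chartAt E3 x) x).toLinearMap).smulRight
      ((EuclideanSpace.proj j : E3 →L[ℝ] ℝ).toLinearMap.comp
        (mfderiv (𝓡 3) (𝓡 3) (chartAt E3 x) x).toLinearMap)

theorem dFormBilin_apply (α : ∀ x : M, TangentSpace (𝓡 3) x →ₗ[ℝ] ℝ) (x : M)
    (v w : TangentSpace (𝓡 3) x) : dFormBilin α x v w = dForm α x v w := by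
  simp only [dFormBilin, dForm, LinearMap.sum_apply, LinearMap.smul_apply, mul_assoc]
  rfl

/-- On a contact metric manifold, the 2-form `dt ∧ α + dα / θ'` is a calibration for which the
complex lines are calibrated. -/
theorem IsContactMetric.exists_calibration {α : ∀ x : M, TangentSpace (𝓡 3) x →ₗ[ℝ] ℝ}
    (hα : IsContactMetric α)
    {J : ∀ p : ℝ × M, (ℝ × TangentSpace (𝓡 3) p.2) →ₗ[ℝ] (ℝ × TangentSpace (𝓡 3) p.2)}
    (hJ : IsAdaptedACS α J) :
    ∃ θ' > 0, (∀ x s s' (v v' : TangentSpace (𝓡 3) x),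
      s * α x v' - s' * α x v + dForm α x v v' / θ'
        ≤ 1 / 2 * (s ^ 2 + ‖v‖ ^ 2 + s' ^ 2 + ‖v'‖ ^ 2)) ∧
      ∀ p ∈ symplectization M, ∀ s (v : TangentSpace (𝓡 3) p.2),
        s * α p.2 (J p (s, v)).2 - (J p (s, v)).1 * α p.2 v + dForm α p.2 v (J p (s, v)).2 / θ'
          = 1 / 2 * (s ^ 2 + ‖v‖ ^ 2 + (J p (s, v)).1 ^ 2 + ‖(J p (s, v)).2‖ ^ 2) := by
  obtain ⟨θ', hθ, hstar⟩ := hα.star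
  have hbasis : ∀ x, ∃ b : OrthonormalBasis (Fin 3) ℝ (TangentSpace (𝓡 3) x),
      (∀ v, α x v = inner ℝ (b 0) v) ∧ (∀ v w, dForm α x v w
        = θ' * (inner ℝ (b 1) v * inner ℝ (b 2) w - inner ℝ (b 2) v * inner ℝ (b 1) w)) ∧
      reeb α x = b 0 := by
    intro x
    have h3 : Module.finrank ℝ (TangentSpace (𝓡 3) x) = 3 :=
      finrank_euclideanSpace_fin (𝕜 := ℝ) (n := 3)
    have hsk : ∀ v, dFormBilin α x v v = 0 := fun v => by
      rw [dFormBilin_apply, hα.contact.dForm_eq (IsManifold.chart_mem_maximalAtlas x)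
        (mem_chart_source E3 x), formDeriv_apply, sub_self]
    have := exists_adapted_basis (F := TangentSpace (𝓡 3) x) h3 (α := α x) (β := dFormBilin α x)
      hsk (θ' := θ') (R := reeb α x) (by
        simp only [dFormBilin_apply]
        exact hα.contact.nondegenerate x)
      (fun b hb hpos => by
        rw [dFormBilin_apply]
        simp only [dFormBilin_apply] at hpos
        exact hstar x b hb hpos)
      (fun v h1 h2 => by
        simp only [dFormBilin_apply] at h2 ⊢
        exact Classical.epsilon_spec 
          (p := fun v => α x v = 1 ∧ ∀ w, dForm α x v w = 0) ⟨v, h1, h2⟩)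
      (hα.norm_reeb x)
    simpa only [dFormBilin_apply] using this
  refine ⟨θ', hθ, fun x s s' v v' => ?_, fun p hp s v => ?_⟩
  · obtain ⟨b, h1, h2, -⟩ := hbasis x
    rw [h1, h1, h2, mul_div_cancel_left₀ _ hθ.ne']
    exact calibration_le b s s' v v'
  · obtain ⟨b, h1, h2, h3⟩ := hbasis p.2
    rw [h1, h1, h2, mul_div_cancel_left₀ _ hθ.ne']
    have hij : ∀ i j, inner ℝ (b i) (b j) = if i = j then (1 : ℝ) else 0 :=
      orthonormal_iff_ite.1 b.orthonormal
    refine calibration_eq b (J := J p) (hJ.sq p hp) ((hJ.map_dt p hp).trans (by rw [h3]))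
      (fun w hw => ?_) (hJ.isometry p hp) ?_ s v
    · have := hJ.map_xi p hp w ((h1 w).trans hw)
      rwa [h1] at this
    · have h4 : ((0 : ℝ), b 1) ≠ (0 : ℝ × TangentSpace (𝓡 3) p.2) := fun h =>
        b.orthonormal.ne_zero 1 (Prod.ext_iff.1 h).2
      have h5 := hJ.tame p hp (0, b 1) h4
      obtain ⟨h6, h7⟩ := hJ.map_xi p hp (b 1) (by rw [h1]; simp [hij])
      rw [sympForm, h6, h2] at h5
      have h8 : 0 < p.1 * θ' := mul_pos hp hθ
      have e1 : inner ℝ (b 1) (b 1) = (1 : ℝ) := by simp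
      have e2 : inner ℝ (b 2) (b 1) = (0 : ℝ) := by simp
      change 0 < (0 : ℝ) * _ - 0 * _ + p.1 * (θ' * (inner ℝ (b 1) (b 1) * _
        - inner ℝ (b 2) (b 1) * _)) at h5
      rw [e1, e2] at h5
      refine pos_of_mul_pos_right (a := p.1 * θ') ?_ h8.le
      linarith

end Calibration

section Tension

theorem eq_zero_of_forall_nonneg_taylor {a b : ℝ} (h : ∀ t : ℝ, 0 ≤ t * a + t ^ 2 * b) : a = 0 := by
  have h1 := (nonneg_of_eventually_nonneg_taylor (a := a) (b := b) fun ε hε =>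
    .of_forall fun t => add_nonneg (h t) (by positivity)).1
  have h2 := (nonneg_of_eventually_nonneg_taylor (a := -a) (b := b) fun ε hε =>
    .of_forall fun t => add_nonneg (by have := h (-t); rw [neg_sq] at this; linarith)
      (by positivity)).1
  linarith

variable {E : Type*} [NormedAddCommGroup E] [NormedSpace ℝ E] {G : E → E →L[ℝ] E →L[ℝ] ℝ}
  {A : E → E →L[ℝ] ℝ} {U : Set E}

/-- The first order conditions satisfied by a calibrated pair of vectors `s ∂ₜ + v`, `s' ∂ₜ + v'`
for the calibration `dt ∧ A + dA / θ'`. -/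
theorem calibrated_first_order (hG : IsMetricOn G U) (hA : ContDiffOn ℝ ∞ A U) {θ' : ℝ}
    (hle : ∀ y ∈ U, ∀ (s s' : ℝ) (v v' : E), s * A y v' - s' * A y v + formDeriv A y v v' / θ'
      ≤ 1 / 2 * (s ^ 2 + G y v v + s' ^ 2 + G y v' v')) {y : E} (hy : y ∈ U) {s s' : ℝ} {v v' : E}
    (heq : s * A y v' - s' * A y v + formDeriv A y v v' / θ'
      = 1 / 2 * (s ^ 2 + G y v v + s' ^ 2 + G y v' v')) :
    s = A y v' ∧ s' = -A y v ∧ (∀ l, G y v l + s' * A y l - formDeriv A y l v' / θ' = 0) ∧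
      (∀ l, G y v' l - s * A y l - formDeriv A y v l / θ' = 0) ∧
      ∀ l, 1 / 2 * (fderiv ℝ G y l v v + fderiv ℝ G y l v' v') - s * fderiv ℝ A y l v'
        + s' * fderiv ℝ A y l v - fderiv ℝ (formDeriv A) y l v v' / θ' = 0 := by
  have hA1 : HasFDerivAt A (fderiv ℝ A y) y :=
    ((hA.contDiffAt (hG.mem_nhds hy)).differentiableAt (by simp)).hasFDerivAt
  have hA2 : HasFDerivAt (formDeriv A) (fderiv ℝ (formDeriv A) y) y := by
    have h1 : ContDiffAt ℝ ∞ A y := hA.contDiffAt (hG.mem_nhds hy)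
    have h2 : DifferentiableAt ℝ (fderiv ℝ A) y :=
      (h1.fderiv_right (m := ∞) (by simp)).differentiableAt (by simp)
    exact (h2.sub ((ContinuousLinearMap.flipₗᵢ ℝ E E
      ℝ).toContinuousLinearEquiv.toContinuousLinearMap.differentiableAt.comp y h2)).hasFDerivAt
  refine ⟨?_, ?_, fun l => ?_, fun l => ?_, fun l => ?_⟩
  · have := eq_zero_of_forall_nonneg_taylor (a := s - A y v') (b := 1 / 2) fun t => by
      linarith [hle y hy (s + t) s' v v']
    linarith
  · have := eq_zero_of_forall_nonneg_taylor (a := s' + A y v) (b := 1 / 2) fun t => by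
      linarith [hle y hy s (s' + t) v v']
    linarith
  · refine eq_zero_of_forall_nonneg_taylor (b := 1 / 2 * G y l l) fun t => ?_
    have h1 := hle y hy s s' (v + t • l) v'
    simp only [map_add, map_smul, _root_.add_apply, _root_.smul_apply, smul_eq_mul,
      hG.symm y hy l v] at h1
    rw [add_div, mul_div_assoc] at h1
    linarith
  · refine eq_zero_of_forall_nonneg_taylor (b := 1 / 2 * G y l l) fun t => ?_
    have h1 := hle y hy s s' v (v' + t • l)
    simp only [map_add, map_smul, _root_.add_apply, _root_.smul_apply, smul_eq_mul,
      hG.symm y hy l v'] at h1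
    rw [add_div, mul_div_assoc] at h1
    linarith
  · have hline : HasDerivAt (fun t : ℝ => y + t • l) l 0 := by
      simpa using ((hasDerivAt_id (0 : ℝ)).smul_const l).const_add y
    have e0 : y + (0 : ℝ) • l = y := by simp
    have hcomp : ∀ {W : Type _} [NormedAddCommGroup W] [NormedSpace ℝ W] {f : E → W}
        {f' : E →L[ℝ] W}, HasFDerivAt f f' y →
        HasDerivAt (fun t : ℝ => f (y + t • l)) (f' l) 0 := fun h =>
      HasFDerivAt.comp_hasDerivAt 0 (e0.symm ▸ h) hline
    have d1 : HasDerivAt (fun t : ℝ => G (y + t • l)) (fderiv ℝ G y l) 0 := hcomp (hG.hasFDerivAt hy)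
    have d2 : HasDerivAt (fun t : ℝ => A (y + t • l)) (fderiv ℝ A y l) 0 := hcomp hA1
    have d3 : HasDerivAt (fun t : ℝ => formDeriv A (y + t • l)) (fderiv ℝ (formDeriv A) y l) 0 :=
      hcomp hA2
    have hap : ∀ {f : ℝ → E →L[ℝ] ℝ} {f' : E →L[ℝ] ℝ}, HasDerivAt f f' 0 → ∀ w,
        HasDerivAt (fun t => f t w) (f' w) 0 := fun h w => by
      simpa using h.clm_apply (hasDerivAt_const (0 : ℝ) w)
    have hap2 : ∀ {f : ℝ → E →L[ℝ] E →L[ℝ] ℝ} {f' : E →L[ℝ] E →L[ℝ] ℝ}, HasDerivAt f f' 0 →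
        ∀ u w, HasDerivAt (fun t => f t u w) (f' u w) 0 := fun h u w => by
      refine hap ?_ w
      simpa using h.clm_apply (hasDerivAt_const (0 : ℝ) u)
    have d4 := (((((hap2 d1 v v).add (hap2 d1 v' v')).const_mul (1 / 2)).sub
      ((hap d2 v').const_mul s)).add ((hap d2 v).const_mul s')).sub ((hap2 d3 v v').div_const θ')
    refine IsLocalMin.hasDerivAt_eq_zero ?_ d4
    have h1 : ∀ᶠ t in 𝓝 (0 : ℝ), y + t • l ∈ U := hline.continuousAt.eventually (by
      simpa using hG.mem_nhds hy)
    filter_upwards [h1] with t ht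
    have h2 := hle _ ht s s' v v'
    simp only [Pi.add_apply, Pi.sub_apply, e0]
    linarith

/-- The tension field of a calibrated surface: the surface is harmonic up to a term of first
order. -/
theorem tension_of_calibrated (hG : IsMetricOn G U) (hA : ContDiffOn ℝ ∞ A U) {θ' : ℝ}
    (hθ : θ' ≠ 0)
    (hle : ∀ y ∈ U, ∀ (s s' : ℝ) (v v' : E), s * A y v' - s' * A y v + formDeriv A y v v' / θ'
      ≤ 1 / 2 * (s ^ 2 + G y v v + s' ^ 2 + G y v' v')) {V : Set ℂ} (hV : IsOpen V) {a : ℂ → ℝ}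
    {v : ℂ → E} (ha : ContDiffOn ℝ ∞ a V) (hv : ContDiffOn ℝ ∞ v V) (hvU : MapsTo v V U)
    (heq : ∀ z ∈ V, fderiv ℝ a z 1 * A (v z) (fderiv ℝ v z Complex.I)
      - fderiv ℝ a z Complex.I * A (v z) (fderiv ℝ v z 1)
      + formDeriv A (v z) (fderiv ℝ v z 1) (fderiv ℝ v z Complex.I) / θ'
      = 1 / 2 * (fderiv ℝ a z 1 ^ 2 + G (v z) (fderiv ℝ v z 1) (fderiv ℝ v z 1)
        + fderiv ℝ a z Complex.I ^ 2
        + G (v z) (fderiv ℝ v z Complex.I) (fderiv ℝ v z Complex.I))) {z : ℂ} (hz : z ∈ V) (l : E) :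
    (G (v z) (fderiv ℝ (fderiv ℝ v) z 1 1) l
        + koszul G (v z) (fderiv ℝ v z 1) (fderiv ℝ v z 1) l)
      + (G (v z) (fderiv ℝ (fderiv ℝ v) z Complex.I Complex.I) l
        + koszul G (v z) (fderiv ℝ v z Complex.I) (fderiv ℝ v z Complex.I) l)
      = -(θ' * (fderiv ℝ a z 1 * G (v z) (fderiv ℝ v z 1) l
        + fderiv ℝ a z Complex.I * G (v z) (fderiv ℝ v z Complex.I) l)) := by
  have hcrit := fun z (hz : z ∈ V) => calibrated_first_order hG hA hle (hvU hz) (heq z hz)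
  have hyU := hvU hz
  have haz := ha.contDiffAt (hV.mem_nhds hz)
  have hvz := hv.contDiffAt (hV.mem_nhds hz)
  have hAy : ContDiffAt ℝ ∞ A (v z) := hA.contDiffAt (hG.mem_nhds hyU)
  have hmin : minSmoothness ℝ 2 ≤ (∞ : WithTop ℕ∞) := by
    rw [minSmoothness_of_isRCLikeNormedField]; exact ENat.LEInfty.out
  have hsa : IsSymmSndFDerivAt ℝ a z := haz.isSymmSndFDerivAt hmin
  have hsv : IsSymmSndFDerivAt ℝ v z := hvz.isSymmSndFDerivAt hmin
  have dA1 : HasFDerivAt A (fderiv ℝ A (v z)) (v z) := (hAy.differentiableAt (by simp)).hasFDerivAt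
  have dA2 : HasFDerivAt (formDeriv A) (fderiv ℝ (formDeriv A) (v z)) (v z) := by
    have h2 : DifferentiableAt ℝ (fderiv ℝ A) (v z) :=
      (hAy.fderiv_right (m := ∞) (by simp)).differentiableAt (by simp)
    exact (h2.sub ((ContinuousLinearMap.flipₗᵢ ℝ E E
      ℝ).toContinuousLinearEquiv.toContinuousLinearMap.differentiableAt.comp _ h2)).hasFDerivAt
  have dv : HasFDerivAt v (fderiv ℝ v z) z := (hvz.differentiableAt (by simp)).hasFDerivAt
  have dv2 : HasFDerivAt (fderiv ℝ v) (fderiv ℝ (fderiv ℝ v) z) z :=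
    ((hvz.fderiv_right (m := ∞) (by simp)).differentiableAt (by simp)).hasFDerivAt
  have da2 : HasFDerivAt (fderiv ℝ a) (fderiv ℝ (fderiv ℝ a) z) z :=
    ((haz.fderiv_right (m := ∞) (by simp)).differentiableAt (by simp)).hasFDerivAt
  have dG := (hG.hasFDerivAt hyU).comp z dv
  have dA := dA1.comp z dv
  have dB := dA2.comp z dv
  -- the first order conditions are differentiated along the surface
  have k1 : HasFDerivAt (fun ζ => G (v ζ) (fderiv ℝ v ζ 1) l + fderiv ℝ a ζ Complex.I * A (v ζ) l
      - formDeriv A (v ζ) l (fderiv ℝ v ζ Complex.I) * θ'⁻¹) _ z :=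
    (((dG.clm_apply (dv2.clm_apply (hasFDerivAt_const (1 : ℂ) z))).clm_apply
      (hasFDerivAt_const l z)).add ((da2.clm_apply (hasFDerivAt_const Complex.I z)).mul
        (dA.clm_apply (hasFDerivAt_const l z)))).sub
      (((dB.clm_apply (hasFDerivAt_const l z)).clm_apply
        (dv2.clm_apply (hasFDerivAt_const Complex.I z))).mul_const θ'⁻¹)
  have k2 : HasFDerivAt (fun ζ => G (v ζ) (fderiv ℝ v ζ Complex.I) l - fderiv ℝ a ζ 1 * A (v ζ) l
      - formDeriv A (v ζ) (fderiv ℝ v ζ 1) l * θ'⁻¹) _ z :=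
    (((dG.clm_apply (dv2.clm_apply (hasFDerivAt_const Complex.I z))).clm_apply
      (hasFDerivAt_const l z)).sub ((da2.clm_apply (hasFDerivAt_const (1 : ℂ) z)).mul
        (dA.clm_apply (hasFDerivAt_const l z)))).sub
      (((dB.clm_apply (dv2.clm_apply (hasFDerivAt_const (1 : ℂ) z))).clm_apply
        (hasFDerivAt_const l z)).mul_const θ'⁻¹)
  have z1 : (fun ζ => G (v ζ) (fderiv ℝ v ζ 1) l + fderiv ℝ a ζ Complex.I * A (v ζ) l
      - formDeriv A (v ζ) l (fderiv ℝ v ζ Complex.I) * θ'⁻¹) =ᶠ[𝓝 z] fun _ => 0 := by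
    filter_upwards [hV.mem_nhds hz] with ζ hζ
    rw [← div_eq_mul_inv]
    exact (hcrit ζ hζ).2.2.1 l
  have z2 : (fun ζ => G (v ζ) (fderiv ℝ v ζ Complex.I) l - fderiv ℝ a ζ 1 * A (v ζ) l
      - formDeriv A (v ζ) (fderiv ℝ v ζ 1) l * θ'⁻¹) =ᶠ[𝓝 z] fun _ => 0 := by
    filter_upwards [hV.mem_nhds hz] with ζ hζ
    rw [← div_eq_mul_inv]
    exact (hcrit ζ hζ).2.2.2.1 l
  have m1 := congrArg (fun L : ℂ →L[ℝ] ℝ => L 1)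
    (k1.unique ((hasFDerivAt_const (0 : ℝ) z).congr_of_eventuallyEq z1))
  have m2 := congrArg (fun L : ℂ →L[ℝ] ℝ => L Complex.I)
    (k2.unique ((hasFDerivAt_const (0 : ℝ) z).congr_of_eventuallyEq z2))
  simp only [ContinuousLinearMap.comp_zero, zero_add, _root_.add_apply, _root_.sub_apply,
    _root_.smul_apply, ContinuousLinearMap.flip_apply, ContinuousLinearMap.comp_apply, smul_eq_mul,
    _root_.zero_apply, Function.comp_apply] at m1 m2
  obtain ⟨-, -, c3, c4, c5⟩ := hcrit z hz
  have q3 := c3 l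
  have q4 := c4 l
  have q5 := c5 l
  have hd := fderiv_formDeriv_cyclic hAy l (fderiv ℝ v z 1) (fderiv ℝ v z Complex.I)
  have hsw1 : ∀ u w p, fderiv ℝ (formDeriv A) (v z) u w p
      = -fderiv ℝ (formDeriv A) (v z) u p w := by
    intro u w p
    have i1 := ((dA2.clm_apply (hasFDerivAt_const w (v z))).clm_apply (hasFDerivAt_const p (v z)))
    have i2 := ((dA2.clm_apply (hasFDerivAt_const p (v z))).clm_apply
      (hasFDerivAt_const w (v z))).neg
    have i3 : (fun y => formDeriv A y w p) = -fun y => formDeriv A y p w :=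
      funext fun y => formDeriv_swap A y w p
    rw [← i3] at i2
    have i4 := congrArg (fun L : E →L[ℝ] ℝ => L u) (i1.unique i2)
    simpa using i4
  rw [hsv.eq Complex.I 1, hsa.eq Complex.I 1] at m2
  have q3' : formDeriv A (v z) l (fderiv ℝ v z Complex.I)
      = θ' * (G (v z) (fderiv ℝ v z 1) l + fderiv ℝ a z Complex.I * A (v z) l) := by
    field_simp at q3
    linarith
  have q4' : formDeriv A (v z) (fderiv ℝ v z 1) l
      = θ' * (G (v z) (fderiv ℝ v z Complex.I) l - fderiv ℝ a z 1 * A (v z) l) := by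
    field_simp at q4
    linarith
  rw [koszul_apply, koszul_apply]
  linear_combination m1 + m2 - q5 - θ'⁻¹ * hd
    + fderiv ℝ a z Complex.I * formDeriv_apply A (v z) (fderiv ℝ v z 1) l
    + fderiv ℝ a z 1 * formDeriv_apply A (v z) l (fderiv ℝ v z Complex.I)
    - fderiv ℝ a z Complex.I * q4' - fderiv ℝ a z 1 * q3'
    + θ'⁻¹ * formDeriv_swap A (v z) (fderiv ℝ (fderiv ℝ v) z 1 Complex.I) l
    + θ'⁻¹ * hsw1 (fderiv ℝ v z 1) l (fderiv ℝ v z Complex.I)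
    + θ'⁻¹ * hsw1 (fderiv ℝ v z Complex.I) (fderiv ℝ v z 1) l

end Tension

/-! ### Holomorphic curves in coordinates -/

section Curves

variable {M : Type*} [MetricSpace M] [ChartedSpace E3 M] [IsManifold (𝓡 3) ∞ M]
  [RiemannianBundle (fun x : M => TangentSpace (𝓡 3) x)]
  [IsContMDiffRiemannianBundle (𝓡 3) ∞ E3 (fun x : M => TangentSpace (𝓡 3) x)]
  [IsRiemannianManifold (𝓡 3) M]

theorem chartVec_mfderiv_symm_self {e : OpenPartialHomeomorph M E3}
    (he : e ∈ IsManifold.maximalAtlas (𝓡 3) ∞ M) {y : E3} (hy : y ∈ e.target) (u : E3) :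
    chartVec e (e.symm y) (mfderiv (𝓡 3) (𝓡 3) e.symm y u) = u := by
  have hmem : y ∈ (e.symm.trans e).source := ⟨hy, e.map_target hy⟩
  rw [chartVec_mfderiv_symm he he hmem]
  have h1 : (e ∘ e.symm) =ᶠ[𝓝 y] id := by
    filter_upwards [e.open_target.mem_nhds hy] with z hz using e.right_inv hz
  rw [h1.fderiv_eq, fderiv_id]
  rfl

theorem formDeriv_chartForm_apply {e : OpenPartialHomeomorph M E3}
    (he : e ∈ IsManifold.maximalAtlas (𝓡 3) ∞ M) {α : ∀ x : M, TangentSpace (𝓡 3) x →ₗ[ℝ] ℝ}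
    (hα : IsContactForm α) {y : E3} (hy : y ∈ e.target) (u w : E3) :
    formDeriv (chartForm e α) y u w = dForm α (e.symm y) (mfderiv (𝓡 3) (𝓡 3) e.symm y u)
      (mfderiv (𝓡 3) (𝓡 3) e.symm y w) := by
  rw [hα.dForm_eq he (e.map_target hy), chartVec_mfderiv_symm_self he hy,
    chartVec_mfderiv_symm_self he hy, e.right_inv hy]

theorem chartVec_mfderiv {e : OpenPartialHomeomorph M E3}
    (he : e ∈ IsManifold.maximalAtlas (𝓡 3) ∞ M) {m : ℂ → M} {z : ℂ}
    (hm : MDifferentiableAt 𝓘(ℝ, ℂ) (𝓡 3) m z) (hz : m z ∈ e.source) (η : ℂ) :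
    chartVec e (m z) (mfderiv 𝓘(ℝ, ℂ) (𝓡 3) m z η) = fderiv ℝ (e ∘ m) z η := by
  have i2 := (mdifferentiable_of_mem_maximalAtlas he).mdifferentiableAt (x := m z) hz
  have i3 := mfderiv_comp z i2 hm
  rw [mfderiv_eq_fderiv] at i3
  exact (congrArg (fun T => T η) i3).symm

/-- Holomorphic curves in the domain, in coordinates: the distance to the boundary satisfies the
strong minimum principle, and the differential of the curve vanishes where this distance attains a
positive minimum. -/
theorem isOpen_and_fderiv_eq_zero_of_holomorphic (hsec : SecGE M 1)
    {α : ∀ x : M, TangentSpace (𝓡 3) x →ₗ[ℝ] ℝ} (hα : IsContactMetric α)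
    {J : ∀ p : ℝ × M, (ℝ × TangentSpace (𝓡 3) p.2) →ₗ[ℝ] (ℝ × TangentSpace (𝓡 3) p.2)}
    (hJ : IsAdaptedACS α J) {D : Set M} (hD : IsComplete D) (hconv : GeodesicallyConvex D)
    (hbd : (frontier D).Nonempty) {e : OpenPartialHomeomorph M E3}
    (he : e ∈ IsManifold.maximalAtlas (𝓡 3) ∞ M) {V : Set ℂ} (hV : IsOpen V) {a : ℂ → ℝ} {m : ℂ → M}
    (ha : ContDiffOn ℝ ∞ a V) (hm : ContMDiffOn 𝓘(ℝ, ℂ) (𝓡 3) ∞ m V)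
    (hsrc : ∀ z ∈ V, m z ∈ e.source) (hpos : ∀ z ∈ V, 0 < a z) (hmD : ∀ z ∈ V, m z ∈ D)
    (hol : ∀ z ∈ V, ∀ η : ℂ, J (a z, m z) (fderiv ℝ a z η, mfderiv 𝓘(ℝ, ℂ) (𝓡 3) m z η)
      = (fderiv ℝ a z (Complex.I * η), mfderiv 𝓘(ℝ, ℂ) (𝓡 3) m z (Complex.I * η : ℂ)))
    {r : ℝ} (hr : 0 < r) (hmin : ∀ z ∈ V, r ≤ Metric.infDist (m z) (interior D)ᶜ) :
    IsOpen {z | z ∈ V ∧ Metric.infDist (m z) (interior D)ᶜ = r} ∧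
    ∀ z ∈ V, Metric.infDist (m z) (interior D)ᶜ = r →
      fderiv ℝ a z = 0 ∧ fderiv ℝ (e ∘ m) z = 0 := by
  obtain ⟨θ', hθ, hle, heq⟩ := hα.exists_calibration hJ
  have hG := isMetricOn_gram he
  set A := chartForm e α with hA
  have hAs : ContDiffOn ℝ ∞ A e.target := hα.contact.contDiffOn_chartForm he
  set v : ℂ → E3 := e ∘ m with hv
  have hvs : ContDiffOn ℝ ∞ v V :=
    ((contMDiffOn_of_mem_maximalAtlas he).comp hm hsrc).contDiffOn
  have hvU : MapsTo v V e.target := fun z hz => e.map_source (hsrc z hz)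
  have hle' : ∀ y ∈ e.target, ∀ (s s' : ℝ) (u u' : E3),
      s * A y u' - s' * A y u + formDeriv A y u u' / θ'
        ≤ 1 / 2 * (s ^ 2 + gram e y u u + s' ^ 2 + gram e y u' u') := by
    intro y hy s s' u u'
    rw [hA, chartForm_apply, chartForm_apply, formDeriv_chartForm_apply he hα.contact hy,
      gram_self_eq_norm, gram_self_eq_norm]
    exact hle _ s s' _ _
  have hcv : ∀ z ∈ V, ∀ η : ℂ,
      chartVec e (m z) (mfderiv 𝓘(ℝ, ℂ) (𝓡 3) m z η) = fderiv ℝ v z η := fun z hz η =>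
    chartVec_mfderiv he ((hm.contMDiffAt (hV.mem_nhds hz)).mdifferentiableAt (by simp)) (hsrc z hz) η
  have heq' : ∀ z ∈ V, fderiv ℝ a z 1 * A (v z) (fderiv ℝ v z Complex.I)
      - fderiv ℝ a z Complex.I * A (v z) (fderiv ℝ v z 1)
      + formDeriv A (v z) (fderiv ℝ v z 1) (fderiv ℝ v z Complex.I) / θ'
      = 1 / 2 * (fderiv ℝ a z 1 ^ 2 + gram e (v z) (fderiv ℝ v z 1) (fderiv ℝ v z 1)
        + fderiv ℝ a z Complex.I ^ 2
        + gram e (v z) (fderiv ℝ v z Complex.I) (fderiv ℝ v z Complex.I)) := by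
    intro z hz
    have h1 := heq (a z, m z) (hpos z hz) (fderiv ℝ a z 1) (mfderiv 𝓘(ℝ, ℂ) (𝓡 3) m z (1 : ℂ))
    rw [hol z hz 1] at h1
    have hI : Complex.I * 1 = Complex.I := mul_one _
    rw [hI] at h1
    have e1 : ∀ η : ℂ, α (m z) (mfderiv 𝓘(ℝ, ℂ) (𝓡 3) m z η) = A (v z) (fderiv ℝ v z η) :=
      fun η => (chartForm_chartVec he (hsrc z hz) _).symm.trans
        (congrArg (fun w : E3 => A (v z) w) (hcv z hz η))
    have e2 : dForm α (m z) (mfderiv 𝓘(ℝ, ℂ) (𝓡 3) m z (1 : ℂ))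
        (mfderiv 𝓘(ℝ, ℂ) (𝓡 3) m z Complex.I)
        = formDeriv A (v z) (fderiv ℝ v z 1) (fderiv ℝ v z Complex.I) :=
      (hα.contact.dForm_eq he (hsrc z hz) _ _).trans
        (congrArg₂ (fun w w' : E3 => formDeriv A (v z) w w') (hcv z hz 1) (hcv z hz Complex.I))
    have e3 : ∀ η : ℂ, ‖mfderiv 𝓘(ℝ, ℂ) (𝓡 3) m z η‖ ^ 2
        = gram e (v z) (fderiv ℝ v z η) (fderiv ℝ v z η) := fun η =>
      (real_inner_self_eq_norm_sq _).symm.trans ((gram_chartVec he (hsrc z hz) _ _).symm.trans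
        (congrArg (fun w : E3 => gram e (v z) w w) (hcv z hz η)))
    rw [← e1, ← e1, ← e2, ← e3, ← e3]
    exact h1
  have htens := fun z (hz : z ∈ V) (l : E3) =>
    tension_of_calibrated hG hAs hθ.ne' hle' hV ha hvs hvU heq' hz l
  -- the differential inequality for smooth functions touching from below
  have key : ∀ z ∈ V, ∀ w : ℂ → ℝ, ContDiff ℝ ∞ w →
      (∀ᶠ ζ in 𝓝 z, Metric.infDist (m z) (interior D)ᶜ + (w ζ - w z)
        ≤ Metric.infDist (m ζ) (interior D)ᶜ) →
      ∃ ν, gram e (v z) ν ν = 1 ∧ (∀ η, gram e (v z) ν (fderiv ℝ v z η) = fderiv ℝ w z η) ∧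
        fderiv ℝ (fderiv ℝ w) z 1 1 + fderiv ℝ (fderiv ℝ w) z Complex.I Complex.I
        + (θ' * fderiv ℝ a z 1 * fderiv ℝ w z 1
          + θ' * fderiv ℝ a z Complex.I * fderiv ℝ w z Complex.I)
        ≤ -(Metric.infDist (m z) (interior D)ᶜ / 2
          * ((gram e (v z) (fderiv ℝ v z 1) (fderiv ℝ v z 1) - fderiv ℝ w z 1 ^ 2)
            + (gram e (v z) (fderiv ℝ v z Complex.I) (fderiv ℝ v z Complex.I)
              - fderiv ℝ w z Complex.I ^ 2))) := by
    intro z hz w hw htouch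
    obtain ⟨ν, hone, hbar⟩ := hconv.exists_hasBarrier hsec hD hbd (hmD z hz)
      (hr.trans_le (hmin z hz)) he (hsrc z hz)
    obtain ⟨h1, h2⟩ := HasBarrier.le_of_eventually_le he (fun x y => by
      have := Metric.infDist_le_infDist_add_dist (x := y) (y := x) (s := (interior D)ᶜ)
      rwa [dist_comm] at this) hV hvs hz (hvU hz) hone hbar hw.contDiffOn (by
        filter_upwards [htouch, hV.mem_nhds hz] with ζ h3 hζ
        have h4 : e.symm (v ζ) = m ζ := e.left_inv (hsrc ζ hζ)
        rwa [h4])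
    refine ⟨ν, hone, h1, ?_⟩
    have h3 := htens z hz ν
    have hs := fun u => hG.symm (v z) (hvU hz) u ν
    rw [hs, hs, hs, hs, h1, h1] at h3
    linarith [h2 1, h2 Complex.I]
  refine ⟨isOpen_setOf_eq_of_touching (h := fun z => Metric.infDist (m z) (interior D)ᶜ)
    (b₁ := fun z => θ' * fderiv ℝ a z 1) (b₂ := fun z => θ' * fderiv ℝ a z Complex.I) hV
    ((Metric.continuous_infDist_pt _).comp_continuousOn hm.continuousOn) hmin ?_ ?_
    (fun z hz w hw htouch => ?_), fun z hz hzr => ?_⟩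
  · exact continuousOn_const.mul (((ha.fderiv_of_isOpen hV (m := ∞) (by simp)).continuousOn).clm_apply
      continuousOn_const)
  · exact continuousOn_const.mul (((ha.fderiv_of_isOpen hV (m := ∞) (by simp)).continuousOn).clm_apply
      continuousOn_const)
  · obtain ⟨ν, hone, h1, h2⟩ := key z hz w hw htouch
    have hcs : ∀ η, 0 ≤ gram e (v z) (fderiv ℝ v z η) (fderiv ℝ v z η) - fderiv ℝ w z η ^ 2 := by
      intro η
      have := gram_cauchy_schwarz e (v z) ν (fderiv ℝ v z η)
      rw [hone, one_mul, h1] at this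
      linarith
    have h3 : 0 ≤ Metric.infDist (m z) (interior D)ᶜ / 2 := by
      have := hmin z hz
      linarith
    have h4 := mul_nonneg h3 (add_nonneg (hcs 1) (hcs Complex.I))
    linarith
  · -- the constant function touches at a minimum
    obtain ⟨ν, -, -, h2⟩ := key z hz (fun _ => 0) contDiff_const (by
      filter_upwards [hV.mem_nhds hz] with ζ hζ
      rw [hzr]
      simpa using hmin ζ hζ)
    have e0 : fderiv ℝ (fun _ : ℂ => (0 : ℝ)) = 0 := by
      funext ζ
      exact fderiv_const_apply 0
    simp only [e0, fderiv_zero, Pi.zero_apply, _root_.zero_apply, mul_zero, add_zero, ne_eq,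
      OfNat.ofNat_ne_zero, not_false_eq_true, zero_pow, sub_zero, hzr] at h2
    have g1 := gram_self_nonneg (e := e) (v z) (fderiv ℝ v z 1)
    have g2 := gram_self_nonneg (e := e) (v z) (fderiv ℝ v z Complex.I)
    have h3 : gram e (v z) (fderiv ℝ v z 1) (fderiv ℝ v z 1)
        + gram e (v z) (fderiv ℝ v z Complex.I) (fderiv ℝ v z Complex.I) ≤ 0 := by
      by_contra! hcon
      have := mul_pos (half_pos hr) hcon
      linarith
    have hz0 : ∀ u, gram e (v z) u u ≤ 0 → u = 0 := fun u hu => by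
      by_contra hne
      exact absurd (hG.pos _ (hvU hz) u hne) (not_lt.2 hu)
    have v1 := hz0 _ (by linarith : gram e (v z) (fderiv ℝ v z 1) (fderiv ℝ v z 1) ≤ 0)
    have v2 := hz0 _ (by linarith :
      gram e (v z) (fderiv ℝ v z Complex.I) (fderiv ℝ v z Complex.I) ≤ 0)
    obtain ⟨a1, a2, -⟩ := calibrated_first_order hG hAs hle' (hvU hz) (heq' z hz)
    rw [v2, map_zero] at a1
    rw [v1, map_zero, neg_zero] at a2
    have hext : ∀ η : ℂ, η = η.re • (1 : ℂ) + η.im • Complex.I := fun η => by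
      apply Complex.ext <;> simp
    constructor
    · ext1 η
      rw [hext η, map_add, map_smul, map_smul, a1, a2]
      simp
    · ext1 η
      rw [hext η, map_add, map_smul, map_smul, v1, v2]
      simp

/-- A holomorphic curve in the domain, parametrized by a connected open set, is constant if the
distance to the boundary attains a positive minimum. -/
theorem eqOn_of_holomorphic (hsec : SecGE M 1)
    {α : ∀ x : M, TangentSpace (𝓡 3) x →ₗ[ℝ] ℝ} (hα : IsContactMetric α)
    {J : ∀ p : ℝ × M, (ℝ × TangentSpace (𝓡 3) p.2) →ₗ[ℝ] (ℝ × TangentSpace (𝓡 3) p.2)}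
    (hJ : IsAdaptedACS α J) {D : Set M} (hD : IsComplete D) (hconv : GeodesicallyConvex D)
    (hbd : (frontier D).Nonempty) {V : Set ℂ} (hV : IsOpen V) (hVc : IsPreconnected V)
    {a : ℂ → ℝ} {m : ℂ → M}
    (ha : ContDiffOn ℝ ∞ a V) (hm : ContMDiffOn 𝓘(ℝ, ℂ) (𝓡 3) ∞ m V)
    (hpos : ∀ z ∈ V, 0 < a z) (hmD : ∀ z ∈ V, m z ∈ D)
    (hol : ∀ z ∈ V, ∀ η : ℂ, J (a z, m z) (fderiv ℝ a z η, mfderiv 𝓘(ℝ, ℂ) (𝓡 3) m z η)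
      = (fderiv ℝ a z (Complex.I * η), mfderiv 𝓘(ℝ, ℂ) (𝓡 3) m z (Complex.I * η : ℂ)))
    {r : ℝ} (hr : 0 < r) (hmin : ∀ z ∈ V, r ≤ Metric.infDist (m z) (interior D)ᶜ) {z₀ : ℂ}
    (hz₀ : z₀ ∈ V) (hz₀r : Metric.infDist (m z₀) (interior D)ᶜ = r) :
    ∀ z ∈ V, a z = a z₀ ∧ m z = m z₀ := by
  have hcont : ContinuousOn (fun z => (a z, m z)) V := ha.continuousOn.prodMk hm.continuousOn
  have hopen : IsOpen (V ∩ (fun z => (a z, m z)) ⁻¹' {(a z₀, m z₀)}) := by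
    rw [isOpen_iff_mem_nhds]
    rintro z ⟨hz, hz'⟩
    obtain ⟨hza, hzm⟩ := Prod.ext_iff.1 hz'
    change a z = a z₀ at hza
    change m z = m z₀ at hzm
    set e := chartAt E3 (m z)
    have hV' : IsOpen (V ∩ m ⁻¹' e.source) := hm.continuousOn.isOpen_inter_preimage hV e.open_source
    obtain ⟨h1, h2⟩ := isOpen_and_fderiv_eq_zero_of_holomorphic hsec hα hJ hD hconv hbd
      (IsManifold.chart_mem_maximalAtlas (m z)) hV' (ha.mono inter_subset_left)
      (hm.mono inter_subset_left) (fun ζ hζ => hζ.2) (fun ζ hζ => hpos ζ hζ.1)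
      (fun ζ hζ => hmD ζ hζ.1) (fun ζ hζ => hol ζ hζ.1) hr (fun ζ hζ => hmin ζ hζ.1)
    have hzmem : z ∈ {z | z ∈ V ∩ m ⁻¹' e.source ∧ Metric.infDist (m z) (interior D)ᶜ = r} :=
      ⟨⟨hz, mem_chart_source E3 (m z)⟩, by rw [hzm, hz₀r]⟩
    obtain ⟨δ, hδ, hball⟩ := Metric.isOpen_iff.1 h1 z hzmem
    have hpre : IsPreconnected (Metric.ball z δ) := (convex_ball z δ).isPreconnected
    have hvd : ContDiffOn ℝ ∞ (e ∘ m) (V ∩ m ⁻¹' e.source) :=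
      ((contMDiffOn_of_mem_maximalAtlas (IsManifold.chart_mem_maximalAtlas (m z))).comp
        (hm.mono inter_subset_left) fun ζ hζ => hζ.2).contDiffOn
    have hzb : z ∈ Metric.ball z δ := Metric.mem_ball_self hδ
    have ca : ∀ ζ ∈ Metric.ball z δ, a ζ = a z := fun ζ hζ =>
      Metric.isOpen_ball.is_const_of_fderiv_eq_zero hpre
        ((ha.differentiableOn (by simp)).mono fun ζ hζ => (hball hζ).1.1)
        (fun ζ hζ => (h2 ζ (hball hζ).1 (hball hζ).2).1) hζ hzb
    have cv : ∀ ζ ∈ Metric.ball z δ, (e ∘ m) ζ = (e ∘ m) z := fun ζ hζ =>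
      Metric.isOpen_ball.is_const_of_fderiv_eq_zero hpre
        ((hvd.differentiableOn (by simp)).mono fun ζ hζ => (hball hζ).1)
        (fun ζ hζ => (h2 ζ (hball hζ).1 (hball hζ).2).2) hζ hzb
    refine Filter.mem_of_superset (Metric.ball_mem_nhds z hδ) fun ζ hζ => ⟨(hball hζ).1.1, ?_⟩
    refine Prod.ext ((ca ζ hζ).trans hza) ?_
    exact (e.injOn (hball hζ).1.2 (mem_chart_source E3 (m z)) (cv ζ hζ)).trans hzm
  have hopen' : IsOpen (V ∩ (fun z => (a z, m z)) ⁻¹' {(a z₀, m z₀)}ᶜ) :=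
    hcont.isOpen_inter_preimage hV isOpen_compl_singleton
  have hsub := hVc.subset_left_of_subset_union hopen hopen'
    (disjoint_left.2 fun z hz hz' => hz'.2 hz.2)
    (fun z hz => by
      by_cases h : (a z, m z) = (a z₀, m z₀)
      · exact Or.inl ⟨hz, h⟩
      · exact Or.inr ⟨hz, h⟩) ⟨z₀, hz₀, hz₀, rfl⟩
  intro z hz
  exact Prod.ext_iff.1 (hsub hz).2

end Curves

/-! ### Surfaces with boundary -/

section Surface

variable {S : Type*} [TopologicalSpace S] [ChartedSpace ClosedHalfPlane S]

/-- A Riemann surface with boundary is a smooth surface with boundary. -/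
theorem isManifold_halfPlaneReal [IsManifold halfPlaneComplex ∞ S] :
    IsManifold halfPlaneReal ∞ S := by
  refine isManifold_of_contDiffOn halfPlaneReal ∞ S fun e e' he he' => ?_
  have h := (contDiffGroupoid ∞ halfPlaneComplex).compatible he he'
  rw [contDiffGroupoid, mem_groupoid_of_pregroupoid] at h
  have h1 : ContDiffOn ℂ ∞ (halfPlaneComplex ∘ (e.symm ≫ₕ e') ∘ halfPlaneComplex.symm)
    (halfPlaneComplex.symm ⁻¹' (e.symm ≫ₕ e').source ∩ range halfPlaneComplex) := h.1
  exact h1.restrict_scalars ℝ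

theorem interior_range_halfPlaneReal : interior (range halfPlaneReal) = {z : ℂ | 0 < z.im} := by
  have h : range halfPlaneReal = {z : ℂ | 0 ≤ z.im} := range_halfPlaneEquiv
  rw [h, Complex.interior_setOfPred_le_im]

/-- Changes of coordinates are complex differentiable at interior points. The charts are those of the
real model, as the two models have the same underlying maps. -/
theorem differentiableAt_coordChange [IsManifold halfPlaneComplex ∞ S] {p q : S} {ζ : ℂ}
    (hζ : ζ ∈ (extChartAt halfPlaneReal p).target) (hi : 0 < ζ.im)
    (hq : (extChartAt halfPlaneReal p).symm ζ ∈ (chartAt ClosedHalfPlane q).source) :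
    DifferentiableAt ℂ (extChartAt halfPlaneReal q ∘ (extChartAt halfPlaneReal p).symm) ζ := by
  have h := ModelWithCorners.contDiffOn_extendCoordChange (I := halfPlaneComplex) (n := ∞)
    (IsManifold.chart_mem_maximalAtlas (I := halfPlaneComplex) (n := ∞) p)
    (IsManifold.chart_mem_maximalAtlas (I := halfPlaneComplex) (n := ∞) q)
  have hmem : ζ ∈ (halfPlaneComplex.extendCoordChange (chartAt ClosedHalfPlane p)
      (chartAt ClosedHalfPlane q)).source := by
    simp only [ModelWithCorners.extendCoordChange, PartialEquiv.trans_source,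
      PartialEquiv.symm_source, OpenPartialHomeomorph.extend_source]
    exact ⟨hζ, hq⟩
  have hr : range halfPlaneComplex ∈ 𝓝 ζ := by
    have h : range halfPlaneComplex = {z : ℂ | 0 ≤ z.im} := range_halfPlaneEquiv
    rw [h]
    exact Filter.mem_of_superset ((isOpen_lt continuous_const Complex.continuous_im).mem_nhds hi)
      fun z (hz : 0 < z.im) => hz.le
  refine (h.differentiableOn (by simp) ζ hmem).differentiableAt ?_
  have h2 := ModelWithCorners.extendCoordChange_source_mem_nhdsWithin (I := halfPlaneComplex) hmem
  rwa [nhdsWithin_eq_nhds.2 hr] at h2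

/-- The derivative of a parametrization of a Riemann surface is complex linear. -/
theorem hasMFDerivAt_extChartAt_symm [IsManifold halfPlaneComplex ∞ S] {p : S} {ζ : ℂ}
    (hζ : ζ ∈ (extChartAt halfPlaneReal p).target) (hi : 0 < ζ.im) :
    HasMFDerivAt 𝓘(ℝ, ℂ) halfPlaneReal (extChartAt halfPlaneReal p).symm ζ
      ((fderiv ℂ (extChartAt halfPlaneReal ((extChartAt halfPlaneReal p).symm ζ) ∘
        (extChartAt halfPlaneReal p).symm) ζ).restrictScalars ℝ) := by
  refine ⟨continuousAt_extChartAt_symm'' hζ, ?_⟩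
  have h := differentiableAt_coordChange hζ hi (mem_chart_source ClosedHalfPlane _)
  exact (h.hasFDerivAt.restrictScalars ℝ).hasFDerivWithinAt

/-- The equation for holomorphic curves, in a holomorphic parametrization of the surface. -/
theorem holomorphic_comp_extChartAt_symm {M : Type*} [TopologicalSpace M] [ChartedSpace E3 M]
    {J : ∀ p : ℝ × M, (ℝ × TangentSpace (𝓡 3) p.2) →ₗ[ℝ] (ℝ × TangentSpace (𝓡 3) p.2)}
    [IsManifold halfPlaneComplex ∞ S] {u : S → ℝ × M} (hu : IsJHolomorphicCurve J u) {p : S} {ζ : ℂ}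
    (hζ : ζ ∈ (extChartAt halfPlaneReal p).target) (hi : 0 < ζ.im)
    (hint : (extChartAt halfPlaneReal p).symm ζ ∈ surfaceInterior S)
    (h1 : MDifferentiableAt halfPlaneReal 𝓘(ℝ, ℝ) (fun w => (u w).1)
      ((extChartAt halfPlaneReal p).symm ζ))
    (h2 : MDifferentiableAt halfPlaneReal (𝓡 3) (fun w => (u w).2)
      ((extChartAt halfPlaneReal p).symm ζ)) (η : ℂ) :
    J (u ((extChartAt halfPlaneReal p).symm ζ))
        (fderiv ℝ (fun z => (u ((extChartAt halfPlaneReal p).symm z)).1) ζ η,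
          mfderiv 𝓘(ℝ, ℂ) (𝓡 3) (fun z => (u ((extChartAt halfPlaneReal p).symm z)).2) ζ η)
      = (fderiv ℝ (fun z => (u ((extChartAt halfPlaneReal p).symm z)).1) ζ (Complex.I * η),
        mfderiv 𝓘(ℝ, ℂ) (𝓡 3) (fun z => (u ((extChartAt halfPlaneReal p).symm z)).2) ζ
          (Complex.I * η : ℂ)) := by
  have hψ := hasMFDerivAt_extChartAt_symm hζ hi
  set A := fderiv ℂ (extChartAt halfPlaneReal ((extChartAt halfPlaneReal p).symm ζ) ∘
        (extChartAt halfPlaneReal p).symm) ζ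
  have e1 := (h1.hasMFDerivAt.comp ζ hψ).mfderiv
  have e2 := (h2.hasMFDerivAt.comp ζ hψ).mfderiv
  have e1' : ∀ w : ℂ, fderiv ℝ (fun z => (u ((extChartAt halfPlaneReal p).symm z)).1) ζ w
      = mfderiv halfPlaneReal 𝓘(ℝ, ℝ) (fun w => (u w).1) ((extChartAt halfPlaneReal p).symm ζ)
        (A w) := fun w =>
    (DFunLike.congr_fun (mfderiv_eq_fderiv (𝕜 := ℝ)
      (f := fun z => (u ((extChartAt halfPlaneReal p).symm z)).1) (x := ζ)).symm w).trans
      (DFunLike.congr_fun e1 w)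
  have e2' : ∀ w : ℂ, mfderiv 𝓘(ℝ, ℂ) (𝓡 3)
        (fun z => (u ((extChartAt halfPlaneReal p).symm z)).2) ζ w
      = mfderiv halfPlaneReal (𝓡 3) (fun w => (u w).2) ((extChartAt halfPlaneReal p).symm ζ)
        (A w) := fun w => DFunLike.congr_fun e2 w
  have hA : A (Complex.I * η) = Complex.I * A η := A.map_smul Complex.I η
  have key := hu.holomorphic _ hint (A η)
  rw [← hA] at key
  refine (congrArg _ (Prod.ext (e1' η) (e2' η))).trans (key.trans ?_)
  exact Prod.ext (e1' _).symm (e2' _).symm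

theorem extChartAt_symm_mem_surfaceInterior [IsManifold halfPlaneComplex ∞ S] {p : S} {ζ : ℂ}
    (hζ : ζ ∈ (extChartAt halfPlaneReal p).target) (hi : 0 < ζ.im) :
    (extChartAt halfPlaneReal p).symm ζ ∈ surfaceInterior S := by
  have : IsManifold halfPlaneReal ∞ S := isManifold_halfPlaneReal
  refine (halfPlaneReal.isInteriorPoint_iff_of_mem_atlas (n := ∞) (by simp)
    (chart_mem_atlas ClosedHalfPlane p) ?_).2 ?_
  · have := (extChartAt halfPlaneReal p).map_target hζ
    rwa [extChartAt_source] at this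
  · change extChartAt halfPlaneReal p _ ∈ _
    rw [(extChartAt halfPlaneReal p).right_inv hζ]
    rw [mem_interior_iff_mem_nhds]
    have hr : range halfPlaneReal ∈ 𝓝 ζ := mem_interior_iff_mem_nhds.1
      (by rw [interior_range_halfPlaneReal]; exact hi)
    have := extChartAt_target_mem_nhdsWithin_of_mem hζ
    rwa [nhdsWithin_eq_nhds.2 hr] at this

end Surface

section Surface

variable {S : Type*} [TopologicalSpace S] [ChartedSpace ClosedHalfPlane S]

/-- Every point of a surface with boundary has a neighbourhood whose interior points are
parametrized by a convex open subset of the open half plane, and are dense in it. -/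
theorem exists_convex_parametrization [IsManifold halfPlaneComplex ∞ S] (p : S) :
    ∃ N : Set S, IsOpen N ∧ p ∈ N ∧ ∃ V : Set ℂ, IsOpen V ∧ Convex ℝ V ∧
      (∀ ζ ∈ V, ζ ∈ (extChartAt halfPlaneReal p).target ∧ 0 < ζ.im) ∧
      N ⊆ closure ((extChartAt halfPlaneReal p).symm '' V) ∧
      N ∩ surfaceInterior S ⊆ (extChartAt halfPlaneReal p).symm '' V := by
  have : IsManifold halfPlaneReal ∞ S := isManifold_halfPlaneReal
  have hrange : range halfPlaneReal = {z : ℂ | 0 ≤ z.im} := range_halfPlaneEquiv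
  obtain ⟨r, hr, hball⟩ := Metric.mem_nhdsWithin_iff.1
    (extChartAt_target_mem_nhdsWithin (I := halfPlaneReal) p)
  rw [hrange] at hball
  have hcl : ∀ ζ ∈ Metric.ball (extChartAt halfPlaneReal p p) r ∩ {z : ℂ | 0 ≤ z.im},
      ζ ∈ closure (Metric.ball (extChartAt halfPlaneReal p p) r ∩ {z : ℂ | 0 < z.im}) := by
    intro ζ hζ
    refine Metric.isOpen_ball.inter_closure ⟨hζ.1, ?_⟩
    rw [Complex.closure_setOfPred_lt_im]
    exact hζ.2
  have hmem : ∀ w ∈ (chartAt ClosedHalfPlane p).source,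
      0 ≤ (extChartAt halfPlaneReal p w).im := by
    intro w hw
    have h : extChartAt halfPlaneReal p w ∈ range halfPlaneReal := mem_range_self _
    rwa [hrange] at h
  have hVt : ∀ ζ ∈ Metric.ball (extChartAt halfPlaneReal p p) r ∩ {z : ℂ | 0 < z.im},
      ζ ∈ (extChartAt halfPlaneReal p).target := fun ζ hζ =>
    hball ⟨hζ.1, (show 0 ≤ ζ.im from le_of_lt hζ.2)⟩
  refine ⟨(chartAt ClosedHalfPlane p).source ∩ extChartAt halfPlaneReal p ⁻¹'
      Metric.ball (extChartAt halfPlaneReal p p) r,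
    isOpen_extChartAt_preimage (I := halfPlaneReal) p Metric.isOpen_ball,
    ⟨mem_chart_source _ p, Metric.mem_ball_self hr⟩,
    Metric.ball (extChartAt halfPlaneReal p p) r ∩ {z : ℂ | 0 < z.im},
    Metric.isOpen_ball.inter (isOpen_lt continuous_const Complex.continuous_im),
    (convex_ball _ _).inter (convex_halfSpace_im_gt 0), fun ζ hζ => ⟨hVt ζ hζ, hζ.2⟩, ?_, ?_⟩
  · rintro w ⟨hw, hwb⟩
    have hws : w ∈ (extChartAt halfPlaneReal p).source := by rwa [extChartAt_source]
    have hc := (continuousOn_extChartAt_symm (I := halfPlaneReal) p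
      (extChartAt halfPlaneReal p w) ((extChartAt halfPlaneReal p).map_source hws)).mono
      (fun ζ hζ => hVt ζ hζ)
    have h := hc.mem_closure_image (hcl _ ⟨hwb, hmem w hw⟩)
    rwa [(extChartAt halfPlaneReal p).left_inv hws] at h
  · rintro w ⟨⟨hw, hwb⟩, hwi⟩
    have hws : w ∈ (extChartAt halfPlaneReal p).source := by rwa [extChartAt_source]
    have h := (halfPlaneReal.isInteriorPoint_iff_of_mem_atlas (n := ∞) (by simp)
      (chart_mem_atlas ClosedHalfPlane p) hw).1 hwi
    have h' := interior_mono (extChartAt_target_subset_range (I := halfPlaneReal) p) h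
    rw [interior_range_halfPlaneReal] at h'
    exact ⟨extChartAt halfPlaneReal p w, ⟨hwb, h'⟩, (extChartAt halfPlaneReal p).left_inv hws⟩

variable {M : Type*} [MetricSpace M] [ChartedSpace E3 M] [IsManifold (𝓡 3) ∞ M]
  [RiemannianBundle (fun x : M => TangentSpace (𝓡 3) x)]
  [IsContMDiffRiemannianBundle (𝓡 3) ∞ E3 (fun x : M => TangentSpace (𝓡 3) x)]
  [IsRiemannianManifold (𝓡 3) M]

/-- A holomorphic curve in the domain is constant if the distance to the boundary attains a positive
minimum at an interior point of the surface. The set of points near which the curve takes its value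
at that point is open, and closed because interior points are dense in the surface. -/
theorem IsJHolomorphicCurve.eq_of_infDist_minimum [IsManifold halfPlaneComplex ∞ S]
    [PreconnectedSpace S] (hsec : SecGE M 1)
    {α : ∀ x : M, TangentSpace (𝓡 3) x →ₗ[ℝ] ℝ} (hα : IsContactMetric α)
    {J : ∀ p : ℝ × M, (ℝ × TangentSpace (𝓡 3) p.2) →ₗ[ℝ] (ℝ × TangentSpace (𝓡 3) p.2)}
    (hJ : IsAdaptedACS α J) {D : Set M} (hD : IsComplete D) (hconv : GeodesicallyConvex D)
    (hbd : (frontier D).Nonempty) {u : S → ℝ × M} (hu : IsJHolomorphicCurve J u)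
    (huD : ∀ z, (u z).2 ∈ D) {r : ℝ} (hr : 0 < r)
    (hmin : ∀ z, r ≤ Metric.infDist (u z).2 (interior D)ᶜ) {z₀ : S}
    (hz₀ : z₀ ∈ surfaceInterior S) (hz₀r : Metric.infDist (u z₀).2 (interior D)ᶜ = r) (z : S) :
    u z = u z₀ := by
  have : IsManifold halfPlaneReal ∞ S := isManifold_halfPlaneReal
  have hint : IsOpen (surfaceInterior S) := halfPlaneReal.isOpen_interior (n := ∞) (by simp)
  have hclosed : IsClosed {w | u w = u z₀} := isClosed_eq hu.continuous continuous_const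
  have h1 : ContMDiffOn halfPlaneReal 𝓘(ℝ, ℝ) ∞ (fun w => (u w).1) (surfaceInterior S) :=
    contMDiff_fst.comp_contMDiffOn hu.smooth
  have h2 : ContMDiffOn halfPlaneReal (𝓡 3) ∞ (fun w => (u w).2) (surfaceInterior S) :=
    contMDiff_snd.comp_contMDiffOn hu.smooth
  have loc : ∀ p : S, ∃ N : Set S, IsOpen N ∧ p ∈ N ∧ ∃ K : Set S, N ⊆ closure K ∧
      N ∩ surfaceInterior S ⊆ K ∧ ((∃ w ∈ K, u w = u z₀) → ∀ w ∈ N, u w = u z₀) := by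
    intro p
    obtain ⟨N, hN, hp, V, hV, hVc, hVt, hcl, hNi⟩ := exists_convex_parametrization p
    refine ⟨N, hN, hp, _, hcl, hNi, ?_⟩
    rintro ⟨_, ⟨ζ₀, hζ₀, rfl⟩, hw⟩ w hwN
    have hVi : ∀ ζ ∈ V, (extChartAt halfPlaneReal p).symm ζ ∈ surfaceInterior S := fun ζ hζ =>
      extChartAt_symm_mem_surfaceInterior (hVt ζ hζ).1 (hVt ζ hζ).2
    have hψ : ContMDiffOn 𝓘(ℝ, ℂ) halfPlaneReal ∞ (extChartAt halfPlaneReal p).symm V :=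
      (contMDiffOn_extChartAt_symm p).mono fun ζ hζ => (hVt ζ hζ).1
    have key := eqOn_of_holomorphic hsec hα hJ hD hconv hbd hV hVc.isPreconnected
      (a := fun ζ => (u ((extChartAt halfPlaneReal p).symm ζ)).1)
      (m := fun ζ => (u ((extChartAt halfPlaneReal p).symm ζ)).2)
      (h1.comp hψ hVi).contDiffOn (h2.comp hψ hVi) (fun ζ _ => hu.mem _) (fun ζ _ => huD _)
      (fun ζ hζ η => holomorphic_comp_extChartAt_symm hu (hVt ζ hζ).1 (hVt ζ hζ).2 (hVi ζ hζ)
        ((h1.contMDiffAt (hint.mem_nhds (hVi ζ hζ))).mdifferentiableAt (by simp))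
        ((h2.contMDiffAt (hint.mem_nhds (hVi ζ hζ))).mdifferentiableAt (by simp)) η)
      hr (fun ζ _ => hmin _) hζ₀ (by rw [hw]; exact hz₀r)
    refine closure_minimal ?_ hclosed (hcl hwN)
    rintro _ ⟨ζ, hζ, rfl⟩
    exact (Prod.ext (key ζ hζ).1 (key ζ hζ).2).trans hw
  have hclopen : IsClopen {p : S | ∀ᶠ w in 𝓝 p, u w = u z₀} := by
    refine ⟨isClosed_of_closure_subset fun p hp => ?_, isOpen_setOfPred_eventually_nhds⟩
    obtain ⟨N, hN, hpN, K, hNK, -, hK⟩ := loc p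
    obtain ⟨w, hwN, hw⟩ := mem_closure_iff.1 hp N hN hpN
    obtain ⟨w', hw', hw'K⟩ := mem_closure_iff_nhds.1 (hNK hwN) _ hw
    exact Filter.mem_of_superset (hN.mem_nhds hpN) (hK ⟨w', hw'K, hw'⟩)
  have hne : {p : S | ∀ᶠ w in 𝓝 p, u w = u z₀}.Nonempty := by
    obtain ⟨N, hN, hpN, K, -, hNK, hK⟩ := loc z₀
    exact ⟨z₀, Filter.mem_of_superset (hN.mem_nhds hpN) (hK ⟨z₀, hNK ⟨hpN, hz₀⟩, rfl⟩)⟩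
  have hz : z ∈ {p : S | ∀ᶠ w in 𝓝 p, u w = u z₀} := by
    rw [hclopen.eq_univ hne]
    exact mem_univ z
  have h : z ∈ {w | u w = u z₀} := mem_of_mem_nhds hz
  exact h

end Surface

end

theorem mainTheorem5
    {M : Type*} [MetricSpace M] [ChartedSpace E3 M] [IsManifold (𝓡 3) ∞ M]
    [RiemannianBundle (fun x : M => TangentSpace (𝓡 3) x)]
    [IsContMDiffRiemannianBundle (𝓡 3) ∞ E3 (fun x : M => TangentSpace (𝓡 3) x)]
    [IsRiemannianManifold (𝓡 3) M]
    (hsec : SecGE M 1)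
    (α : ∀ x : M, TangentSpace (𝓡 3) x →ₗ[ℝ] ℝ) (hα : IsContactMetric α)
    (J : ∀ p : ℝ × M, (ℝ × TangentSpace (𝓡 3) p.2) →ₗ[ℝ] (ℝ × TangentSpace (𝓡 3) p.2))
    (hJ : IsAdaptedACS α J)
    (D : Set M) (hD : IsComplete D) (hconv : GeodesicallyConvex D) (hbd : (frontier D).Nonempty)
    (c : ℝ) (hc : c < Real.exp (Real.pi / 2)) :
    frontier (OmegaSet D c) ∩ symplectization M = SigmaSet D c ∧
    ∀ (S : Type*) [TopologicalSpace S] [ChartedSpace ClosedHalfPlane S]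
      [IsManifold halfPlaneComplex ∞ S] [ConnectedSpace S] (u : S → ℝ × M),
      IsJHolomorphicCurve J u → (∀ z, u z ∈ OmegaSet D c) →
        ∀ z ∈ surfaceInterior S, u z ∉ SigmaSet D c := by
  refine ⟨frontier_OmegaSet hD hconv hbd hc, fun S _ _ _ _ u hu huD z₀ hz₀ hσ => ?_⟩
  have hcpos : 0 < c := (Real.exp_pos _).trans_le (huD z₀).2.2
  have hdist : ∀ z, Metric.infDist (u z).2 (interior D)ᶜ = Metric.infDist (u z).2 (frontier D) :=
    fun z => (infDist_frontier_eq hD.isClosed hbd (huD z).2.1).symm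
  have hr : 0 < Real.pi / 2 - Real.log c := by
    have := (Real.log_lt_iff_lt_exp hcpos).2 hc
    linarith
  have hmin : ∀ z, Real.pi / 2 - Real.log c ≤ Metric.infDist (u z).2 (interior D)ᶜ := fun z => by
    have h := (Real.le_log_iff_exp_le hcpos).2 (huD z).2.2
    rw [hdist]
    linarith
  have heq : Metric.infDist (u z₀).2 (interior D)ᶜ = Real.pi / 2 - Real.log c := by
    have h : Real.log (expDist D (u z₀).2) = Real.log c := congrArg Real.log hσ.2.2
    rw [expDist, Real.log_exp] at h
    rw [hdist]
    linarith
  obtain ⟨z, w, hzw⟩ := hu.nonconstant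
  have hconst := hu.eq_of_infDist_minimum hsec hα hJ hD hconv hbd (fun z => (huD z).2.1) hr hmin
    hz₀ heq
  exact hzw ((hconst z).trans (hconst w).symm)
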